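/- **Setting.** Let $d\ge 1$, let $\Omega\subset\mathbb R^d$ be a bounded open set with $\operatorname{int}\overline\Omega=\Omega$ (e.g. a bounded Lipschitz domain), let $0=t_0<t_1<\dots<t_N=T$, $I_n=(t_n,t_{n+1})$, $\tau_n=t_{n+1}-t_n$. For $n=0,\dots,N-1$ let $\mathcal T_n$ be a finite family of disjoint open convex polytopes (e.g. simplices or boxes) with $\overline\Omega=\bigcup_{K\in\mathcal T_n}\overline K$; the meshes may change with $n$ and hanging nodes are allowed. Let $0<c_a\le a\le C_a$ in $\Omega$, with $a$ constant on every $K\in\mathcal T_n$ for every $n$. Put $\Gamma_n=\bigcup_{K\in\mathcal T_n}\partial K$, $\Gamma_n^{\rm int}=\Gamma_n\setminus\partial\Omega$, $\hat\Gamma_n=\Gamma_{n-1}\cup\Gamma_n$ for $1\le n<N$ and $\hat\Gamma_N=\Gamma_{N-1}$. On a face between $K^+$ and $K^-$, with outward normals $\mathbf n^\pm$, let $\{u\}=\frac12(u^++u^-)$, $[u]=u^+\mathbf n^++u^-\mathbf n^-$, $\{\mathbf v\}=\frac12(\mathbf v^++\mathbf v^-)$, $[\mathbf v]=\mathbf v^+\cdot\mathbf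 n^++\mathbf v^-\cdot\mathbf n^-$; on $\partial\Omega$ let $[u]=u^+\mathbf n^+$, $\{\mathbf v\}=\mathbf v^+$. (Off the skeleton of the mesh on which a function lives, the average is its value and the jump is $0$.) Gradients are taken elementwise, and $(\cdot,\cdot)_\Sigma$, $\|\cdot\|_\Sigma$ are the inner product and norm of $L^2(\Sigma)$. Let $p\ge1$ and let $h$ on $\Gamma_n$ be the average of the diameters of the adjacent elements of $\mathcal T_n$. On $\Gamma_n\times I_n$ let $$\sigma_0=\frac{C_{\sigma_0}p^2}{h},\qquad \sigma_1=\frac{C_a\,p^3}{h\,\tau_n},\qquad \sigma_2=\frac{h}{C_a\tau_n},$$ and at the node $t_n$ on $\hat\Gamma_n$ let $\hat\sigma_0=C_{\sigma_0}p^2/\hat h$, with $\hat h$ the larger of the values of $h$ of those of the meshes $\mathcal T_{n-1},\mathcal T_n$ on whose skeleton the point lies (so $\hat\sigma_0=\sigma_0$ if the mesh does not change). The constant $C_{\sigma_0}$ is large enough in the following sense: $C_{\sigma_0}\ge 2d\,\kappa\,c_{\mathcal T}C_a^2C_{\rm inv}/c_a$. Here * $\operatorname{diam}K\le\kappa\operatorname{diam}L$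 for $K,L\in\mathcal T_n$ whose closures meet in a set of positive surface measure (in particular for elements sharing a part of a face); * with $P$ running through the elements and through the nonempty overlaps $P=K\cap L$, $K\in\mathcal T_{n},L\in\mathcal T_{n+1}$, one has $\operatorname{diam}K,\operatorname{diam}L\le c_{\mathcal T}\rho_P$ with $\rho_P$ the inradius of $P$ ($K=L=P$ if $P$ is an element); * $C_{\rm inv}$ is a constant in the inverse inequality $\|q\|^2_{\partial P}\le C_{\rm inv}\,p^2\frac{|\partial P|}{|P|}\|q\|_P^2$ for the same sets $P$ and all polynomials $q$ of degree at most $p$. **Spaces.** $V_{\rm Trefftz}$ is the space of functions $v$ which on every $K\times I_n$, $K\in\mathcal T_n$, are polynomials of total degree at most $p$ in $(t,x)$ with $\ddot v-\nabla\cdot(a\nabla v)=0$ there. $\mathcal X$ is the space of weak solutions $u$ of $\ddot u-\nabla\cdot(a\nabla u)=0$ in $\Omega\times(0,T)$, $u=0$ on $\partial\Omega\times(0,T)$, with $u(0)\in H^1_0(\Omega)$, $\dot u(0)\in L^2(\Omega)$. A function $w\in\mathcal X+V_{\rm Trefftz}$ is called *regular* if on each $K\times I_n$ the functions $w,\dot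 w$, $\partial_iw$, $\partial_i\dot w$ are in $L^2(I_n;H^1(K))$ and $\ddot w\in L^2(I_n;L^2(K))$, with $L^2$ traces on $\partial K \times I_n$, and $w,\nabla w,\dot w$ have $L^2(K)$ limits at the two end times of $I_n$, those of $w$ and $\partial_iw$ being in $H^1(K)$ with $L^2$ traces on $\partial K$ at $t_n^+$ and on $\overline K\cap\hat\Gamma_{n+1}$ at $t_{n+1}^-$; that is, if all terms below are meaningful. **Forms and norms.** Let $a(u,v)=\sum_{n=0}^{N-1}a_n(u,v)-\sum_{n=1}^{N-1}b_n(u,v)$ with $$\begin{aligned}a_n(u,v)=\;&(\ddot u,\dot v)_{\Omega\times I_n}+(\dot u(t_n^+),\dot v(t_n^+))_\Omega+(a\nabla u,\nabla\dot v)_{\Omega\times I_n}+(a\nabla u(t_n^+),\nabla v(t_n^+))_\Omega\\&-(\{a\nabla u\},[\dot v])_{\Gamma_n\times I_n}-(\{a\nabla u(t_n^+)\},[v(t_n^+)])_{\Gamma_n}-([u],\{a\nabla\dot v\})_{\Gamma_n\times I_n}-([u(t_n^+)],\{a\nabla v(t_n^+)\})_{\Gamma_n}\\&+(\sigma_0[u],[\dot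 v])_{\Gamma_n\times I_n}+(\sigma_0[u(t_n^+)],[v(t_n^+)])_{\Gamma_n}+(\sigma_1[u],[v])_{\Gamma_n\times I_n}+(\sigma_2[a\nabla u],[a\nabla v])_{\Gamma_n^{\rm int}\times I_n},\\ b_n(u,v)=\;&(\dot u(t_n^-),\dot v(t_n^+))_\Omega+(a\nabla u(t_n^-),\nabla v(t_n^+))_\Omega-(\{a\nabla u(t_n^-)\},[v(t_n^+)])_{\Gamma_n}\\&-([u(t_n^-)],\{a\nabla v(t_n^+)\})_{\Gamma_{n-1}}+(\hat\sigma_0[u(t_n^-)],[v(t_n^+)])_{\hat\Gamma_n},\end{aligned}$$ let $|||v|||=a(v,v)^{1/2}$ for $v\in V_{\rm Trefftz}$, and let $$\begin{aligned}|||w|||_*^2=\;&\tfrac12\sum_{n=1}^N\Big(\|\dot w(t_n^-)\|_\Omega^2+\|\sqrt a\,\nabla w(t_n^-)\|_\Omega^2+\|\sqrt{\sigma_0}\,[w(t_n^-)]\|^2_{\Gamma_{n-1}}+\|\hat\sigma_0^{-1/2}\{a\nabla w(t_n^-)\}\|^2_{\hat\Gamma_n}\Big)\\&+\sum_{n=0}^{N-1}\Big(\|\sqrt{\sigma_1}[w]\|^2_{\Gamma_n\times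 I_n}+\|\sqrt{\sigma_2}[a\nabla w]\|^2_{\Gamma^{\rm int}_n\times I_n}+\|\sigma_2^{-1/2}\{\dot w\}\|^2_{\Gamma_n^{\rm int}\times I_n}\\&\qquad\quad+\|\sigma_1^{-1/2}\{a\nabla\dot w\}\|^2_{\Gamma_n\times I_n}+\|\sigma_0\sigma_1^{-1/2}[\dot w]\|^2_{\Gamma_n\times I_n}\Big).\end{aligned}$$ **Proposition.** There is an absolute constant $C_\star>0$ such that in every such setting $$|a(w,v)|\le C_\star\,|||w|||_*\,|||v|||$$ for all regular $w\in\mathcal X+V_{\rm Trefftz}$ and all $v\in V_{\rm Trefftz}$. -/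

import Mathlib

open MeasureTheory Filter Topology Set
open scoped ContDiff

namespace TrefftzDG

/-- Euclidean space of dimension `d`. -/
abbrev E (d : ℕ) : Type := EuclideanSpace ℝ (Fin d)

/-- Surface measure in dimension `d`: the `(d-1)`-dimensional Hausdorff measure, normalised so that
it agrees with Lebesgue measure on hyperplanes (the counting measure if `d = 1`). -/
noncomputable def surf (d : ℕ) : Measure (E d) := Measure.euclideanHausdorffMeasure (d - 1)

/-! ### Traces and weak derivatives -/

/-- `f ∈ H¹(K)` and the values of `f` on the lower-dimensional set `S ⊆ closure K` are its trace:
`f` is the limit in `H¹(K)` of smooth functions whose restrictions to `S` tend to `f` in `L²(S)`. -/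
def HasTrace {d : ℕ} (K S : Set (E d)) (f : E d → ℝ) : Prop :=
  MemLp f 2 (volume.restrict K) ∧ MemLp f 2 ((surf d).restrict S) ∧
  ∃ (G : E d → E d) (φ : ℕ → E d → ℝ), MemLp G 2 (volume.restrict K) ∧
    (∀ k, ContDiff ℝ ∞ (φ k)) ∧
    Tendsto (fun k => eLpNorm (fun x => φ k x - f x) 2 (volume.restrict K)) atTop (𝓝 0) ∧
    Tendsto (fun k => eLpNorm (fun x => gradient (φ k) x - G x) 2 (volume.restrict K))
      atTop (𝓝 0) ∧
    Tendsto (fun k => eLpNorm (fun x => φ k x - f x) 2 ((surf d).restrict S)) atTop (𝓝 0)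

/-- `f ∈ L²(I; H¹(K))` and the values of `f` on `I × S` are its (lateral) trace. -/
def HasLateralTrace {d : ℕ} (I : Set ℝ) (K S : Set (E d)) (f : ℝ → E d → ℝ) : Prop :=
  MemLp (fun z : ℝ × E d => f z.1 z.2) 2 ((volume.restrict I).prod (volume.restrict K)) ∧
  MemLp (fun z : ℝ × E d => f z.1 z.2) 2 ((volume.restrict I).prod ((surf d).restrict S)) ∧
  ∃ (G : ℝ × E d → E d) (φ : ℕ → ℝ × E d → ℝ),
    MemLp G 2 ((volume.restrict I).prod (volume.restrict K)) ∧
    (∀ k, ContDiff ℝ ∞ (φ k)) ∧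
    Tendsto (fun k => eLpNorm (fun z => φ k z - f z.1 z.2) 2
      ((volume.restrict I).prod (volume.restrict K))) atTop (𝓝 0) ∧
    Tendsto (fun k => eLpNorm (fun z => gradient (fun y => φ k (z.1, y)) z.2 - G z) 2
      ((volume.restrict I).prod (volume.restrict K))) atTop (𝓝 0) ∧
    Tendsto (fun k => eLpNorm (fun z => φ k z - f z.1 z.2) 2
      ((volume.restrict I).prod ((surf d).restrict S))) atTop (𝓝 0)

/-- The slice `f s` is the limit in `L²(K)` of `f t` as `t → s`, `t ∈ I` (up to a null set of
times, so that the notion does not depend on the representative of `f` in `I × K`). -/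
def HasTimeTrace {d : ℕ} {F : Type*} [NormedAddCommGroup F] (I : Set ℝ) (K : Set (E d))
    (f : ℝ → E d → F) (s : ℝ) : Prop :=
  MemLp (f s) 2 (volume.restrict K) ∧
  Tendsto (fun t => eLpNorm (fun x => f t x - f s x) 2 (volume.restrict K))
    (𝓝[I] s ⊓ ae volume) (𝓝 0)

/-- Smooth test functions with compact support in `U`. -/
def IsTest {X : Type*} [NormedAddCommGroup X] [NormedSpace ℝ X] (U : Set X) (φ : X → ℝ) : Prop :=
  ContDiff ℝ ∞ φ ∧ HasCompactSupport φ ∧ tsupport φ ⊆ U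

/-- `g` is the weak time derivative of `f` in `I × K`. -/
def IsWeakDt {d : ℕ} (I : Set ℝ) (K : Set (E d)) (f g : ℝ → E d → ℝ) : Prop :=
  ∀ φ : ℝ × E d → ℝ, IsTest (I ×ˢ K) φ →
    ∫ z, f z.1 z.2 * fderiv ℝ φ z (1, 0) = - ∫ z, g z.1 z.2 * φ z

/-- `g` is the weak spatial gradient of `f` in `I × K`. -/
def IsWeakGrad {d : ℕ} (I : Set ℝ) (K : Set (E d)) (f : ℝ → E d → ℝ) (g : ℝ → E d → E d) : Prop :=
  ∀ (e : E d) (φ : ℝ × E d → ℝ), IsTest (I ×ˢ K) φ →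
    ∫ z, f z.1 z.2 * fderiv ℝ φ z (0, e) = - ∫ z, inner ℝ (g z.1 z.2) e * φ z

/-! ### Weak solutions of the wave equation -/

/-- `f ∈ H¹₀(Ω)` with weak gradient `g`. -/
def InH10 {d : ℕ} (Ω : Set (E d)) (f : E d → ℝ) (g : E d → E d) : Prop :=
  MemLp f 2 (volume.restrict Ω) ∧ MemLp g 2 (volume.restrict Ω) ∧
  ∃ φ : ℕ → E d → ℝ, (∀ k, IsTest Ω (φ k)) ∧
    Tendsto (fun k => eLpNorm (fun x => φ k x - f x) 2 (volume.restrict Ω)) atTop (𝓝 0) ∧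
    Tendsto (fun k => eLpNorm (fun x => gradient (φ k) x - g x) 2 (volume.restrict Ω))
      atTop (𝓝 0)

/-- `u` is a weak solution of `ü - ∇·(a ∇u) = 0` in `Ω × (0,T)`, `u = 0` on `∂Ω × (0,T)`, with
some initial data `u(0) = u₀ ∈ H¹₀(Ω)`, `u̇(0) = v₀ ∈ L²(Ω)`. -/
def IsWeakSolution {d : ℕ} (Ω : Set (E d)) (T : ℝ) (a : E d → ℝ) (u : ℝ → E d → ℝ) : Prop :=
  ∃ (du : ℝ → E d → ℝ) (gu : ℝ → E d → E d) (u₀ v₀ : E d → ℝ) (g₀ : E d → E d),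
    MemLp (fun z : ℝ × E d => u z.1 z.2) 2
      ((volume.restrict (Ioo 0 T)).prod (volume.restrict Ω)) ∧
    MemLp (fun z : ℝ × E d => du z.1 z.2) 2
      ((volume.restrict (Ioo 0 T)).prod (volume.restrict Ω)) ∧
    MemLp (fun z : ℝ × E d => gu z.1 z.2) 2
      ((volume.restrict (Ioo 0 T)).prod (volume.restrict Ω)) ∧
    IsWeakDt (Ioo 0 T) Ω u du ∧ IsWeakGrad (Ioo 0 T) Ω u gu ∧
    (∀ᵐ t ∂(volume.restrict (Ioo 0 T)), InH10 Ω (u t) (gu t)) ∧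
    InH10 Ω u₀ g₀ ∧ MemLp v₀ 2 (volume.restrict Ω) ∧
    Tendsto (fun t => eLpNorm (fun x => u t x - u₀ x) 2 (volume.restrict Ω))
      (𝓝[Ioo 0 T] 0 ⊓ ae volume) (𝓝 0) ∧
    ∀ φ : ℝ × E d → ℝ, IsTest (Iio T ×ˢ Ω) φ →
      - (∫ z in Ioo 0 T ×ˢ Ω, du z.1 z.2 * fderiv ℝ φ z (1, 0))
        + (∫ z in Ioo 0 T ×ˢ Ω, a z.2 * inner ℝ (gu z.1 z.2) (gradient (fun y => φ (z.1, y)) z.2))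
      = ∫ x in Ω, v₀ x * φ (0, x)

/-! ### Space-time meshes -/

/-- A bounded open convex polytope (for example a simplex or a box), given by finitely many
half-spaces `{x | ⟪ν, x⟫ < b}`, `‖ν‖ = 1`. -/
structure Polytope (d : ℕ) where
  faces : Finset (E d × ℝ)
  unit : ∀ f ∈ faces, ‖f.1‖ = 1
  nonempty : {x : E d | ∀ f ∈ faces, inner ℝ f.1 x < f.2}.Nonempty
  bounded : Bornology.IsBounded {x : E d | ∀ f ∈ faces, inner ℝ f.1 x < f.2}

/-- The open set described by a polytope. -/
def Polytope.set {d : ℕ} (K : Polytope d) : Set (E d) :=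
  {x | ∀ f ∈ K.faces, inner ℝ f.1 x < f.2}

open Classical in
/-- The outward unit normal at almost every point of the boundary of `K` (at the points lying on
exactly one bounding hyperplane); it vanishes inside `K`. -/
noncomputable def Polytope.normal {d : ℕ} (K : Polytope d) (x : E d) : E d :=
  ∑ f ∈ K.faces with inner ℝ f.1 x = f.2, f.1

/-- Radius of the largest ball contained in `P`. -/
noncomputable def inradius {d : ℕ} (P : Set (E d)) : ℝ :=
  sSup {r : ℝ | ∃ x, Metric.ball x r ⊆ P}

/-- A space-time mesh: a bounded open set `Ω` that is the interior of its closure (as every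
Lipschitz domain is), time nodes `0 = t 0 < ⋯ < t N`, and for each slab `(t n, t (n+1))`, `n < N`,
a finite partition `elems n` of `Ω` into polytopes (hanging nodes allowed). -/
structure Mesh (d : ℕ) where
  Ω : Set (E d)
  open_Ω : IsOpen Ω
  bounded_Ω : Bornology.IsBounded Ω
  regular_Ω : interior (closure Ω) = Ω
  N : ℕ
  N_pos : 0 < N
  t : ℕ → ℝ
  t_zero : t 0 = 0
  t_lt : ∀ n < N, t n < t (n + 1)
  elems : ℕ → Finset (Polytope d)
  cover : ∀ n < N, closure Ω = ⋃ K ∈ elems n, closure K.set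
  disjoint : ∀ n < N, ∀ K ∈ elems n, ∀ L ∈ elems n, K ≠ L → Disjoint K.set L.set

namespace Mesh

variable {d : ℕ} (M : Mesh d)

/-- The time interval `I_n`. -/
def slab (n : ℕ) : Set ℝ := Ioo (M.t n) (M.t (n + 1))

/-- The length `τ_n` of `I_n`. -/
def tau (n : ℕ) : ℝ := M.t (n + 1) - M.t n

/-- The skeleton `Γ_n`. -/
def skel (n : ℕ) : Set (E d) := ⋃ K ∈ M.elems n, frontier K.set

/-- The interior skeleton `Γ_n \ ∂Ω`. -/
def intSkel (n : ℕ) : Set (E d) := M.skel n \ frontier M.Ω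

/-- The union of the skeletons of the slabs meeting at the time `t (n+1)`:
`Γ_n ∪ Γ_{n+1}` if `n + 1 < N`, and `Γ_{N-1}` at the final time. -/
def nodeSkel (n : ℕ) : Set (E d) := M.skel n ∪ (if n + 1 < M.N then M.skel (n + 1) else ∅)

open Classical in
/-- The elements of the mesh of slab `n` whose closure contains `x`: for almost every `x` in the
skeleton these are the two elements `K⁺, K⁻` sharing the face of `x`, or the single element `K⁺`
if `x ∈ ∂Ω`. -/
noncomputable def touching (n : ℕ) (x : E d) : Finset (Polytope d) :=
  (M.elems n).filter (fun K => x ∈ closure K.set)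

/-- The function on `Ω` that equals `f K` in each element `K`. -/
noncomputable def bulk {F : Type*} [AddCommMonoid F] (n : ℕ) (f : Polytope d → E d → F)
    (x : E d) : F :=
  ∑ K ∈ M.elems n, K.set.indicator (f K) x

/-- The average of the one-sided values at `x`. -/
noncomputable def avg {F : Type*} [AddCommMonoid F] [Module ℝ F] (n : ℕ)
    (f : Polytope d → E d → F) (x : E d) : F :=
  ((M.touching n x).card : ℝ)⁻¹ • ∑ K ∈ M.touching n x, f K x

/-- The jump `u⁺ n⁺ + u⁻ n⁻` (`u⁺ n⁺` on `∂Ω`) of a scalar function. -/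
noncomputable def jump (n : ℕ) (f : Polytope d → E d → ℝ) (x : E d) : E d :=
  ∑ K ∈ M.touching n x, f K x • K.normal x

/-- The jump `v⁺ · n⁺ + v⁻ · n⁻` of a vector field. -/
noncomputable def jumpV (n : ℕ) (f : Polytope d → E d → E d) (x : E d) : ℝ :=
  ∑ K ∈ M.touching n x, inner ℝ (f K x) (K.normal x)

/-- The mesh size on the skeleton: the average of the diameters of the adjacent elements. -/
noncomputable def h (n : ℕ) (x : E d) : ℝ := M.avg n (fun K _ => Metric.diam K.set) x

/-- The mesh size at the time `t (n+1)` on `nodeSkel n`: the larger of the mesh sizes of the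
(one or two) adjacent slabs on whose skeleton the point lies. -/
noncomputable def nodeH (n : ℕ) (x : E d) : ℝ :=
  max ((M.skel n).indicator (M.h n) x)
    (if n + 1 < M.N then (M.skel (n + 1)).indicator (M.h (n + 1)) x else 0)

/-- Slabs that are equal or consecutive. -/
def Adjacent (m n : ℕ) : Prop := m < M.N ∧ n < M.N ∧ (m = n ∨ m + 1 = n)

/-- Shape regularity with constant `cT`, for the elements and for the overlaps `K ∩ L` of elements
of consecutive slabs (for `m = n` the only overlaps are the elements themselves). -/
def ShapeRegular (cT : ℝ) : Prop :=
  ∀ m n, M.Adjacent m n → ∀ K ∈ M.elems m, ∀ L ∈ M.elems n, (K.set ∩ L.set).Nonempty →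
    Metric.diam K.set ≤ cT * inradius (K.set ∩ L.set) ∧
    Metric.diam L.set ≤ cT * inradius (K.set ∩ L.set)

/-- Local quasi-uniformity of each spatial mesh: diameters of elements sharing (a part of) a face
differ at most by the factor `κ`. -/
def LocallyQuasiUniform (κ : ℝ) : Prop :=
  ∀ n < M.N, ∀ K ∈ M.elems n, ∀ L ∈ M.elems n, surf d (closure K.set ∩ closure L.set) ≠ 0 →
    Metric.diam K.set ≤ κ * Metric.diam L.set

/-- `Cinv` is a constant in the inverse inequality
`‖q‖²_{∂P} ≤ Cinv p² |∂P| / |P| ‖q‖²_P` for all polynomials `q` of degree at most `p` on the elements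
and on the overlaps of elements of consecutive slabs. -/
def IsInverseConstant (p : ℕ) (Cinv : ℝ) : Prop :=
  ∀ m n, M.Adjacent m n → ∀ K ∈ M.elems m, ∀ L ∈ M.elems n, (K.set ∩ L.set).Nonempty →
    ∀ q : MvPolynomial (Fin d) ℝ, q.totalDegree ≤ p →
      ∫ x in frontier (K.set ∩ L.set), (MvPolynomial.eval (fun i => x i) q) ^ 2 ∂(surf d)
        ≤ Cinv * (p : ℝ) ^ 2 *
          ((surf d).real (frontier (K.set ∩ L.set)) / volume.real (K.set ∩ L.set)) *
          ∫ x in K.set ∩ L.set, (MvPolynomial.eval (fun i => x i) q) ^ 2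

end Mesh

/-! ### Broken functions -/

/-- A function on a space-time element together with the derivatives that enter the method. The
values on lower-dimensional sets are meant to be the traces. -/
structure Jet (d : ℕ) where
  val : ℝ → E d → ℝ
  dt : ℝ → E d → ℝ
  dtt : ℝ → E d → ℝ
  grad : ℝ → E d → E d
  gradDt : ℝ → E d → E d

/-- A broken function: one jet for every slab `n` and every element `K`, extended to the closure of
`K × I_n` by its own limits. -/
abbrev Broken (d : ℕ) : Type := ℕ → Polytope d → Jet d

/-- `J` consists of a function on `K × I_n` and its weak derivatives, all in `L²(K × I_n)`, in a
representative which takes the trace values on `∂K × I_n`, on `K × {t n}`, `K × {t (n+1)}`, and on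
the parts of the skeletons in `closure K` at these two times. -/
structure IsRegularJet {d : ℕ} (M : Mesh d) (n : ℕ) (K : Polytope d) (J : Jet d) : Prop where
  memLp_dtt : MemLp (fun z : ℝ × E d => J.dtt z.1 z.2) 2
    ((volume.restrict (M.slab n)).prod (volume.restrict K.set))
  weak_dt : IsWeakDt (M.slab n) K.set J.val J.dt
  weak_dtt : IsWeakDt (M.slab n) K.set J.dt J.dtt
  weak_grad : IsWeakGrad (M.slab n) K.set J.val J.grad
  weak_gradDt : IsWeakGrad (M.slab n) K.set J.dt J.gradDt
  lateral_val : HasLateralTrace (M.slab n) K.set (frontier K.set) J.val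
  lateral_dt : HasLateralTrace (M.slab n) K.set (frontier K.set) J.dt
  lateral_grad : ∀ i, HasLateralTrace (M.slab n) K.set (frontier K.set) (fun t x => J.grad t x i)
  lateral_gradDt : ∀ i,
    HasLateralTrace (M.slab n) K.set (frontier K.set) (fun t x => J.gradDt t x i)
  time_val : ∀ s ∈ ({M.t n, M.t (n + 1)} : Set ℝ), HasTimeTrace (M.slab n) K.set J.val s
  time_dt : ∀ s ∈ ({M.t n, M.t (n + 1)} : Set ℝ), HasTimeTrace (M.slab n) K.set J.dt s
  time_grad : ∀ s ∈ ({M.t n, M.t (n + 1)} : Set ℝ), HasTimeTrace (M.slab n) K.set J.grad s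
  start_val : HasTrace K.set (frontier K.set) (J.val (M.t n))
  start_grad : ∀ i, HasTrace K.set (frontier K.set) (fun x => J.grad (M.t n) x i)
  end_val : HasTrace K.set (closure K.set ∩ M.nodeSkel n) (J.val (M.t (n + 1)))
  end_grad : ∀ i,
    HasTrace K.set (closure K.set ∩ M.nodeSkel n) (fun x => J.grad (M.t (n + 1)) x i)

/-- All jets of `w` are regular. -/
def IsRegular {d : ℕ} (M : Mesh d) (w : Broken d) : Prop :=
  ∀ n < M.N, ∀ K ∈ M.elems n, IsRegularJet M n K (w n K)

/-- Space-time polynomials in the variables `t, x₁, …, x_d` (variable `0` is time). -/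
abbrev Poly (d : ℕ) : Type := MvPolynomial (Fin (d + 1)) ℝ

/-- The value of a space-time polynomial at `(t, x)`. -/
noncomputable def Poly.at {d : ℕ} (q : Poly d) (t : ℝ) (x : E d) : ℝ :=
  MvPolynomial.eval (Fin.cons t (fun i => x i) : Fin (d + 1) → ℝ) q

/-- The time derivative of a space-time polynomial. -/
noncomputable def Poly.dt {d : ℕ} (q : Poly d) : Poly d := MvPolynomial.pderiv 0 q

/-- The spatial gradient of a space-time polynomial at `(t, x)`. -/
noncomputable def Poly.gradAt {d : ℕ} (q : Poly d) (t : ℝ) (x : E d) : E d :=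
  WithLp.toLp 2 (fun i => Poly.at (MvPolynomial.pderiv i.succ q) t x)

/-- The spatial Laplacian of a space-time polynomial. -/
noncomputable def Poly.laplacian {d : ℕ} (q : Poly d) : Poly d :=
  ∑ i : Fin d, MvPolynomial.pderiv i.succ (MvPolynomial.pderiv i.succ q)

/-- The jet of a polynomial, given by evaluation. -/
noncomputable def Poly.jet {d : ℕ} (q : Poly d) : Jet d where
  val := Poly.at q
  dt := Poly.at (Poly.dt q)
  dtt := Poly.at (Poly.dt (Poly.dt q))
  grad := Poly.gradAt q
  gradDt := Poly.gradAt (Poly.dt q)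

/-- A piecewise polynomial: one polynomial for every slab and every element. -/
abbrev PwPoly (d : ℕ) : Type := ℕ → Polytope d → Poly d

/-- A piecewise polynomial as a broken function. -/
noncomputable def PwPoly.broken {d : ℕ} (v : PwPoly d) : Broken d := fun n K => Poly.jet (v n K)

/-- The (constant) value of the coefficient `a` in the element `K`. -/
noncomputable def coef {d : ℕ} (a : E d → ℝ) (K : Polytope d) : ℝ := a K.nonempty.choose

/-- The Trefftz space: piecewise polynomials of total degree at most `p` that satisfy the
homogeneous wave equation in each space-time element. -/
def IsTrefftz {d : ℕ} (M : Mesh d) (a : E d → ℝ) (p : ℕ) (v : PwPoly d) : Prop :=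
  ∀ n < M.N, ∀ K ∈ M.elems n, (v n K).totalDegree ≤ p ∧
    ∀ t ∈ M.slab n, ∀ x ∈ K.set,
      Poly.at (Poly.dt (Poly.dt (v n K))) t x - a x * Poly.at (Poly.laplacian (v n K)) t x = 0

/-- `w` represents an element of `𝒳 + V_Trefftz`, where `𝒳` is the space of weak solutions. -/
def InSolutionPlusTrefftz {d : ℕ} (M : Mesh d) (a : E d → ℝ) (p : ℕ) (w : Broken d) : Prop :=
  ∃ (u : ℝ → E d → ℝ) (V : PwPoly d), IsWeakSolution M.Ω (M.t M.N) a u ∧ IsTrefftz M a p V ∧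
    ∀ n < M.N, ∀ K ∈ M.elems n,
      ∀ᵐ z ∂((volume.restrict (M.slab n)).prod (volume.restrict K.set)),
        (w n K).val z.1 z.2 = u z.1 z.2 + Poly.at (V n K) z.1 z.2

/-! ### The method -/

/-- The data of the method: mesh, diffusion coefficient `a` with upper bound `Ca`, polynomial degree
`p`, and the parameter `Cσ` of the interior penalty. -/
structure Method (d : ℕ) where
  M : Mesh d
  a : E d → ℝ
  Ca : ℝ
  p : ℕ
  Cσ : ℝ

namespace Method

variable {d : ℕ} (S : Method d)

/-- `σ₀ = C_{σ₀} p² / h`. -/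
noncomputable def σ₀ (n : ℕ) (x : E d) : ℝ := S.Cσ * (S.p : ℝ) ^ 2 / S.M.h n x

/-- `σ₀` at the time node `t (n+1)`. -/
noncomputable def nodeσ₀ (n : ℕ) (x : E d) : ℝ := S.Cσ * (S.p : ℝ) ^ 2 / S.M.nodeH n x

/-- `σ₁ = C_a p³ / (h τ_n)`. -/
noncomputable def σ₁ (n : ℕ) (x : E d) : ℝ := S.Ca * (S.p : ℝ) ^ 3 / (S.M.h n x * S.M.tau n)

/-- `σ₂ = h / (C_a τ_n)`. -/
noncomputable def σ₂ (n : ℕ) (x : E d) : ℝ := S.M.h n x / (S.Ca * S.M.tau n)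

/-! Values at time `t` of the quantities that are built from the jets of slab `n`. -/

/-- `[u(t)]` -/
noncomputable def jmp (u : Broken d) (n : ℕ) (t : ℝ) : E d → E d :=
  S.M.jump n (fun K => (u n K).val t)

/-- `[u̇(t)]` -/
noncomputable def jmpDt (u : Broken d) (n : ℕ) (t : ℝ) : E d → E d :=
  S.M.jump n (fun K => (u n K).dt t)

/-- `[a ∇u(t)]` -/
noncomputable def jmpFlux (u : Broken d) (n : ℕ) (t : ℝ) : E d → ℝ :=
  S.M.jumpV n (fun K x => coef S.a K • (u n K).grad t x)

/-- `{u̇(t)}` -/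
noncomputable def avgDt (u : Broken d) (n : ℕ) (t : ℝ) : E d → ℝ :=
  S.M.avg n (fun K => (u n K).dt t)

/-- `{a ∇u(t)}` -/
noncomputable def avgFlux (u : Broken d) (n : ℕ) (t : ℝ) : E d → E d :=
  S.M.avg n (fun K x => coef S.a K • (u n K).grad t x)

/-- `{a ∇u̇(t)}` -/
noncomputable def avgFluxDt (u : Broken d) (n : ℕ) (t : ℝ) : E d → E d :=
  S.M.avg n (fun K x => coef S.a K • (u n K).gradDt t x)

/-- `u̇(t)` on `Ω` -/
noncomputable def bDt (u : Broken d) (n : ℕ) (t : ℝ) : E d → ℝ :=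
  S.M.bulk n (fun K => (u n K).dt t)

/-- `ü(t)` on `Ω` -/
noncomputable def bDtt (u : Broken d) (n : ℕ) (t : ℝ) : E d → ℝ :=
  S.M.bulk n (fun K => (u n K).dtt t)

/-- The broken gradient of `u(t)` on `Ω` -/
noncomputable def bGrad (u : Broken d) (n : ℕ) (t : ℝ) : E d → E d :=
  S.M.bulk n (fun K => (u n K).grad t)

/-- The broken gradient of `u̇(t)` on `Ω` -/
noncomputable def bGradDt (u : Broken d) (n : ℕ) (t : ℝ) : E d → E d :=
  S.M.bulk n (fun K => (u n K).gradDt t)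

/-- The form `a_n(u, v)` of the slab `I_n`. -/
noncomputable def slabForm (n : ℕ) (u v : Broken d) : ℝ :=
  (∫ t in S.M.slab n, ∫ x in S.M.Ω, S.bDtt u n t x * S.bDt v n t x)
  + (∫ x in S.M.Ω, S.bDt u n (S.M.t n) x * S.bDt v n (S.M.t n) x)
  + (∫ t in S.M.slab n, ∫ x in S.M.Ω, S.a x * inner ℝ (S.bGrad u n t x) (S.bGradDt v n t x))
  + (∫ x in S.M.Ω, S.a x * inner ℝ (S.bGrad u n (S.M.t n) x) (S.bGrad v n (S.M.t n) x))
  - (∫ t in S.M.slab n, ∫ x in S.M.skel n,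
      inner ℝ (S.avgFlux u n t x) (S.jmpDt v n t x) ∂(surf d))
  - (∫ x in S.M.skel n,
      inner ℝ (S.avgFlux u n (S.M.t n) x) (S.jmp v n (S.M.t n) x) ∂(surf d))
  - (∫ t in S.M.slab n, ∫ x in S.M.skel n,
      inner ℝ (S.jmp u n t x) (S.avgFluxDt v n t x) ∂(surf d))
  - (∫ x in S.M.skel n,
      inner ℝ (S.jmp u n (S.M.t n) x) (S.avgFlux v n (S.M.t n) x) ∂(surf d))
  + (∫ t in S.M.slab n, ∫ x in S.M.skel n,
      S.σ₀ n x * inner ℝ (S.jmp u n t x) (S.jmpDt v n t x) ∂(surf d))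
  + (∫ x in S.M.skel n,
      S.σ₀ n x * inner ℝ (S.jmp u n (S.M.t n) x) (S.jmp v n (S.M.t n) x) ∂(surf d))
  + (∫ t in S.M.slab n, ∫ x in S.M.skel n,
      S.σ₁ n x * inner ℝ (S.jmp u n t x) (S.jmp v n t x) ∂(surf d))
  + (∫ t in S.M.slab n, ∫ x in S.M.intSkel n,
      S.σ₂ n x * (S.jmpFlux u n t x * S.jmpFlux v n t x) ∂(surf d))

/-- The form `b_{n+1}(u, v)` coupling the slabs `I_n` and `I_{n+1}` at the time `t (n+1)`. -/
noncomputable def couplingForm (n : ℕ) (u v : Broken d) : ℝ :=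
  (∫ x in S.M.Ω, S.bDt u n (S.M.t (n + 1)) x * S.bDt v (n + 1) (S.M.t (n + 1)) x)
  + (∫ x in S.M.Ω, S.a x *
      inner ℝ (S.bGrad u n (S.M.t (n + 1)) x) (S.bGrad v (n + 1) (S.M.t (n + 1)) x))
  - (∫ x in S.M.skel (n + 1),
      inner ℝ (S.avgFlux u n (S.M.t (n + 1)) x) (S.jmp v (n + 1) (S.M.t (n + 1)) x) ∂(surf d))
  - (∫ x in S.M.skel n,
      inner ℝ (S.jmp u n (S.M.t (n + 1)) x) (S.avgFlux v (n + 1) (S.M.t (n + 1)) x) ∂(surf d))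
  + (∫ x in S.M.nodeSkel n, S.nodeσ₀ n x *
      inner ℝ (S.jmp u n (S.M.t (n + 1)) x) (S.jmp v (n + 1) (S.M.t (n + 1)) x) ∂(surf d))

/-- The space-time form `a(u, v) = ∑_{n < N} a_n(u, v) - ∑_{1 ≤ n < N} b_n(u, v)`. -/
noncomputable def form (u v : Broken d) : ℝ :=
  ∑ n ∈ Finset.range S.M.N, S.slabForm n u v
    - ∑ n ∈ Finset.range (S.M.N - 1), S.couplingForm n u v

/-- The dG norm `|||v||| = a(v, v)^{1/2}` of a piecewise polynomial. -/
noncomputable def dgNorm (v : PwPoly d) : ℝ := Real.sqrt (S.form v.broken v.broken)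

/-- The contribution of the end `t (n+1)` of the slab `I_n` to `|||w|||_*²`. -/
noncomputable def starNode (n : ℕ) (w : Broken d) : ℝ :=
  (∫ x in S.M.Ω, (S.bDt w n (S.M.t (n + 1)) x) ^ 2)
  + (∫ x in S.M.Ω, S.a x * ‖S.bGrad w n (S.M.t (n + 1)) x‖ ^ 2)
  + (∫ x in S.M.skel n, S.σ₀ n x * ‖S.jmp w n (S.M.t (n + 1)) x‖ ^ 2 ∂(surf d))
  + (∫ x in S.M.nodeSkel n,
      (S.nodeσ₀ n x)⁻¹ * ‖S.avgFlux w n (S.M.t (n + 1)) x‖ ^ 2 ∂(surf d))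

/-- The contribution of the skeleton of the slab `I_n` to `|||w|||_*²`. -/
noncomputable def starSlab (n : ℕ) (w : Broken d) : ℝ :=
  (∫ t in S.M.slab n, ∫ x in S.M.skel n, S.σ₁ n x * ‖S.jmp w n t x‖ ^ 2 ∂(surf d))
  + (∫ t in S.M.slab n, ∫ x in S.M.intSkel n, S.σ₂ n x * (S.jmpFlux w n t x) ^ 2 ∂(surf d))
  + (∫ t in S.M.slab n, ∫ x in S.M.intSkel n, (S.σ₂ n x)⁻¹ * (S.avgDt w n t x) ^ 2 ∂(surf d))
  + (∫ t in S.M.slab n, ∫ x in S.M.skel n,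
      (S.σ₁ n x)⁻¹ * ‖S.avgFluxDt w n t x‖ ^ 2 ∂(surf d))
  + (∫ t in S.M.slab n, ∫ x in S.M.skel n,
      (S.σ₀ n x) ^ 2 * (S.σ₁ n x)⁻¹ * ‖S.jmpDt w n t x‖ ^ 2 ∂(surf d))

/-- The augmented norm `|||w|||_*`. -/
noncomputable def starNorm (w : Broken d) : ℝ :=
  Real.sqrt ((1 / 2) * ∑ n ∈ Finset.range S.M.N, S.starNode n w
    + ∑ n ∈ Finset.range S.M.N, S.starSlab n w)

end Method

end TrefftzDG

/-!
The proof integrates by parts, so that all derivatives fall on `w`, and then compares term by term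
with an energy identity for `v`.

**Integration by parts.** The traces and end values of a regular `w` satisfy the fundamental theorem
of calculus against polynomials in time (`TimeFTC`, `HasFTC.pairing_inner`) and Green's formula on
each element (`HasLateralTrace.green`); both come from the divergence theorem on a polytope
(`Polytope.integral_fderiv`), or its one-dimensional analogue, by approximation with smooth
functions. As `v` solves the wave equation in every element, all volume terms in space-time cancel
in `slabForm_eq`. There remain, for each slab, the terms at its end time and the terms on its
skeleton (`form_eq_sum`). For `w = v` the same integration by parts in time is applied to the form
itself and gives `slabForm_self` and the energy identity `form_self_eq_sum`.

**The skeleton terms.** The weights in `|||w|||_*` are dual to the weights `σ₁`, `σ₂` of the penalty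
terms in `|||v|||²`, so these terms need only Young's inequality (`side_estimate`).

**The nodes.** At the end of a slab the section of `w` enters tested with the jump
`v(t⁻) - v(t⁺)` in the interior penalty energy form (`Section.energyForm`, `endForm_eq`,
`couplingForm_eq`), and at the final time tested with `v(t⁻)`. The energy identity contains exactly
half of that form evaluated at the same jump. Estimating the former by the latter (`stop_estimate`)
needs coercivity of the form for differences of sections of two meshes. Where the meshes differ, the
weight `σ₀` of a slab may exceed the weight `σ̂₀` at the node; the excess is part of `|||w|||_*`
and in the energy of `v`, and is split off as a separate penalty term.

**Coercivity.** What has to be shown is that the averaged flux of such a difference, with weight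
`σ̂₀⁻¹`, is bounded by half of its gradient energy (`fluxBound`). At almost every point of the
skeletons only one hyperplane bounding an element is visible (`ae_singleFace`). Hence the averages of
both meshes are averages over the same one or two overlaps `K ∩ L`, also where the point lies on one
skeleton only, and these overlaps have inradii comparable with the mesh size (`ae_pairH_mul_sq_le`).
On each overlap `P` the difference is a polynomial, to which the inverse inequality applies, and
`ρ_P |∂P| ≤ d |P|` follows from the divergence theorem for the field `x - y`, with `y` the centre of
the inscribed ball (`integral_pairH_mul_sq_le`).

Young's inequality is used in all terms with the same parameter; optimising it at the end
(`le_mul_sqrt_mul_sqrt`) gives the constant `8`.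
-/

namespace TrefftzDG

/-! ### Surface measure on hyperplanes -/

/-- Orthogonal coordinates `(s, y) ↦ y + s ν`, `y ⊥ ν`, adapted to a unit vector `ν`. -/
noncomputable def normalCoords {d : ℕ} (ν : E d) (hν : ‖ν‖ = 1) : ℝ × (Submodule.span ℝ {ν})ᗮ ≃ᵐ E d :=
  ((LinearIsometryEquiv.toSpanUnitSingleton (𝕜 := ℝ) ν hν).toHomeomorph.toMeasurableEquiv.prodCongr
    (MeasurableEquiv.refl _)).trans ((Submodule.span ℝ {ν}).measurableEquivProd (0 : E d)).symm

theorem normalCoords_apply {d : ℕ} (ν : E d) (hν : ‖ν‖ = 1) (p : ℝ × (Submodule.span ℝ {ν})ᗮ) :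
    normalCoords ν hν p = p.1 • ν + p.2 := by
  simp [normalCoords, MeasurableEquiv.prodCongr]

theorem measurePreserving_normalCoords {d : ℕ} (ν : E d) (hν : ‖ν‖ = 1) :
    MeasurePreserving (normalCoords ν hν) volume volume := by
  have h1 := (LinearIsometryEquiv.toSpanUnitSingleton (𝕜 := ℝ) ν hν).measurePreserving
  have h2 := ((Submodule.span ℝ {ν}).measurePreserving_measurableEquivProd (0 : E d)).symm
  have h3 : (Measure.euclideanHausdorffMeasure (Module.finrank ℝ (E d)) : Measure (E d)) = volume :=
    InnerProductSpace.euclideanHausdorffMeasure_eq_volume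
  rw [h3] at h2
  exact (h1.prod (MeasurePreserving.id volume)).trans h2

theorem inner_perp {d : ℕ} (ν : E d) (y : (Submodule.span ℝ {ν})ᗮ) : inner ℝ ν (y : E d) = 0 :=
  Submodule.mem_orthogonal_singleton_iff_inner_right.1 y.2

/-- On a hyperplane the normalised Hausdorff measure is the Lebesgue measure of the orthogonal
complement of the normal, translated to the hyperplane. -/
theorem surf_restrict_hyperplane {d : ℕ} (ν : E d) (hν : ‖ν‖ = 1) (b : ℝ) :
    (surf d).restrict {x | inner ℝ ν x = b} =
      (volume : Measure (Submodule.span ℝ {ν})ᗮ).map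
        (fun y : (Submodule.span ℝ {ν})ᗮ => b • ν + (y : E d)) := by
  have hν0 : ν ≠ 0 := by rintro rfl; simp at hν
  have hr : Module.finrank ℝ (Submodule.span ℝ {ν})ᗮ = d - 1 := by
    have h := (Submodule.span ℝ {ν}).finrank_add_finrank_orthogonal
    rw [finrank_span_singleton hν0, finrank_euclideanSpace_fin] at h
    omega
  have hiso : Isometry (fun y : (Submodule.span ℝ {ν})ᗮ => b • ν + (y : E d)) :=
    (isometry_add_left _).comp isometry_subtype_coe
  have hrange : range (fun y : (Submodule.span ℝ {ν})ᗮ => b • ν + (y : E d)) =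
      {x | inner ℝ ν x = b} := by
    ext x
    constructor
    · rintro ⟨y, rfl⟩
      simp [inner_add_right, inner_smul_right, inner_perp, hν]
    · intro hx
      refine ⟨⟨x - b • ν, ?_⟩, by simp⟩
      rw [Submodule.mem_orthogonal_singleton_iff_inner_right, inner_sub_right, inner_smul_right]
      simp only [mem_ofPred_eq] at hx
      simp [hx, hν]
  have h := hiso.map_euclideanHausdorffMeasure (d := d - 1)
  rw [hrange, ← hr, InnerProductSpace.euclideanHausdorffMeasure_eq_volume, hr] at h
  exact h.symm

theorem measurableEmbedding_hyperplane {d : ℕ} (ν : E d) (b : ℝ) :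
    MeasurableEmbedding (fun y : (Submodule.span ℝ {ν})ᗮ => b • ν + (y : E d)) :=
  (Isometry.isClosedEmbedding ((isometry_add_left _).comp isometry_subtype_coe)).measurableEmbedding

/-- Two different hyperplanes (neither equal nor equal with opposite orientation) cross in a set of
vanishing surface measure. -/
theorem ae_hyperplane_inner_ne {d : ℕ} {f g : E d × ℝ} (hf : ‖f.1‖ = 1) (hg : ‖g.1‖ = 1)
    (hfg : g ≠ f) (hfg' : g ≠ -f) :
    ∀ᵐ y : (Submodule.span ℝ {f.1})ᗮ, inner ℝ g.1 (f.2 • f.1 + (y : E d)) ≠ g.2 := by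
  set W := (Submodule.span ℝ {f.1})ᗮ
  let ℓ : W →ₗ[ℝ] ℝ := (innerₛₗ ℝ g.1).comp W.subtype
  have hℓ : ∀ y : W, ℓ y = inner ℝ g.1 (y : E d) := fun y => rfl
  by_cases h0 : ℓ = 0
  · -- here `g.1` is a multiple of `f.1`, hence `± f.1`
    have hmem : g.1 ∈ Submodule.span ℝ {f.1} := by
      rw [← Submodule.orthogonal_orthogonal (Submodule.span ℝ {f.1})]
      rw [Submodule.mem_orthogonal]
      intro u hu
      rw [real_inner_comm, ← hℓ ⟨u, hu⟩, h0]; rfl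
    obtain ⟨c, hc⟩ := Submodule.mem_span_singleton.1 hmem
    have hc1 : |c| = 1 := by
      have := congrArg norm hc
      rwa [norm_smul, hf, hg, mul_one, Real.norm_eq_abs] at this
    refine Eventually.of_forall fun y hy => ?_
    rw [inner_add_right, ← hℓ, h0, inner_smul_right, ← hc, inner_smul_left] at hy
    simp [hf] at hy
    rcases (abs_eq one_pos.le).1 hc1 with rfl | rfl
    · exact hfg (Prod.ext (by simpa using hc.symm) (by simpa using hy.symm))
    · exact hfg' (Prod.ext (by simpa using hc.symm) (by simpa using hy.symm))
  · have hsurj : ∃ y₀, ℓ y₀ = g.2 - inner ℝ g.1 (f.2 • f.1) := by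
      obtain ⟨z, hz⟩ : ∃ z, ℓ z ≠ 0 := by
        by_contra hcon; push Not at hcon; exact h0 (LinearMap.ext hcon)
      exact ⟨((g.2 - inner ℝ g.1 (f.2 • f.1)) / ℓ z) • z, by simp [hz]⟩
    obtain ⟨y₀, hy₀⟩ := hsurj
    have hne : (AffineSubspace.mk' y₀ (LinearMap.ker ℓ)) ≠ ⊤ := by
      intro h
      have := congrArg AffineSubspace.direction h
      rw [AffineSubspace.direction_mk', AffineSubspace.direction_top] at this
      exact h0 (LinearMap.ker_eq_top.1 this)
    have hnull := Measure.addHaar_affineSubspace (volume : Measure W) _ hne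
    refine measure_mono_null (fun y hy => ?_) hnull
    simp only [mem_compl_iff, mem_ofPred_eq, not_not] at hy
    rw [SetLike.mem_coe, AffineSubspace.mem_mk', vsub_eq_sub, LinearMap.mem_ker, map_sub, hy₀, hℓ,
      ← hy, inner_add_right]
    ring

theorem surf_inter_hyperplane {d : ℕ} {f g : E d × ℝ} (hf : ‖f.1‖ = 1) (hg : ‖g.1‖ = 1)
    (hfg : g ≠ f) (hfg' : g ≠ -f) :
    surf d {x | inner ℝ f.1 x = f.2 ∧ inner ℝ g.1 x = g.2} = 0 := by
  have hm : MeasurableSet {x : E d | inner ℝ g.1 x = g.2} :=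
    (isClosed_eq (by fun_prop) continuous_const).measurableSet
  have h1 : {x : E d | inner ℝ f.1 x = f.2 ∧ inner ℝ g.1 x = g.2} =
      {x | inner ℝ g.1 x = g.2} ∩ {x | inner ℝ f.1 x = f.2} := by ext; simp [and_comm]
  rw [h1, ← Measure.restrict_apply hm, surf_restrict_hyperplane f.1 hf,
    Measure.map_apply (measurableEmbedding_hyperplane _ _).measurable hm]
  have := ae_hyperplane_inner_ne hf hg hfg hfg'
  rw [ae_iff] at this
  simpa using this

/-! ### The divergence theorem on a polytope -/

theorem contDiff_smoothTransition : ContDiff ℝ ∞ Real.smoothTransition := Real.smoothTransition.contDiff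

theorem deriv_smoothTransition_eq_zero {u : ℝ} (hu : u ∉ Icc (0 : ℝ) 1) :
    deriv Real.smoothTransition u = 0 := by
  rw [mem_Icc, not_and_or, not_le, not_le] at hu
  rcases hu with hu | hu
  · have : Real.smoothTransition =ᶠ[𝓝 u] fun _ => 0 := by
      filter_upwards [Iio_mem_nhds hu] with x hx
      exact Real.smoothTransition.zero_of_nonpos hx.le
    rw [this.deriv_eq]; simp
  · have : Real.smoothTransition =ᶠ[𝓝 u] fun _ => 1 := by
      filter_upwards [Ioi_mem_nhds hu] with x hx
      exact Real.smoothTransition.one_of_one_le hx.le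
    rw [this.deriv_eq]; simp

theorem continuous_deriv_smoothTransition : Continuous (deriv Real.smoothTransition) :=
  contDiff_smoothTransition.continuous_deriv (by simp)

theorem hasCompactSupport_deriv_smoothTransition :
    HasCompactSupport (deriv Real.smoothTransition) :=
  HasCompactSupport.intro isCompact_Icc fun _ hu => deriv_smoothTransition_eq_zero hu

theorem integral_deriv_smoothTransition : ∫ u, deriv Real.smoothTransition u = 1 := by
  have h1 : ∫ u, deriv Real.smoothTransition u = ∫ u in Icc (0 : ℝ) 1, deriv Real.smoothTransition u :=
    (setIntegral_eq_integral_of_forall_compl_eq_zero fun u hu =>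
      deriv_smoothTransition_eq_zero hu).symm
  rw [h1, integral_Icc_eq_integral_Ioc, ← intervalIntegral.integral_of_le zero_le_one,
    intervalIntegral.integral_deriv_eq_sub
      (fun x _ => (contDiff_smoothTransition.differentiable (by simp)).differentiableAt)
      (continuous_deriv_smoothTransition.intervalIntegrable _ _)]
  simp

theorem tendsto_smoothTransition_div {c α : ℝ} (hc : c ≠ 0) :
    Tendsto (fun ε => Real.smoothTransition ((c + ε * α) / ε)) (𝓝[>] 0)
      (𝓝 (if 0 < c then 1 else 0)) := by
  have h0 : Tendsto (fun ε : ℝ => c + ε * α) (𝓝[>] 0) (𝓝 c) := by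
    have : Tendsto (fun ε : ℝ => c + ε * α) (𝓝 0) (𝓝 (c + 0 * α)) := by
      apply Continuous.tendsto; fun_prop
    simpa using this.mono_left nhdsWithin_le_nhds
  apply tendsto_const_nhds.congr'
  split_ifs with h
  · have h1 : ∀ᶠ ε : ℝ in 𝓝[>] 0, c / 2 < c + ε * α := h0.eventually (lt_mem_nhds (by linarith))
    have h2 : ∀ᶠ ε : ℝ in 𝓝[>] 0, ε < c / 2 :=
      (tendsto_id.mono_left nhdsWithin_le_nhds).eventually (gt_mem_nhds (by linarith))
    filter_upwards [h1, h2, self_mem_nhdsWithin] with ε h1 h2 h3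
    have h3 : 0 < ε := h3
    symm
    apply Real.smoothTransition.one_of_one_le
    rw [le_div_iff₀ h3]; linarith
  · have hc' : c < 0 := lt_of_le_of_ne (not_lt.1 h) hc
    have h1 : ∀ᶠ ε : ℝ in 𝓝[>] 0, c + ε * α < 0 := h0.eventually (gt_mem_nhds hc')
    filter_upwards [h1, self_mem_nhdsWithin] with ε h1 h3
    have h3 : 0 < ε := h3
    symm
    exact Real.smoothTransition.zero_of_nonpos (div_nonpos_of_nonpos_of_nonneg h1.le h3.le)

theorem tendsto_smoothTransition_div' (c : ℝ) :
    Tendsto (fun ε => Real.smoothTransition (c / ε)) (𝓝[>] 0) (𝓝 (if 0 < c then 1 else 0)) := by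
  by_cases hc : c = 0
  · simp [hc]
  · simpa using tendsto_smoothTransition_div (α := 0) hc

open Classical in
/-- The relatively open face of `K` on the hyperplane `f`. -/
def Polytope.openFace {d : ℕ} (K : Polytope d) (f : E d × ℝ) : Set (E d) :=
  {x | inner ℝ f.1 x = f.2 ∧ ∀ g ∈ K.faces.erase f, inner ℝ g.1 x < g.2}

theorem Polytope.ne_neg_of_mem_faces {d : ℕ} (K : Polytope d) {f g : E d × ℝ} (hf : f ∈ K.faces)
    (hg : g ∈ K.faces) : g ≠ -f := by
  rintro rfl
  obtain ⟨x, hx⟩ := K.nonempty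
  have h1 := hx f hf
  have h2 := hx _ hg
  simp at h2
  linarith

open Classical in
theorem Polytope.measurableSet_openFace {d : ℕ} (K : Polytope d) (f : E d × ℝ) :
    MeasurableSet (K.openFace f) := by
  have : K.openFace f = {x | inner ℝ f.1 x = f.2} ∩
      ⋂ g ∈ K.faces.erase f, {x | inner ℝ g.1 x < g.2} := by
    ext x; simp only [openFace, mem_ofPred_eq, mem_inter_iff, mem_iInter]
  rw [this]
  exact (isClosed_eq (by fun_prop) continuous_const).measurableSet.inter
    (Finset.measurableSet_biInter _ fun g _ =>
      (isOpen_lt (by fun_prop) continuous_const).measurableSet)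

open Classical in
theorem setIntegral_openFace {d : ℕ} (K : Polytope d) {f : E d × ℝ} (hf : f ∈ K.faces)
    (F : E d → ℝ) :
    ∫ x in K.openFace f, F x ∂(surf d) = ∫ y : (Submodule.span ℝ {f.1})ᗮ,
      (∏ g ∈ K.faces.erase f, if 0 < g.2 - inner ℝ g.1 (f.2 • f.1 + (y : E d)) then (1 : ℝ) else 0)
        * F (f.2 • f.1 + y) := by
  have hsub : K.openFace f ⊆ {x | inner ℝ f.1 x = f.2} := fun x hx => hx.1
  rw [← inter_eq_self_of_subset_left hsub,
    ← Measure.restrict_restrict (K.measurableSet_openFace f),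
    surf_restrict_hyperplane f.1 (K.unit f hf), ← integral_indicator (K.measurableSet_openFace f),
    (measurableEmbedding_hyperplane _ _).integral_map]
  congr 1 with y
  rw [Finset.prod_ite_zero]
  simp only [Finset.prod_const_one, sub_pos, ite_mul, one_mul, zero_mul, indicator_apply]
  congr 1
  simp [Polytope.openFace, inner_add_right, inner_smul_right, inner_perp, K.unit f hf]

open Classical in
/-- The kernel `S'((b - ⟨ν, x⟩) / ε) / ε` belonging to a face concentrates on the hyperplane of that
face, and the cutoffs of the other faces turn into the indicator function of the face. -/
theorem tendsto_strip {d : ℕ} (K : Polytope d) {f : E d × ℝ} (hf : f ∈ K.faces)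
    {F : E d → ℝ} (hF : Continuous F) (hFc : HasCompactSupport F) :
    Tendsto (fun ε => ∫ x, F x * (deriv Real.smoothTransition ((f.2 - inner ℝ f.1 x) / ε) / ε *
        ∏ g ∈ K.faces.erase f, Real.smoothTransition ((g.2 - inner ℝ g.1 x) / ε)))
      (𝓝[>] 0) (𝓝 (∫ x in K.openFace f, F x ∂(surf d))) := by
  set W := (Submodule.span ℝ {f.1})ᗮ
  have hν := K.unit f hf
  set S := Real.smoothTransition
  -- the integral in the coordinates `x = y + (b - ε u) ν`
  set Φ : ℝ → ℝ × W → ℝ := fun ε p =>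
    F ((f.2 - ε * p.1) • f.1 + p.2) * (deriv S p.1 *
      ∏ g ∈ K.faces.erase f, S ((g.2 - inner ℝ g.1 ((f.2 - ε * p.1) • f.1 + (p.2 : E d))) / ε))
    with hΦ
  have hcontΦ : ∀ ε, Continuous (Φ ε) := by
    intro ε
    have := continuous_deriv_smoothTransition
    have h2 : Continuous S := Real.smoothTransition.continuous
    refine (hF.comp (by fun_prop)).mul ((this.comp continuous_fst).mul ?_)
    exact continuous_finsetProd _ fun g _ => h2.comp (by fun_prop)
  obtain ⟨R, hR⟩ : ∃ R, ∀ x, F x ≠ 0 → ‖x‖ ≤ R := by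
    obtain ⟨R, hR⟩ := hFc.isCompact.isBounded.exists_norm_le
    exact ⟨R, fun x hx => hR x (subset_tsupport _ hx)⟩
  obtain ⟨C, hC⟩ := hF.bounded_above_of_compact_support hFc
  obtain ⟨C', hC'⟩ := continuous_deriv_smoothTransition.bounded_above_of_compact_support
    hasCompactSupport_deriv_smoothTransition
  have hprod : ∀ (ε : ℝ) (x : E d), |∏ g ∈ K.faces.erase f, S ((g.2 - inner ℝ g.1 x) / ε)| ≤ 1 := by
    intro ε x
    rw [Finset.abs_prod]
    refine Finset.prod_le_one (fun _ _ => abs_nonneg _) fun g _ => ?_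
    rw [abs_of_nonneg (Real.smoothTransition.nonneg _)]
    exact Real.smoothTransition.le_one _
  have hsuppy : ∀ (s : ℝ) (y : W), F (s • f.1 + y) ≠ 0 → ‖y‖ ≤ R := by
    intro s y h
    refine le_trans ?_ (hR _ h)
    have : ‖s • f.1 + (y : E d)‖ ^ 2 = ‖s • f.1‖ ^ 2 + ‖(y : E d)‖ ^ 2 := by
      rw [norm_add_sq_real, inner_smul_left, inner_perp]; simp
    have h3 : ‖(y : E d)‖ ^ 2 ≤ ‖s • f.1 + (y : E d)‖ ^ 2 := by rw [this]; nlinarith [sq_nonneg ‖s • f.1‖]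
    exact le_of_sq_le_sq h3 (norm_nonneg _)
  have hbound : ∀ ε p, ‖Φ ε p‖ ≤ (Icc (0 : ℝ) 1 ×ˢ Metric.closedBall (0 : W) R).indicator
      (fun _ => C * C') p := by
    intro ε p
    by_cases hp : p ∈ Icc (0 : ℝ) 1 ×ˢ Metric.closedBall (0 : W) R
    · rw [indicator_of_mem hp]
      simp only [hΦ, norm_mul]
      have h1 := hC ((f.2 - ε * p.1) • f.1 + p.2)
      have h2 := hC' p.1
      have h3 := hprod ε ((f.2 - ε * p.1) • f.1 + p.2)
      have hC0 : 0 ≤ C := (norm_nonneg _).trans h1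
      have hC0' : 0 ≤ C' := (norm_nonneg _).trans h2
      calc _ ≤ C * (C' * 1) := by
            gcongr
            exact h3
        _ = C * C' := by ring
    · rw [indicator_of_notMem hp]
      have : Φ ε p = 0 := by
        by_contra hne
        have hA : F ((f.2 - ε * p.1) • f.1 + p.2) ≠ 0 := fun h => hne (by simp [hΦ, h])
        have hB : deriv S p.1 ≠ 0 := fun h => hne (by simp [hΦ, h])
        refine hp ⟨by_contra fun h => hB (deriv_smoothTransition_eq_zero h), ?_⟩
        rw [mem_closedBall_zero_iff]
        exact hsuppy _ _ hA
      simp [this]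
  have hms : MeasurableSet (Icc (0 : ℝ) 1 ×ˢ Metric.closedBall (0 : W) R) :=
    measurableSet_Icc.prod Metric.isClosed_closedBall.measurableSet
  have hbint : Integrable ((Icc (0 : ℝ) 1 ×ˢ Metric.closedBall (0 : W) R).indicator
      (fun _ => C * C')) (volume : Measure (ℝ × W)) := by
    rw [integrable_indicator_iff hms]
    refine integrableOn_const ?_
    exact ((isCompact_Icc.prod (isCompact_closedBall _ _)).measure_lt_top).ne
  have hΦint : ∀ ε, Integrable (Φ ε) (volume : Measure (ℝ × W)) := fun ε =>
    hbint.mono' (hcontΦ ε).aestronglyMeasurable (Eventually.of_forall (hbound ε))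
  have hcov : ∀ ε, 0 < ε → ∫ x, F x * (deriv S ((f.2 - inner ℝ f.1 x) / ε) / ε *
        ∏ g ∈ K.faces.erase f, S ((g.2 - inner ℝ g.1 x) / ε)) = ∫ p, Φ ε p := by
    intro ε hε
    rw [← (measurePreserving_normalCoords f.1 hν).integral_comp'
      (g := fun x => F x * (deriv S ((f.2 - inner ℝ f.1 x) / ε) / ε *
        ∏ g ∈ K.faces.erase f, S ((g.2 - inner ℝ g.1 x) / ε)))]
    -- the affine substitution `s = b - ε u` in the first coordinate
    have hΨ : ∀ p : ℝ × W, (fun x => F x * (deriv S ((f.2 - inner ℝ f.1 x) / ε) / ε *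
        ∏ g ∈ K.faces.erase f, S ((g.2 - inner ℝ g.1 x) / ε))) (normalCoords f.1 hν p) =
        ε⁻¹ * Φ ε ((f.2 - p.1) / ε, p.2) := by
      intro p
      simp only [hΦ, normalCoords_apply]
      rw [mul_div_cancel₀ _ hε.ne', sub_sub_cancel, inner_add_right, inner_smul_right, inner_perp,
        real_inner_self_eq_norm_sq, hν]
      simp only [one_pow, mul_one, add_zero]
      ring
    simp_rw [hΨ]
    rw [integral_const_mul]
    have hint2 : Integrable (fun p : ℝ × W => Φ ε ((f.2 - p.1) / ε, p.2)) := by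
      have h1 : Continuous (fun p : ℝ × W => Φ ε ((f.2 - p.1) / ε, p.2)) :=
        (hcontΦ ε).comp (by fun_prop)
      refine Continuous.integrable_of_hasCompactSupport h1 ?_
      refine HasCompactSupport.intro
        ((isCompact_Icc (a := f.2 - ε) (b := f.2)).prod (isCompact_closedBall (0 : W) R)) ?_
      intro p hp
      have hb := hbound ε ((f.2 - p.1) / ε, p.2)
      rw [indicator_of_notMem] at hb
      · simpa using hb
      · intro hmem
        apply hp
        obtain ⟨⟨h1, h2⟩, h3⟩ := hmem
        simp only [le_div_iff₀ hε, div_le_iff₀ hε] at h1 h2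
        exact ⟨⟨by linarith, by linarith⟩, h3⟩
    rw [Measure.volume_eq_prod] at hint2 ⊢
    rw [integral_prod_symm _ hint2, integral_prod_symm _ (by simpa [Measure.volume_eq_prod] using hΦint ε),
      ← integral_const_mul]
    congr 1 with y
    have e1 := integral_sub_left_eq_self (fun s => Φ ε (s / ε, y)) volume f.2
    have e2 := Measure.integral_comp_div (fun s => Φ ε (s, y)) ε
    rw [e1, e2, abs_of_pos hε, smul_eq_mul, ← mul_assoc, inv_mul_cancel₀ hε.ne', one_mul]
  have hlim : Tendsto (fun ε => ∫ p, Φ ε p) (𝓝[>] 0) (𝓝 (∫ p : ℝ × W, deriv S p.1 *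
      ((∏ g ∈ K.faces.erase f, if 0 < g.2 - inner ℝ g.1 (f.2 • f.1 + (p.2 : E d)) then (1 : ℝ) else 0)
        * F (f.2 • f.1 + p.2)))) := by
    refine tendsto_integral_filter_of_dominated_convergence _
      (Eventually.of_forall fun ε => (hcontΦ ε).aestronglyMeasurable)
      (Eventually.of_forall fun ε => Eventually.of_forall (hbound ε)) hbint ?_
    have hae : ∀ᵐ y : W, ∀ g ∈ K.faces.erase f, inner ℝ g.1 (f.2 • f.1 + (y : E d)) ≠ g.2 := by
      rw [Finset.eventually_all]
      intro g hg
      rw [Finset.mem_erase] at hg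
      exact ae_hyperplane_inner_ne hν (K.unit g hg.2) hg.1 (K.ne_neg_of_mem_faces hf hg.2)
    have hae2 : ∀ᵐ p : ℝ × W, ∀ g ∈ K.faces.erase f, inner ℝ g.1 (f.2 • f.1 + (p.2 : E d)) ≠ g.2 :=
      (Measure.quasiMeasurePreserving_snd (μ := (volume : Measure ℝ)) (ν := (volume : Measure W))).ae hae
    filter_upwards [hae2] with p hp
    have h1 : Tendsto (fun ε : ℝ => F ((f.2 - ε * p.1) • f.1 + p.2)) (𝓝[>] 0)
        (𝓝 (F (f.2 • f.1 + p.2))) := by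
      have hc : Continuous (fun ε : ℝ => F ((f.2 - ε * p.1) • f.1 + p.2)) := hF.comp (by fun_prop)
      have := hc.tendsto 0
      simp only [zero_mul, sub_zero] at this
      exact this.mono_left nhdsWithin_le_nhds
    have h2 : Tendsto (fun ε : ℝ => ∏ g ∈ K.faces.erase f,
        S ((g.2 - inner ℝ g.1 ((f.2 - ε * p.1) • f.1 + (p.2 : E d))) / ε)) (𝓝[>] 0)
        (𝓝 (∏ g ∈ K.faces.erase f,
          if 0 < g.2 - inner ℝ g.1 (f.2 • f.1 + (p.2 : E d)) then (1 : ℝ) else 0)) := by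
      refine tendsto_finsetProd _ fun g hg => ?_
      have := tendsto_smoothTransition_div (c := g.2 - inner ℝ g.1 (f.2 • f.1 + (p.2 : E d)))
        (α := p.1 * inner ℝ g.1 f.1) (sub_ne_zero.2 (hp g hg).symm)
      refine this.congr fun ε => ?_
      congr 2
      simp only [inner_add_right, inner_smul_right]
      ring
    have h3 := h1.mul (h2.const_mul (deriv S p.1))
    convert h3 using 2
    ring
  have hval : ∫ p : ℝ × W, deriv S p.1 *
      ((∏ g ∈ K.faces.erase f, if 0 < g.2 - inner ℝ g.1 (f.2 • f.1 + (p.2 : E d)) then (1 : ℝ) else 0)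
        * F (f.2 • f.1 + p.2)) = ∫ x in K.openFace f, F x ∂(surf d) := by
    rw [Measure.volume_eq_prod, integral_prod_mul (fun u => deriv S u) (fun y : W =>
      (∏ g ∈ K.faces.erase f, if 0 < g.2 - inner ℝ g.1 (f.2 • f.1 + (y : E d)) then (1 : ℝ) else 0)
        * F (f.2 • f.1 + y)), integral_deriv_smoothTransition, one_mul, setIntegral_openFace K hf]
  rw [← hval]
  refine hlim.congr' ?_
  filter_upwards [self_mem_nhdsWithin] with ε hε
  exact (hcov ε hε).symm


theorem Polytope.isOpen_set {d : ℕ} (K : Polytope d) : IsOpen K.set := by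
  have : K.set = ⋂ g ∈ K.faces, {x | inner ℝ g.1 x < g.2} := by
    ext x; simp only [Polytope.set, mem_ofPred_eq, mem_iInter]
  rw [this]
  exact isOpen_biInter_finset fun g _ => isOpen_lt (by fun_prop) continuous_const

theorem Polytope.convex_set {d : ℕ} (K : Polytope d) : Convex ℝ K.set := by
  have : K.set = ⋂ g ∈ K.faces, {x | inner ℝ g.1 x < g.2} := by
    ext x; simp only [Polytope.set, mem_ofPred_eq, mem_iInter]
  rw [this]
  exact convex_iInter₂ fun g _ => convex_halfSpace_lt (innerₛₗ ℝ g.1).isLinear _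

theorem Polytope.closure_set {d : ℕ} (K : Polytope d) :
    closure K.set = {x | ∀ f ∈ K.faces, inner ℝ f.1 x ≤ f.2} := by
  apply Subset.antisymm
  · apply closure_minimal fun x hx f hf => (hx f hf).le
    have : {x : E d | ∀ f ∈ K.faces, inner ℝ f.1 x ≤ f.2} =
        ⋂ g ∈ K.faces, {x | inner ℝ g.1 x ≤ g.2} := by
      ext x; simp only [mem_ofPred_eq, mem_iInter]
    rw [this]
    exact isClosed_biInter fun g _ => isClosed_le (by fun_prop) continuous_const
  · intro x hx
    obtain ⟨x₀, hx₀⟩ := K.nonempty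
    have hlim : Tendsto (fun s : ℝ => x + s • (x₀ - x)) (𝓝[>] 0) (𝓝 x) := by
      have : Continuous (fun s : ℝ => x + s • (x₀ - x)) := by fun_prop
      have := this.tendsto 0
      simp only [zero_smul, add_zero] at this
      exact this.mono_left nhdsWithin_le_nhds
    refine mem_closure_of_tendsto hlim ?_
    have h1 : ∀ᶠ s : ℝ in 𝓝[>] 0, s < 1 :=
      (tendsto_id.mono_left nhdsWithin_le_nhds).eventually (gt_mem_nhds one_pos)
    filter_upwards [h1, self_mem_nhdsWithin] with s hs hs' f hf
    have hs' : 0 < s := hs'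
    rw [inner_add_right, inner_smul_right, inner_sub_right]
    have a1 := hx f hf
    have a2 := hx₀ f hf
    nlinarith

theorem Polytope.isBounded_closure {d : ℕ} (K : Polytope d) : Bornology.IsBounded (closure K.set) :=
  Bornology.IsBounded.closure K.bounded

theorem Polytope.isBounded_frontier {d : ℕ} (K : Polytope d) :
    Bornology.IsBounded (frontier K.set) :=
  K.isBounded_closure.subset frontier_subset_closure

theorem Polytope.measurableSet_set {d : ℕ} (K : Polytope d) : MeasurableSet K.set :=
  K.isOpen_set.measurableSet

theorem Polytope.measurableSet_frontier {d : ℕ} (K : Polytope d) :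
    MeasurableSet (frontier K.set) := isClosed_frontier.measurableSet

theorem Polytope.volume_frontier {d : ℕ} (K : Polytope d) : volume (frontier K.set) = 0 :=
  K.convex_set.addHaar_frontier _

theorem Polytope.volume_lt_top {d : ℕ} (K : Polytope d) : volume K.set < ⊤ := K.bounded.measure_lt_top

instance {d : ℕ} (K : Polytope d) : IsFiniteMeasure (volume.restrict K.set) :=
  ⟨by simpa using K.volume_lt_top⟩

theorem Polytope.mem_frontier {d : ℕ} (K : Polytope d) (x : E d) :
    x ∈ frontier K.set ↔ x ∈ closure K.set ∧ x ∉ K.set := by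
  rw [K.isOpen_set.frontier_eq]; rfl

open Classical in
theorem Polytope.openFace_subset_frontier {d : ℕ} (K : Polytope d) {f : E d × ℝ}
    (hf : f ∈ K.faces) : K.openFace f ⊆ frontier K.set := by
  intro x hx
  rw [K.mem_frontier, K.closure_set]
  refine ⟨fun g hg => ?_, fun h => (h f hf).ne hx.1⟩
  by_cases hgf : g = f
  · rw [hgf]; exact hx.1.le
  · exact (hx.2 g (Finset.mem_erase.2 ⟨hgf, hg⟩)).le

open Classical in
theorem Polytope.pairwiseDisjoint_openFace {d : ℕ} (K : Polytope d) :
    (K.faces : Set (E d × ℝ)).Pairwise (fun f g => Disjoint (K.openFace f) (K.openFace g)) := by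
  intro f hf g hg hfg
  rw [Set.disjoint_left]
  intro x hx hx'
  exact (hx.2 g (Finset.mem_erase.2 ⟨hfg.symm, hg⟩)).ne hx'.1

open Classical in
/-- Almost every boundary point lies on exactly one of the bounding hyperplanes. -/
theorem Polytope.ae_mem_openFace {d : ℕ} (K : Polytope d) :
    ∀ᵐ x ∂(surf d), x ∈ frontier K.set → ∃ f ∈ K.faces, x ∈ K.openFace f := by
  have hae : ∀ᵐ x ∂(surf d), ∀ f ∈ K.faces, ∀ g ∈ K.faces.erase f,
      ¬ (inner ℝ f.1 x = f.2 ∧ inner ℝ g.1 x = g.2) := by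
    rw [Finset.eventually_all]
    intro f hf
    rw [Finset.eventually_all]
    intro g hg
    have hg := Finset.mem_erase.1 hg
    rw [ae_iff]
    simp only [not_not]
    exact surf_inter_hyperplane (K.unit f hf) (K.unit g hg.2) hg.1 (K.ne_neg_of_mem_faces hf hg.2)
  filter_upwards [hae] with x hx hxK
  rw [K.mem_frontier, K.closure_set] at hxK
  obtain ⟨f, hf, hfx⟩ : ∃ f ∈ K.faces, inner ℝ f.1 x = f.2 := by
    have := hxK.2
    simp only [Polytope.set, mem_ofPred_eq, not_forall] at this
    obtain ⟨f, hf, h⟩ := this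
    exact ⟨f, hf, le_antisymm (hxK.1 f hf) (not_lt.1 h)⟩
  exact ⟨f, hf, hfx, fun g hg => lt_of_le_of_ne (hxK.1 g (Finset.mem_of_mem_erase hg))
    fun h => hx f hf g hg ⟨hfx, h⟩⟩

open Classical in
/-- Up to a set of vanishing surface measure the boundary is the union of the open faces. -/
theorem Polytope.frontier_ae_eq {d : ℕ} (K : Polytope d) :
    (frontier K.set : Set (E d)) =ᵐ[surf d] (⋃ f ∈ K.faces, K.openFace f : Set (E d)) := by
  filter_upwards [K.ae_mem_openFace] with x hx
  apply propext
  constructor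
  · intro h
    obtain ⟨f, hf, hfx⟩ := hx h
    exact mem_iUnion₂.2 ⟨f, hf, hfx⟩
  · intro h
    obtain ⟨f, hf, hfx⟩ := mem_iUnion₂.1 h
    exact K.openFace_subset_frontier hf hfx

theorem surf_inter_hyperplane_lt_top {d : ℕ} {ν : E d} (hν : ‖ν‖ = 1) (b : ℝ) {s : Set (E d)}
    (hs : Bornology.IsBounded s) (hm : MeasurableSet s) : surf d (s ∩ {x | inner ℝ ν x = b}) < ⊤ := by
  rw [← Measure.restrict_apply hm, surf_restrict_hyperplane ν hν,
    Measure.map_apply (measurableEmbedding_hyperplane _ _).measurable hm]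
  apply Bornology.IsBounded.measure_lt_top
  have hiso : Isometry (fun y : (Submodule.span ℝ {ν})ᗮ => b • ν + (y : E d)) :=
    (isometry_add_left _).comp isometry_subtype_coe
  exact hiso.antilipschitz.isBounded_preimage hs

open Classical in
theorem Polytope.surf_frontier_lt_top {d : ℕ} (K : Polytope d) : surf d (frontier K.set) < ⊤ := by
  rw [measure_congr K.frontier_ae_eq]
  refine (measure_biUnion_finset_le _ _).trans_lt (ENNReal.sum_lt_top.2 fun f hf => ?_)
  refine lt_of_le_of_lt (measure_mono ?_)
    (surf_inter_hyperplane_lt_top (K.unit f hf) f.2 K.isBounded_frontier K.measurableSet_frontier)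
  exact fun x hx => ⟨K.openFace_subset_frontier hf hx, hx.1⟩

instance {d : ℕ} (K : Polytope d) : IsFiniteMeasure ((surf d).restrict (frontier K.set)) :=
  ⟨by simpa using K.surf_frontier_lt_top⟩

open Classical in
theorem Polytope.normal_eq_of_mem_openFace {d : ℕ} (K : Polytope d) {f : E d × ℝ}
    (hf : f ∈ K.faces) {x : E d} (hx : x ∈ K.openFace f) : K.normal x = f.1 := by
  unfold Polytope.normal
  rw [Finset.sum_eq_single_of_mem f (by simp [hf, hx.1])]
  intro g hg hgf
  rw [Finset.mem_filter] at hg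
  exact absurd hg.2 (hx.2 g (Finset.mem_erase.2 ⟨hgf, hg.1⟩)).ne

open Classical in
theorem Polytope.setIntegral_frontier {d : ℕ} (K : Polytope d) {F : E d → ℝ}
    (hF : IntegrableOn F (frontier K.set) (surf d)) :
    ∫ x in frontier K.set, F x ∂(surf d) = ∑ f ∈ K.faces, ∫ x in K.openFace f, F x ∂(surf d) := by
  rw [setIntegral_congr_set K.frontier_ae_eq]
  refine integral_biUnion_finset _ (fun f _ => K.measurableSet_openFace f)
    K.pairwiseDisjoint_openFace fun f hf => hF.mono_set (K.openFace_subset_frontier hf)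

open Classical in
theorem Polytope.normal_eq_sum_indicator {d : ℕ} (K : Polytope d) (x : E d) :
    K.normal x = ∑ f ∈ K.faces, {x | inner ℝ f.1 x = f.2}.indicator (fun _ => f.1) x := by
  rw [Polytope.normal, Finset.sum_filter]; rfl

theorem Polytope.measurable_normal {d : ℕ} (K : Polytope d) : Measurable K.normal := by
  have : K.normal = fun x => ∑ f ∈ K.faces, {x | inner ℝ f.1 x = f.2}.indicator (fun _ => f.1) x :=
    funext K.normal_eq_sum_indicator
  rw [this]
  exact Finset.measurable_sum _ fun f _ => measurable_const.indicator
    (isClosed_eq (by fun_prop) continuous_const).measurableSet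

theorem Polytope.norm_normal_le {d : ℕ} (K : Polytope d) (x : E d) : ‖K.normal x‖ ≤ K.faces.card := by
  classical
  rw [normal_eq_sum_indicator]
  refine (norm_sum_le _ _).trans ?_
  rw [Finset.card_eq_sum_ones, Nat.cast_sum]
  refine Finset.sum_le_sum fun f hf => ?_
  refine (norm_indicator_le_norm_self _ _).trans ?_
  simp [K.unit f hf]

open Classical in
theorem Polytope.ae_norm_normal {d : ℕ} (K : Polytope d) :
    ∀ᵐ x ∂((surf d).restrict (frontier K.set)), ‖K.normal x‖ = 1 := by
  rw [ae_restrict_iff' K.measurableSet_frontier]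
  filter_upwards [K.ae_mem_openFace] with x hx hxK
  obtain ⟨f, hf, hfx⟩ := hx hxK
  rw [K.normal_eq_of_mem_openFace hf hfx, K.unit f hf]

theorem Polytope.exists_cutoff {d : ℕ} (K : Polytope d) : ∃ χ : E d → ℝ, ContDiff ℝ ∞ χ ∧
    HasCompactSupport χ ∧ (∀ x ∈ closure K.set, χ =ᶠ[𝓝 x] 1) := by
  obtain ⟨R, hR0, hR⟩ := K.isBounded_closure.subset_ball_lt 0 0
  let b : ContDiffBump (0 : E d) := ⟨R, R + 1, hR0, by linarith⟩
  refine ⟨b, b.contDiff, b.hasCompactSupport, fun x hx => ?_⟩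
  exact b.eventuallyEq_one_of_mem_ball (hR hx)

/-- **Divergence theorem** on a polytope, for a field in a constant direction. -/
theorem Polytope.integral_fderiv {d : ℕ} (K : Polytope d) {F : E d → ℝ} (hF : ContDiff ℝ ∞ F)
    (e : E d) :
    ∫ x in K.set, fderiv ℝ F x e = ∫ x in frontier K.set, F x * inner ℝ (K.normal x) e ∂(surf d) := by
  classical
  -- reduction to compact support
  wlog hFc : HasCompactSupport F generalizing F with H
  · obtain ⟨χ, hχ, hχc, hχ1⟩ := K.exists_cutoff
    have h := H (F := fun x => χ x * F x) (hχ.mul hF) hχc.mul_right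
    have e1 : ∀ x ∈ closure K.set, (fun x => χ x * F x) =ᶠ[𝓝 x] F := by
      intro x hx
      filter_upwards [hχ1 x hx] with y hy
      simp [hy]
    rw [setIntegral_congr_fun K.measurableSet_set
        (g := fun x => fderiv ℝ (fun x => χ x * F x) x e),
      setIntegral_congr_fun (g := fun x => (χ x * F x) * inner ℝ (K.normal x) e)
        K.measurableSet_frontier, h]
    · intro x hx
      have := (e1 x (frontier_subset_closure hx)).eq_of_nhds
      exact congrArg (· * inner ℝ (K.normal x) e) this.symm
    · intro x hx
      simp only [(e1 x (subset_closure hx)).fderiv_eq]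
  set S := Real.smoothTransition
  have hScd : ContDiff ℝ ∞ S := Real.smoothTransition.contDiff
  have hFd : Differentiable ℝ F := hF.differentiable (by simp)
  have hF' : Continuous (fun x => fderiv ℝ F x e) := (hF.continuous_fderiv (by simp)).clm_apply continuous_const
  have hFc' : HasCompactSupport (fun x => fderiv ℝ F x e) :=
    (hFc.fderiv ℝ).comp_left (g := fun L : E d →L[ℝ] ℝ => L e) (by simp)
  let χ : ℝ → E d → ℝ := fun ε x => ∏ f ∈ K.faces, S ((f.2 - inner ℝ f.1 x) / ε)
  have hχcont : ∀ ε, Continuous (χ ε) := fun ε => continuous_finsetProd _ fun g _ =>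
    hScd.continuous.comp (by fun_prop)
  have hfd : ∀ (ε : ℝ) (f : E d × ℝ) (x : E d), HasFDerivAt (fun x => S ((f.2 - inner ℝ f.1 x) / ε))
      (deriv S ((f.2 - inner ℝ f.1 x) / ε) • ((-ε⁻¹) • innerSL ℝ f.1)) x := by
    intro ε f x
    have h1 : HasDerivAt S (deriv S ((f.2 - inner ℝ f.1 x) / ε)) ((f.2 - inner ℝ f.1 x) / ε) :=
      (hScd.differentiable (by simp)).differentiableAt.hasDerivAt
    have h2 : HasFDerivAt (fun x : E d => (f.2 - inner ℝ f.1 x) / ε) ((-ε⁻¹) • innerSL ℝ f.1) x := by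
      have := ((innerSL ℝ f.1).hasFDerivAt (x := x)).const_sub f.2 |>.mul_const ε⁻¹
      rw [smul_neg, ← neg_smul] at this
      exact this
    exact h1.comp_hasFDerivAt x h2
  have hχfd : ∀ ε x, HasFDerivAt (χ ε) (∑ f ∈ K.faces, (∏ g ∈ K.faces.erase f, S ((g.2 - inner ℝ g.1 x) / ε)) •
      (deriv S ((f.2 - inner ℝ f.1 x) / ε) • ((-ε⁻¹) • innerSL ℝ f.1))) x := fun ε x =>
    HasFDerivAt.finsetProd fun f _ => hfd ε f x
  have hχdiff : ∀ ε, Differentiable ℝ (χ ε) := fun ε x => (hχfd ε x).differentiableAt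
  have hstripcont : ∀ ε, ∀ f : E d × ℝ, Continuous (fun x =>
      F x * (deriv S ((f.2 - inner ℝ f.1 x) / ε) / ε *
      ∏ g ∈ K.faces.erase f, S ((g.2 - inner ℝ g.1 x) / ε))) := by
    intro ε f
    refine hF.continuous.mul (((continuous_deriv_smoothTransition.comp (by fun_prop)).div_const _).mul
      (continuous_finsetProd _ fun g _ => hScd.continuous.comp (by fun_prop)))
  have hstripint : ∀ ε, ∀ f : E d × ℝ, Integrable (fun x =>
      F x * (deriv S ((f.2 - inner ℝ f.1 x) / ε) / ε *
      ∏ g ∈ K.faces.erase f, S ((g.2 - inner ℝ g.1 x) / ε))) := fun ε f =>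
    (hstripcont ε f).integrable_of_hasCompactSupport hFc.mul_right
  have hderiv : ∀ ε x, F x * fderiv ℝ (χ ε) x e = - ∑ f ∈ K.faces, inner ℝ f.1 e *
      (F x * (deriv S ((f.2 - inner ℝ f.1 x) / ε) / ε *
      ∏ g ∈ K.faces.erase f, S ((g.2 - inner ℝ g.1 x) / ε))) := by
    intro ε x
    rw [(hχfd ε x).fderiv, _root_.sum_apply, Finset.mul_sum, ← Finset.sum_neg_distrib]
    refine Finset.sum_congr rfl fun f _ => ?_
    simp only [_root_.smul_apply, smul_eq_mul, innerSL_apply_apply]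
    ring
  have hibp : ∀ ε, ∑ f ∈ K.faces, inner ℝ f.1 e *
      ∫ x, (F x * (deriv S ((f.2 - inner ℝ f.1 x) / ε) / ε *
      ∏ g ∈ K.faces.erase f, S ((g.2 - inner ℝ g.1 x) / ε))) = ∫ x, fderiv ℝ F x e * χ ε x := by
    intro ε
    have := integral_mul_fderiv_eq_neg_fderiv_mul_of_integrable (μ := (volume : Measure (E d)))
      (f := F) (g := χ ε) (v := e)
      ((hF'.mul (hχcont ε)).integrable_of_hasCompactSupport hFc'.mul_right)
      (by
        simp_rw [hderiv]
        exact (integrable_finsetSum _ fun f _ => (hstripint ε f).const_mul _).neg)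
      ((hF.continuous.mul (hχcont ε)).integrable_of_hasCompactSupport hFc.mul_right)
      (fun x _ => hFd x) (fun x _ => hχdiff ε x)
    simp_rw [hderiv] at this
    rw [integral_neg, neg_inj, integral_finsetSum _ fun f _ => (hstripint ε f).const_mul _] at this
    rw [← this]
    simp_rw [integral_const_mul]
  have hlim1 : Tendsto (fun ε => ∫ x, fderiv ℝ F x e * χ ε x) (𝓝[>] 0)
      (𝓝 (∑ f ∈ K.faces, inner ℝ f.1 e * ∫ x in K.openFace f, F x ∂(surf d))) := by
    simp_rw [← hibp]
    exact tendsto_finsetSum _ fun f hf => (tendsto_strip K hf hF.continuous hFc).const_mul _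
  have hlim2 : Tendsto (fun ε => ∫ x, fderiv ℝ F x e * χ ε x) (𝓝[>] 0)
      (𝓝 (∫ x in K.set, fderiv ℝ F x e)) := by
    rw [← integral_indicator K.measurableSet_set]
    refine tendsto_integral_filter_of_dominated_convergence (fun x => |fderiv ℝ F x e|)
      (Eventually.of_forall fun ε => (hF'.mul (hχcont ε)).aestronglyMeasurable)
      (Eventually.of_forall fun ε => Eventually.of_forall fun x => ?_)
      (hF'.abs.integrable_of_hasCompactSupport hFc'.abs)
      (Eventually.of_forall fun x => ?_)
    · rw [norm_mul, Real.norm_eq_abs, Real.norm_eq_abs]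
      refine mul_le_of_le_one_right (abs_nonneg _) ?_
      rw [Finset.abs_prod]
      refine Finset.prod_le_one (fun _ _ => abs_nonneg _) fun g _ => ?_
      rw [abs_of_nonneg (Real.smoothTransition.nonneg _)]
      exact Real.smoothTransition.le_one _
    · have h1 : Tendsto (fun ε => χ ε x) (𝓝[>] 0)
          (𝓝 (∏ f ∈ K.faces, if 0 < f.2 - inner ℝ f.1 x then (1 : ℝ) else 0)) :=
        tendsto_finsetProd _ fun f _ => tendsto_smoothTransition_div' _
      have h2 := h1.const_mul (fderiv ℝ F x e)
      convert h2 using 2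
      rw [Finset.prod_ite_zero]
      simp only [Finset.prod_const_one, sub_pos, mul_ite, mul_one, mul_zero, indicator_apply]
      congr 1
  rw [tendsto_nhds_unique hlim2 hlim1, K.setIntegral_frontier]
  · refine Finset.sum_congr rfl fun f hf => ?_
    rw [← integral_const_mul]
    refine setIntegral_congr_fun (K.measurableSet_openFace f) fun x hx => ?_
    simp only [K.normal_eq_of_mem_openFace hf hx]
    ring
  · obtain ⟨C, hC⟩ := hF.continuous.bounded_above_of_compact_support hFc
    refine Integrable.of_bound (C := C * (K.faces.card * ‖e‖)) ?_ (Eventually.of_forall fun x => ?_)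
    · exact hF.continuous.aestronglyMeasurable.mul
        (K.measurable_normal.inner_const (𝕜 := ℝ)).aestronglyMeasurable
    · rw [norm_mul]
      have h1 := hC x
      have h0 : 0 ≤ C := (norm_nonneg _).trans h1
      have h2 : ‖inner ℝ (K.normal x) e‖ ≤ K.faces.card * ‖e‖ :=
        (norm_inner_le_norm _ _).trans (by gcongr; exact K.norm_normal_le x)
      gcongr

/-- The divergence theorem for the field `x ↦ x - x₀`. -/
theorem Polytope.integral_normal_sub {d : ℕ} (K : Polytope d) (x₀ : E d) :
    IntegrableOn (fun x => inner ℝ (K.normal x) (x - x₀)) (frontier K.set) (surf d) ∧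
    ∫ x in frontier K.set, inner ℝ (K.normal x) (x - x₀) ∂(surf d) = d * volume.real K.set := by
  have h : ∀ i : Fin d, ∫ x in frontier K.set,
      (x - x₀) i * inner ℝ (K.normal x) (EuclideanSpace.single i (1 : ℝ)) ∂(surf d) =
      volume.real K.set := by
    intro i
    have hcd : ContDiff ℝ ∞ (fun x : E d => (x - x₀) i) := by
      simp only [PiLp.sub_apply]; fun_prop
    rw [← K.integral_fderiv hcd]
    have : ∀ x, fderiv ℝ (fun x : E d => (x - x₀) i) x (EuclideanSpace.single i 1) = 1 := by
      intro x
      have : HasFDerivAt (fun x : E d => (x - x₀) i) (EuclideanSpace.proj i : E d →L[ℝ] ℝ) x := by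
        have := (EuclideanSpace.proj i : E d →L[ℝ] ℝ).hasFDerivAt (x := x) |>.sub_const (x₀ i)
        exact this
      rw [this.fderiv]; simp
    simp_rw [this]
    simp
  have hint : ∀ i : Fin d, Integrable (fun x => (x - x₀) i * inner ℝ (K.normal x)
      (EuclideanSpace.single i (1 : ℝ))) ((surf d).restrict (frontier K.set)) := by
    intro i
    obtain ⟨R, hR⟩ := (K.isBounded_frontier.subset_closedBall x₀)
    have hmeas : AEStronglyMeasurable (fun x : E d => (x - x₀) i * inner ℝ (K.normal x)
        (EuclideanSpace.single i (1 : ℝ))) ((surf d).restrict (frontier K.set)) := by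
      have hc : Continuous (fun x : E d => (x - x₀) i) := by
        simp only [PiLp.sub_apply]; fun_prop
      exact hc.aestronglyMeasurable.mul
        (K.measurable_normal.inner_const (𝕜 := ℝ)).aestronglyMeasurable
    refine Integrable.of_bound (C := R * K.faces.card) hmeas ?_
    rw [ae_restrict_iff' K.measurableSet_frontier]
    refine Eventually.of_forall fun x hx => ?_
    have h1 := hR hx
    rw [mem_closedBall_iff_norm] at h1
    rw [norm_mul]
    have h2 : ‖(x - x₀) i‖ ≤ R := (PiLp.norm_apply_le _ _).trans h1
    have h3 : ‖inner ℝ (K.normal x) (EuclideanSpace.single i (1 : ℝ))‖ ≤ K.faces.card := by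
      refine (norm_inner_le_norm _ _).trans ?_
      simpa using K.norm_normal_le x
    have := (norm_nonneg _).trans h2
    gcongr
  have hsum : (fun x => inner ℝ (K.normal x) (x - x₀)) = fun x => ∑ i : Fin d, (x - x₀) i *
      inner ℝ (K.normal x) (EuclideanSpace.single i (1 : ℝ)) := by
    ext x
    simp [PiLp.inner_apply]
  rw [hsum]
  refine ⟨integrable_finsetSum _ fun i _ => hint i, ?_⟩
  rw [integral_finsetSum _ fun i _ => hint i]
  simp_rw [h]
  simp

theorem Polytope.volume_pos {d : ℕ} (K : Polytope d) : 0 < volume.real K.set :=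
  ENNReal.toReal_pos (K.isOpen_set.measure_pos _ K.nonempty).ne' K.volume_lt_top.ne

theorem Polytope.surf_frontier_pos {d : ℕ} (hd : 1 ≤ d) (K : Polytope d) :
    0 < (surf d).real (frontier K.set) := by
  refine lt_of_le_of_ne measureReal_nonneg fun h => ?_
  have h0 : surf d (frontier K.set) = 0 :=
    (measureReal_eq_zero_iff K.surf_frontier_lt_top.ne).1 h.symm
  have h1 := (K.integral_normal_sub 0).2
  rw [Measure.restrict_eq_zero.2 h0, integral_zero_measure] at h1
  have : 0 < (d : ℝ) * volume.real K.set := mul_pos (by exact_mod_cast hd) K.volume_pos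
  linarith

theorem Polytope.mul_surf_frontier_le {d : ℕ} (K : Polytope d) {x₀ : E d} {r : ℝ}
    (hr : Metric.ball x₀ r ⊆ K.set) :
    r * (surf d).real (frontier K.set) ≤ d * volume.real K.set := by
  rw [← (K.integral_normal_sub x₀).2]
  have hconst : r * (surf d).real (frontier K.set) = ∫ x in frontier K.set, r ∂(surf d) := by
    simp [mul_comm]
  rw [hconst]
  rcases le_or_gt r 0 with hr0 | hr0
  · rw [(K.integral_normal_sub x₀).2]
    refine le_trans (integral_nonpos fun _ => hr0) (by positivity)
  refine integral_mono_ae (integrable_const _) (K.integral_normal_sub x₀).1 ?_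
  rw [EventuallyLE, ae_restrict_iff' K.measurableSet_frontier]
  filter_upwards [K.ae_mem_openFace] with x hx hxK
  obtain ⟨f, hf, hfx⟩ := hx hxK
  rw [K.normal_eq_of_mem_openFace hf hfx, inner_sub_right, hfx.1]
  refine le_of_forall_lt fun s hs => ?_
  -- the point `x₀ + max s 0 ν` of the ball lies inside the half-space
  have hmem : x₀ + (max s 0) • f.1 ∈ K.set := by
    apply hr
    rw [mem_ball_iff_norm, add_sub_cancel_left, norm_smul, K.unit f hf, mul_one, Real.norm_eq_abs,
      abs_of_nonneg (le_max_right _ _)]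
    exact max_lt hs hr0
  have := hmem f hf
  rw [inner_add_right, inner_smul_right, real_inner_self_eq_norm_sq, K.unit f hf] at this
  have := le_max_left s 0
  linarith

/-- `ρ |∂K| ≤ d |K|` for the inradius `ρ` of a polytope. -/
theorem Polytope.inradius_mul_surf_frontier_le {d : ℕ} (hd : 1 ≤ d) (K : Polytope d) :
    inradius K.set * (surf d).real (frontier K.set) ≤ d * volume.real K.set := by
  rw [← le_div_iff₀ (K.surf_frontier_pos hd)]
  refine csSup_le ⟨0, 0, by simp⟩ ?_
  rintro r ⟨x, hx⟩
  rw [le_div_iff₀ (K.surf_frontier_pos hd)]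
  exact K.mul_surf_frontier_le hx

open Classical in
/-- The overlap of two polytopes. -/
noncomputable def Polytope.inter {d : ℕ} (K L : Polytope d) (h : (K.set ∩ L.set).Nonempty) : Polytope d where
  faces := K.faces ∪ L.faces
  unit := fun f hf => (Finset.mem_union.1 hf).elim (K.unit f) (L.unit f)
  nonempty := by
    obtain ⟨x, hx, hx'⟩ := h
    exact ⟨x, fun f hf => (Finset.mem_union.1 hf).elim (hx f) (hx' f)⟩
  bounded := K.bounded.subset fun _ hx f hf => hx f (Finset.mem_union_left _ hf)

theorem Polytope.inter_set {d : ℕ} (K L : Polytope d) (h : (K.set ∩ L.set).Nonempty) :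
    (K.inter L h).set = K.set ∩ L.set := by
  ext x
  simp only [Polytope.set, Polytope.inter, Finset.mem_union, mem_ofPred_eq, mem_inter_iff]
  exact ⟨fun hx => ⟨fun f hf => hx f (Or.inl hf), fun f hf => hx f (Or.inr hf)⟩,
    fun hx f hf => hf.elim (hx.1 f) (hx.2 f)⟩

theorem Polytope.diam_pos {d : ℕ} (hd : 1 ≤ d) (K : Polytope d) : 0 < Metric.diam K.set := by
  obtain ⟨x, hx⟩ := K.nonempty
  obtain ⟨ε, hε, hb⟩ := Metric.isOpen_iff.1 K.isOpen_set x hx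
  let i : Fin d := ⟨0, hd⟩
  have hy : x + EuclideanSpace.single i (ε / 2) ∈ K.set := by
    apply hb
    rw [mem_ball_iff_norm, add_sub_cancel_left, PiLp.norm_single, Real.norm_eq_abs,
      abs_of_pos (by positivity)]
    linarith
  have h1 : _ ≤ Metric.diam K.set := Metric.dist_le_diam_of_mem K.bounded hy hx
  rw [dist_eq_norm, add_sub_cancel_left, PiLp.norm_single, Real.norm_eq_abs,
      abs_of_pos (by positivity)] at h1
  linarith

/-- A piece of a hyperplane that is cut out by a ball has positive surface measure. -/
theorem surf_hyperplane_inter_ball_pos {d : ℕ} {ν : E d} (hν : ‖ν‖ = 1) {b : ℝ} {x : E d}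
    (hx : inner ℝ ν x = b) {ε : ℝ} (hε : 0 < ε) :
    0 < surf d (Metric.ball x ε ∩ {y | inner ℝ ν y = b}) := by
  rw [← Measure.restrict_apply Metric.isOpen_ball.measurableSet, surf_restrict_hyperplane ν hν,
    Measure.map_apply (measurableEmbedding_hyperplane _ _).measurable Metric.isOpen_ball.measurableSet]
  refine IsOpen.measure_pos _ (Metric.isOpen_ball.preimage (by fun_prop)) ?_
  refine ⟨⟨x - b • ν, ?_⟩, by simpa using hε⟩
  rw [Submodule.mem_orthogonal_singleton_iff_inner_right, inner_sub_right, inner_smul_right]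
  simp [hx, hν]

/-! ### The partition of the domain into elements -/

namespace Mesh

variable {d : ℕ} (M : Mesh d)

theorem closure_subset_of_mem {n : ℕ} (hn : n < M.N) {K : Polytope d} (hK : K ∈ M.elems n) :
    closure K.set ⊆ closure M.Ω := by
  rw [M.cover n hn]
  exact subset_biUnion_of_mem (u := fun K : Polytope d => closure K.set) hK

theorem set_subset_of_mem {n : ℕ} (hn : n < M.N) {K : Polytope d} (hK : K ∈ M.elems n) :
    K.set ⊆ M.Ω := by
  rw [← M.regular_Ω]
  exact interior_maximal (subset_closure.trans (M.closure_subset_of_mem hn hK)) K.isOpen_set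

theorem eq_of_mem {n : ℕ} (hn : n < M.N) {K L : Polytope d} (hK : K ∈ M.elems n)
    (hL : L ∈ M.elems n) (h : (K.set ∩ L.set).Nonempty) : K = L := by
  by_contra hne
  exact Set.not_disjoint_iff_nonempty_inter.2 h (M.disjoint n hn K hK L hL hne)

theorem eq_of_mem_closure {n : ℕ} (hn : n < M.N) {K L : Polytope d} (hK : K ∈ M.elems n)
    (hL : L ∈ M.elems n) {x : E d} (hxK : x ∈ K.set) (hxL : x ∈ closure L.set) : K = L :=
  M.eq_of_mem hn hK hL (mem_closure_iff.1 hxL _ K.isOpen_set hxK)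

theorem skel_inter_closure {n : ℕ} (hn : n < M.N) {K : Polytope d} (hK : K ∈ M.elems n) :
    M.skel n ∩ closure K.set = frontier K.set := by
  apply Subset.antisymm
  · rintro x ⟨hx, hxK⟩
    obtain ⟨L, hL, hxL⟩ := mem_iUnion₂.1 hx
    rw [K.mem_frontier]
    refine ⟨hxK, fun h => ?_⟩
    have := M.eq_of_mem_closure hn hK hL h (frontier_subset_closure hxL)
    rw [← this, K.mem_frontier] at hxL
    exact hxL.2 h
  · exact fun x hx => ⟨mem_iUnion₂.2 ⟨K, hK, hx⟩, frontier_subset_closure hx⟩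

theorem notMem_skel_of_mem {n : ℕ} (hn : n < M.N) {K : Polytope d} (hK : K ∈ M.elems n) {x : E d}
    (hx : x ∈ K.set) : x ∉ M.skel n := fun h => by
  have : x ∈ frontier K.set := by
    rw [← M.skel_inter_closure hn hK]; exact ⟨h, subset_closure hx⟩
  exact (K.mem_frontier x).1 this |>.2 hx

theorem isClosed_skel (n : ℕ) : IsClosed (M.skel n) :=
  isClosed_biUnion_finset fun _ _ => isClosed_frontier

theorem measurableSet_skel (n : ℕ) : MeasurableSet (M.skel n) := (M.isClosed_skel n).measurableSet

theorem surf_skel_lt_top (n : ℕ) : surf d (M.skel n) < ⊤ :=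
  (measure_biUnion_finset_le _ _).trans_lt (ENNReal.sum_lt_top.2 fun K _ => K.surf_frontier_lt_top)

theorem skel_subset_closure {n : ℕ} (hn : n < M.N) : M.skel n ⊆ closure M.Ω :=
  iUnion₂_subset fun _ hK => frontier_subset_closure.trans (M.closure_subset_of_mem hn hK)

open Classical in
theorem mem_touching {n : ℕ} {x : E d} {K : Polytope d} :
    K ∈ M.touching n x ↔ K ∈ M.elems n ∧ x ∈ closure K.set := Finset.mem_filter

theorem volume_frontiers {n : ℕ} : ∀ᵐ x : E d, ∀ K ∈ M.elems n, x ∉ frontier K.set := by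
  rw [Finset.eventually_all]
  exact fun K _ => measure_eq_zero_iff_ae_notMem.1 K.volume_frontier

/-- Almost every point of `Ω` lies in an element. -/
theorem ae_mem_elem {n : ℕ} (hn : n < M.N) : ∀ᵐ x : E d, x ∈ M.Ω → ∃ K ∈ M.elems n, x ∈ K.set := by
  filter_upwards [M.volume_frontiers (n := n)] with x hx hΩ
  have : x ∈ ⋃ K ∈ M.elems n, closure K.set := by rw [← M.cover n hn]; exact subset_closure hΩ
  obtain ⟨K, hK, hxK⟩ := mem_iUnion₂.1 this
  refine ⟨K, hK, by_contra fun h => hx K hK ?_⟩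
  exact (K.mem_frontier x).2 ⟨hxK, h⟩

theorem bulk_eq {F : Type*} [AddCommMonoid F] {n : ℕ} (hn : n < M.N) {K : Polytope d}
    (hK : K ∈ M.elems n) (f : Polytope d → E d → F) {x : E d} (hx : x ∈ K.set) :
    M.bulk n f x = f K x := by
  unfold bulk
  rw [Finset.sum_eq_single_of_mem K hK, indicator_of_mem hx]
  intro L hL hne
  refine indicator_of_notMem (fun h => hne ?_) _
  exact M.eq_of_mem hn hL hK ⟨x, h, hx⟩

/-- The integral over a part of `Ω` is the sum over the elements. -/
theorem setIntegral_eq_sum {n : ℕ} (hn : n < M.N) {A : Set (E d)} (hA : A ⊆ M.Ω)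
    (hAm : MeasurableSet A) {f : E d → ℝ} (hf : IntegrableOn f A) :
    ∫ x in A, f x = ∑ K ∈ M.elems n, ∫ x in A ∩ K.set, f x := by
  have hae : (A : Set (E d)) =ᵐ[volume] (⋃ K ∈ M.elems n, A ∩ K.set : Set (E d)) := by
    filter_upwards [M.ae_mem_elem hn] with x hx
    apply propext
    constructor
    · intro h
      obtain ⟨K, hK, hxK⟩ := hx (hA h)
      exact mem_iUnion₂.2 ⟨K, hK, h, hxK⟩
    · intro h
      obtain ⟨K, hK, hxK⟩ := mem_iUnion₂.1 h
      exact hxK.1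
  rw [setIntegral_congr_set hae]
  refine integral_biUnion_finset _ (fun K _ => hAm.inter K.measurableSet_set) ?_
    fun K _ => hf.mono_set inter_subset_left
  intro K hK L hL hne
  exact (M.disjoint n hn K hK L hL hne).mono inter_subset_right inter_subset_right

theorem setIntegral_Ω_eq_sum {n : ℕ} (hn : n < M.N) {f : E d → ℝ} (hf : IntegrableOn f M.Ω) :
    ∫ x in M.Ω, f x = ∑ K ∈ M.elems n, ∫ x in K.set, f x := by
  rw [M.setIntegral_eq_sum hn Subset.rfl M.open_Ω.measurableSet hf]
  refine Finset.sum_congr rfl fun K hK => ?_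
  rw [inter_eq_self_of_subset_right (M.set_subset_of_mem hn hK)]

/-! ### Local structure of the skeleton -/

/-- The points of the ball of radius `ε` around `x` on the inner side of the hyperplane `f`. -/
def halfBall (f : E d × ℝ) (x : E d) (ε : ℝ) : Set (E d) :=
  Metric.ball x ε ∩ {y | inner ℝ f.1 y < f.2}

theorem isOpen_halfBall (f : E d × ℝ) (x : E d) (ε : ℝ) : IsOpen (halfBall f x ε) :=
  Metric.isOpen_ball.inter (isOpen_lt (by fun_prop) continuous_const)

theorem exists_mem_halfBall {f : E d × ℝ} (hf : ‖f.1‖ = 1) {x : E d} (hx : inner ℝ f.1 x ≤ f.2)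
    {ε δ : ℝ} (hε : 0 < ε) (hδ : 0 < δ) : ∃ y ∈ halfBall f x ε, dist y x < δ := by
  have hm : 0 < min ε δ / 2 := by positivity
  have hd : dist (x - (min ε δ / 2) • f.1) x = min ε δ / 2 := by
    rw [dist_eq_norm, sub_sub_cancel_left, norm_neg, norm_smul, hf, mul_one, Real.norm_eq_abs,
      abs_of_pos hm]
  refine ⟨x - (min ε δ / 2) • f.1, ⟨?_, ?_⟩, ?_⟩
  · rw [Metric.mem_ball, hd]
    linarith [min_le_left ε δ]
  · rw [mem_ofPred_eq, inner_sub_right, inner_smul_right, real_inner_self_eq_norm_sq, hf]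
    linarith
  · rw [hd]; linarith [min_le_right ε δ]

theorem mem_closure_halfBall {f : E d × ℝ} (hf : ‖f.1‖ = 1) {x y : E d} {ε : ℝ}
    (hy : y ∈ Metric.ball x ε) (hfy : inner ℝ f.1 y ≤ f.2) : y ∈ closure (halfBall f x ε) := by
  rw [Metric.mem_closure_iff]
  intro δ hδ
  have hε' : 0 < ε - dist y x := sub_pos.2 hy
  obtain ⟨z, hz, hzd⟩ := exists_mem_halfBall hf hfy hε' hδ
  refine ⟨z, ⟨?_, hz.2⟩, by rwa [dist_comm]⟩
  have h1 : dist z y < ε - dist y x := hz.1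
  rw [Metric.mem_ball]
  linarith [dist_triangle z y x]

/-- `f` is, up to orientation, the only hyperplane through `x` that bounds a polytope of the family
`Q`; inside the ball of radius `ε` around `x` no other bounding hyperplane is visible. -/
structure SingleFace (Q : Finset (Polytope d)) (f : E d × ℝ) (x : E d) (ε : ℝ) : Prop where
  unit : ‖f.1‖ = 1
  mem : inner ℝ f.1 x = f.2
  pos : 0 < ε
  face : ∀ K ∈ Q, ∀ g ∈ K.faces, inner ℝ g.1 x = g.2 → g = f ∨ g = -f
  away : ∀ K ∈ Q, ∀ g ∈ K.faces, inner ℝ g.1 x ≠ g.2 → ∀ y ∈ Metric.ball x ε,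
    (inner ℝ g.1 y < g.2 ↔ inner ℝ g.1 x < g.2)

theorem SingleFace.mono {Q Q' : Finset (Polytope d)} {f : E d × ℝ} {x : E d} {ε : ℝ}
    (h : SingleFace Q f x ε) (hQ : Q' ⊆ Q) : SingleFace Q' f x ε :=
  ⟨h.unit, h.mem, h.pos, fun K hK => h.face K (hQ hK), fun K hK => h.away K (hQ hK)⟩

theorem SingleFace.neg {Q : Finset (Polytope d)} {f : E d × ℝ} {x : E d} {ε : ℝ}
    (h : SingleFace Q f x ε) : SingleFace Q (-f) x ε := by
  refine ⟨by simpa using h.unit, by simp [h.mem], h.pos, fun K hK g hg hgx => ?_, h.away⟩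
  rw [neg_neg]
  exact (h.face K hK g hg hgx).symm

/-- Almost every point on a bounding hyperplane sees no other one. -/
theorem ae_singleFace (Q : Finset (Polytope d)) :
    ∀ᵐ x ∂(surf d), (∃ K ∈ Q, x ∈ frontier K.set) → ∃ f ε, SingleFace Q f x ε := by
  classical
  have hae : ∀ᵐ x ∂(surf d), ∀ K ∈ Q, ∀ L ∈ Q, ∀ f ∈ K.faces, ∀ g ∈ L.faces,
      inner ℝ f.1 x = f.2 → inner ℝ g.1 x = g.2 → g = f ∨ g = -f := by
    rw [Finset.eventually_all]; intro K hK
    rw [Finset.eventually_all]; intro L hL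
    rw [Finset.eventually_all]; intro f hf
    rw [Finset.eventually_all]; intro g hg
    by_cases h : g = f ∨ g = -f
    · exact Eventually.of_forall fun _ _ _ => h
    · rw [not_or] at h
      filter_upwards [measure_eq_zero_iff_ae_notMem.1
        (surf_inter_hyperplane (K.unit f hf) (L.unit g hg) h.1 h.2)] with x hx h1 h2
      exact absurd ⟨h1, h2⟩ hx
  filter_upwards [hae] with x hx hxQ
  obtain ⟨K, hK, hxK⟩ := hxQ
  obtain ⟨f, hf, hfx⟩ : ∃ f ∈ K.faces, inner ℝ f.1 x = f.2 := by
    rw [K.mem_frontier, K.closure_set] at hxK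
    have := hxK.2
    simp only [Polytope.set, mem_ofPred_eq, not_forall] at this
    obtain ⟨f, hf, h⟩ := this
    exact ⟨f, hf, le_antisymm (hxK.1 f hf) (not_lt.1 h)⟩
  have hev : ∀ᶠ y in 𝓝 x, ∀ L ∈ Q, ∀ g ∈ L.faces, inner ℝ g.1 x ≠ g.2 →
      (inner ℝ g.1 y < g.2 ↔ inner ℝ g.1 x < g.2) := by
    rw [Finset.eventually_all]; intro L hL
    rw [Finset.eventually_all]; intro g hg
    have hc : Tendsto (fun y : E d => inner ℝ g.1 y) (𝓝 x) (𝓝 (inner ℝ g.1 x)) :=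
      Continuous.tendsto (by fun_prop) x
    rcases lt_trichotomy (inner ℝ g.1 x) g.2 with h | h | h
    · filter_upwards [hc.eventually (gt_mem_nhds h)] with y hy _
      exact ⟨fun _ => h, fun _ => hy⟩
    · exact Eventually.of_forall fun _ h' => absurd h h'
    · filter_upwards [hc.eventually (lt_mem_nhds h)] with y hy _
      exact ⟨fun h' => absurd h' hy.not_gt, fun h' => absurd h' h.not_gt⟩
  obtain ⟨ε, hε, hball⟩ := Metric.eventually_nhds_iff_ball.1 hev
  exact ⟨f, ε, K.unit f hf, hfx, hε, fun L hL g hg hgx => hx K hK L hL f hf g hg hfx hgx,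
    fun L hL g hg hne y hy => hball y hy L hL g hg hne⟩

section Local

variable {M}
variable {Q : Finset (Polytope d)} {f : E d × ℝ} {x : E d} {ε : ℝ}

/-- Near `x` an element contains all or nothing of either side of the hyperplane. -/
theorem SingleFace.subset_of_nonempty (h : SingleFace Q f x ε) {K : Polytope d} (hK : K ∈ Q)
    (hne : (halfBall f x ε ∩ K.set).Nonempty) : halfBall f x ε ⊆ K.set := by
  obtain ⟨z, hz, hzK⟩ := hne
  intro y hy g hg
  by_cases hgx : inner ℝ g.1 x = g.2
  · rcases h.face K hK g hg hgx with rfl | rfl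
    · exact hy.2
    · have h1 := hzK _ hg
      have h2 : inner ℝ f.1 z < f.2 := hz.2
      simp at h1
      linarith
  · exact (h.away K hK g hg hgx y hy.1).2 ((h.away K hK g hg hgx z hz.1).1 (hzK g hg))

theorem SingleFace.nonempty_halfBall (h : SingleFace Q f x ε) : (halfBall f x ε).Nonempty :=
  let ⟨y, hy, _⟩ := exists_mem_halfBall h.unit h.mem.le h.pos h.pos
  ⟨y, hy⟩

theorem SingleFace.mem_closure (h : SingleFace Q f x ε) {s : Set (E d)} (hs : halfBall f x ε ⊆ s) :
    x ∈ closure s :=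
  closure_mono hs (mem_closure_halfBall h.unit (Metric.mem_ball_self h.pos) h.mem.le)

theorem SingleFace.hyperplane_subset_closure (h : SingleFace Q f x ε) {s : Set (E d)}
    (hs : halfBall f x ε ⊆ s) : Metric.ball x ε ∩ {y | inner ℝ f.1 y = f.2} ⊆ closure s :=
  fun _ hy => closure_mono hs (mem_closure_halfBall h.unit hy.1 (le_of_eq hy.2))

/-- An element that contains both sides of the hyperplane near `x` contains `x`. -/
theorem SingleFace.mem_of_both (h : SingleFace Q f x ε) {K : Polytope d}
    (h1 : halfBall f x ε ⊆ K.set) (h2 : halfBall (-f) x ε ⊆ K.set) : x ∈ K.set := by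
  have hd : ∀ s : ℝ, |s| = 1 → dist (x + (s * (ε / 2)) • f.1) x < ε := by
    intro s hs
    rw [dist_eq_norm, add_sub_cancel_left, norm_smul, h.unit, mul_one, Real.norm_eq_abs, abs_mul, hs,
      one_mul, abs_of_pos (half_pos h.pos)]
    exact half_lt_self h.pos
  have ha : x + ((-1) * (ε / 2)) • f.1 ∈ K.set := by
    refine h1 ⟨hd _ (by simp), ?_⟩
    rw [mem_ofPred_eq, inner_add_right, inner_smul_right, real_inner_self_eq_norm_sq, h.unit, h.mem]
    linarith [h.pos]
  have hb : x + (1 * (ε / 2)) • f.1 ∈ K.set := by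
    refine h2 ⟨hd _ (by simp), ?_⟩
    simp only [mem_ofPred_eq, Prod.fst_neg, Prod.snd_neg, inner_neg_left]
    rw [inner_add_right, inner_smul_right, real_inner_self_eq_norm_sq, h.unit, h.mem]
    linarith [h.pos]
  have := K.convex_set ha hb (a := 1 / 2) (b := 1 / 2) (by norm_num) (by norm_num) (by norm_num)
  convert this using 1
  module

theorem SingleFace.exists_side {n : ℕ} (hn : n < M.N) (h : SingleFace (M.elems n) f x ε) :
    (∃ K ∈ M.elems n, halfBall f x ε ⊆ K.set) ∨ halfBall f x ε ∩ closure M.Ω = ∅ := by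
  by_contra hcon
  push Not at hcon
  obtain ⟨h1, y, hy, hyΩ⟩ := hcon
  rw [M.cover n hn] at hyΩ
  obtain ⟨K, hK, hyK⟩ := mem_iUnion₂.1 hyΩ
  exact h1 K hK (h.subset_of_nonempty hK (mem_closure_iff.1 hyK _ (isOpen_halfBall f x ε) hy))

/-- An element whose closure contains `x` contains one of the sides. -/
theorem SingleFace.side_of_mem_closure (h : SingleFace Q f x ε) {K : Polytope d} (hK : K ∈ Q)
    (hx : x ∈ closure K.set) : halfBall f x ε ⊆ K.set ∨ halfBall (-f) x ε ⊆ K.set := by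
  obtain ⟨y, hyB, hyK⟩ := mem_closure_iff.1 hx _ Metric.isOpen_ball (Metric.mem_ball_self h.pos)
  rcases lt_trichotomy (inner ℝ f.1 y) f.2 with hlt | heq | hgt
  · exact Or.inl (h.subset_of_nonempty hK ⟨y, ⟨hyB, hlt⟩, hyK⟩)
  · have hyc := mem_closure_halfBall h.unit hyB heq.le
    obtain ⟨z, hzK, hz⟩ := mem_closure_iff.1 hyc _ K.isOpen_set hyK
    exact Or.inl (h.subset_of_nonempty hK ⟨z, hz, hzK⟩)
  · refine Or.inr (h.neg.subset_of_nonempty hK ⟨y, ⟨hyB, ?_⟩, hyK⟩)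
    simpa using hgt

/-- At a point of the skeleton inside `Ω` where only one bounding hyperplane is visible, exactly two
elements meet: each contains one of the half balls. -/
theorem SingleFace.interior {n : ℕ} (hn : n < M.N) (h : SingleFace (M.elems n) f x ε)
    (hx : x ∈ M.Ω) : ∃ K ∈ M.elems n, ∃ L ∈ M.elems n, halfBall f x ε ⊆ K.set ∧
      halfBall (-f) x ε ⊆ L.set ∧ ∀ P, P ∈ M.touching n x ↔ P = K ∨ P = L := by
  have key : ∀ g, SingleFace (M.elems n) g x ε → ∃ K ∈ M.elems n, halfBall g x ε ⊆ K.set := by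
    intro g hg
    refine (hg.exists_side hn).resolve_right fun hempty => ?_
    have hxc := mem_closure_halfBall hg.unit (Metric.mem_ball_self hg.pos) hg.mem.le
    obtain ⟨y, hyΩ, hy⟩ := mem_closure_iff.1 hxc _ M.open_Ω hx
    exact (hempty ▸ (⟨hy, subset_closure hyΩ⟩ : y ∈ halfBall g x ε ∩ closure M.Ω) : y ∈ (∅ : Set (E d)))
  obtain ⟨K, hK, hKs⟩ := key f h
  obtain ⟨L, hL, hLs⟩ := key (-f) h.neg
  refine ⟨K, hK, L, hL, hKs, hLs, fun P => ?_⟩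
  rw [mem_touching]
  constructor
  · rintro ⟨hP, hxP⟩
    rcases h.side_of_mem_closure hP hxP with hs | hs
    · obtain ⟨y, hy⟩ := h.nonempty_halfBall
      exact Or.inl (M.eq_of_mem hn hP hK ⟨y, hs hy, hKs hy⟩)
    · obtain ⟨y, hy⟩ := h.neg.nonempty_halfBall
      exact Or.inr (M.eq_of_mem hn hP hL ⟨y, hs hy, hLs hy⟩)
  · rintro (rfl | rfl)
    · exact ⟨hK, h.mem_closure hKs⟩
    · exact ⟨hL, h.neg.mem_closure hLs⟩

/-- At a point of the skeleton on `∂Ω` where only one bounding hyperplane is visible, exactly one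
element is adjacent: it contains the half ball inside `Ω`. -/
theorem SingleFace.boundary {n : ℕ} (hn : n < M.N) (h : SingleFace (M.elems n) f x ε)
    (hx : x ∈ closure M.Ω) (hempty : halfBall (-f) x ε ∩ closure M.Ω = ∅) :
    ∃ K ∈ M.elems n, halfBall f x ε ⊆ K.set ∧ ∀ P, P ∈ M.touching n x ↔ P = K := by
  have hno : ∀ P ∈ M.elems n, ¬ halfBall (-f) x ε ⊆ P.set := by
    intro P hP hs
    obtain ⟨y, hy⟩ := h.neg.nonempty_halfBall
    have : y ∈ halfBall (-f) x ε ∩ closure M.Ω :=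
      ⟨hy, M.closure_subset_of_mem hn hP (subset_closure (hs hy))⟩
    rw [hempty] at this
    exact this
  rw [M.cover n hn] at hx
  obtain ⟨K, hK, hxK⟩ := mem_iUnion₂.1 hx
  have hKs := (h.side_of_mem_closure hK hxK).resolve_right (hno K hK)
  refine ⟨K, hK, hKs, fun P => ?_⟩
  rw [mem_touching]
  constructor
  · rintro ⟨hP, hxP⟩
    have hs := (h.side_of_mem_closure hP hxP).resolve_right (hno P hP)
    obtain ⟨y, hy⟩ := h.nonempty_halfBall
    exact M.eq_of_mem hn hP hK ⟨y, hs hy, hKs hy⟩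
  · rintro rfl
    exact ⟨hK, hxK⟩

/-- At a boundary point of `Ω` one of the two sides lies outside. -/
theorem SingleFace.side_of_notMem {n : ℕ} (hn : n < M.N) (h : SingleFace (M.elems n) f x ε)
    (hx : x ∉ M.Ω) :
    halfBall f x ε ∩ closure M.Ω = ∅ ∨ halfBall (-f) x ε ∩ closure M.Ω = ∅ := by
  by_contra hcon
  rw [not_or] at hcon
  obtain ⟨K, hK, hKs⟩ := (h.exists_side hn).resolve_right hcon.1
  obtain ⟨L, hL, hLs⟩ := (h.neg.exists_side hn).resolve_right hcon.2
  apply hx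
  rw [← M.regular_Ω]
  refine mem_interior.2 ⟨Metric.ball x ε, fun y hy => ?_, Metric.isOpen_ball,
    Metric.mem_ball_self h.pos⟩
  rcases le_total (inner ℝ f.1 y) f.2 with hle | hle
  · exact M.closure_subset_of_mem hn hK (closure_mono hKs (mem_closure_halfBall h.unit hy hle))
  · exact M.closure_subset_of_mem hn hL
      (closure_mono hLs (mem_closure_halfBall h.neg.unit hy (by simpa using hle)))

/-- The two sides of the hyperplane belong to disjoint elements with opposite normals. -/
theorem SingleFace.normal_eq (h : SingleFace Q f x ε) {K : Polytope d} (hK : K ∈ Q)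
    (hs : halfBall f x ε ⊆ K.set) (hx : x ∉ K.set) : K.normal x = f.1 := by
  classical
  have hnf : -f ∉ K.faces := by
    intro hmem
    obtain ⟨y, hy⟩ := h.nonempty_halfBall
    have h1 := hs hy _ hmem
    have h2 : inner ℝ f.1 y < f.2 := hy.2
    simp at h1
    linarith
  have hxc : x ∈ closure K.set := h.mem_closure hs
  have hf : f ∈ K.faces := by
    rw [K.closure_set] at hxc
    simp only [Polytope.set, mem_ofPred_eq, not_forall] at hx
    obtain ⟨g, hg, hgx⟩ := hx
    have := le_antisymm (hxc g hg) (not_lt.1 hgx)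
    rcases h.face K hK g hg this with rfl | rfl
    · exact hg
    · exact absurd hg hnf
  unfold Polytope.normal
  rw [Finset.sum_eq_single_of_mem f (by simp [hf, h.mem])]
  intro g hg hne
  rw [Finset.mem_filter] at hg
  rcases h.face K hK g hg.1 hg.2 with rfl | rfl
  · exact absurd rfl hne
  · exact absurd hg.1 hnf

/-- The arithmetic mean is also correct for `K = L`, which allows a uniform treatment of points
inside an element of one mesh and on the skeleton of the other. -/
theorem avg_of_pair {F : Type*} [AddCommGroup F] [Module ℝ F] {n : ℕ} {K L : Polytope d}
    (h : ∀ P, P ∈ M.touching n x ↔ P = K ∨ P = L) (φ : Polytope d → E d → F) :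
    M.avg n φ x = (1 / 2 : ℝ) • (φ K x + φ L x) := by
  classical
  have ht : M.touching n x = {K, L} := by ext P; simp [h]
  unfold avg
  rw [ht]
  by_cases hKL : K = L
  · subst hKL
    simp [← two_smul ℝ (φ K x)]
  · rw [Finset.card_pair hKL, Finset.sum_pair hKL]
    norm_num

theorem avg_of_single {F : Type*} [AddCommGroup F] [Module ℝ F] {n : ℕ} {K : Polytope d}
    (h : ∀ P, P ∈ M.touching n x ↔ P = K) (φ : Polytope d → E d → F) :
    M.avg n φ x = φ K x := by
  have ht : M.touching n x = {K} := by ext P; simp [h]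
  unfold avg
  rw [ht]
  simp

end Local

end Mesh

/-! ### Averages and jumps on the skeleton -/

theorem Polytope.inradius_inter_pos {d : ℕ} (hd : 1 ≤ d) {K L : Polytope d}
    (h : (K.set ∩ L.set).Nonempty) : 0 < inradius (K.set ∩ L.set) := by
  obtain ⟨x, hx⟩ := h
  obtain ⟨ε, hε, hb⟩ := Metric.isOpen_iff.1 (K.isOpen_set.inter L.isOpen_set) x hx
  refine hε.trans_le (le_csSup ?_ ⟨x, hb⟩)
  have hne : (K.set ∩ L.set).Nonempty := ⟨x, hx⟩
  refine ⟨d * volume.real (K.inter L hne).set / (surf d).real (frontier (K.inter L hne).set), ?_⟩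
  rintro r ⟨y, hy⟩
  rw [le_div_iff₀ (Polytope.surf_frontier_pos hd _)]
  exact Polytope.mul_surf_frontier_le _ (by rwa [Polytope.inter_set])

namespace Mesh

variable {d : ℕ} (M : Mesh d)

/-- The elementwise fluxes on the skeleton in terms of averages and jumps. -/
theorem ae_sum_touching_flux {n : ℕ} (hn : n < M.N) :
    ∀ᵐ x ∂(surf d), x ∈ M.skel n → ∀ (φ : Polytope d → E d → ℝ) (G : Polytope d → E d → E d),
      ∑ K ∈ M.touching n x, φ K x * inner ℝ (G K x) (K.normal x) =
        inner ℝ (M.jump n φ x) (M.avg n G x) +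
          (M.intSkel n).indicator (fun x => M.avg n φ x * M.jumpV n G x) x := by
  classical
  filter_upwards [ae_singleFace (M.elems n)] with x hx hxs φ G
  obtain ⟨K₀, hK₀, hxK₀⟩ := mem_iUnion₂.1 hxs
  obtain ⟨f, ε, h⟩ := hx ⟨K₀, hK₀, hxK₀⟩
  by_cases hΩ : x ∈ M.Ω
  · have hint : x ∈ M.intSkel n := ⟨hxs, fun hfr => (M.open_Ω.frontier_eq ▸ hfr).2 hΩ⟩
    obtain ⟨K, hK, L, hL, hKs, hLs, ht⟩ := h.interior hn hΩ
    have hxK : x ∉ K.set := fun hmem => M.notMem_skel_of_mem hn hK hmem hxs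
    have hxL : x ∉ L.set := fun hmem => M.notMem_skel_of_mem hn hL hmem hxs
    have hKL : K ≠ L := by
      rintro rfl
      exact hxK (h.mem_of_both hKs hLs)
    have htt : M.touching n x = {K, L} := by ext P; simp [ht]
    rw [indicator_of_mem hint, avg_of_pair ht, avg_of_pair ht]
    unfold jump jumpV
    rw [htt, Finset.sum_pair hKL, Finset.sum_pair hKL, Finset.sum_pair hKL,
      h.normal_eq hK hKs hxK, h.neg.normal_eq hL hLs hxL]
    simp only [Prod.fst_neg, inner_neg_right, smul_neg, inner_add_left, inner_add_right,
      inner_neg_left, inner_smul_left, inner_smul_right, smul_eq_mul, RCLike.conj_to_real]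
    rw [real_inner_comm (G K x), real_inner_comm (G L x)]
    ring
  · have hint : x ∉ M.intSkel n := fun hmem =>
      hmem.2 (M.open_Ω.frontier_eq ▸ ⟨M.skel_subset_closure hn hxs, hΩ⟩)
    rw [indicator_of_notMem hint, add_zero]
    have key : ∀ g, SingleFace (M.elems n) g x ε → halfBall (-g) x ε ∩ closure M.Ω = ∅ →
        ∑ K ∈ M.touching n x, φ K x * inner ℝ (G K x) (K.normal x) =
          inner ℝ (M.jump n φ x) (M.avg n G x) := by
      intro g hg hge
      obtain ⟨K, hK, hKs, ht⟩ := hg.boundary hn (M.skel_subset_closure hn hxs) hge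
      have htt : M.touching n x = {K} := by ext P; simp [ht]
      rw [avg_of_single ht]
      unfold jump
      rw [htt, Finset.sum_singleton, Finset.sum_singleton, inner_smul_left, real_inner_comm]
      rfl
    rcases h.side_of_notMem hn hΩ with he | he
    · exact key (-f) h.neg (by rwa [neg_neg])
    · exact key f h he

/-! ### Averaged fluxes of two meshes -/

/-- The larger of the mesh sizes of the two meshes on whose skeletons a point lies. -/
noncomputable def pairH (m n : ℕ) (x : E d) : ℝ :=
  max ((M.skel m).indicator (M.h m) x) ((M.skel n).indicator (M.h n) x)

theorem Adjacent.left {M : Mesh d} {m n : ℕ} (h : M.Adjacent m n) : m < M.N := h.1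
theorem Adjacent.right {M : Mesh d} {m n : ℕ} (h : M.Adjacent m n) : n < M.N := h.2.1

/-- An element shares its boundary, of positive measure, with itself. -/
theorem one_le_of_locallyQuasiUniform (hd : 1 ≤ d) {κ : ℝ} (hκ : M.LocallyQuasiUniform κ) {n : ℕ}
    (hn : n < M.N) {K : Polytope d} (hK : K ∈ M.elems n) : 1 ≤ κ := by
  have hpos := K.diam_pos hd
  have h := hκ n hn K hK K hK ?_
  · by_contra hcon
    push Not at hcon
    nlinarith
  · intro h0
    have h1 : surf d (frontier K.set) = 0 :=
      measure_mono_null (by rw [inter_self]; exact frontier_subset_closure) h0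
    have := K.surf_frontier_pos hd
    rw [measureReal_def, h1] at this
    simp at this

/-- The contribution of the overlap of a pair of elements at the point `x`. -/
noncomputable def overlapTerm (F F' : Polytope d → E d → E d) (x : E d)
    (P : Polytope d × Polytope d) : ℝ :=
  (frontier (P.1.set ∩ P.2.set)).indicator
    (fun x => inradius (P.1.set ∩ P.2.set) * ‖F P.1 x - F' P.2 x‖ ^ 2) x

theorem overlapTerm_nonneg (hd : 1 ≤ d) (F F' : Polytope d → E d → E d) (x : E d)
    (P : Polytope d × Polytope d) : 0 ≤ overlapTerm F F' x P := by
  unfold overlapTerm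
  by_cases hx : x ∈ frontier (P.1.set ∩ P.2.set)
  · rw [indicator_of_mem hx]
    have hne : (P.1.set ∩ P.2.set).Nonempty := by
      by_contra h0
      rw [not_nonempty_iff_eq_empty] at h0
      simp [h0] at hx
    exact mul_nonneg (Polytope.inradius_inter_pos hd hne).le (sq_nonneg _)
  · rw [indicator_of_notMem hx]

variable {M} in
/-- A half ball on either side of the hyperplane spans an overlap with `x` on its boundary. -/
theorem SingleFace.mem_frontier_inter {Q : Finset (Polytope d)} {g : E d × ℝ} {x : E d} {ε : ℝ}
    (hg : SingleFace Q g x ε) {m n : ℕ} (hmn : M.Adjacent m n) (hxs : x ∈ M.skel m ∪ M.skel n)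
    {K L : Polytope d} (hK : K ∈ M.elems m) (hL : L ∈ M.elems n)
    (hgK : halfBall g x ε ⊆ K.set) (hgL : halfBall g x ε ⊆ L.set) :
    (K.set ∩ L.set).Nonempty ∧ x ∈ frontier (K.set ∩ L.set) := by
  obtain ⟨y, hy⟩ := hg.nonempty_halfBall
  refine ⟨⟨y, hgK hy, hgL hy⟩, ?_⟩
  rw [(K.isOpen_set.inter L.isOpen_set).frontier_eq]
  refine ⟨hg.mem_closure (subset_inter hgK hgL), fun hmem => ?_⟩
  exact hxs.elim (M.notMem_skel_of_mem hmn.left hK hmem.1)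
    (M.notMem_skel_of_mem hmn.right hL hmem.2)

open Classical in
/-- The bound of `ae_pairH_mul_sq_le` at a point of `Ω`: both averages are taken over the two
overlaps on either side of the visible hyperplane. -/
theorem pairH_mul_sq_le_of_mem (hd : 1 ≤ d) {cT κ : ℝ} (hT : M.ShapeRegular cT)
    (hκ : M.LocallyQuasiUniform κ) {m n : ℕ} (hmn : M.Adjacent m n) {x : E d} {f : E d × ℝ} {ε : ℝ}
    (h : SingleFace (M.elems m ∪ M.elems n) f x ε) (hκ1 : 1 ≤ κ) (hxs : x ∈ M.skel m ∪ M.skel n)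
    (hΩ : x ∈ M.Ω) (F F' : Polytope d → E d → E d) :
    M.pairH m n x * ‖M.avg m F x - M.avg n F' x‖ ^ 2 ≤
      κ * cT * ∑ P ∈ M.elems m ×ˢ M.elems n, overlapTerm F F' x P := by
  have hm := hmn.left
  have hn := hmn.right
  obtain ⟨K, hK, L, hL, hKs, hLs, ht⟩ := (h.mono Finset.subset_union_left).interior hm hΩ
  obtain ⟨K', hK', L', hL', hKs', hLs', ht'⟩ := (h.mono Finset.subset_union_right).interior hn hΩ
  obtain ⟨hne1, hfr1⟩ := h.mem_frontier_inter hmn hxs hK hK' hKs hKs'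
  obtain ⟨hne2, hfr2⟩ := h.neg.mem_frontier_inter hmn hxs hL hL' hLs hLs'
  have hne : (K, K') ≠ (L, L') := by
    intro heq
    obtain ⟨rfl, rfl⟩ := Prod.mk.inj heq
    have h1 := h.mem_of_both hKs hLs
    have h2 := h.mem_of_both hKs' hLs'
    exact hxs.elim (M.notMem_skel_of_mem hm hK h1) (M.notMem_skel_of_mem hn hK' h2)
  have hsurf : ∀ A B : Set (E d), halfBall f x ε ⊆ A → halfBall (-f) x ε ⊆ B →
      surf d (closure A ∩ closure B) ≠ 0 := by
    intro A B hA hB h0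
    refine (surf_hyperplane_inter_ball_pos h.unit h.mem h.pos).ne' (measure_mono_null ?_ h0)
    refine subset_inter (h.hyperplane_subset_closure hA) ?_
    have := h.neg.hyperplane_subset_closure hB
    simpa using this
  -- the mesh sizes are controlled by the diameters of the elements on both sides
  have hhm : M.h m x ≤ κ * Metric.diam K.set ∧ M.h m x ≤ κ * Metric.diam L.set := by
    have e : M.h m x = (1 / 2) * (Metric.diam K.set + Metric.diam L.set) := by
      unfold Mesh.h; rw [avg_of_pair ht]; rfl
    have h1 := hκ m hm K hK L hL (hsurf _ _ hKs hLs)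
    have h2 := hκ m hm L hL K hK (by rw [inter_comm]; exact hsurf _ _ hKs hLs)
    have p1 := K.diam_pos hd
    have p2 := L.diam_pos hd
    rw [e]
    constructor <;> nlinarith
  have hhn : M.h n x ≤ κ * Metric.diam K'.set ∧ M.h n x ≤ κ * Metric.diam L'.set := by
    have e : M.h n x = (1 / 2) * (Metric.diam K'.set + Metric.diam L'.set) := by
      unfold Mesh.h; rw [avg_of_pair ht']; rfl
    have h1 := hκ n hn K' hK' L' hL' (hsurf _ _ hKs' hLs')
    have h2 := hκ n hn L' hL' K' hK' (by rw [inter_comm]; exact hsurf _ _ hKs' hLs')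
    have p1 := K'.diam_pos hd
    have p2 := L'.diam_pos hd
    rw [e]
    constructor <;> nlinarith
  have hT1 := hT m n hmn K hK K' hK' hne1
  have hT2 := hT m n hmn L hL L' hL' hne2
  have hb : ∀ (P : Set (E d)) (a b : ℝ), 0 < a → a ≤ cT * inradius P → b ≤ cT * inradius P →
      M.h m x ≤ κ * a → M.h n x ≤ κ * b → M.pairH m n x ≤ κ * cT * inradius P := by
    intro P a b ha h1 h2 h3 h4
    have hκ0 : 0 ≤ κ := by linarith
    have hP : 0 ≤ κ * cT * inradius P := by
      rw [mul_assoc]; exact mul_nonneg hκ0 (by linarith)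
    have h5 : κ * a ≤ κ * cT * inradius P := by
      rw [mul_assoc]; exact mul_le_mul_of_nonneg_left h1 hκ0
    have h6 : κ * b ≤ κ * cT * inradius P := by
      rw [mul_assoc]; exact mul_le_mul_of_nonneg_left h2 hκ0
    refine max_le ?_ ?_
    · exact indicator_apply_le' (fun _ => h3.trans h5) (fun _ => hP)
    · exact indicator_apply_le' (fun _ => h4.trans h6) (fun _ => hP)
  have hp1 := hb _ _ _ (K.diam_pos hd) hT1.1 hT1.2 hhm.1 hhn.1
  have hp2 := hb _ _ _ (L.diam_pos hd) hT2.1 hT2.2 hhm.2 hhn.2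
  have hle : overlapTerm F F' x (K, K') + overlapTerm F F' x (L, L') ≤ ∑ P ∈ M.elems m ×ˢ M.elems n, overlapTerm F F' x P := by
    rw [← Finset.sum_pair hne]
    refine Finset.sum_le_sum_of_subset_of_nonneg ?_ fun P hP _ =>
      overlapTerm_nonneg hd F F' x P
    intro P hP
    simp only [Finset.mem_insert, Finset.mem_singleton] at hP
    rcases hP with rfl | rfl <;> simp [*]
  have e1 : overlapTerm F F' x (K, K') = inradius (K.set ∩ K'.set) * ‖F K x - F' K' x‖ ^ 2 := by
    unfold overlapTerm; rw [indicator_of_mem hfr1]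
  have e2 : overlapTerm F F' x (L, L') = inradius (L.set ∩ L'.set) * ‖F L x - F' L' x‖ ^ 2 := by
    unfold overlapTerm; rw [indicator_of_mem hfr2]
  have hpH : 0 ≤ M.pairH m n x := by
    have hh : ∀ k, 0 ≤ M.h k x := fun k => by
      unfold Mesh.h avg
      exact smul_nonneg (by positivity) (Finset.sum_nonneg fun _ _ => Metric.diam_nonneg)
    exact le_max_of_le_left (indicator_nonneg (fun _ _ => by
      unfold Mesh.h avg
      exact smul_nonneg (by positivity) (Finset.sum_nonneg fun _ _ => Metric.diam_nonneg)) _)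
  have hcT0 : 0 ≤ κ * cT := by
    have h1 := (K.diam_pos hd).trans_le hT1.1
    have h2 := Polytope.inradius_inter_pos hd hne1
    exact mul_nonneg (by linarith) (pos_of_mul_pos_left h1 h2.le).le
  have hsq : ‖M.avg m F x - M.avg n F' x‖ ^ 2 ≤
      (1 / 2) * (‖F K x - F' K' x‖ ^ 2 + ‖F L x - F' L' x‖ ^ 2) := by
    have e : M.avg m F x - M.avg n F' x =
        (1 / 2 : ℝ) • ((F K x - F' K' x) + (F L x - F' L' x)) := by
      rw [avg_of_pair ht, avg_of_pair ht']; module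
    rw [e, norm_smul, mul_pow]
    have h1 := norm_add_le (F K x - F' K' x) (F L x - F' L' x)
    have h2 := norm_nonneg ((F K x - F' K' x) + (F L x - F' L' x))
    norm_num
    nlinarith [sq_nonneg (‖F K x - F' K' x‖ - ‖F L x - F' L' x‖)]
  calc M.pairH m n x * ‖M.avg m F x - M.avg n F' x‖ ^ 2
      ≤ M.pairH m n x * ((1 / 2) * (‖F K x - F' K' x‖ ^ 2 + ‖F L x - F' L' x‖ ^ 2)) := by gcongr
    _ ≤ M.pairH m n x * (‖F K x - F' K' x‖ ^ 2 + ‖F L x - F' L' x‖ ^ 2) := by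
        gcongr
        nlinarith [sq_nonneg ‖F K x - F' K' x‖, sq_nonneg ‖F L x - F' L' x‖]
    _ = M.pairH m n x * ‖F K x - F' K' x‖ ^ 2 + M.pairH m n x * ‖F L x - F' L' x‖ ^ 2 := by ring
    _ ≤ (κ * cT * inradius (K.set ∩ K'.set)) * ‖F K x - F' K' x‖ ^ 2 +
        (κ * cT * inradius (L.set ∩ L'.set)) * ‖F L x - F' L' x‖ ^ 2 := by gcongr
    _ = κ * cT * (overlapTerm F F' x (K, K') + overlapTerm F F' x (L, L')) := by rw [e1, e2]; ring
    _ ≤ _ := by gcongr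

open Classical in
/-- The bound of `ae_pairH_mul_sq_le` at a point of `∂Ω`: both averages are values on the one
overlap inside `Ω`. -/
theorem pairH_mul_sq_le_of_halfBall (hd : 1 ≤ d) {cT κ : ℝ} (hT : M.ShapeRegular cT)
    {m n : ℕ} (hmn : M.Adjacent m n) {x : E d} {g : E d × ℝ} {ε : ℝ}
    (hg : SingleFace (M.elems m ∪ M.elems n) g x ε) (hκ1 : 1 ≤ κ)
    (hxs : x ∈ M.skel m ∪ M.skel n) (hxc : x ∈ closure M.Ω)
    (hge : halfBall (-g) x ε ∩ closure M.Ω = ∅) (F F' : Polytope d → E d → E d) :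
    M.pairH m n x * ‖M.avg m F x - M.avg n F' x‖ ^ 2 ≤
      κ * cT * ∑ P ∈ M.elems m ×ˢ M.elems n, overlapTerm F F' x P := by
  have hm := hmn.left
  have hn := hmn.right
  obtain ⟨K, hK, hKs, ht⟩ := (hg.mono Finset.subset_union_left).boundary hm hxc hge
  obtain ⟨K', hK', hKs', ht'⟩ := (hg.mono Finset.subset_union_right).boundary hn hxc hge
  obtain ⟨hne1, hfr1⟩ := hg.mem_frontier_inter hmn hxs hK hK' hKs hKs'
  have hT1 := hT m n hmn K hK K' hK' hne1
  have hP1 := Polytope.inradius_inter_pos hd hne1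
  have hcT : 0 < cT := pos_of_mul_pos_left ((K.diam_pos hd).trans_le hT1.1) hP1.le
  have hp1 : M.pairH m n x ≤ κ * cT * inradius (K.set ∩ K'.set) := by
    have hP : 0 ≤ cT * inradius (K.set ∩ K'.set) := by positivity
    have em : M.h m x = Metric.diam K.set := by unfold Mesh.h; rw [avg_of_single ht]
    have en : M.h n x = Metric.diam K'.set := by unfold Mesh.h; rw [avg_of_single ht']
    have h1 : M.pairH m n x ≤ cT * inradius (K.set ∩ K'.set) := max_le
      (indicator_apply_le' (fun _ => em ▸ hT1.1) (fun _ => hP))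
      (indicator_apply_le' (fun _ => en ▸ hT1.2) (fun _ => hP))
    rw [mul_assoc]
    nlinarith
  have e1 : overlapTerm F F' x (K, K') = inradius (K.set ∩ K'.set) * ‖F K x - F' K' x‖ ^ 2 := by
    unfold overlapTerm; rw [indicator_of_mem hfr1]
  rw [avg_of_single ht, avg_of_single ht']
  calc M.pairH m n x * ‖F K x - F' K' x‖ ^ 2
      ≤ (κ * cT * inradius (K.set ∩ K'.set)) * ‖F K x - F' K' x‖ ^ 2 := by gcongr
    _ = κ * cT * overlapTerm F F' x (K, K') := by rw [e1]; ring
    _ ≤ _ := by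
      have : 0 ≤ κ * cT := mul_nonneg (by linarith) hcT.le
      gcongr
      exact Finset.single_le_sum (fun P hP => overlapTerm_nonneg hd F F' x P) (Finset.mem_product.2 ⟨hK, hK'⟩)

/-- At almost every point of the skeletons of two consecutive meshes the averages of both meshes are
averages over the same (one or two) overlaps, whose inradii control the mesh size. -/
theorem ae_pairH_mul_sq_le (hd : 1 ≤ d) {cT κ : ℝ} (hT : M.ShapeRegular cT)
    (hκ : M.LocallyQuasiUniform κ) {m n : ℕ} (hmn : M.Adjacent m n) :
    ∀ᵐ x ∂(surf d), x ∈ M.skel m ∪ M.skel n → ∀ (F F' : Polytope d → E d → E d),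
      M.pairH m n x * ‖M.avg m F x - M.avg n F' x‖ ^ 2 ≤
        κ * cT * ∑ P ∈ M.elems m ×ˢ M.elems n, overlapTerm F F' x P := by
  classical
  have hm := hmn.left
  have hn := hmn.right
  filter_upwards [ae_singleFace (M.elems m ∪ M.elems n)] with x hx hxs F F'
  obtain ⟨f, ε, h⟩ : ∃ f ε, SingleFace (M.elems m ∪ M.elems n) f x ε := by
    apply hx
    rcases hxs with hxs | hxs
    · obtain ⟨K, hK, hxK⟩ := mem_iUnion₂.1 hxs
      exact ⟨K, Finset.mem_union_left _ hK, hxK⟩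
    · obtain ⟨K, hK, hxK⟩ := mem_iUnion₂.1 hxs
      exact ⟨K, Finset.mem_union_right _ hK, hxK⟩
  have hxc : x ∈ closure M.Ω := hxs.elim (fun h => M.skel_subset_closure hm h)
    (fun h => M.skel_subset_closure hn h)
  obtain ⟨K₀, hK₀⟩ : (M.elems m).Nonempty := by
    have hxc := hxc
    rw [M.cover m hm] at hxc
    obtain ⟨K, hK, -⟩ := mem_iUnion₂.1 hxc
    exact ⟨K, hK⟩
  have hκ1 := M.one_le_of_locallyQuasiUniform hd hκ hm hK₀
  by_cases hΩ : x ∈ M.Ω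
  · exact M.pairH_mul_sq_le_of_mem hd hT hκ hmn h hκ1 hxs hΩ F F'
  · rcases (h.mono Finset.subset_union_left).side_of_notMem hm hΩ with he | he
    · exact M.pairH_mul_sq_le_of_halfBall hd hT hmn h.neg hκ1 hxs hxc (by rwa [neg_neg]) F F'
    · exact M.pairH_mul_sq_le_of_halfBall hd hT hmn h hκ1 hxs hxc he F F'

end Mesh

/-! ### The discrete trace inequality -/

theorem integrableOn_of_continuous {X : Type*} [PseudoMetricSpace X] [ProperSpace X]
    [SecondCountableTopology X]
    [MeasurableSpace X] [OpensMeasurableSpace X] {μ : Measure X} {s : Set X}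
    (hs : Bornology.IsBounded s) (hm : MeasurableSet s) (hμ : μ s < ⊤) {g : X → ℝ}
    (hg : Continuous g) : IntegrableOn g s μ := by
  obtain ⟨C, hC⟩ := (hs.isCompact_closure.image hg).isBounded.exists_norm_le
  have : IsFiniteMeasure (μ.restrict s) := ⟨by simpa using hμ⟩
  refine Integrable.of_bound hg.aestronglyMeasurable C ?_
  rw [ae_restrict_iff' hm]
  exact Eventually.of_forall fun x hx => hC _ (mem_image_of_mem g (subset_closure hx))

/-- The vector field on an element whose components are given polynomials. -/
noncomputable def polyField {d : ℕ} (q : Polytope d → Fin d → MvPolynomial (Fin d) ℝ)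
    (K : Polytope d) (x : E d) : E d :=
  WithLp.toLp 2 (fun i => MvPolynomial.eval (fun j => x j) (q K i))

theorem continuous_eval_mvPolynomial {d : ℕ} (q : MvPolynomial (Fin d) ℝ) :
    Continuous (fun x : E d => MvPolynomial.eval (fun j => x j) q) :=
  (MvPolynomial.continuous_eval q).comp (by fun_prop)

theorem continuous_polyField {d : ℕ} (q : Polytope d → Fin d → MvPolynomial (Fin d) ℝ)
    (K : Polytope d) : Continuous (polyField q K) := by
  unfold polyField
  refine (PiLp.continuous_toLp 2 _).comp (continuous_pi fun i => continuous_eval_mvPolynomial _)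

namespace Mesh

variable {d : ℕ} (M : Mesh d)

/-- The inverse inequality on an overlap `P` of two elements, with `ρ |∂P| ≤ d |P|`. -/
theorem inradius_mul_integral_sq_le (hd : 1 ≤ d) {p : ℕ}
    {Cinv : ℝ} (hC0 : 0 ≤ Cinv) (hinv : M.IsInverseConstant p Cinv) {m n : ℕ}
    (hmn : M.Adjacent m n) {K L : Polytope d} (hK : K ∈ M.elems m) (hL : L ∈ M.elems n)
    (hne : (K.set ∩ L.set).Nonempty) (q : MvPolynomial (Fin d) ℝ) (hq : q.totalDegree ≤ p) :
    inradius (K.set ∩ L.set) *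
      ∫ x in frontier (K.set ∩ L.set), (MvPolynomial.eval (fun i => x i) q) ^ 2 ∂(surf d) ≤
    Cinv * (p : ℝ) ^ 2 * d * ∫ x in K.set ∩ L.set, (MvPolynomial.eval (fun i => x i) q) ^ 2 := by
  have hρ := Polytope.inradius_inter_pos hd hne
  have h1 := hinv m n hmn K hK L hL hne q hq
  have h2 := (K.inter L hne).inradius_mul_surf_frontier_le hd
  have hvol := (K.inter L hne).volume_pos
  rw [Polytope.inter_set] at h2 hvol
  have hI : 0 ≤ ∫ x in K.set ∩ L.set, (MvPolynomial.eval (fun i => x i) q) ^ 2 :=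
    integral_nonneg fun x => sq_nonneg _
  set I := ∫ x in K.set ∩ L.set, (MvPolynomial.eval (fun i => x i) q) ^ 2
  set V := volume.real (K.set ∩ L.set)
  set s := (surf d).real (frontier (K.set ∩ L.set))
  calc _ ≤ inradius (K.set ∩ L.set) * (Cinv * (p : ℝ) ^ 2 * (s / V) * I) := by gcongr
    _ = Cinv * (p : ℝ) ^ 2 * I * (inradius (K.set ∩ L.set) * s / V) := by ring
    _ ≤ Cinv * (p : ℝ) ^ 2 * I * d := by
        gcongr
        rw [div_le_iff₀ hvol]
        exact h2
    _ = _ := by ring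

/-- The inverse inequality for the polynomial `q = 1`. -/
theorem one_le_inverseConstant (hd : 1 ≤ d) {p : ℕ} {Cinv : ℝ} (hinv : M.IsInverseConstant p Cinv)
    {n : ℕ} (hn : n < M.N) {K : Polytope d} (hK : K ∈ M.elems n) : 1 ≤ Cinv * (p : ℝ) ^ 2 := by
  have hne : (K.set ∩ K.set).Nonempty := by rw [inter_self]; exact K.nonempty
  have h := hinv n n ⟨hn, hn, Or.inl rfl⟩ K hK K hK hne 1 (by simp)
  have h1 := K.surf_frontier_pos hd
  have h2 := K.volume_pos
  simp only [inter_self, map_one, one_pow, integral_const, smul_eq_mul, mul_one,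
    measureReal_restrict_apply_univ] at h
  have e : Cinv * (p : ℝ) ^ 2 * ((surf d).real (frontier K.set) / volume.real K.set) *
      volume.real K.set = Cinv * (p : ℝ) ^ 2 * (surf d).real (frontier K.set) := by
    field_simp
  rw [e] at h
  exact le_of_mul_le_mul_right (by simpa using h) h1

/-- The weighted averages of piecewise polynomial fluxes on the skeletons of two consecutive meshes
are controlled by the energy of the difference of the fields. -/
theorem integral_pairH_mul_sq_le (hd : 1 ≤ d) {cT κ Ca Cinv : ℝ} {p : ℕ} (hT : M.ShapeRegular cT)
    (hκ : M.LocallyQuasiUniform κ) (hinv : M.IsInverseConstant p Cinv)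
    {m n : ℕ} (hmn : M.Adjacent m n) (hκ0 : 0 ≤ κ) (hcT0 : 0 ≤ cT) (hC0 : 0 ≤ Cinv)
    {c : Polytope d → ℝ} (hc0 : ∀ K ∈ M.elems m, 0 ≤ c K) (hcC : ∀ K ∈ M.elems m, c K ≤ Ca)
    (hcc : ∀ K ∈ M.elems m, ∀ L ∈ M.elems n, (K.set ∩ L.set).Nonempty → c L = c K)
    {q q' : Polytope d → Fin d → MvPolynomial (Fin d) ℝ}
    (hq : ∀ K ∈ M.elems m, ∀ i, (q K i).totalDegree ≤ p)
    (hq' : ∀ K ∈ M.elems n, ∀ i, (q' K i).totalDegree ≤ p) :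
    ∫ x in M.skel m ∪ M.skel n, M.pairH m n x *
      ‖M.avg m (fun K x => c K • polyField q K x) x -
        M.avg n (fun K x => c K • polyField q' K x) x‖ ^ 2 ∂(surf d) ≤
    κ * cT * Cinv * (p : ℝ) ^ 2 * d * Ca * ∑ K ∈ M.elems m, ∑ L ∈ M.elems n,
      c K * ∫ x in K.set ∩ L.set, ‖polyField q K x - polyField q' L x‖ ^ 2 := by
  classical
  set F : Polytope d → E d → E d := fun K x => c K • polyField q K x
  set F' : Polytope d → E d → E d := fun K x => c K • polyField q' K x
  have hFc : ∀ K, Continuous (F K) := fun K => (continuous_polyField q K).const_smul (c K)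
  have hFc' : ∀ K, Continuous (F' K) := fun K => (continuous_polyField q' K).const_smul (c K)
  have hfr : ∀ K L : Polytope d, MeasurableSet (frontier (K.set ∩ L.set)) :=
    fun _ _ => isClosed_frontier.measurableSet
  have hfrb : ∀ K L : Polytope d, Bornology.IsBounded (frontier (K.set ∩ L.set)) := fun K L =>
    (K.isBounded_closure).subset (frontier_subset_closure.trans (closure_mono inter_subset_left))
  have hfrfin : ∀ K L : Polytope d, surf d (frontier (K.set ∩ L.set)) < ⊤ := by
    intro K L
    by_cases hne : (K.set ∩ L.set).Nonempty
    · rw [← Polytope.inter_set K L hne]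
      exact Polytope.surf_frontier_lt_top _
    · rw [not_nonempty_iff_eq_empty] at hne
      simp [hne]
  have hint : ∀ K L : Polytope d, IntegrableOn
      (fun x => inradius (K.set ∩ L.set) * ‖F K x - F' L x‖ ^ 2) (frontier (K.set ∩ L.set)) (surf d) :=
    fun K L => integrableOn_of_continuous (hfrb K L) (hfr K L) (hfrfin K L)
      (continuous_const.mul (((hFc K).sub (hFc' L)).norm.pow 2))
  have hintT : ∀ P : Polytope d × Polytope d, Integrable (fun x => overlapTerm F F' x P)
      ((surf d).restrict (M.skel m ∪ M.skel n)) := by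
    intro P
    exact ((integrable_indicator_iff (hfr P.1 P.2)).2 (hint P.1 P.2)).integrableOn
  have hmeas : MeasurableSet (M.skel m ∪ M.skel n) :=
    (M.measurableSet_skel m).union (M.measurableSet_skel n)
  have step1 : ∫ x in M.skel m ∪ M.skel n, M.pairH m n x *
      ‖M.avg m F x - M.avg n F' x‖ ^ 2 ∂(surf d) ≤
      ∫ x in M.skel m ∪ M.skel n, κ * cT *
        ∑ P ∈ M.elems m ×ˢ M.elems n, overlapTerm F F' x P ∂(surf d) := by
    refine integral_mono_of_nonneg ?_ ((integrable_finsetSum _ fun P _ => hintT P).const_mul _) ?_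
    · refine Eventually.of_forall fun x => mul_nonneg ?_ (sq_nonneg _)
      exact le_max_of_le_left (indicator_nonneg (fun _ _ => by
        unfold Mesh.h avg
        exact smul_nonneg (by positivity) (Finset.sum_nonneg fun _ _ => Metric.diam_nonneg)) _)
    · rw [EventuallyLE, ae_restrict_iff' hmeas]
      filter_upwards [M.ae_pairH_mul_sq_le hd hT hκ hmn] with x hx hxs
      exact hx hxs F F'
  have step2 : ∀ K ∈ M.elems m, ∀ L ∈ M.elems n,
      ∫ x in M.skel m ∪ M.skel n, overlapTerm F F' x (K, L) ∂(surf d) ≤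
      Cinv * (p : ℝ) ^ 2 * d * Ca *
        (c K * ∫ x in K.set ∩ L.set, ‖polyField q K x - polyField q' L x‖ ^ 2) := by
    intro K hK L hL
    by_cases hne : (K.set ∩ L.set).Nonempty
    swap
    · rw [not_nonempty_iff_eq_empty] at hne
      simp [overlapTerm, hne]
    have hρ := Polytope.inradius_inter_pos hd hne
    have hcK := hc0 K hK
    have hpt : ∀ x, ‖polyField q K x - polyField q' L x‖ ^ 2 =
        ∑ i, (MvPolynomial.eval (fun j => x j) (q K i - q' L i)) ^ 2 := by
      intro x
      rw [EuclideanSpace.norm_sq_eq]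
      simp [polyField]
    have hptF : ∀ x, ‖F K x - F' L x‖ ^ 2 = c K ^ 2 *
        ∑ i, (MvPolynomial.eval (fun j => x j) (q K i - q' L i)) ^ 2 := by
      intro x
      simp only [F, F', hcc K hK L hL hne, ← smul_sub, norm_smul, mul_pow, hpt]
      simp
    have hi1 : ∀ i, IntegrableOn (fun x : E d => (MvPolynomial.eval (fun j => x j) (q K i - q' L i)) ^ 2)
        (frontier (K.set ∩ L.set)) (surf d) := fun i =>
      integrableOn_of_continuous (hfrb K L) (hfr K L) (hfrfin K L)
        ((continuous_eval_mvPolynomial _).pow 2)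
    have hi2 : ∀ i, IntegrableOn (fun x : E d => (MvPolynomial.eval (fun j => x j) (q K i - q' L i)) ^ 2)
        (K.set ∩ L.set) := fun i =>
      integrableOn_of_continuous (K.bounded.subset inter_subset_left)
        (K.measurableSet_set.inter L.measurableSet_set)
        ((measure_mono inter_subset_left).trans_lt K.volume_lt_top)
        ((continuous_eval_mvPolynomial _).pow 2)
    have hdeg : ∀ i, (q K i - q' L i).totalDegree ≤ p := fun i =>
      (MvPolynomial.totalDegree_sub _ _).trans (max_le (hq K hK i) (hq' L hL i))
    calc ∫ x in M.skel m ∪ M.skel n, overlapTerm F F' x (K, L) ∂(surf d)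
        = ∫ x in (M.skel m ∪ M.skel n) ∩ frontier (K.set ∩ L.set),
            inradius (K.set ∩ L.set) * ‖F K x - F' L x‖ ^ 2 ∂(surf d) := by
          unfold overlapTerm
          rw [setIntegral_indicator (hfr K L)]
      _ ≤ ∫ x in frontier (K.set ∩ L.set),
            inradius (K.set ∩ L.set) * ‖F K x - F' L x‖ ^ 2 ∂(surf d) := by
          refine setIntegral_mono_set (hint K L) (Eventually.of_forall fun x => ?_)
            (Eventually.of_forall fun x hx => hx.2)
          exact mul_nonneg hρ.le (sq_nonneg _)
      _ = c K ^ 2 * ∑ i, inradius (K.set ∩ L.set) * ∫ x in frontier (K.set ∩ L.set),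
            (MvPolynomial.eval (fun j => x j) (q K i - q' L i)) ^ 2 ∂(surf d) := by
          simp_rw [hptF]
          rw [integral_const_mul, integral_const_mul, integral_finsetSum _ fun i _ => hi1 i,
            ← Finset.mul_sum]
          ring
      _ ≤ c K ^ 2 * ∑ i, Cinv * (p : ℝ) ^ 2 * d * ∫ x in K.set ∩ L.set,
            (MvPolynomial.eval (fun j => x j) (q K i - q' L i)) ^ 2 := by
          refine mul_le_mul_of_nonneg_left (Finset.sum_le_sum fun i _ => ?_) (sq_nonneg _)
          exact M.inradius_mul_integral_sq_le hd hC0 hinv hmn hK hL hne _ (hdeg i)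
      _ = c K * (Cinv * (p : ℝ) ^ 2 * d * (c K * ∫ x in K.set ∩ L.set,
            ‖polyField q K x - polyField q' L x‖ ^ 2)) := by
          simp_rw [hpt]
          rw [integral_finsetSum _ fun i _ => hi2 i, ← Finset.mul_sum]
          ring
      _ ≤ Ca * (Cinv * (p : ℝ) ^ 2 * d * (c K * ∫ x in K.set ∩ L.set,
            ‖polyField q K x - polyField q' L x‖ ^ 2)) := by
          refine mul_le_mul_of_nonneg_right (hcC K hK) ?_
          exact mul_nonneg (by positivity) (mul_nonneg hcK (integral_nonneg fun _ => sq_nonneg _))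
      _ = _ := by ring
  refine step1.trans ?_
  rw [integral_const_mul, integral_finsetSum _ fun P _ => hintT P, Finset.sum_product]
  calc κ * cT * ∑ K ∈ M.elems m, ∑ L ∈ M.elems n,
        ∫ x in M.skel m ∪ M.skel n, overlapTerm F F' x (K, L) ∂(surf d)
      ≤ κ * cT * ∑ K ∈ M.elems m, ∑ L ∈ M.elems n, Cinv * (p : ℝ) ^ 2 * d * Ca *
        (c K * ∫ x in K.set ∩ L.set, ‖polyField q K x - polyField q' L x‖ ^ 2) := by
        gcongr with K hK L hL
        exact step2 K hK L hL
    _ = _ := by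
      simp_rw [← Finset.mul_sum]
      ring

end Mesh


/-! ### Weak time derivatives and the fundamental theorem of calculus -/

theorem tendsto_integral_mul_of_tendsto_eLpNorm {X ι : Type*} [MeasurableSpace X] {μ : Measure X}
    {l : Filter ι} {F : ι → X → ℝ} {f h : X → ℝ} (hf : MemLp f 2 μ) (hh : MemLp h 2 μ)
    (hF : ∀ᶠ k in l, AEStronglyMeasurable (F k) μ)
    (hlim : Tendsto (fun k => eLpNorm (fun x => F k x - f x) 2 μ) l (𝓝 0)) :
    Tendsto (fun k => ∫ x, F k x * h x ∂μ) l (𝓝 (∫ x, f x * h x ∂μ)) := by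
  have hfin : ∀ᶠ k in l, eLpNorm (fun x => F k x - f x) 2 μ < 1 := hlim.eventually (gt_mem_nhds one_pos)
  have hFm : ∀ᶠ k in l, MemLp (F k) 2 μ := by
    filter_upwards [hfin, hF] with k hk hk'
    have h1 : MemLp (fun x => F k x - f x) 2 μ := ⟨hk'.sub hf.1, hk.trans ENNReal.one_lt_top⟩
    have e : ((fun x => F k x - f x) + f) = F k := by ext; simp
    exact e ▸ h1.add hf
  refine tendsto_integral_of_L1' _ (hf.integrable_mul hh).1 ?_ ?_
  · filter_upwards [hFm] with k hk
    exact hk.integrable_mul hh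
  · have hb : ∀ᶠ k in l, eLpNorm ((fun x => F k x * h x) - fun x => f x * h x) 1 μ ≤
        eLpNorm (fun x => F k x - f x) 2 μ * eLpNorm h 2 μ := by
      filter_upwards [hF] with k hk
      have := eLpNorm_smul_le_mul_eLpNorm (p := 2) (q := 2) (r := 1) hh.1 (hk.sub hf.1)
      refine le_trans (le_of_eq ?_) this
      congr 1
      ext x
      simp [sub_mul]
    have hz : Tendsto (fun k => eLpNorm (fun x => F k x - f x) 2 μ * eLpNorm h 2 μ) l (𝓝 0) := by
      have := ENNReal.Tendsto.mul_const (b := eLpNorm h 2 μ) hlim (Or.inr hh.2.ne)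
      simpa using this
    exact tendsto_of_tendsto_of_tendsto_of_le_of_le' tendsto_const_nhds hz
      (Eventually.of_forall fun _ => bot_le) hb

/-- Averages of `G` against kernels that concentrate at `s` tend to the limit of `G` at `s`. -/
theorem tendsto_setIntegral_kernel {I : Set ℝ} (hI : MeasurableSet I) {s g₀ : ℝ} {G : ℝ → ℝ}
    (hG : IntegrableOn G I) (hlim : Tendsto G (𝓝[I] s ⊓ ae volume) (𝓝 g₀))
    {k : ℝ → ℝ → ℝ} (hkc : ∀ ε, Continuous (k ε)) (hkb : ∀ ε, ∃ C, ∀ t, |k ε t| ≤ C)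
    (hk0 : ∀ᶠ ε in 𝓝[>] (0 : ℝ), ∀ t, 0 ≤ k ε t)
    (hk1 : ∀ᶠ ε in 𝓝[>] (0 : ℝ), IntegrableOn (k ε) I ∧ ∫ t in I, k ε t = 1)
    (hks : ∀ᶠ ε in 𝓝[>] (0 : ℝ), ∀ t, k ε t ≠ 0 → |t - s| ≤ 2 * ε) :
    Tendsto (fun ε => ∫ t in I, G t * k ε t) (𝓝[>] 0) (𝓝 g₀) := by
  rw [Metric.tendsto_nhds]
  intro δ hδ
  have h1 : ∀ᶠ t in 𝓝[I] s ⊓ ae volume, |G t - g₀| < δ / 2 := by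
    have := Metric.tendsto_nhds.1 hlim (δ / 2) (half_pos hδ)
    simpa [Real.dist_eq] using this
  obtain ⟨U, hU, V, hV, hUV⟩ := mem_inf_iff_superset.1 h1
  obtain ⟨r, hr, hrU⟩ := Metric.mem_nhdsWithin_iff.1 hU
  have h2 : ∀ᶠ ε in 𝓝[>] (0 : ℝ), ε < r / 4 :=
    (tendsto_id.mono_left nhdsWithin_le_nhds).eventually (gt_mem_nhds (by positivity))
  filter_upwards [h2, hk0, hk1, hks, self_mem_nhdsWithin] with ε hε hk0 hk1 hks hε0
  have hε0 : 0 < ε := hε0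
  obtain ⟨C, hC⟩ := hkb ε
  have hGk : IntegrableOn (fun t => G t * k ε t) I :=
    Integrable.mul_bdd (c := C) hG (hkc ε).aestronglyMeasurable (Eventually.of_forall hC)
  have e : (∫ t in I, G t * k ε t) - g₀ = ∫ t in I, (G t - g₀) * k ε t := by
    simp_rw [sub_mul]
    rw [integral_sub hGk (hk1.1.const_mul _), integral_const_mul, hk1.2, mul_one]
  rw [Real.dist_eq, e]
  calc |∫ t in I, (G t - g₀) * k ε t| ≤ ∫ t in I, ‖(G t - g₀) * k ε t‖ :=
        norm_integral_le_integral_norm (fun t => (G t - g₀) * k ε t)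
    _ ≤ ∫ t in I, δ / 2 * k ε t := by
        refine integral_mono_of_nonneg (Eventually.of_forall fun _ => norm_nonneg _)
          (hk1.1.const_mul _) ?_
        rw [EventuallyLE, ae_restrict_iff' hI]
        filter_upwards [hV] with t htV htI
        by_cases hkt : k ε t = 0
        · simp [hkt]
        · have ht : t ∈ U := hrU ⟨by
            rw [Metric.mem_ball, Real.dist_eq]
            linarith [hks t hkt], htI⟩
          have h3 : |G t - g₀| < δ / 2 := hUV ⟨ht, htV⟩
          rw [norm_mul, Real.norm_eq_abs, Real.norm_eq_abs, abs_of_nonneg (hk0 t)]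
          exact mul_le_mul_of_nonneg_right h3.le (hk0 t)
    _ = δ / 2 := by rw [integral_const_mul, hk1.2, mul_one]
    _ < δ := half_lt_self hδ

theorem deriv_smoothTransition_nonneg (u : ℝ) : 0 ≤ deriv Real.smoothTransition u :=
  Real.smoothTransition.monotone.deriv_nonneg

/-- **Fundamental theorem of calculus** for a function with a weak derivative and limits at both ends
of an interval. -/
theorem setIntegral_weakDeriv {s₀ s₁ : ℝ} (hs : s₀ < s₁) {G G' : ℝ → ℝ} {g₀ g₁ : ℝ}
    (hG : IntegrableOn G (Ioo s₀ s₁)) (hG' : IntegrableOn G' (Ioo s₀ s₁))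
    (hweak : ∀ η : ℝ → ℝ, IsTest (Ioo s₀ s₁) η →
      ∫ t in Ioo s₀ s₁, G t * deriv η t = - ∫ t in Ioo s₀ s₁, G' t * η t)
    (h₀ : Tendsto G (𝓝[Ioo s₀ s₁] s₀ ⊓ ae volume) (𝓝 g₀))
    (h₁ : Tendsto G (𝓝[Ioo s₀ s₁] s₁ ⊓ ae volume) (𝓝 g₁)) :
    ∫ t in Ioo s₀ s₁, G' t = g₁ - g₀ := by
  set S := Real.smoothTransition
  have hScd : ContDiff ℝ ∞ S := Real.smoothTransition.contDiff
  have hSd : ∀ u, HasDerivAt S (deriv S u) u := fun u =>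
    (hScd.differentiable (by simp)).differentiableAt.hasDerivAt
  obtain ⟨C, hC⟩ := continuous_deriv_smoothTransition.bounded_above_of_compact_support
    hasCompactSupport_deriv_smoothTransition
  set I := Ioo s₀ s₁
  -- a plateau function and its derivative, concentrated near the two ends
  let η : ℝ → ℝ → ℝ := fun ε t => S ((t - s₀) / ε - 1) * S ((s₁ - t) / ε - 1)
  let k₀ : ℝ → ℝ → ℝ := fun ε t => deriv S ((t - s₀) / ε - 1) / ε
  let k₁ : ℝ → ℝ → ℝ := fun ε t => deriv S ((s₁ - t) / ε - 1) / ε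
  have hsmall : ∀ᶠ ε in 𝓝[>] (0 : ℝ), 4 * ε < s₁ - s₀ := by
    have : ∀ᶠ ε in 𝓝[>] (0 : ℝ), ε < (s₁ - s₀) / 4 :=
      (tendsto_id.mono_left nhdsWithin_le_nhds).eventually (gt_mem_nhds (by linarith))
    filter_upwards [this] with ε hε
    linarith
  have hsupp : ∀ ε, 0 < ε → ∀ u, deriv S (u / ε - 1) ≠ 0 → ε ≤ u ∧ u ≤ 2 * ε := by
    intro ε hε u hu
    have : u / ε - 1 ∈ Icc (0 : ℝ) 1 := by
      by_contra h
      exact hu (deriv_smoothTransition_eq_zero h)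
    obtain ⟨a, b⟩ := this
    constructor
    · have : 1 ≤ u / ε := by linarith
      rwa [le_div_iff₀ hε, one_mul] at this
    · have : u / ε ≤ 2 := by linarith
      rwa [div_le_iff₀ hε] at this
  have hηtest : ∀ᶠ ε in 𝓝[>] (0 : ℝ), IsTest I (η ε) := by
    filter_upwards [hsmall, self_mem_nhdsWithin] with ε hε hε0
    have hε0 : 0 < ε := hε0
    have hsub : Function.support (η ε) ⊆ Icc (s₀ + ε) (s₁ - ε) := by
      intro t ht
      rw [Function.mem_support] at ht
      constructor
      · by_contra h
        apply ht
        have : (t - s₀) / ε - 1 ≤ 0 := by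
          rw [sub_nonpos, div_le_one hε0]; linarith
        simp only [η, S, Real.smoothTransition.zero_of_nonpos this, zero_mul]
      · by_contra h
        apply ht
        have : (s₁ - t) / ε - 1 ≤ 0 := by
          rw [sub_nonpos, div_le_one hε0]; linarith
        simp only [η, S, Real.smoothTransition.zero_of_nonpos this, mul_zero]
    have hts : tsupport (η ε) ⊆ Icc (s₀ + ε) (s₁ - ε) := closure_minimal hsub isClosed_Icc
    refine ⟨(hScd.comp (by fun_prop)).mul (hScd.comp (by fun_prop)), ?_, ?_⟩
    · exact HasCompactSupport.of_support_subset_isCompact isCompact_Icc hsub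
    · exact hts.trans fun t ht => ⟨by linarith [ht.1], by linarith [ht.2]⟩
  have hηd : ∀ᶠ ε in 𝓝[>] (0 : ℝ), ∀ t, deriv (η ε) t = k₀ ε t - k₁ ε t := by
    filter_upwards [hsmall, self_mem_nhdsWithin] with ε hε hε0 t
    have hε0 : 0 < ε := hε0
    have d1 : HasDerivAt (fun t => S ((t - s₀) / ε - 1)) (deriv S ((t - s₀) / ε - 1) * (1 / ε)) t :=
      (hSd _).comp t ((((hasDerivAt_id t).sub_const s₀).div_const ε).sub_const 1)
    have d2 : HasDerivAt (fun t => S ((s₁ - t) / ε - 1)) (deriv S ((s₁ - t) / ε - 1) * (-1 / ε)) t :=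
      (hSd _).comp t ((((hasDerivAt_id t).const_sub s₁).div_const ε).sub_const 1)
    have := (d1.mul d2).deriv
    change deriv (η ε) t = _ at this
    rw [this]
    have e1 : deriv S ((t - s₀) / ε - 1) * S ((s₁ - t) / ε - 1) = deriv S ((t - s₀) / ε - 1) := by
      by_cases h : deriv S ((t - s₀) / ε - 1) = 0
      · rw [h, zero_mul]
      · have h1 := hsupp ε hε0 _ h
        have : 1 ≤ (s₁ - t) / ε - 1 := by
          rw [le_sub_iff_add_le, le_div_iff₀ hε0]; linarith [h1.2]
        rw [show S ((s₁ - t) / ε - 1) = 1 from Real.smoothTransition.one_of_one_le this, mul_one]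
    have e2 : S ((t - s₀) / ε - 1) * deriv S ((s₁ - t) / ε - 1) = deriv S ((s₁ - t) / ε - 1) := by
      by_cases h : deriv S ((s₁ - t) / ε - 1) = 0
      · rw [h, mul_zero]
      · have h1 := hsupp ε hε0 _ h
        have : 1 ≤ (t - s₀) / ε - 1 := by
          rw [le_sub_iff_add_le, le_div_iff₀ hε0]; linarith [h1.2]
        rw [show S ((t - s₀) / ε - 1) = 1 from Real.smoothTransition.one_of_one_le this, one_mul]
    simp only [k₀, k₁]
    calc _ = (deriv S ((t - s₀) / ε - 1) * S ((s₁ - t) / ε - 1)) / ε -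
          (S ((t - s₀) / ε - 1) * deriv S ((s₁ - t) / ε - 1)) / ε := by ring
      _ = _ := by rw [e1, e2]
  have hkc₀ : ∀ ε, Continuous (k₀ ε) := fun ε =>
    (continuous_deriv_smoothTransition.comp (by fun_prop)).div_const _
  have hkc₁ : ∀ ε, Continuous (k₁ ε) := fun ε =>
    (continuous_deriv_smoothTransition.comp (by fun_prop)).div_const _
  have hkb₀ : ∀ ε, ∃ C, ∀ t, |k₀ ε t| ≤ C := fun ε => ⟨C / |ε|, fun t => by
    simp only [k₀, abs_div]; exact div_le_div_of_nonneg_right (hC _) (abs_nonneg _)⟩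
  have hkb₁ : ∀ ε, ∃ C, ∀ t, |k₁ ε t| ≤ C := fun ε => ⟨C / |ε|, fun t => by
    simp only [k₁, abs_div]; exact div_le_div_of_nonneg_right (hC _) (abs_nonneg _)⟩
  have hint : ∀ k : ℝ → ℝ, Continuous k → IntegrableOn k I := fun k hk =>
    (hk.integrableOn_Icc (a := s₀) (b := s₁)).mono_set Ioo_subset_Icc_self
  have hone₀ : ∀ᶠ ε in 𝓝[>] (0 : ℝ), IntegrableOn (k₀ ε) I ∧ ∫ t in I, k₀ ε t = 1 := by
    filter_upwards [hsmall, self_mem_nhdsWithin] with ε hε hε0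
    have hε0 : 0 < ε := hε0
    refine ⟨hint _ (hkc₀ ε), ?_⟩
    rw [setIntegral_eq_integral_of_forall_compl_eq_zero]
    · simp only [k₀]
      rw [integral_div, integral_sub_right_eq_self (fun t => deriv S (t / ε - 1)) s₀,
        Measure.integral_comp_div (fun u => deriv S (u - 1)) ε,
        integral_sub_right_eq_self (fun u => deriv S u) 1, integral_deriv_smoothTransition,
        abs_of_pos hε0, smul_eq_mul, mul_one, div_self hε0.ne']
    · intro t ht
      by_contra h
      have h1 := hsupp ε hε0 (t - s₀) (fun h' => h (by simp only [k₀, h', zero_div]))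
      exact ht ⟨by linarith [h1.1], by linarith [h1.2]⟩
  have hone₁ : ∀ᶠ ε in 𝓝[>] (0 : ℝ), IntegrableOn (k₁ ε) I ∧ ∫ t in I, k₁ ε t = 1 := by
    filter_upwards [hsmall, self_mem_nhdsWithin] with ε hε hε0
    have hε0 : 0 < ε := hε0
    refine ⟨hint _ (hkc₁ ε), ?_⟩
    rw [setIntegral_eq_integral_of_forall_compl_eq_zero]
    · simp only [k₁]
      rw [integral_div, integral_sub_left_eq_self (fun t => deriv S (t / ε - 1)) volume s₁,
        Measure.integral_comp_div (fun u => deriv S (u - 1)) ε,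
        integral_sub_right_eq_self (fun u => deriv S u) 1, integral_deriv_smoothTransition,
        abs_of_pos hε0, smul_eq_mul, mul_one, div_self hε0.ne']
    · intro t ht
      by_contra h
      have h1 := hsupp ε hε0 (s₁ - t) (fun h' => h (by simp only [k₁, h', zero_div]))
      exact ht ⟨by linarith [h1.2], by linarith [h1.1]⟩
  have hlim₀ := tendsto_setIntegral_kernel measurableSet_Ioo hG h₀ hkc₀ hkb₀
    (by
      filter_upwards [self_mem_nhdsWithin] with ε hε0 t
      exact div_nonneg (deriv_smoothTransition_nonneg _) (le_of_lt hε0)) hone₀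
    (by
      filter_upwards [self_mem_nhdsWithin] with ε hε0 t ht
      have h1 := hsupp ε hε0 (t - s₀) (fun h' => ht (by simp only [k₀, h', zero_div]))
      have hε0 : 0 < ε := hε0
      rw [abs_of_nonneg (by linarith [h1.1])]
      exact h1.2)
  have hlim₁ := tendsto_setIntegral_kernel measurableSet_Ioo hG h₁ hkc₁ hkb₁
    (by
      filter_upwards [self_mem_nhdsWithin] with ε hε0 t
      exact div_nonneg (deriv_smoothTransition_nonneg _) (le_of_lt hε0)) hone₁
    (by
      filter_upwards [self_mem_nhdsWithin] with ε hε0 t ht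
      have h1 := hsupp ε hε0 (s₁ - t) (fun h' => ht (by simp only [k₁, h', zero_div]))
      have hε0 : 0 < ε := hε0
      rw [abs_sub_comm, abs_of_nonneg (by linarith [h1.1])]
      exact h1.2)
  have hη1 : Tendsto (fun ε => ∫ t in I, G' t * η ε t) (𝓝[>] 0) (𝓝 (∫ t in I, G' t)) := by
    refine tendsto_integral_filter_of_dominated_convergence (fun t => |G' t|)
      (Eventually.of_forall fun ε => hG'.1.mul ?_) (Eventually.of_forall fun ε =>
        Eventually.of_forall fun t => ?_) hG'.abs ?_
    · exact (Continuous.mul (hScd.continuous.comp (by fun_prop))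
        (hScd.continuous.comp (by fun_prop))).aestronglyMeasurable
    · rw [norm_mul, Real.norm_eq_abs]
      refine mul_le_of_le_one_right (abs_nonneg _) ?_
      rw [Real.norm_eq_abs, abs_of_nonneg (mul_nonneg (Real.smoothTransition.nonneg _)
        (Real.smoothTransition.nonneg _))]
      exact mul_le_one₀ (Real.smoothTransition.le_one _) (Real.smoothTransition.nonneg _)
        (Real.smoothTransition.le_one _)
    · rw [ae_restrict_iff' measurableSet_Ioo]
      refine Eventually.of_forall fun t ht => ?_
      apply tendsto_const_nhds.congr'
      have a1 : ∀ᶠ ε in 𝓝[>] (0 : ℝ), ε < (t - s₀) / 2 :=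
        (tendsto_id.mono_left nhdsWithin_le_nhds).eventually (gt_mem_nhds (by linarith [ht.1]))
      have a2 : ∀ᶠ ε in 𝓝[>] (0 : ℝ), ε < (s₁ - t) / 2 :=
        (tendsto_id.mono_left nhdsWithin_le_nhds).eventually (gt_mem_nhds (by linarith [ht.2]))
      filter_upwards [a1, a2, self_mem_nhdsWithin] with ε b1 b2 hε0
      have hε0 : 0 < ε := hε0
      have c1 : 1 ≤ (t - s₀) / ε - 1 := by
        rw [le_sub_iff_add_le, le_div_iff₀ hε0]; linarith
      have c2 : 1 ≤ (s₁ - t) / ε - 1 := by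
        rw [le_sub_iff_add_le, le_div_iff₀ hε0]; linarith
      simp only [η, S, Real.smoothTransition.one_of_one_le c1,
        Real.smoothTransition.one_of_one_le c2, mul_one]
  have hcomb := hlim₀.sub hlim₁
  have heq : (fun ε => (∫ t in I, G t * k₀ ε t) - ∫ t in I, G t * k₁ ε t) =ᶠ[𝓝[>] 0]
      fun ε => - ∫ t in I, G' t * η ε t := by
    filter_upwards [hηtest, hηd] with ε h1 h2
    rw [← hweak _ h1]
    simp_rw [h2, mul_sub]
    obtain ⟨C₀, hC₀⟩ := hkb₀ ε
    obtain ⟨C₁, hC₁⟩ := hkb₁ ε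
    rw [integral_sub]
    · exact Integrable.mul_bdd (c := C₀) hG (hkc₀ ε).aestronglyMeasurable (Eventually.of_forall hC₀)
    · exact Integrable.mul_bdd (c := C₁) hG (hkc₁ ε).aestronglyMeasurable (Eventually.of_forall hC₁)
  have := tendsto_nhds_unique (hcomb.congr' heq) hη1.neg
  linarith

/-- At almost every point the fundamental theorem of calculus holds for the products of `f` with the
powers of `t`, where `f'` is the time derivative of `f`. -/
def TimeFTC {X : Type*} [MeasurableSpace X] (s₀ s₁ : ℝ) (μ : Measure X) (f f' : ℝ → X → ℝ) : Prop :=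
  ∀ᵐ x ∂μ, ∀ j : ℕ, ∫ t in Ioo s₀ s₁, (t ^ j * f' t x + (j * t ^ (j - 1)) * f t x) =
    s₁ ^ j * f s₁ x - s₀ ^ j * f s₀ x

theorem memLp_top_fst_of_continuous {X : Type*} [MeasurableSpace X] {s₀ s₁ : ℝ} {μ : Measure X}
    [SFinite μ] {θ : ℝ → ℝ} (hθ : Continuous θ) :
    MemLp (fun z : ℝ × X => θ z.1) ⊤ ((volume.restrict (Ioo s₀ s₁)).prod μ) := by
  obtain ⟨C, hC⟩ := (isCompact_Icc (a := s₀) (b := s₁)).exists_bound_of_continuousOn hθ.continuousOn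
  refine memLp_top_of_bound (hθ.measurable.comp measurable_fst).aestronglyMeasurable C ?_
  have : ∀ᵐ t ∂(volume.restrict (Ioo s₀ s₁)), ‖θ t‖ ≤ C := by
    rw [ae_restrict_iff' measurableSet_Ioo]
    exact Eventually.of_forall fun t ht => hC t (Ioo_subset_Icc_self ht)
  exact Measure.quasiMeasurePreserving_fst.ae this

/-- `t^j f' + j t^(j-1) f` is square integrable. -/
theorem memLp_timeCombination {X : Type*} [MeasurableSpace X] {s₀ s₁ : ℝ} {μ : Measure X} [SFinite μ]
    {f f' : ℝ → X → ℝ}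
    (hf : MemLp (fun z : ℝ × X => f z.1 z.2) 2 ((volume.restrict (Ioo s₀ s₁)).prod μ))
    (hf' : MemLp (fun z : ℝ × X => f' z.1 z.2) 2 ((volume.restrict (Ioo s₀ s₁)).prod μ)) (j : ℕ) :
    MemLp (fun z : ℝ × X => z.1 ^ j * f' z.1 z.2 + (j * z.1 ^ (j - 1)) * f z.1 z.2) 2
      ((volume.restrict (Ioo s₀ s₁)).prod μ) := by
  refine MemLp.add ?_ ?_
  · exact hf'.mul (p := ⊤) (q := 2) (r := 2) (memLp_top_fst_of_continuous (θ := fun t => t ^ j) (by fun_prop))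
  · exact hf.mul (p := ⊤) (q := 2) (r := 2)
      (memLp_top_fst_of_continuous (θ := fun t => j * t ^ (j - 1)) (by fun_prop))


theorem memLp_of_bounded {X : Type*} [MeasurableSpace X] {μ : Measure X} [IsFiniteMeasure μ]
    {p : ENNReal} {h : X → ℝ} {C : ℝ} (hm : AEStronglyMeasurable h μ) (hC : ∀ x, |h x| ≤ C) :
    MemLp h p μ := MemLp.of_bound hm C (Eventually.of_forall hC)

/-- The identity defining the weak time derivative, with the integrals restricted to `I × K`. -/
theorem IsWeakDt.restrict {d : ℕ} {I : Set ℝ} {K : Set (E d)} {f f' : ℝ → E d → ℝ}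
    (h : IsWeakDt I K f f') {φ : ℝ × E d → ℝ} (hφ : IsTest (I ×ˢ K) φ) :
    ∫ z, f z.1 z.2 * fderiv ℝ φ z (1, 0) ∂((volume.restrict I).prod (volume.restrict K)) =
      - ∫ z, f' z.1 z.2 * φ z ∂((volume.restrict I).prod (volume.restrict K)) := by
  rw [Measure.prod_restrict, ← Measure.volume_eq_prod,
    setIntegral_eq_integral_of_forall_compl_eq_zero,
    setIntegral_eq_integral_of_forall_compl_eq_zero, h φ hφ]
  · intro z hz
    rw [image_eq_zero_of_notMem_tsupport fun hz' => hz (hφ.2.2 hz'), mul_zero]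
  · intro z hz
    have : fderiv ℝ φ z = 0 := by
      by_contra hne
      exact hz (hφ.2.2 (support_fderiv_subset ℝ hne))
    simp [this]

theorem IsWeakGrad.restrict {d : ℕ} {I : Set ℝ} {K : Set (E d)} {f : ℝ → E d → ℝ}
    {g : ℝ → E d → E d} (h : IsWeakGrad I K f g) (e : E d) {φ : ℝ × E d → ℝ}
    (hφ : IsTest (I ×ˢ K) φ) :
    ∫ z, f z.1 z.2 * fderiv ℝ φ z (0, e) ∂((volume.restrict I).prod (volume.restrict K)) =
      - ∫ z, inner ℝ (g z.1 z.2) e * φ z ∂((volume.restrict I).prod (volume.restrict K)) := by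
  rw [Measure.prod_restrict, ← Measure.volume_eq_prod,
    setIntegral_eq_integral_of_forall_compl_eq_zero,
    setIntegral_eq_integral_of_forall_compl_eq_zero, h e φ hφ]
  · intro z hz
    rw [image_eq_zero_of_notMem_tsupport fun hz' => hz (hφ.2.2 hz'), mul_zero]
  · intro z hz
    have : fderiv ℝ φ z = 0 := by
      by_contra hne
      exact hz (hφ.2.2 (support_fderiv_subset ℝ hne))
    simp [this]

theorem IsTest.prod_mul {d : ℕ} {I : Set ℝ} {K : Set (E d)} {η : ℝ → ℝ} {χ : E d → ℝ}
    (hη : IsTest I η) (hχ : IsTest K χ) : IsTest (I ×ˢ K) (fun z : ℝ × E d => η z.1 * χ z.2) := by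
  have hsub : Function.support (fun z : ℝ × E d => η z.1 * χ z.2) ⊆ tsupport η ×ˢ tsupport χ := by
    intro z hz
    exact ⟨subset_tsupport _ (left_ne_zero_of_mul hz), subset_tsupport _ (right_ne_zero_of_mul hz)⟩
  have hcl : IsClosed (tsupport η ×ˢ tsupport χ) := (isClosed_tsupport _).prod (isClosed_tsupport _)
  refine ⟨(hη.1.comp contDiff_fst).mul (hχ.1.comp contDiff_snd), ?_, ?_⟩
  · exact HasCompactSupport.of_support_subset_isCompact (hη.2.1.prod hχ.2.1) hsub
  · exact (closure_minimal hsub hcl).trans (prod_mono hη.2.2 hχ.2.2)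

theorem fderiv_prod_mul {d : ℕ} {η : ℝ → ℝ} {χ : E d → ℝ} (hη : ContDiff ℝ ∞ η)
    (hχ : ContDiff ℝ ∞ χ) (z v : ℝ × E d) :
    fderiv ℝ (fun z : ℝ × E d => η z.1 * χ z.2) z v =
      deriv η z.1 * v.1 * χ z.2 + η z.1 * fderiv ℝ χ z.2 v.2 := by
  have h1 : HasFDerivAt (fun z : ℝ × E d => η z.1)
      (deriv η z.1 • ContinuousLinearMap.fst ℝ ℝ (E d)) z :=
    ((hη.differentiable (by simp)) z.1).hasDerivAt.comp_hasFDerivAt z hasFDerivAt_fst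
  have h2 : HasFDerivAt (fun z : ℝ × E d => χ z.2)
      ((fderiv ℝ χ z.2).comp (ContinuousLinearMap.snd ℝ ℝ (E d))) z :=
    ((hχ.differentiable (by simp)) z.2).hasFDerivAt.comp z hasFDerivAt_snd
  have h3 := (h1.mul h2).fderiv
  change fderiv ℝ (fun z : ℝ × E d => η z.1 * χ z.2) z = _ at h3
  rw [h3]
  simp
  ring

theorem IsTest.continuous_bound {X : Type*} [NormedAddCommGroup X] [NormedSpace ℝ X] {U : Set X}
    {φ : X → ℝ} (h : IsTest U φ) : ∃ C, ∀ x, |φ x| ≤ C :=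
  h.1.continuous.bounded_above_of_compact_support h.2.1

/-- A function on `I × K` with a weak time derivative and traces at both ends of `I` satisfies the
fundamental theorem of calculus at almost every point of `K`. -/
theorem timeFTC_of_isWeakDt {d : ℕ} {s₀ s₁ : ℝ} (hs : s₀ < s₁) {K : Set (E d)} (hK : IsOpen K)
    (hKf : volume K < ⊤) {f f' : ℝ → E d → ℝ}
    (hf : MemLp (fun z : ℝ × E d => f z.1 z.2) 2
      ((volume.restrict (Ioo s₀ s₁)).prod (volume.restrict K)))
    (hf' : MemLp (fun z : ℝ × E d => f' z.1 z.2) 2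
      ((volume.restrict (Ioo s₀ s₁)).prod (volume.restrict K)))
    (hw : IsWeakDt (Ioo s₀ s₁) K f f') (h₀ : HasTimeTrace (Ioo s₀ s₁) K f s₀)
    (h₁ : HasTimeTrace (Ioo s₀ s₁) K f s₁) :
    TimeFTC s₀ s₁ (volume.restrict K) f f' := by
  have : IsFiniteMeasure (volume.restrict K) := ⟨by simpa using hKf⟩
  set I := Ioo s₀ s₁
  have : IsFiniteMeasure (volume.restrict I) := ⟨by simp [I]⟩
  set μ := (volume.restrict I).prod (volume.restrict K)
  rw [TimeFTC, ae_all_iff]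
  intro j
  have hcomb := memLp_timeCombination hf hf' j
  have hcombI := hcomb.integrable one_le_two
  have hfI := hf.integrable one_le_two
  have hf'I := hf'.integrable one_le_two
  have hΨ : IntegrableOn (fun x => (∫ t in I, (t ^ j * f' t x + (j * t ^ (j - 1)) * f t x)) -
      (s₁ ^ j * f s₁ x - s₀ ^ j * f s₀ x)) K := by
    refine Integrable.sub hcombI.integral_prod_right ?_
    exact ((h₁.1.integrable one_le_two).const_mul _).sub ((h₀.1.integrable one_le_two).const_mul _)
  have key := hK.ae_eq_zero_of_integral_contDiff_smul_eq_zero hΨ.locallyIntegrableOn ?_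
  · rw [ae_restrict_iff' hK.measurableSet]
    filter_upwards [key] with x hx hxK
    exact sub_eq_zero.1 (hx hxK)
  intro χ hχ hχc hχs
  have hχt : IsTest K χ := ⟨hχ, hχc, hχs⟩
  obtain ⟨C, hC⟩ := hχt.continuous_bound
  have hχm : MemLp χ 2 (volume.restrict K) :=
    memLp_of_bounded hχ.continuous.aestronglyMeasurable hC
  -- the time-dependent moment of `f` against `χ`
  set G : ℝ → ℝ := fun t => ∫ x in K, t ^ j * f t x * χ x
  set G' : ℝ → ℝ := fun t => ∫ x in K, (t ^ j * f' t x + (j * t ^ (j - 1)) * f t x) * χ x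
  have hb : ∀ {h : ℝ × E d → ℝ}, Integrable h μ → Integrable (fun z => h z * χ z.2) μ := fun hh =>
    hh.mul_bdd (c := C) ((hχ.continuous.comp continuous_snd).aestronglyMeasurable)
      (Eventually.of_forall fun z => hC z.2)
  have hGint : Integrable (fun z : ℝ × E d => z.1 ^ j * f z.1 z.2 * χ z.2) μ := hb
    ((hf.mul (p := ⊤) (q := 2) (r := 2)
      (memLp_top_fst_of_continuous (θ := fun t => t ^ j) (by fun_prop))).integrable one_le_two)
  have hG'int : Integrable (fun z : ℝ × E d =>
      (z.1 ^ j * f' z.1 z.2 + (j * z.1 ^ (j - 1)) * f z.1 z.2) * χ z.2) μ := hb hcombI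
  have hslice : ∀ᵐ t ∂volume, t ∈ I → AEStronglyMeasurable (f t) (volume.restrict K) := by
    have := hf.1.prodMk_left
    rwa [ae_restrict_iff' measurableSet_Ioo] at this
  have hlim : ∀ s, HasTimeTrace I K f s → Tendsto G (𝓝[I] s ⊓ ae volume)
      (𝓝 (s ^ j * ∫ x in K, f s x * χ x)) := by
    intro s hst
    have h1 := tendsto_integral_mul_of_tendsto_eLpNorm (l := 𝓝[I] s ⊓ ae volume) (F := f) hst.1 hχm
      (by
        have e1 : ∀ᶠ t in 𝓝[I] s ⊓ ae volume, t ∈ I :=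
          (mem_inf_of_left self_mem_nhdsWithin : I ∈ 𝓝[I] s ⊓ ae volume)
        have e2 : ∀ᶠ t in 𝓝[I] s ⊓ ae volume, t ∈ I → AEStronglyMeasurable (f t) (volume.restrict K) :=
          hslice.filter_mono inf_le_right
        filter_upwards [e1, e2] with t h1 h2 using h2 h1) hst.2
    have h2 : Tendsto (fun t : ℝ => t ^ j) (𝓝[I] s ⊓ ae volume) (𝓝 (s ^ j)) :=
      ((continuous_pow j).tendsto s).mono_left (inf_le_left.trans nhdsWithin_le_nhds)
    refine (h2.mul h1).congr fun t => ?_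
    simp only [G]
    rw [← integral_const_mul]
    congr 1 with x
    ring
  have hFTC := setIntegral_weakDeriv hs (G := G) (G' := G') hGint.integral_prod_left
    hG'int.integral_prod_left ?_ (hlim s₀ h₀) (hlim s₁ h₁)
  · have e1 : ∫ t in I, G' t = ∫ x in K, χ x *
        ∫ t in I, (t ^ j * f' t x + (j * t ^ (j - 1)) * f t x) := by
      simp only [G']
      rw [integral_integral_swap hG'int]
      congr 1 with x
      rw [← integral_const_mul]
      congr 1 with t
      ring
    have e2 : ∀ s, HasTimeTrace I K f s → IntegrableOn (fun x => χ x * (s ^ j * f s x)) K := by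
      intro s hst
      exact ((hst.1.integrable one_le_two).const_mul _).bdd_mul (c := C)
        hχ.continuous.aestronglyMeasurable (Eventually.of_forall hC)
    have e3 : IntegrableOn (fun x => χ x * ∫ t in I, (t ^ j * f' t x + (j * t ^ (j - 1)) * f t x)) K :=
      hcombI.integral_prod_right.bdd_mul (c := C) hχ.continuous.aestronglyMeasurable
        (Eventually.of_forall hC)
    rw [← setIntegral_eq_integral_of_forall_compl_eq_zero (s := K)]
    · simp only [smul_eq_mul, mul_sub]
      have e5 : IntegrableOn (fun x => χ x * (s₁ ^ j * f s₁ x) - χ x * (s₀ ^ j * f s₀ x)) K :=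
        (e2 s₁ h₁).sub (e2 s₀ h₀)
      rw [integral_sub e3 e5, integral_sub (e2 s₁ h₁) (e2 s₀ h₀), ← e1, hFTC]
      have e4 : ∀ s, ∫ x in K, χ x * (s ^ j * f s x) = s ^ j * ∫ x in K, f s x * χ x := by
        intro s
        rw [← integral_const_mul]
        congr 1 with x
        ring
      rw [e4, e4]
      ring
    · intro x hx
      rw [image_eq_zero_of_notMem_tsupport fun hx' => hx (hχs hx'), zero_smul]
  · intro η hη
    have hθ : IsTest I (fun t => η t * t ^ j) := by
      have hsub : tsupport (fun t => η t * t ^ j) ⊆ tsupport η := tsupport_mul_subset_left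
      exact ⟨hη.1.mul (by fun_prop), hη.2.1.mul_right, hsub.trans hη.2.2⟩
    have hwk := hw.restrict (hθ.prod_mul hχt)
    have hd : ∀ t, deriv (fun t => η t * t ^ j) t = deriv η t * t ^ j + η t * (j * t ^ (j - 1)) := by
      intro t
      have := ((hη.1.differentiable (by simp)) t).hasDerivAt.mul (hasDerivAt_pow j t)
      exact this.deriv
    simp_rw [fderiv_prod_mul hθ.1 hχ, hd] at hwk
    obtain ⟨Cη, hCη⟩ := hη.continuous_bound
    obtain ⟨Cη', hCη'⟩ := (hη.1.continuous_deriv (by simp)).bounded_above_of_compact_support hη.2.1.deriv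
    have i1 : Integrable (fun z : ℝ × E d => (z.1 ^ j * f z.1 z.2 * χ z.2) * deriv η z.1) μ :=
      hGint.mul_bdd (c := Cη') (((hη.1.continuous_deriv (by simp)).comp
        continuous_fst).aestronglyMeasurable) (Eventually.of_forall fun z => hCη' z.1)
    have i2 : Integrable (fun z : ℝ × E d =>
        ((z.1 ^ j * f' z.1 z.2 + (j * z.1 ^ (j - 1)) * f z.1 z.2) * χ z.2) * η z.1) μ :=
      hG'int.mul_bdd (c := Cη) ((hη.1.continuous.comp
        continuous_fst).aestronglyMeasurable) (Eventually.of_forall fun z => hCη z.1)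
    have i3 : Integrable (fun z : ℝ × E d => f' z.1 z.2 * (η z.1 * z.1 ^ j * χ z.2)) μ := by
      have hθc : Continuous fun t => η t * t ^ j := hθ.1.continuous
      have := hb ((hf'.mul (p := ⊤) (q := 2) (r := 2)
        (memLp_top_fst_of_continuous (θ := fun t => η t * t ^ j) hθc)).integrable one_le_two)
      refine this.congr (Eventually.of_forall fun z => ?_)
      simp only [Pi.mul_apply]; ring
    simp only [G, G']
    have f1 : ∫ t in I, (∫ x in K, t ^ j * f t x * χ x) * deriv η t =
        ∫ z, (z.1 ^ j * f z.1 z.2 * χ z.2) * deriv η z.1 ∂μ := by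
      rw [integral_prod _ i1]
      simp_rw [integral_mul_const]
    have f2 : ∫ t in I, (∫ x in K, (t ^ j * f' t x + (j * t ^ (j - 1)) * f t x) * χ x) * η t =
        ∫ z, ((z.1 ^ j * f' z.1 z.2 + (j * z.1 ^ (j - 1)) * f z.1 z.2) * χ z.2) * η z.1 ∂μ := by
      rw [integral_prod _ i2]
      simp_rw [integral_mul_const]
    rw [f1, f2, ← integral_neg]
    have g1 : ∫ z, (z.1 ^ j * f z.1 z.2 * χ z.2) * deriv η z.1 ∂μ +
        ∫ z, (((z.1 ^ j * f' z.1 z.2 + (j * z.1 ^ (j - 1)) * f z.1 z.2) * χ z.2) * η z.1 -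
          f' z.1 z.2 * (η z.1 * z.1 ^ j * χ z.2)) ∂μ =
        - ∫ z, f' z.1 z.2 * (η z.1 * z.1 ^ j * χ z.2) ∂μ := by
      have i4 : Integrable (fun z : ℝ × E d =>
          ((z.1 ^ j * f' z.1 z.2 + (j * z.1 ^ (j - 1)) * f z.1 z.2) * χ z.2) * η z.1 -
            f' z.1 z.2 * (η z.1 * z.1 ^ j * χ z.2)) μ := i2.sub i3
      rw [← integral_add i1 i4, ← hwk]
      congr 1 with z
      simp
      ring
    rw [integral_sub i2 i3] at g1
    rw [integral_neg]
    linarith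


/-! ### Traces and Green's formula -/

theorem memLp_of_continuous_prod {d : ℕ} {s₀ s₁ : ℝ} {μ : Measure (E d)} {A : Set (E d)}
    (hA : MeasurableSet A) (hAb : Bornology.IsBounded A) [IsFiniteMeasure (μ.restrict A)]
    [SFinite μ]
    {F : Type*} [NormedAddCommGroup F] [SecondCountableTopology F] [MeasurableSpace F] [BorelSpace F]
    {p : ENNReal} {g : ℝ × E d → F} (hg : Continuous g) :
    MemLp g p ((volume.restrict (Ioo s₀ s₁)).prod (μ.restrict A)) := by
  have hc : IsCompact (Icc s₀ s₁ ×ˢ closure A) := isCompact_Icc.prod hAb.isCompact_closure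
  obtain ⟨C, hC⟩ := hc.exists_bound_of_continuousOn hg.continuousOn
  refine MemLp.of_bound hg.measurable.aestronglyMeasurable C ?_
  rw [Measure.prod_restrict, ae_restrict_iff' (measurableSet_Ioo.prod hA)]
  exact Eventually.of_forall fun z hz => hC z ⟨Ioo_subset_Icc_self hz.1, subset_closure hz.2⟩

theorem fderiv_slice {d : ℕ} {ψ : ℝ × E d → ℝ} (hψ : ContDiff ℝ ∞ ψ) (t : ℝ) (x e : E d) :
    fderiv ℝ (fun y => ψ (t, y)) x e = fderiv ℝ ψ (t, x) (0, e) := by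
  have h1 : HasFDerivAt (fun y : E d => (t, y)) (ContinuousLinearMap.inr ℝ ℝ (E d)) x :=
    hasFDerivAt_prodMk_right t x
  have := ((hψ.differentiable (by simp)) (t, x)).hasFDerivAt.comp x h1
  change HasFDerivAt (fun y => ψ (t, y)) _ x at this
  rw [this.fderiv]
  simp

theorem contDiff_slice {d : ℕ} {ψ : ℝ × E d → ℝ} (hψ : ContDiff ℝ ∞ ψ) (t : ℝ) :
    ContDiff ℝ ∞ fun y => ψ (t, y) := hψ.comp (contDiff_prodMk_right t)

theorem continuous_fderiv_apply_const {X : Type*} [NormedAddCommGroup X] [NormedSpace ℝ X]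
    {ψ : X → ℝ} (hψ : ContDiff ℝ ∞ ψ) (v : X) : Continuous fun z => fderiv ℝ ψ z v :=
  (hψ.continuous_fderiv (by simp)).clm_apply continuous_const

theorem memLp_inner_normal {d : ℕ} (K : Polytope d) (e : E d) {s₀ s₁ : ℝ} {p : ENNReal}
    {ψ : ℝ × E d → ℝ} (hψ : Continuous ψ) :
    MemLp (fun z : ℝ × E d => ψ z * inner ℝ (K.normal z.2) e) p
      ((volume.restrict (Ioo s₀ s₁)).prod ((surf d).restrict (frontier K.set))) := by
  have h1 : MemLp ψ p ((volume.restrict (Ioo s₀ s₁)).prod ((surf d).restrict (frontier K.set))) := by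
    have := memLp_of_continuous_prod (s₀ := s₀) (s₁ := s₁) (p := p)
      (μ := (surf d).restrict (frontier K.set)) (A := frontier K.set)
      K.measurableSet_frontier K.isBounded_frontier hψ
    rwa [Measure.restrict_restrict K.measurableSet_frontier, inter_self] at this
  have h2 : MemLp (fun z : ℝ × E d => inner ℝ (K.normal z.2) e) ⊤
      ((volume.restrict (Ioo s₀ s₁)).prod ((surf d).restrict (frontier K.set))) := by
    refine memLp_top_of_bound ?_ (K.faces.card * ‖e‖) (Eventually.of_forall fun z => ?_)
    · exact ((K.measurable_normal.comp measurable_snd).inner measurable_const).aestronglyMeasurable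
    · exact (norm_inner_le_norm _ _).trans
        (mul_le_mul_of_nonneg_right (K.norm_normal_le _) (norm_nonneg _))
  exact h2.mul h1

theorem eLpNorm_inner_sub_le {X : Type*} [MeasurableSpace X] {d : ℕ} {μ : Measure X} {F G : X → E d}
    (e : E d) : eLpNorm (fun x => inner ℝ (F x) e - inner ℝ (G x) e) 2 μ ≤
      ENNReal.ofReal ‖e‖ * eLpNorm (fun x => F x - G x) 2 μ := by
  refine eLpNorm_le_mul_eLpNorm_of_ae_le_mul (Eventually.of_forall fun x => ?_) 2
  rw [← inner_sub_left, mul_comm]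
  exact norm_inner_le_norm _ _

theorem tendsto_eLpNorm_inner {X : Type*} [MeasurableSpace X] {d : ℕ} {μ : Measure X} {ι : Type*}
    {l : Filter ι} {F : ι → X → E d} {G : X → E d}
    (h : Tendsto (fun k => eLpNorm (fun x => F k x - G x) 2 μ) l (𝓝 0)) (e : E d) :
    Tendsto (fun k => eLpNorm (fun x => inner ℝ (F k x) e - inner ℝ (G x) e) 2 μ) l (𝓝 0) := by
  have := ENNReal.Tendsto.const_mul (a := ENNReal.ofReal ‖e‖) h (Or.inr ENNReal.ofReal_ne_top)
  rw [mul_zero] at this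
  exact tendsto_of_tendsto_of_tendsto_of_le_of_le tendsto_const_nhds this (fun _ => bot_le)
    fun k => eLpNorm_inner_sub_le e

/-- **Green's formula** for a function with a lateral trace, tested with smooth functions. -/
theorem HasLateralTrace.exists_green {d : ℕ} {K : Polytope d} {s₀ s₁ : ℝ} {f : ℝ → E d → ℝ}
    (h : HasLateralTrace (Ioo s₀ s₁) K.set (frontier K.set) f) :
    ∃ G : ℝ × E d → E d, MemLp G 2 ((volume.restrict (Ioo s₀ s₁)).prod (volume.restrict K.set)) ∧
      ∀ (e : E d) (ψ : ℝ × E d → ℝ), ContDiff ℝ ∞ ψ →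
        ∫ z, f z.1 z.2 * (ψ z * inner ℝ (K.normal z.2) e)
            ∂((volume.restrict (Ioo s₀ s₁)).prod ((surf d).restrict (frontier K.set))) =
          ∫ z, inner ℝ (G z) e * ψ z
            ∂((volume.restrict (Ioo s₀ s₁)).prod (volume.restrict K.set)) +
          ∫ z, f z.1 z.2 * fderiv ℝ ψ z (0, e)
            ∂((volume.restrict (Ioo s₀ s₁)).prod (volume.restrict K.set)) := by
  obtain ⟨hfK, hfB, G, φ, hG, hφ, l1, l2, l3⟩ := h
  refine ⟨G, hG, fun e ψ hψ => ?_⟩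
  have hKb : Bornology.IsBounded K.set := K.bounded
  have mK : ∀ g : ℝ × E d → ℝ, Continuous g → MemLp g 2
      ((volume.restrict (Ioo s₀ s₁)).prod (volume.restrict K.set)) := fun g hg =>
    memLp_of_continuous_prod K.measurableSet_set hKb hg
  have hgr : ∀ k (z : ℝ × E d), inner ℝ (gradient (fun y => φ k (z.1, y)) z.2) e =
      fderiv ℝ (φ k) z (0, e) := by
    intro k z
    rw [← fderiv_slice (hφ k) z.1 z.2 e, gradient, InnerProductSpace.toDual_symm_apply]
  have t1 := tendsto_integral_mul_of_tendsto_eLpNorm hfK (mK _ (continuous_fderiv_apply_const hψ (0, e)))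
    (Eventually.of_forall fun k => (hφ k).continuous.aestronglyMeasurable) l1
  have t2 := tendsto_integral_mul_of_tendsto_eLpNorm (F := fun k z => fderiv ℝ (φ k) z (0, e))
    (hG.inner_const e) (mK _ hψ.continuous)
    (Eventually.of_forall fun k => (continuous_fderiv_apply_const (hφ k) (0, e)).aestronglyMeasurable)
    (by simpa only [hgr] using tendsto_eLpNorm_inner l2 e)
  have t3 := tendsto_integral_mul_of_tendsto_eLpNorm hfB (memLp_inner_normal K e hψ.continuous)
    (Eventually.of_forall fun k => (hφ k).continuous.aestronglyMeasurable) l3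
  refine tendsto_nhds_unique t3 ((t2.add t1).congr fun k => ?_)
  have i1 : Integrable (fun z : ℝ × E d => fderiv ℝ (φ k) z (0, e) * ψ z)
      ((volume.restrict (Ioo s₀ s₁)).prod (volume.restrict K.set)) :=
    (mK _ ((continuous_fderiv_apply_const (hφ k) (0, e)).mul hψ.continuous)).integrable one_le_two
  have i2 : Integrable (fun z : ℝ × E d => φ k z * fderiv ℝ ψ z (0, e))
      ((volume.restrict (Ioo s₀ s₁)).prod (volume.restrict K.set)) :=
    (mK _ ((hφ k).continuous.mul (continuous_fderiv_apply_const hψ (0, e)))).integrable one_le_two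
  have i3 : Integrable (fun z : ℝ × E d => φ k z * (ψ z * inner ℝ (K.normal z.2) e))
      ((volume.restrict (Ioo s₀ s₁)).prod ((surf d).restrict (frontier K.set))) := by
    have := (memLp_inner_normal K e (s₀ := s₀) (s₁ := s₁) (p := 2)
      ((hφ k).continuous.mul hψ.continuous)).integrable one_le_two
    refine this.congr (Eventually.of_forall fun z => ?_)
    simp only [Pi.mul_apply, mul_assoc]
  have i4 : Integrable (fun z : ℝ × E d => fderiv ℝ (φ k) z (0, e) * ψ z +
      φ k z * fderiv ℝ ψ z (0, e))
      ((volume.restrict (Ioo s₀ s₁)).prod (volume.restrict K.set)) := i1.add i2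
  rw [← integral_add i1 i2, integral_prod _ i4, integral_prod _ i3]
  congr 1 with t
  have hF : ContDiff ℝ ∞ fun y => φ k (t, y) * ψ (t, y) :=
    (contDiff_slice (hφ k) t).mul (contDiff_slice hψ t)
  have := K.integral_fderiv hF e
  simp only [mul_assoc] at this
  rw [← this]
  congr 1 with x
  have h1 := ((contDiff_slice (hφ k) t).differentiable (by simp) x).hasFDerivAt
  have h2 := ((contDiff_slice hψ t).differentiable (by simp) x).hasFDerivAt
  have h3 := (h1.mul h2).fderiv
  change fderiv ℝ (fun y => φ k (t, y) * ψ (t, y)) x = _ at h3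
  rw [h3]
  simp [fderiv_slice (hφ k), fderiv_slice hψ]
  ring

/-- The weak gradient of a function with a lateral trace is the one in Green's formula. -/
theorem HasLateralTrace.green {d : ℕ} {K : Polytope d} {s₀ s₁ : ℝ} {f : ℝ → E d → ℝ}
    {g : ℝ → E d → E d} (h : HasLateralTrace (Ioo s₀ s₁) K.set (frontier K.set) f)
    (hg : IsWeakGrad (Ioo s₀ s₁) K.set f g)
    (hgL : MemLp (fun z : ℝ × E d => g z.1 z.2) 2
      ((volume.restrict (Ioo s₀ s₁)).prod (volume.restrict K.set)))
    (e : E d) {ψ : ℝ × E d → ℝ} (hψ : ContDiff ℝ ∞ ψ) :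
    ∫ z, f z.1 z.2 * (ψ z * inner ℝ (K.normal z.2) e)
        ∂((volume.restrict (Ioo s₀ s₁)).prod ((surf d).restrict (frontier K.set))) =
      ∫ z, inner ℝ (g z.1 z.2) e * ψ z
        ∂((volume.restrict (Ioo s₀ s₁)).prod (volume.restrict K.set)) +
      ∫ z, f z.1 z.2 * fderiv ℝ ψ z (0, e)
        ∂((volume.restrict (Ioo s₀ s₁)).prod (volume.restrict K.set)) := by
  obtain ⟨G, hG, hGreen⟩ := h.exists_green
  rw [hGreen e ψ hψ]
  congr 1
  refine integral_congr_ae ?_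
  set μ := (volume.restrict (Ioo s₀ s₁)).prod (volume.restrict K.set) with hμ
  have hU : IsOpen (Ioo s₀ s₁ ×ˢ K.set) := isOpen_Ioo.prod K.isOpen_set
  have hint : Integrable (fun z : ℝ × E d => inner ℝ (G z) e - inner ℝ (g z.1 z.2) e) μ :=
    ((hG.inner_const e).integrable one_le_two).sub ((hgL.inner_const e).integrable one_le_two)
  have key := hU.ae_eq_zero_of_integral_contDiff_smul_eq_zero (μ := μ)
    (f := fun z : ℝ × E d => inner ℝ (G z) e - inner ℝ (g z.1 z.2) e)
    hint.integrableOn.locallyIntegrableOn ?_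
  · have hmem : ∀ᵐ z ∂μ, z ∈ Ioo s₀ s₁ ×ˢ K.set := by
      rw [hμ, Measure.prod_restrict]
      exact ae_restrict_mem hU.measurableSet
    filter_upwards [key, hmem] with z h1 h2
    rw [sub_eq_zero.1 (h1 h2)]
  · intro χ hχ hχc hχs
    have hT : IsTest (Ioo s₀ s₁ ×ˢ K.set) χ := ⟨hχ, hχc, hχs⟩
    have e1 := hGreen e χ hχ
    have e2 := hg.restrict e hT
    have e3 : ∫ z, f z.1 z.2 * (χ z * inner ℝ (K.normal z.2) e)
        ∂((volume.restrict (Ioo s₀ s₁)).prod ((surf d).restrict (frontier K.set))) = 0 := by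
      refine integral_eq_zero_of_ae ?_
      filter_upwards [Measure.quasiMeasurePreserving_snd.ae
        (ae_restrict_mem K.measurableSet_frontier)] with z hz
      have hz' : z ∉ tsupport χ := fun h' =>
        disjoint_left.1 (disjoint_frontier_iff_isOpen.2 K.isOpen_set).symm (hχs h').2 hz
      simp [image_eq_zero_of_notMem_tsupport hz']
    obtain ⟨C, hC⟩ := hT.continuous_bound
    have j1 : Integrable (fun z => χ z * inner ℝ (G z) e) μ :=
      ((hG.inner_const e).integrable one_le_two).bdd_mul (c := C) hχ.continuous.aestronglyMeasurable
        (Eventually.of_forall hC)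
    have j2 : Integrable (fun z => χ z * inner ℝ (g z.1 z.2) e) μ :=
      ((hgL.inner_const e).integrable one_le_two).bdd_mul (c := C) hχ.continuous.aestronglyMeasurable
        (Eventually.of_forall hC)
    simp only [smul_eq_mul, mul_sub]
    rw [integral_sub j1 j2]
    simp only [mul_comm (χ _)]
    rw [e3, e2] at e1
    linarith


/-- `fb` is the trace of `f` on `∂K` in the sense of Green's formula with smooth test functions, for
some integrable gradient `Z`. -/
def IsGreen {d : ℕ} (K : Polytope d) (f fb : E d → ℝ) : Prop :=
  IntegrableOn f K.set ∧ IntegrableOn fb (frontier K.set) (surf d) ∧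
  ∃ Z : E d → E d, IntegrableOn Z K.set ∧ ∀ (e : E d) (χ : E d → ℝ), ContDiff ℝ ∞ χ →
    HasCompactSupport χ →
    ∫ x in frontier K.set, fb x * (χ x * inner ℝ (K.normal x) e) ∂(surf d) =
      (∫ x in K.set, inner ℝ (Z x) e * χ x) + ∫ x in K.set, f x * fderiv ℝ χ x e

theorem exists_bound_of_test {d : ℕ} {χ : E d → ℝ} (h : ContDiff ℝ ∞ χ) (hc : HasCompactSupport χ)
    (e : E d) : (∃ C, ∀ x, ‖χ x‖ ≤ C) ∧ ∃ C, ∀ x, ‖fderiv ℝ χ x e‖ ≤ C :=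
  ⟨h.continuous.bounded_above_of_compact_support hc,
    (continuous_fderiv_apply_const h e).bounded_above_of_compact_support
      (hc.fderiv_apply (𝕜 := ℝ) e)⟩

theorem IsGreen.integrable_boundary {d : ℕ} {K : Polytope d} {fb : E d → ℝ}
    (h : IntegrableOn fb (frontier K.set) (surf d)) {χ : E d → ℝ} (hχ : ContDiff ℝ ∞ χ)
    (hχc : HasCompactSupport χ) (e : E d) :
    IntegrableOn (fun x => fb x * (χ x * inner ℝ (K.normal x) e)) (frontier K.set) (surf d) := by
  obtain ⟨C, hC⟩ := (exists_bound_of_test hχ hχc e).1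
  refine h.mul_bdd (c := C * (K.faces.card * ‖e‖)) ?_ (Eventually.of_forall fun x => ?_)
  · exact hχ.continuous.aestronglyMeasurable.mul
      (K.measurable_normal.inner measurable_const).aestronglyMeasurable
  · rw [norm_mul]
    refine mul_le_mul (hC x) ((norm_inner_le_norm _ _).trans
      (mul_le_mul_of_nonneg_right (K.norm_normal_le _) (norm_nonneg _))) (norm_nonneg _)
      ((norm_nonneg _).trans (hC x))

theorem IsGreen.add {d : ℕ} {K : Polytope d} {f fb g gb : E d → ℝ} (hf : IsGreen K f fb)
    (hg : IsGreen K g gb) : IsGreen K (fun x => f x + g x) fun x => fb x + gb x := by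
  obtain ⟨f1, f2, Z, hZ, hfg⟩ := hf
  obtain ⟨g1, g2, W, hW, hgg⟩ := hg
  refine ⟨f1.add g1, f2.add g2, fun x => Z x + W x, hZ.add hW, fun e χ hχ hχc => ?_⟩
  obtain ⟨⟨C, hC⟩, C', hC'⟩ := exists_bound_of_test hχ hχc e
  simp only [inner_add_left, add_mul]
  rw [integral_add (IsGreen.integrable_boundary f2 hχ hχc e)
      (IsGreen.integrable_boundary g2 hχ hχc e), hfg e χ hχ hχc, hgg e χ hχ hχc,
    integral_add, integral_add]
  · ring
  · exact f1.mul_bdd (c := C') (continuous_fderiv_apply_const hχ e).aestronglyMeasurable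
      (Eventually.of_forall hC')
  · exact g1.mul_bdd (c := C') (continuous_fderiv_apply_const hχ e).aestronglyMeasurable
      (Eventually.of_forall hC')
  · exact (hZ.inner_const e).mul_bdd (c := C) hχ.continuous.aestronglyMeasurable
      (Eventually.of_forall hC)
  · exact (hW.inner_const e).mul_bdd (c := C) hχ.continuous.aestronglyMeasurable
      (Eventually.of_forall hC)

theorem IsGreen.const_mul {d : ℕ} {K : Polytope d} {f fb : E d → ℝ} (hf : IsGreen K f fb) (c : ℝ) :
    IsGreen K (fun x => c * f x) fun x => c * fb x := by
  obtain ⟨f1, f2, Z, hZ, hfg⟩ := hf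
  refine ⟨f1.const_mul c, f2.const_mul c, fun x => c • Z x, hZ.smul c, fun e χ hχ hχc => ?_⟩
  simp only [real_inner_smul_left, mul_assoc, integral_const_mul]
  rw [hfg e χ hχ hχc]
  ring

/-- Time averages of a function with a lateral trace have the time averages of the trace as their
trace. -/
theorem HasLateralTrace.isGreen {d : ℕ} {K : Polytope d} {s₀ s₁ : ℝ} {f : ℝ → E d → ℝ}
    (h : HasLateralTrace (Ioo s₀ s₁) K.set (frontier K.set) f) {θ : ℝ → ℝ} (hθ : ContDiff ℝ ∞ θ) :
    IsGreen K (fun x => ∫ t in Ioo s₀ s₁, θ t * f t x) fun x => ∫ t in Ioo s₀ s₁, θ t * f t x := by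
  obtain ⟨G, hG, hGreen⟩ := h.exists_green
  have θm : ∀ {X : Type} [MeasurableSpace X] (μ : Measure X) [SFinite μ],
      MemLp (fun z : ℝ × X => θ z.1) ⊤ ((volume.restrict (Ioo s₀ s₁)).prod μ) := fun μ _ =>
    memLp_top_fst_of_continuous hθ.continuous
  have i1 : Integrable (fun z : ℝ × E d => θ z.1 * f z.1 z.2)
      ((volume.restrict (Ioo s₀ s₁)).prod (volume.restrict K.set)) :=
    (h.1.mul (p := ⊤) (q := 2) (r := 2) (θm _)).integrable one_le_two
  have i2 : Integrable (fun z : ℝ × E d => θ z.1 * f z.1 z.2)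
      ((volume.restrict (Ioo s₀ s₁)).prod ((surf d).restrict (frontier K.set))) :=
    (h.2.1.mul (p := ⊤) (q := 2) (r := 2) (θm _)).integrable one_le_two
  have i3 : Integrable (fun z : ℝ × E d => θ z.1 • G z)
      ((volume.restrict (Ioo s₀ s₁)).prod (volume.restrict K.set)) :=
    (hG.smul (p := ⊤) (q := 2) (r := 2) (θm _)).integrable one_le_two
  refine ⟨i1.integral_prod_right, i2.integral_prod_right, fun x => ∫ t in Ioo s₀ s₁, θ t • G (t, x),
    i3.integral_prod_right, fun e χ hχ hχc => ?_⟩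
  obtain ⟨⟨C, hC⟩, C', hC'⟩ := exists_bound_of_test hχ hχc e
  have hψ : ContDiff ℝ ∞ fun z : ℝ × E d => θ z.1 * χ z.2 :=
    (hθ.comp contDiff_fst).mul (hχ.comp contDiff_snd)
  have key := hGreen e _ hψ
  simp only [fderiv_prod_mul hθ hχ, mul_zero, zero_mul, zero_add] at key
  have j1 : Integrable (fun z : ℝ × E d => f z.1 z.2 * (θ z.1 * χ z.2 * inner ℝ (K.normal z.2) e))
      ((volume.restrict (Ioo s₀ s₁)).prod ((surf d).restrict (frontier K.set))) :=
    h.2.1.integrable_mul (memLp_inner_normal (p := 2) K e hψ.continuous)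
  have j2 : Integrable (fun z : ℝ × E d => inner ℝ (G z) e * (θ z.1 * χ z.2))
      ((volume.restrict (Ioo s₀ s₁)).prod (volume.restrict K.set)) :=
    (hG.inner_const e).integrable_mul
      (memLp_of_continuous_prod (p := 2) K.measurableSet_set K.bounded hψ.continuous)
  have j3 : Integrable (fun z : ℝ × E d => f z.1 z.2 * (θ z.1 * fderiv ℝ χ z.2 e))
      ((volume.restrict (Ioo s₀ s₁)).prod (volume.restrict K.set)) :=
    h.1.integrable_mul (memLp_of_continuous_prod (p := 2) K.measurableSet_set K.bounded
      ((hθ.continuous.comp continuous_fst).mul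
        ((continuous_fderiv_apply_const hχ e).comp continuous_snd)))
  rw [integral_prod_symm _ j1, integral_prod_symm _ j2, integral_prod_symm _ j3] at key
  convert key using 1
  · congr 1 with x
    rw [← integral_mul_const]
    congr 1 with t
    ring
  · congr 1
    · refine integral_congr_ae ?_
      filter_upwards [i3.prod_left_ae] with x hx
      rw [real_inner_comm, ← integral_inner hx, ← integral_mul_const]
      congr 1 with t
      rw [inner_smul_right, real_inner_comm]
      ring
    · congr 1 with x
      rw [← integral_mul_const]
      congr 1 with t
      ring

theorem eLpNorm_comp_snd {X F : Type*} [MeasurableSpace X] [NormedAddCommGroup F] {μ : Measure X}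
    [SFinite μ] {g : X → F} {p : ENNReal} (hg : AEStronglyMeasurable g μ) :
    eLpNorm (fun z : ℝ × X => g z.2) p ((volume.restrict (Ioo (0 : ℝ) 1)).prod μ) =
      eLpNorm g p μ :=
  have : IsProbabilityMeasure (volume.restrict (Ioo (0 : ℝ) 1)) := ⟨by simp⟩
  eLpNorm_comp_measurePreserving hg measurePreserving_snd

theorem memLp_comp_snd {X F : Type*} [MeasurableSpace X] [NormedAddCommGroup F] {μ : Measure X}
    [SFinite μ] {g : X → F} {p : ENNReal} (hg : MemLp g p μ) :
    MemLp (fun z : ℝ × X => g z.2) p ((volume.restrict (Ioo (0 : ℝ) 1)).prod μ) :=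
  have : IsProbabilityMeasure (volume.restrict (Ioo (0 : ℝ) 1)) := ⟨by simp⟩
  hg.comp_measurePreserving measurePreserving_snd

/-- A function with a trace is a function with a lateral trace that is constant in time. -/
theorem HasTrace.isGreen {d : ℕ} {K : Polytope d} {S : Set (E d)}
    (hKS : frontier K.set ⊆ S) {f : E d → ℝ} (h : HasTrace K.set S f) : IsGreen K f f := by
  obtain ⟨h1, h2, G, φ, hG, hφ, l1, l2, l3⟩ := h
  have hle : (surf d).restrict (frontier K.set) ≤ (surf d).restrict S :=
    Measure.restrict_mono hKS le_rfl
  have hlat : HasLateralTrace (Ioo 0 1) K.set (frontier K.set) fun _ => f := by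
    refine ⟨memLp_comp_snd h1, memLp_comp_snd (h2.mono_measure hle), fun z => G z.2,
      fun k z => φ k z.2, memLp_comp_snd hG, fun k => (hφ k).comp contDiff_snd, ?_, ?_, ?_⟩
    · refine l1.congr fun k => ?_
      have m : AEStronglyMeasurable (fun x => φ k x - f x) (volume.restrict K.set) :=
        (hφ k).continuous.aestronglyMeasurable.sub h1.1
      exact (eLpNorm_comp_snd (p := 2) m).symm
    · refine l2.congr fun k => ?_
      have c : Continuous (gradient (φ k)) := (InnerProductSpace.toDual ℝ (E d)).symm.continuous.comp
        ((hφ k).continuous_fderiv (by simp))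
      have m : AEStronglyMeasurable (fun x => gradient (φ k) x - G x) (volume.restrict K.set) :=
        c.aestronglyMeasurable.sub hG.1
      exact (eLpNorm_comp_snd (p := 2) m).symm
    · have l4 : Tendsto (fun k => eLpNorm (fun x => φ k x - f x) 2
          ((surf d).restrict (frontier K.set))) atTop (𝓝 0) :=
        tendsto_of_tendsto_of_tendsto_of_le_of_le tendsto_const_nhds l3 (fun _ => bot_le)
          fun k => eLpNorm_mono_measure _ hle
      refine l4.congr fun k => ?_
      have m : AEStronglyMeasurable (fun x => φ k x - f x) ((surf d).restrict (frontier K.set)) :=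
        (hφ k).continuous.aestronglyMeasurable.sub (h2.mono_measure hle).1
      exact (eLpNorm_comp_snd (p := 2) m).symm
  have := hlat.isGreen (θ := fun _ => 1) contDiff_const
  simpa using this

/-- The trace of the zero function is zero. -/
theorem IsGreen.ae_eq_zero {d : ℕ} {K : Polytope d} {f fb : E d → ℝ} (h : IsGreen K f fb)
    (hf : ∀ᵐ x ∂(volume.restrict K.set), f x = 0) :
    ∀ᵐ x ∂((surf d).restrict (frontier K.set)), fb x = 0 := by
  obtain ⟨h1, h2, Z, hZ, hg⟩ := h
  have hz : ∀ (e : E d) (χ : E d → ℝ), ∫ x in K.set, f x * fderiv ℝ χ x e = 0 := fun e χ => by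
    refine integral_eq_zero_of_ae ?_
    filter_upwards [hf] with x hx
    simp [hx]
  have hZ0 : ∀ e : E d, ∀ᵐ x ∂(volume.restrict K.set), inner ℝ (Z x) e = 0 := by
    intro e
    have key := K.isOpen_set.ae_eq_zero_of_integral_contDiff_smul_eq_zero (μ := volume)
      (f := fun x => inner ℝ (Z x) e)
      (IntegrableOn.locallyIntegrableOn (Integrable.inner_const hZ e)) ?_
    · rwa [ae_restrict_iff' K.measurableSet_set]
    · intro χ hχ hχc hχs
      have e1 := hg e χ hχ hχc
      have e3 : ∫ x in frontier K.set, fb x * (χ x * inner ℝ (K.normal x) e) ∂(surf d) = 0 := by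
        refine setIntegral_eq_zero_of_forall_eq_zero fun x hx => ?_
        have hx' : x ∉ tsupport χ := fun h' =>
          disjoint_left.1 (disjoint_frontier_iff_isOpen.2 K.isOpen_set).symm (hχs h') hx
        simp [image_eq_zero_of_notMem_tsupport hx']
      rw [e3, hz, add_zero] at e1
      rw [← setIntegral_eq_integral_of_forall_compl_eq_zero (s := K.set)]
      · simp only [smul_eq_mul, mul_comm (χ _)]
        exact e1.symm
      · intro x hx
        rw [image_eq_zero_of_notMem_tsupport fun hx' => hx (hχs hx'), zero_smul]
  have hb : ∀ e : E d, ∀ᵐ x ∂((surf d).restrict (frontier K.set)),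
      fb x * inner ℝ (K.normal x) e = 0 := by
    intro e
    refine ae_eq_zero_of_integral_contDiff_smul_eq_zero ?_ ?_
    · refine Integrable.locallyIntegrable ?_
      refine h2.mul_bdd (c := K.faces.card * ‖e‖)
        (K.measurable_normal.inner measurable_const).aestronglyMeasurable
        (Eventually.of_forall fun x => ?_)
      exact (norm_inner_le_norm _ _).trans
        (mul_le_mul_of_nonneg_right (K.norm_normal_le _) (norm_nonneg _))
    · intro χ hχ hχc
      have e1 := hg e χ hχ hχc
      have e2 : ∫ x in K.set, inner ℝ (Z x) e * χ x = 0 := by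
        refine integral_eq_zero_of_ae ?_
        filter_upwards [hZ0 e] with x hx
        simp [hx]
      rw [hz, e2, add_zero] at e1
      rw [← e1]
      congr 1 with x
      simp only [smul_eq_mul]
      ring
  have hb' := ae_all_iff.2 fun i : Fin d => hb (EuclideanSpace.single i 1)
  filter_upwards [hb', K.ae_norm_normal] with x hx hn
  by_contra hne
  have : K.normal x = 0 := by
    ext i
    have := (mul_eq_zero.1 (hx i)).resolve_left hne
    simpa [EuclideanSpace.inner_single_right] using this
  simp [this] at hn

/-- On `∂K` the trace of `f` satisfies the fundamental theorem of calculus if `f` does in `K`. -/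
theorem TimeFTC.boundary {d : ℕ} {K : Polytope d} {s₀ s₁ : ℝ} {f f' : ℝ → E d → ℝ}
    (h : TimeFTC s₀ s₁ (volume.restrict K.set) f f')
    (hf : HasLateralTrace (Ioo s₀ s₁) K.set (frontier K.set) f)
    (hf' : HasLateralTrace (Ioo s₀ s₁) K.set (frontier K.set) f')
    (h₀ : IsGreen K (f s₀) (f s₀)) (h₁ : IsGreen K (f s₁) (f s₁)) :
    TimeFTC s₀ s₁ ((surf d).restrict (frontier K.set)) f f' := by
  rw [TimeFTC, ae_all_iff]
  intro j
  have hsplit : ∀ (μ : Measure (E d)) [SFinite μ],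
      MemLp (fun z : ℝ × E d => f z.1 z.2) 2 ((volume.restrict (Ioo s₀ s₁)).prod μ) →
      MemLp (fun z : ℝ × E d => f' z.1 z.2) 2 ((volume.restrict (Ioo s₀ s₁)).prod μ) →
      ∀ [IsFiniteMeasure μ], ∀ᵐ x ∂μ,
      ∫ t in Ioo s₀ s₁, (t ^ j * f' t x + (j * t ^ (j - 1)) * f t x) =
        (∫ t in Ioo s₀ s₁, t ^ j * f' t x) + ∫ t in Ioo s₀ s₁, (j * t ^ (j - 1)) * f t x := by
    intro μ _ m m' _
    have a1 : Integrable (fun z : ℝ × E d => z.1 ^ j * f' z.1 z.2)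
        ((volume.restrict (Ioo s₀ s₁)).prod μ) :=
      (m'.mul (p := ⊤) (q := 2) (r := 2)
        (memLp_top_fst_of_continuous (θ := fun t => t ^ j) (by fun_prop))).integrable one_le_two
    have a2 : Integrable (fun z : ℝ × E d => (j * z.1 ^ (j - 1)) * f z.1 z.2)
        ((volume.restrict (Ioo s₀ s₁)).prod μ) :=
      (m.mul (p := ⊤) (q := 2) (r := 2)
        (memLp_top_fst_of_continuous (θ := fun t => j * t ^ (j - 1)) (by fun_prop))).integrable
          one_le_two
    filter_upwards [a1.prod_left_ae, a2.prod_left_ae] with x b1 b2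
    exact integral_add b1 b2
  have hG := (((hf'.isGreen (θ := fun t => t ^ j) (by fun_prop)).add
    (hf.isGreen (θ := fun t => j * t ^ (j - 1)) (by fun_prop))).add (h₁.const_mul (-s₁ ^ j))).add
    (h₀.const_mul (s₀ ^ j))
  have h0 := hG.ae_eq_zero ?_
  · filter_upwards [h0, hsplit _ hf.2.1 hf'.2.1] with x hx hs
    rw [hs]
    linarith
  · filter_upwards [h, hsplit _ hf.1 hf'.1] with x hx hs
    have := hx j
    rw [hs] at this
    rw [this]
    ring

theorem IsTest.fderiv_apply {X : Type*} [NormedAddCommGroup X] [NormedSpace ℝ X] {U : Set X}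
    {φ : X → ℝ} (h : IsTest U φ) (v : X) : IsTest U fun z => fderiv ℝ φ z v :=
  ⟨(h.1.fderiv_right (m := ∞) (by simp)).clm_apply contDiff_const, h.2.1.fderiv_apply (𝕜 := ℝ) v,
    (closure_mono ((Function.support_subset_iff'.2 fun z hz => by
      rw [image_eq_zero_of_notMem_tsupport (f := fderiv ℝ φ) hz]; rfl) :
      Function.support (fun z => fderiv ℝ φ z v) ⊆ tsupport (fderiv ℝ φ))).trans
      ((closure_minimal (tsupport_fderiv_subset ℝ) (isClosed_tsupport _)).trans h.2.2)⟩

theorem fderiv_fderiv_comm {X : Type*} [NormedAddCommGroup X] [NormedSpace ℝ X] {φ : X → ℝ}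
    (h : ContDiff ℝ ∞ φ) (z v w : X) :
    fderiv ℝ (fun y => fderiv ℝ φ y v) z w = fderiv ℝ (fun y => fderiv ℝ φ y w) z v := by
  have hd : DifferentiableAt ℝ (fderiv ℝ φ) z :=
    (h.fderiv_right (m := ∞) (by simp)).differentiable (by simp) z
  have e : ∀ u u' : X, fderiv ℝ (fun y => fderiv ℝ φ y u) z u' = fderiv ℝ (fderiv ℝ φ) z u' u := by
    intro u u'
    have := (hd.hasFDerivAt.clm_apply (hasFDerivAt_const u z)).fderiv
    rw [this]
    simp
  rw [e, e]
  have hs : IsSymmSndFDerivAt ℝ φ z := h.contDiffAt.isSymmSndFDerivAt (by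
    rw [minSmoothness_of_isRCLikeNormedField]
    exact WithTop.coe_le_coe.2 (le_top : (2 : ℕ∞) ≤ ⊤))
  exact hs.eq w v

/-- Weak time derivatives and weak gradients commute. -/
theorem IsWeakDt.grad {d : ℕ} {I : Set ℝ} {K : Set (E d)} {f f' : ℝ → E d → ℝ}
    {g g' : ℝ → E d → E d} (hf : IsWeakDt I K f f') (hg : IsWeakGrad I K f g)
    (hg' : IsWeakGrad I K f' g') (i : Fin d) :
    IsWeakDt I K (fun t x => g t x i) fun t x => g' t x i := by
  intro φ hφ
  set e : E d := EuclideanSpace.single i 1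
  have he : ∀ y : E d, y i = inner ℝ y e := fun y => by simp [e, EuclideanSpace.inner_single_right]
  simp only [he]
  have a1 := hg e _ (hφ.fderiv_apply (1, 0))
  have a2 := hf _ (hφ.fderiv_apply (0, e))
  have a3 := hg' e _ hφ
  simp only [fderiv_fderiv_comm hφ.1 _ (1, 0) (0, e)] at a1
  linarith


/-! ### Space-time polynomials -/

namespace Poly

variable {d : ℕ}

theorem at_C (c : ℝ) (t : ℝ) (x : E d) : Poly.at (MvPolynomial.C c : Poly d) t x = c := by
  simp [Poly.at]

theorem at_add (q r : Poly d) (t : ℝ) (x : E d) : (q + r).at t x = q.at t x + r.at t x := by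
  simp [Poly.at]

theorem at_mul (q r : Poly d) (t : ℝ) (x : E d) : Poly.at (q * r) t x = q.at t x * r.at t x := by
  simp [Poly.at]

theorem at_X (j : Fin (d + 1)) (t : ℝ) (x : E d) : Poly.at (MvPolynomial.X j : Poly d) t x =
    (Fin.cons t (fun i => x i) : Fin (d + 1) → ℝ) j := by
  simp [Poly.at]

theorem at_sum {ι : Type*} (s : Finset ι) (q : ι → Poly d) (t : ℝ) (x : E d) :
    Poly.at (∑ i ∈ s, q i) t x = ∑ i ∈ s, (q i).at t x := by
  simp [Poly.at]

theorem contDiff_coord (j : Fin (d + 1)) :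
    ContDiff ℝ ∞ fun z : ℝ × E d => (Fin.cons z.1 (fun i => z.2 i) : Fin (d + 1) → ℝ) j := by
  refine Fin.cases ?_ (fun i => ?_) j
  · simpa using contDiff_fst
  · simp only [Fin.cons_succ]
    exact (EuclideanSpace.proj i : E d →L[ℝ] ℝ).contDiff.comp contDiff_snd

theorem contDiff (q : Poly d) : ContDiff ℝ ∞ fun z : ℝ × E d => q.at z.1 z.2 := by
  induction q using MvPolynomial.induction_on with
  | C c => simpa only [at_C] using contDiff_const
  | add q r hq hr => simpa only [at_add] using hq.add hr
  | mul_X q j hq => simpa only [at_mul, at_X] using hq.mul (contDiff_coord j)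

theorem continuous (q : Poly d) : Continuous fun z : ℝ × E d => q.at z.1 z.2 := q.contDiff.continuous

theorem fderiv_coord (j : Fin (d + 1)) (z v : ℝ × E d) :
    fderiv ℝ (fun z : ℝ × E d => (Fin.cons z.1 (fun i => z.2 i) : Fin (d + 1) → ℝ) j) z v =
      (Fin.cons v.1 (fun i => v.2 i) : Fin (d + 1) → ℝ) j := by
  refine Fin.cases ?_ (fun i => ?_) j
  · simp only [Fin.cons_zero]
    have := (hasFDerivAt_fst (𝕜 := ℝ) (p := z)).fderiv
    rw [this]; rfl
  · simp only [Fin.cons_succ]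
    have := ((EuclideanSpace.proj i : E d →L[ℝ] ℝ).hasFDerivAt.comp z
      (hasFDerivAt_snd (𝕜 := ℝ) (p := z))).fderiv
    change fderiv ℝ (fun z : ℝ × E d => z.2 i) z = _ at this
    rw [this]; rfl

theorem fderiv_at (q : Poly d) (z v : ℝ × E d) :
    fderiv ℝ (fun z : ℝ × E d => q.at z.1 z.2) z v =
      ∑ j, (Fin.cons v.1 (fun i => v.2 i) : Fin (d + 1) → ℝ) j *
        Poly.at (MvPolynomial.pderiv j q) z.1 z.2 := by
  induction q using MvPolynomial.induction_on with
  | C c => simp [Poly.at]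
  | add q r hq hr =>
    have h1 := ((Poly.contDiff q).differentiable (by simp) z).hasFDerivAt
    have h2 := ((Poly.contDiff r).differentiable (by simp) z).hasFDerivAt
    have h3 := (h1.add h2).fderiv
    change fderiv ℝ (fun z : ℝ × E d => Poly.at q z.1 z.2 + Poly.at r z.1 z.2) z = _ at h3
    simp only [at_add, map_add, mul_add, Finset.sum_add_distrib]
    rw [h3, ← hq, ← hr]
    rfl
  | mul_X q j hq =>
    have h1 := ((Poly.contDiff q).differentiable (by simp) z).hasFDerivAt
    have h2 := ((contDiff_coord (d := d) j).differentiable (by simp) z).hasFDerivAt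
    have h3 := (h1.mul h2).fderiv
    change fderiv ℝ (fun z : ℝ × E d => Poly.at q z.1 z.2 *
      (Fin.cons z.1 (fun i => z.2 i) : Fin (d + 1) → ℝ) j) z = _ at h3
    simp only [at_mul, at_X]
    rw [h3]
    simp only [_root_.add_apply, _root_.smul_apply, smul_eq_mul,
      fderiv_coord, hq, MvPolynomial.pderiv_mul, MvPolynomial.pderiv_X, at_add, at_mul, at_X,
      mul_add, Finset.sum_add_distrib, Finset.mul_sum]
    rw [add_comm]
    congr 1
    · refine Finset.sum_congr rfl fun i _ => ?_
      ring
    · rw [Finset.sum_eq_single j]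
      · simp [Poly.at]; ring
      · intro i _ hij
        simp [Poly.at, hij.symm]
      · simp

theorem fderiv_time (q : Poly d) (z : ℝ × E d) :
    fderiv ℝ (fun z : ℝ × E d => q.at z.1 z.2) z (1, 0) = (Poly.dt q).at z.1 z.2 := by
  rw [fderiv_at, Fin.sum_univ_succ]
  simp [Poly.dt]

theorem fderiv_space (q : Poly d) (z : ℝ × E d) (e : E d) :
    fderiv ℝ (fun z : ℝ × E d => q.at z.1 z.2) z (0, e) = inner ℝ (q.gradAt z.1 z.2) e := by
  rw [fderiv_at, Fin.sum_univ_succ]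
  simp [Poly.gradAt, PiLp.inner_apply]

theorem gradAt_apply (q : Poly d) (t : ℝ) (x : E d) (i : Fin d) :
    q.gradAt t x i = Poly.at (MvPolynomial.pderiv i.succ q) t x := rfl

theorem continuous_gradAt (q : Poly d) : Continuous fun z : ℝ × E d => q.gradAt z.1 z.2 :=
  (PiLp.continuous_toLp 2 _).comp (continuous_pi fun _ => Poly.continuous _)

theorem pderiv_dt (q : Poly d) (i : Fin d) :
    MvPolynomial.pderiv i.succ (Poly.dt q) = Poly.dt (MvPolynomial.pderiv i.succ q) := by
  unfold Poly.dt
  induction q using MvPolynomial.induction_on' with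
  | monomial s c =>
    simp only [MvPolynomial.pderiv_monomial]
    congr 1
    · rw [tsub_right_comm]
    · have h0 : (Fin.succ i) ≠ 0 := Fin.succ_ne_zero i
      simp [Finsupp.tsub_apply, h0, h0.symm]; ring
  | add q r hq hr => simp only [map_add, hq, hr]

/-- At a fixed point in space a space-time polynomial is a polynomial in time. -/
noncomputable def timePoly (q : Poly d) (x : E d) : Polynomial ℝ :=
  MvPolynomial.aeval (Fin.cons Polynomial.X (fun i => Polynomial.C (x i))) q

theorem eval_timePoly (q : Poly d) (x : E d) (t : ℝ) : (q.timePoly x).eval t = q.at t x := by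
  unfold timePoly
  induction q using MvPolynomial.induction_on with
  | C c => simp [Poly.at]
  | add q r hq hr => simp [at_add, hq, hr]
  | mul_X q j hq =>
    rw [map_mul, Polynomial.eval_mul, hq, at_mul, at_X, MvPolynomial.aeval_X]
    congr 1
    refine Fin.cases ?_ (fun i => ?_) j <;> simp

theorem hasDerivAt (q : Poly d) (t : ℝ) (x : E d) :
    HasDerivAt (fun t => q.at t x) ((Poly.dt q).at t x) t := by
  have h1 := (q.contDiff.differentiable (by simp) (t, x)).hasFDerivAt
  have h2 : HasDerivAt (fun t : ℝ => (t, x)) ((1 : ℝ), (0 : E d)) t :=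
    (hasDerivAt_id t).prodMk (hasDerivAt_const t x)
  have := h1.comp_hasDerivAt t h2
  rwa [fderiv_time] at this

theorem eval_derivative_timePoly (q : Poly d) (x : E d) (t : ℝ) :
    (q.timePoly x).derivative.eval t = (Poly.dt q).at t x := by
  have h := (q.timePoly x).hasDerivAt t
  have e : (fun t => (q.timePoly x).eval t) = fun t => q.at t x := funext (q.eval_timePoly x)
  rw [e] at h
  exact h.unique (q.hasDerivAt t x)

/-- At a fixed time a space-time polynomial is a polynomial in space. -/
noncomputable def slice (q : Poly d) (t : ℝ) : MvPolynomial (Fin d) ℝ :=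
  MvPolynomial.aeval (Fin.cons (MvPolynomial.C t) MvPolynomial.X) q

theorem eval_slice (q : Poly d) (t : ℝ) (x : E d) :
    MvPolynomial.eval (fun i => x i) (q.slice t) = q.at t x := by
  unfold slice
  induction q using MvPolynomial.induction_on with
  | C c => simp [Poly.at]
  | add q r hq hr => rw [map_add, map_add, at_add, hq, hr]
  | mul_X q j hq =>
    rw [map_mul, map_mul, hq, at_mul, at_X, MvPolynomial.aeval_X]
    congr 1
    refine Fin.cases ?_ (fun i => ?_) j <;> simp

theorem totalDegree_slice_le (q : Poly d) (t : ℝ) : (q.slice t).totalDegree ≤ q.totalDegree := by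
  unfold slice
  rw [MvPolynomial.aeval_def, MvPolynomial.eval₂_eq]
  refine MvPolynomial.totalDegree_finsetSum_le fun s hs => ?_
  refine (MvPolynomial.totalDegree_mul _ _).trans ?_
  have h1 : (algebraMap ℝ (MvPolynomial (Fin d) ℝ) (MvPolynomial.coeff s q)).totalDegree = 0 :=
    MvPolynomial.totalDegree_C _
  rw [h1, zero_add]
  refine (MvPolynomial.totalDegree_finsetProd _ _).trans ?_
  refine le_trans (Finset.sum_le_sum fun j _ => ?_) (MvPolynomial.le_totalDegree hs)
  refine (MvPolynomial.totalDegree_pow _ _).trans ?_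
  have : ((Fin.cons (MvPolynomial.C t) MvPolynomial.X : Fin (d + 1) → MvPolynomial (Fin d) ℝ)
      j).totalDegree ≤ 1 := by
    refine Fin.cases ?_ (fun i => ?_) j <;> simp
  nlinarith

theorem totalDegree_pderiv_le (q : Poly d) (j : Fin (d + 1)) :
    (MvPolynomial.pderiv j q).totalDegree ≤ q.totalDegree := by
  conv_lhs => rw [q.as_sum, map_sum]
  refine MvPolynomial.totalDegree_finsetSum_le fun s hs => ?_
  rw [MvPolynomial.pderiv_monomial]
  refine (MvPolynomial.totalDegree_monomial_le _ _).trans (le_trans ?_ (MvPolynomial.le_totalDegree hs))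
  change (s - Finsupp.single j 1).degree ≤ s.degree
  exact Finsupp.degree_mono tsub_le_self

end Poly


/-! ### Regular jets -/

theorem HasLateralTrace.of_contDiff {d : ℕ} {K : Polytope d} {s₀ s₁ : ℝ} {g : ℝ → E d → ℝ}
    (hg : ContDiff ℝ ∞ fun z : ℝ × E d => g z.1 z.2) :
    HasLateralTrace (Ioo s₀ s₁) K.set (frontier K.set) g := by
  have hK := memLp_of_continuous_prod (s₀ := s₀) (s₁ := s₁) (μ := volume) (p := 2)
    K.measurableSet_set K.bounded hg.continuous
  have hB := memLp_of_continuous_prod (s₀ := s₀) (s₁ := s₁) (p := 2)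
    (μ := (surf d).restrict (frontier K.set)) K.measurableSet_frontier K.isBounded_frontier hg.continuous
  rw [Measure.restrict_restrict K.measurableSet_frontier, inter_self] at hB
  have hgr : Continuous fun z : ℝ × E d => gradient (fun y => g z.1 y) z.2 := by
    have : Continuous fun z : ℝ × E d => fderiv ℝ (fun y => g z.1 y) z.2 := by
      have e : (fun z : ℝ × E d => fderiv ℝ (fun y => g z.1 y) z.2) = fun z =>
          (fderiv ℝ (fun z : ℝ × E d => g z.1 z.2) z).comp (ContinuousLinearMap.inr ℝ ℝ (E d)) := by
        ext z e
        simpa using fderiv_slice hg z.1 z.2 e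
      rw [e]
      exact (hg.continuous_fderiv (by simp)).clm_comp continuous_const
    exact (InnerProductSpace.toDual ℝ (E d)).symm.continuous.comp this
  refine ⟨hK, hB, fun z => gradient (fun y => g z.1 y) z.2, fun _ z => g z.1 z.2,
    memLp_of_continuous_prod (μ := volume) K.measurableSet_set K.bounded hgr, fun _ => hg, ?_, ?_, ?_⟩
  all_goals simp

theorem HasTrace.of_contDiff {d : ℕ} {K : Polytope d} {S : Set (E d)} (hS : MeasurableSet S)
    (hSb : Bornology.IsBounded S) (hSf : surf d S < ⊤) {g : E d → ℝ} (hg : ContDiff ℝ ∞ g) :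
    HasTrace K.set S g := by
  have hgr : Continuous (gradient g) := (InnerProductSpace.toDual ℝ (E d)).symm.continuous.comp
    (hg.continuous_fderiv (by simp))
  have m : ∀ {F : Type} [NormedAddCommGroup F] [SecondCountableTopology F] [MeasurableSpace F]
      [BorelSpace F] {f : E d → F} {μ : Measure (E d)} {A : Set (E d)}, MeasurableSet A →
      Bornology.IsBounded A → μ A < ⊤ → Continuous f → MemLp f 2 (μ.restrict A) := by
    intro F _ _ _ _ f μ A hA hAb hAf hf
    have : IsFiniteMeasure (μ.restrict A) := ⟨by simpa using hAf⟩
    obtain ⟨C, hC⟩ := hAb.isCompact_closure.exists_bound_of_continuousOn hf.continuousOn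
    refine MemLp.of_bound hf.measurable.aestronglyMeasurable C ?_
    rw [ae_restrict_iff' hA]
    exact Eventually.of_forall fun x hx => hC x (subset_closure hx)
  refine ⟨m K.measurableSet_set K.bounded K.volume_lt_top hg.continuous, m hS hSb hSf hg.continuous,
    gradient g, fun _ => g, m K.measurableSet_set K.bounded K.volume_lt_top hgr, fun _ => hg, ?_, ?_, ?_⟩
  all_goals simp

theorem HasTimeTrace.of_continuous {d : ℕ} {F : Type*} [NormedAddCommGroup F]
    [SecondCountableTopology F] [MeasurableSpace F] [BorelSpace F] {I : Set ℝ} (K : Polytope d)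
    {g : ℝ → E d → F} (hg : Continuous fun z : ℝ × E d => g z.1 z.2) (s : ℝ) :
    HasTimeTrace I K.set g s := by
  have hgs : ∀ t, Continuous (g t) := fun t => hg.comp (by fun_prop : Continuous fun x : E d => (t, x))
  have hKc : IsCompact (closure K.set) := K.bounded.isCompact_closure
  constructor
  · obtain ⟨C, hC⟩ := hKc.exists_bound_of_continuousOn (hgs s).continuousOn
    refine MemLp.of_bound (hgs s).measurable.aestronglyMeasurable C ?_
    rw [ae_restrict_iff' K.measurableSet_set]
    exact Eventually.of_forall fun x hx => hC x (subset_closure hx)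
  · have hlim : ∀ ε > 0, ∀ᶠ t in 𝓝 s, ∀ x ∈ closure K.set, ‖g t x - g s x‖ ≤ ε := by
      intro ε hε
      refine hKc.eventually_forall_of_forall_eventually fun x _ => ?_
      have hc : Continuous fun z : ℝ × E d => ‖g z.1 z.2 - g s z.2‖ :=
        (hg.sub ((hgs s).comp continuous_snd)).norm
      have : Tendsto (fun z : ℝ × E d => ‖g z.1 z.2 - g s z.2‖) (𝓝 (s, x)) (𝓝 0) := by
        simpa using hc.tendsto (s, x)
      filter_upwards [this.eventually (gt_mem_nhds hε)] with z hz using hz.le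
    have hz : Tendsto (fun t => eLpNorm (fun x => g t x - g s x) 2 (volume.restrict K.set))
        (𝓝 s) (𝓝 0) := by
      rw [ENNReal.tendsto_nhds_zero]
      intro δ hδ
      set c : ENNReal := (volume.restrict K.set) univ ^ (2 : ENNReal).toReal⁻¹
      have hc : c ≠ ⊤ := by
        refine ENNReal.rpow_ne_top_of_nonneg (by simp) ?_
        simpa using K.volume_lt_top.ne
      have : Tendsto (fun ε : ℝ => c * ENNReal.ofReal ε) (𝓝[>] 0) (𝓝 0) := by
        have h1 : Tendsto (fun ε : ℝ => ENNReal.ofReal ε) (𝓝[>] 0) (𝓝 0) := by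
          have := (ENNReal.continuous_ofReal.tendsto 0).mono_left
            (nhdsWithin_le_nhds : 𝓝[>] (0 : ℝ) ≤ 𝓝 0)
          simpa using this
        simpa using ENNReal.Tendsto.const_mul h1 (Or.inr hc)
      obtain ⟨ε, hε1, hε0⟩ := ((this.eventually (ge_mem_nhds hδ)).and self_mem_nhdsWithin).exists
      filter_upwards [hlim ε hε0] with t ht
      refine (eLpNorm_le_of_ae_bound (C := ε) ?_).trans hε1
      rw [ae_restrict_iff' K.measurableSet_set]
      exact Eventually.of_forall fun x hx => ht x (subset_closure hx)
    exact hz.mono_left (inf_le_left.trans nhdsWithin_le_nhds)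

theorem integral_mul_fderiv_of_isTest {X : Type*} [NormedAddCommGroup X] [NormedSpace ℝ X]
    [FiniteDimensional ℝ X] [MeasurableSpace X] [BorelSpace X] (μ : Measure X) [μ.IsAddHaarMeasure]
    {U : Set X} {g φ : X → ℝ} (hg : ContDiff ℝ ∞ g) (hφ : IsTest U φ) (v : X) :
    ∫ z, g z * fderiv ℝ φ z v ∂μ = - ∫ z, fderiv ℝ g z v * φ z ∂μ := by
  have hcs : ∀ {f h : X → ℝ}, Continuous f → Continuous h → HasCompactSupport h →
      Integrable (fun z => f z * h z) μ := fun hf hh hc =>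
    (hf.mul hh).integrable_of_hasCompactSupport hc.mul_left
  refine integral_mul_fderiv_eq_neg_fderiv_mul_of_integrable ?_ ?_ ?_
    (fun x _ => hg.differentiable (by simp) x) (fun x _ => hφ.1.differentiable (by simp) x)
  · exact hcs (continuous_fderiv_apply_const hg v) hφ.1.continuous hφ.2.1
  · exact hcs hg.continuous (continuous_fderiv_apply_const hφ.1 v) (hφ.2.1.fderiv_apply (𝕜 := ℝ) v)
  · exact hcs hg.continuous hφ.1.continuous hφ.2.1

instance isAddHaarMeasure_prod (d : ℕ) : (volume : Measure (ℝ × E d)).IsAddHaarMeasure := by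
  rw [Measure.volume_eq_prod]
  infer_instance

namespace Poly

variable {d : ℕ}

theorem isWeakDt (q : Poly d) (I : Set ℝ) (K : Set (E d)) : IsWeakDt I K q.at (Poly.dt q).at := by
  intro φ hφ
  rw [integral_mul_fderiv_of_isTest volume q.contDiff hφ (1, 0)]
  simp only [fderiv_time]

theorem isWeakGrad (q : Poly d) (I : Set ℝ) (K : Set (E d)) : IsWeakGrad I K q.at q.gradAt := by
  intro e φ hφ
  rw [integral_mul_fderiv_of_isTest volume q.contDiff hφ (0, e)]
  simp only [fderiv_space]

theorem contDiff_slice (q : Poly d) (t : ℝ) : ContDiff ℝ ∞ (q.at t) :=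
  TrefftzDG.contDiff_slice q.contDiff t

end Poly

namespace Mesh

variable {d : ℕ} (M : Mesh d)

theorem measurableSet_nodeSkel (n : ℕ) : MeasurableSet (M.nodeSkel n) := by
  unfold nodeSkel
  split_ifs
  · exact (M.measurableSet_skel n).union (M.measurableSet_skel _)
  · simpa using M.measurableSet_skel n

theorem surf_nodeSkel_lt_top (n : ℕ) : surf d (M.nodeSkel n) < ⊤ := by
  unfold nodeSkel
  split_ifs
  · exact measure_union_lt_top (M.surf_skel_lt_top n) (M.surf_skel_lt_top _)
  · simpa using M.surf_skel_lt_top n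

theorem skel_subset_nodeSkel (n : ℕ) : M.skel n ⊆ M.nodeSkel n := subset_union_left

theorem frontier_subset_skel {n : ℕ} {K : Polytope d} (hK : K ∈ M.elems n) :
    frontier K.set ⊆ M.skel n :=
  subset_biUnion_of_mem (u := fun K : Polytope d => frontier K.set) hK

theorem frontier_subset_nodeSkel {n : ℕ} {K : Polytope d} (hK : K ∈ M.elems n) :
    frontier K.set ⊆ closure K.set ∩ M.nodeSkel n :=
  fun _ hx => ⟨frontier_subset_closure hx, M.skel_subset_nodeSkel n (M.frontier_subset_skel hK hx)⟩

end Mesh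

/-- Polynomials have all the regularity that is required of `w`, so what holds for regular jets
applies to the test functions as well. -/
theorem Poly.isRegularJet {d : ℕ} (M : Mesh d) (n : ℕ) (K : Polytope d) (q : Poly d) :
    IsRegularJet M n K q.jet where
  memLp_dtt := memLp_of_continuous_prod (μ := volume) K.measurableSet_set K.bounded
    (Poly.continuous _)
  weak_dt := q.isWeakDt _ _
  weak_dtt := (Poly.dt q).isWeakDt _ _
  weak_grad := q.isWeakGrad _ _
  weak_gradDt := (Poly.dt q).isWeakGrad _ _
  lateral_val := .of_contDiff q.contDiff
  lateral_dt := .of_contDiff (Poly.dt q).contDiff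
  lateral_grad _ := .of_contDiff (Poly.contDiff _)
  lateral_gradDt _ := .of_contDiff (Poly.contDiff _)
  time_val s _ := .of_continuous K q.continuous s
  time_dt s _ := .of_continuous K (Poly.dt q).continuous s
  time_grad s _ := .of_continuous K q.continuous_gradAt s
  start_val := .of_contDiff K.measurableSet_frontier K.isBounded_frontier K.surf_frontier_lt_top
    (q.contDiff_slice _)
  start_grad _ := .of_contDiff K.measurableSet_frontier K.isBounded_frontier K.surf_frontier_lt_top
    (Poly.contDiff_slice _ _)
  end_val := .of_contDiff (isClosed_closure.measurableSet.inter (M.measurableSet_nodeSkel n))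
    (K.isBounded_closure.subset inter_subset_left)
    ((measure_mono inter_subset_right).trans_lt (M.surf_nodeSkel_lt_top n)) (q.contDiff_slice _)
  end_grad _ := .of_contDiff (isClosed_closure.measurableSet.inter (M.measurableSet_nodeSkel n))
    (K.isBounded_closure.subset inter_subset_left)
    ((measure_mono inter_subset_right).trans_lt (M.surf_nodeSkel_lt_top n))
    (Poly.contDiff_slice _ _)

theorem HasTimeTrace.apply {d : ℕ} {I : Set ℝ} {K : Set (E d)} {g : ℝ → E d → E d} {s : ℝ}
    (h : HasTimeTrace I K g s) (i : Fin d) : HasTimeTrace I K (fun t x => g t x i) s := by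
  refine ⟨h.1.eval_piLp i, tendsto_of_tendsto_of_tendsto_of_le_of_le tendsto_const_nhds h.2
    (fun _ => bot_le) fun t => ?_⟩
  refine eLpNorm_mono fun x => ?_
  exact PiLp.norm_apply_le (g t x - g s x) i

namespace IsRegularJet

variable {d : ℕ} {M : Mesh d} {n : ℕ} {K : Polytope d} {J : Jet d}

theorem timeFTC_dt (h : IsRegularJet M n K J) (hn : n < M.N) :
    TimeFTC (M.t n) (M.t (n + 1)) (volume.restrict K.set) J.dt J.dtt :=
  timeFTC_of_isWeakDt (M.t_lt n hn) K.isOpen_set K.volume_lt_top h.lateral_dt.1 h.memLp_dtt h.weak_dtt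
    (h.time_dt _ (by simp)) (h.time_dt _ (by simp))

theorem timeFTC_grad (h : IsRegularJet M n K J) (hn : n < M.N) (i : Fin d) :
    TimeFTC (M.t n) (M.t (n + 1)) (volume.restrict K.set) (fun t x => J.grad t x i)
      fun t x => J.gradDt t x i :=
  timeFTC_of_isWeakDt (M.t_lt n hn) K.isOpen_set K.volume_lt_top (h.lateral_grad i).1
    (h.lateral_gradDt i).1 (h.weak_dt.grad h.weak_grad h.weak_gradDt i)
    ((h.time_grad _ (by simp)).apply i) ((h.time_grad _ (by simp)).apply i)

theorem timeFTC_boundary_val (h : IsRegularJet M n K J) (hn : n < M.N) (hK : K ∈ M.elems n) :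
    TimeFTC (M.t n) (M.t (n + 1)) ((surf d).restrict (frontier K.set)) J.val J.dt :=
  (timeFTC_of_isWeakDt (M.t_lt n hn) K.isOpen_set K.volume_lt_top h.lateral_val.1 h.lateral_dt.1
    h.weak_dt (h.time_val _ (by simp)) (h.time_val _ (by simp))).boundary h.lateral_val h.lateral_dt
    (h.start_val.isGreen Subset.rfl) (h.end_val.isGreen (M.frontier_subset_nodeSkel hK))

theorem timeFTC_boundary_grad (h : IsRegularJet M n K J) (hn : n < M.N) (hK : K ∈ M.elems n)
    (i : Fin d) : TimeFTC (M.t n) (M.t (n + 1)) ((surf d).restrict (frontier K.set))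
      (fun t x => J.grad t x i) fun t x => J.gradDt t x i :=
  (h.timeFTC_grad hn i).boundary (h.lateral_grad i) (h.lateral_gradDt i)
    ((h.start_grad i).isGreen Subset.rfl) ((h.end_grad i).isGreen (M.frontier_subset_nodeSkel hK))

theorem memLp_gradDt (h : IsRegularJet M n K J) : MemLp (fun z : ℝ × E d => J.gradDt z.1 z.2) 2
    ((volume.restrict (M.slab n)).prod (volume.restrict K.set)) :=
  MemLp.of_eval_piLp fun i => (h.lateral_gradDt i).1

/-- Green's formula for `ẇ` and a polynomial. -/
theorem green (h : IsRegularJet M n K J) (q : Poly d) :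
    ∫ z, J.dt z.1 z.2 * inner ℝ (q.gradAt z.1 z.2) (K.normal z.2)
        ∂((volume.restrict (M.slab n)).prod ((surf d).restrict (frontier K.set))) =
      ∫ z, inner ℝ (J.gradDt z.1 z.2) (q.gradAt z.1 z.2) +
          J.dt z.1 z.2 * Poly.at (Poly.laplacian q) z.1 z.2
        ∂((volume.restrict (M.slab n)).prod (volume.restrict K.set)) := by
  have key := fun i : Fin d => h.lateral_dt.green h.weak_gradDt h.memLp_gradDt
    (EuclideanSpace.single i 1) (Poly.contDiff (MvPolynomial.pderiv i.succ q))
  have hsum := Finset.sum_congr (rfl : Finset.univ = Finset.univ) fun i _ => key i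
  simp only [Poly.fderiv_space] at hsum
  have mK : ∀ r : Poly d, MemLp (fun z : ℝ × E d => r.at z.1 z.2) 2
      ((volume.restrict (M.slab n)).prod (volume.restrict K.set)) := fun r =>
    memLp_of_continuous_prod (μ := volume) K.measurableSet_set K.bounded r.continuous
  have hs : ∀ (y : E d) (i : Fin d), inner ℝ y (EuclideanSpace.single i (1 : ℝ)) = y i := fun y i => by
    simp [EuclideanSpace.inner_single_right]
  have j1 : ∀ i ∈ (Finset.univ : Finset (Fin d)), Integrable (fun z : ℝ × E d => J.dt z.1 z.2 *
      (Poly.at (MvPolynomial.pderiv i.succ q) z.1 z.2 *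
        inner ℝ (K.normal z.2) (EuclideanSpace.single i 1)))
      ((volume.restrict (M.slab n)).prod ((surf d).restrict (frontier K.set))) := fun i _ =>
    h.lateral_dt.2.1.integrable_mul (memLp_inner_normal (p := 2) K _ (Poly.continuous _))
  have j2 : ∀ i ∈ (Finset.univ : Finset (Fin d)), Integrable (fun z : ℝ × E d =>
      inner ℝ (J.gradDt z.1 z.2) (EuclideanSpace.single i 1) *
        Poly.at (MvPolynomial.pderiv i.succ q) z.1 z.2)
      ((volume.restrict (M.slab n)).prod (volume.restrict K.set)) := fun i _ =>
    (h.memLp_gradDt.inner_const _).integrable_mul (mK _)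
  have j3 : ∀ i ∈ (Finset.univ : Finset (Fin d)), Integrable (fun z : ℝ × E d => J.dt z.1 z.2 *
      Poly.at (MvPolynomial.pderiv i.succ (MvPolynomial.pderiv i.succ q)) z.1 z.2)
      ((volume.restrict (M.slab n)).prod (volume.restrict K.set)) := fun i _ =>
    h.lateral_dt.1.integrable_mul (mK _)
  simp only [hs, Poly.gradAt_apply, Mesh.slab] at hsum j1 j2 j3 ⊢
  rw [Finset.sum_add_distrib, ← integral_finsetSum _ j1, ← integral_finsetSum _ j2,
    ← integral_finsetSum _ j3, ← integral_add (integrable_finsetSum _ j2)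
    (integrable_finsetSum _ j3)] at hsum
  convert hsum using 1
  · congr 1 with z
    rw [PiLp.inner_apply, Finset.mul_sum]
    refine Finset.sum_congr rfl fun i _ => ?_
    simp only [Poly.gradAt_apply, RCLike.inner_apply, conj_trivial]
    ring
  · congr 1 with z
    rw [PiLp.inner_apply, Poly.laplacian, Poly.at_sum, Finset.mul_sum]
    congr 1
    refine Finset.sum_congr rfl fun i _ => ?_
    simp [Poly.gradAt_apply]; ring

end IsRegularJet


/-! ### Measurability and integrability of averages and jumps -/

theorem MemLp.integrable_inner_of {X V : Type*} [MeasurableSpace X] {μ : Measure X}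
    [NormedAddCommGroup V] [InnerProductSpace ℝ V] {f g : X → V} (hf : MemLp f 2 μ)
    (hg : MemLp g 2 μ) : Integrable (fun x => inner ℝ (f x) (g x)) μ :=
  (hf.norm.integrable_mul hg.norm).mono (hf.1.inner hg.1) (Eventually.of_forall fun x => by
    simpa using norm_inner_le_norm (𝕜 := ℝ) (f x) (g x))

theorem integrable_weight_inner {X V : Type*} [MeasurableSpace X] {μ : Measure X}
    [NormedAddCommGroup V] [InnerProductSpace ℝ V] {ρ : X → ℝ} {f g : X → V} (hρ : MemLp ρ ⊤ μ)
    (hf : MemLp f 2 μ) (hg : MemLp g 2 μ) : Integrable (fun x => ρ x * inner ℝ (f x) (g x)) μ := by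
  have := MemLp.integrable_inner_of (hf.smul (p := ⊤) (q := 2) (r := 2) hρ) hg
  refine this.congr (Eventually.of_forall fun x => ?_)
  simp [real_inner_smul_left]

theorem memLp_comp_snd_of_top {X : Type*} [MeasurableSpace X] {ν : Measure ℝ} {μ : Measure X}
    [SFinite ν] [SFinite μ] {ρ : X → ℝ} (hρ : MemLp ρ ⊤ μ) :
    MemLp (fun z : ℝ × X => ρ z.2) ⊤ (ν.prod μ) := by
  refine ⟨hρ.1.comp_quasiMeasurePreserving Measure.quasiMeasurePreserving_snd, ?_⟩
  have h2 := hρ.2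
  rw [eLpNorm_exponent_top] at h2 ⊢
  refine lt_of_le_of_lt ?_ h2
  exact eLpNormEssSup_le_of_ae_enorm_bound
    (Measure.quasiMeasurePreserving_snd.ae (enorm_ae_le_eLpNormEssSup ρ μ))

theorem memLp_top_of_finite_range {X : Type*} [MeasurableSpace X] {μ : Measure X} {ρ : X → ℝ}
    (hm : Measurable ρ) (hr : (range ρ).Finite) : MemLp ρ ⊤ μ := by
  obtain ⟨C, hC⟩ := hr.isBounded.exists_norm_le
  exact memLp_top_of_bound hm.aestronglyMeasurable C
    (Eventually.of_forall fun x => hC _ (mem_range_self x))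

theorem finite_range_comp {X : Type*} {ρ : X → ℝ} (hr : (range ρ).Finite) (g : ℝ → ℝ) :
    (range fun x => g (ρ x)).Finite := by
  have : (range fun x => g (ρ x)) = g '' range ρ := range_comp g ρ
  rw [this]
  exact hr.image g

theorem prod_restrict_snd {X : Type*} [MeasurableSpace X] (ν : Measure ℝ) (μ : Measure X)
    [SFinite ν] [SFinite μ] (C : Set X) :
    (ν.prod μ).restrict (Prod.snd ⁻¹' C) = ν.prod (μ.restrict C) := by
  rw [← univ_prod, ← Measure.prod_restrict, Measure.restrict_univ]

namespace Mesh

variable {d : ℕ} (M : Mesh d)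

open Classical in
theorem sum_touching {F : Type*} [AddCommMonoid F] (n : ℕ) (x : E d) (f : Polytope d → F) :
    ∑ K ∈ M.touching n x, f K = ∑ K ∈ M.elems n, (closure K.set).indicator (fun _ => f K) x := by
  rw [touching, Finset.sum_filter]
  rfl

theorem measurable_card_touching (n : ℕ) : Measurable fun x => ((M.touching n x).card : ℝ) := by
  have : (fun x => ((M.touching n x).card : ℝ)) = fun x =>
      ∑ K ∈ M.elems n, (closure K.set).indicator (fun _ => (1 : ℝ)) x := by
    ext x
    rw [← M.sum_touching n x (fun _ => (1 : ℝ))]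
    simp
  rw [this]
  exact Finset.measurable_fun_sum _ fun K _ =>
    measurable_const.indicator isClosed_closure.measurableSet

theorem abs_inv_card_le_one (n : ℕ) (x : E d) : ‖((M.touching n x).card : ℝ)⁻¹‖ ≤ 1 := by
  rw [norm_inv, Real.norm_natCast]
  rcases Nat.eq_zero_or_pos (M.touching n x).card with h | h
  · simp [h]
  · exact inv_le_one_of_one_le₀ (by exact_mod_cast h)

theorem measurable_h (n : ℕ) : Measurable (M.h n) := by
  have : M.h n = fun x => ((M.touching n x).card : ℝ)⁻¹ *
      ∑ K ∈ M.elems n, (closure K.set).indicator (fun _ => Metric.diam K.set) x := by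
    ext x
    rw [← M.sum_touching n x (fun K => Metric.diam K.set)]
    rfl
  rw [this]
  exact (M.measurable_card_touching n).inv.mul (Finset.measurable_fun_sum _ fun K _ =>
    measurable_const.indicator isClosed_closure.measurableSet)

open Classical in
theorem finite_range_h (n : ℕ) : (range (M.h n)).Finite := by
  refine ((M.elems n).powerset.finite_toSet.image fun T : Finset (Polytope d) =>
    ((T.card : ℝ)⁻¹ • ∑ K ∈ T, Metric.diam K.set)).subset ?_
  rintro _ ⟨x, rfl⟩
  exact ⟨M.touching n x, by
    rw [Finset.mem_coe, Finset.mem_powerset]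
    exact Finset.filter_subset _ _, rfl⟩

theorem finite_range_indicator {s : Set (E d)} {ρ : E d → ℝ} (h : (range ρ).Finite) :
    (range (s.indicator ρ)).Finite := by
  refine (h.insert 0).subset ?_
  rintro _ ⟨x, rfl⟩
  by_cases hx : x ∈ s
  · rw [indicator_of_mem hx]; exact Or.inr (mem_range_self x)
  · rw [indicator_of_notMem hx]; exact Or.inl rfl

theorem h_pos (hd : 1 ≤ d) {n : ℕ} {x : E d} (hx : x ∈ M.skel n) : 0 < M.h n x := by
  obtain ⟨K, hK, hxK⟩ := mem_iUnion₂.1 hx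
  have hKt : K ∈ M.touching n x := M.mem_touching.2 ⟨hK, frontier_subset_closure hxK⟩
  have hc : 0 < ((M.touching n x).card : ℝ) := by exact_mod_cast Finset.card_pos.2 ⟨K, hKt⟩
  exact mul_pos (inv_pos.2 hc) (Finset.sum_pos (fun L _ => L.diam_pos hd) ⟨K, hKt⟩)

theorem h_le_nodeH {n : ℕ} {x : E d} (hx : x ∈ M.skel n) : M.h n x ≤ M.nodeH n x := by
  unfold nodeH
  rw [indicator_of_mem hx]
  exact le_max_left _ _

theorem h_succ_le_nodeH {n : ℕ} (hn : n + 1 < M.N) {x : E d} (hx : x ∈ M.skel (n + 1)) :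
    M.h (n + 1) x ≤ M.nodeH n x := by
  unfold nodeH
  rw [if_pos hn, indicator_of_mem hx]
  exact le_max_right _ _

theorem nodeH_pos (hd : 1 ≤ d) {n : ℕ} {x : E d} (hx : x ∈ M.nodeSkel n) : 0 < M.nodeH n x := by
  rcases hx with hx | hx
  · exact (M.h_pos hd hx).trans_le (M.h_le_nodeH hx)
  · split_ifs at hx with hn
    · exact (M.h_pos hd hx).trans_le (M.h_succ_le_nodeH hn hx)
    · exact hx.elim

section MemLp

variable {Z : Type*} [MeasurableSpace Z] {μ : Measure Z} {π : Z → E d}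

theorem memLp_avg {F : Type*} [NormedAddCommGroup F] [NormedSpace ℝ F] (hπ : Measurable π) (n : ℕ)
    {f : Polytope d → Z → F}
    (hf : ∀ K ∈ M.elems n, MemLp (f K) 2 (μ.restrict (π ⁻¹' closure K.set))) :
    MemLp (fun z => M.avg n (fun K _ => f K z) (π z)) 2 μ := by
  have e : (fun z => M.avg n (fun K _ => f K z) (π z)) = (fun z => ((M.touching n (π z)).card : ℝ)⁻¹) •
      fun z => ∑ K ∈ M.elems n, (π ⁻¹' closure K.set).indicator (f K) z := by
    ext z
    simp only [avg, Pi.smul_apply', M.sum_touching]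
    rfl
  rw [e]
  refine MemLp.smul (p := ⊤) (q := 2) (r := 2) (memLp_finsetSum _ fun K hK => ?_) ?_
  · exact (memLp_indicator_iff_restrict (hπ isClosed_closure.measurableSet)).2 (hf K hK)
  · exact memLp_top_of_bound ((M.measurable_card_touching n).comp hπ).inv.aestronglyMeasurable 1
      (Eventually.of_forall fun z => M.abs_inv_card_le_one n (π z))

theorem memLp_normal (hπ : Measurable π) (K : Polytope d) : MemLp (fun z => K.normal (π z)) ⊤ μ :=
  memLp_top_of_bound (K.measurable_normal.comp hπ).aestronglyMeasurable K.faces.card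
    (Eventually.of_forall fun _ => K.norm_normal_le _)

theorem memLp_jump (hπ : Measurable π) (n : ℕ) {f : Polytope d → Z → ℝ}
    (hf : ∀ K ∈ M.elems n, MemLp (f K) 2 (μ.restrict (π ⁻¹' closure K.set))) :
    MemLp (fun z => M.jump n (fun K _ => f K z) (π z)) 2 μ := by
  have e : (fun z => M.jump n (fun K _ => f K z) (π z)) =
      fun z => ∑ K ∈ M.elems n, ((π ⁻¹' closure K.set).indicator (f K) z) • K.normal (π z) := by
    ext1 z
    simp only [jump, M.sum_touching]
    refine Finset.sum_congr rfl fun K _ => ?_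
    by_cases hz : π z ∈ closure K.set
    · have hz' : z ∈ π ⁻¹' closure K.set := hz
      simp [hz]
    · have hz' : z ∉ π ⁻¹' closure K.set := hz
      simp [hz]
  rw [e]
  refine memLp_finsetSum _ fun K hK => ?_
  have hi := (memLp_indicator_iff_restrict (hπ isClosed_closure.measurableSet)).2 (hf K hK)
  have hn : MemLp (fun z => K.normal (π z)) ⊤ μ := memLp_normal hπ K
  have h3 : MemLp ((π ⁻¹' closure K.set).indicator (f K) • fun z => K.normal (π z)) 2 μ :=
    hn.smul hi
  exact h3

theorem memLp_jumpV (hπ : Measurable π) (n : ℕ) {f : Polytope d → Z → E d}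
    (hf : ∀ K ∈ M.elems n, MemLp (f K) 2 (μ.restrict (π ⁻¹' closure K.set))) :
    MemLp (fun z => M.jumpV n (fun K _ => f K z) (π z)) 2 μ := by
  have e : (fun z => M.jumpV n (fun K _ => f K z) (π z)) =
      fun z => ∑ K ∈ M.elems n, inner ℝ ((π ⁻¹' closure K.set).indicator (f K) z) (K.normal (π z)) := by
    ext1 z
    simp only [jumpV, M.sum_touching]
    refine Finset.sum_congr rfl fun K _ => ?_
    by_cases hz : π z ∈ closure K.set
    · have hz' : z ∈ π ⁻¹' closure K.set := hz
      simp [hz]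
    · have hz' : z ∉ π ⁻¹' closure K.set := hz
      simp [hz]
  rw [e]
  refine memLp_finsetSum _ fun K hK => ?_
  have hi := (memLp_indicator_iff_restrict (hπ isClosed_closure.measurableSet)).2 (hf K hK)
  refine MemLp.of_le_mul (c := K.faces.card) hi (hi.1.inner (memLp_normal (μ := μ) hπ K).1)
    (Eventually.of_forall fun z => ?_)
  refine (norm_inner_le_norm _ _).trans ?_
  rw [mul_comm]
  exact mul_le_mul_of_nonneg_right (K.norm_normal_le _) (norm_nonneg _)

theorem memLp_bulk {F : Type*} [NormedAddCommGroup F] (hπ : Measurable π) (n : ℕ)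
    {f : Polytope d → Z → F} {p : ENNReal}
    (hf : ∀ K ∈ M.elems n, MemLp (f K) p (μ.restrict (π ⁻¹' K.set))) :
    MemLp (fun z => M.bulk n (fun K _ => f K z) (π z)) p μ := by
  have e : (fun z => M.bulk n (fun K _ => f K z) (π z)) =
      fun z => ∑ K ∈ M.elems n, (π ⁻¹' K.set).indicator (f K) z := rfl
  rw [e]
  exact memLp_finsetSum _ fun K hK =>
    (memLp_indicator_iff_restrict (hπ K.measurableSet_set)).2 (hf K hK)

end MemLp

end Mesh


/-! ### Integration by parts in time -/

/-- Integration by parts on `(s₀, s₁)` for a function `φ` with derivative `φ'` against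
polynomials. -/
def HasFTC (s₀ s₁ : ℝ) (φ φ' : ℝ → ℝ) : Prop :=
  IntegrableOn φ (Ioo s₀ s₁) ∧ IntegrableOn φ' (Ioo s₀ s₁) ∧ ∀ P : Polynomial ℝ,
    ∫ t in Ioo s₀ s₁, (φ t * P.derivative.eval t + φ' t * P.eval t) =
      φ s₁ * P.eval s₁ - φ s₀ * P.eval s₀

theorem IntegrableOn.mul_polynomial {s₀ s₁ : ℝ} {φ : ℝ → ℝ} (h : IntegrableOn φ (Ioo s₀ s₁))
    (P : Polynomial ℝ) : IntegrableOn (fun t => φ t * P.eval t) (Ioo s₀ s₁) := by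
  obtain ⟨C, hC⟩ := (isCompact_Icc (a := s₀) (b := s₁)).exists_bound_of_continuousOn
    P.continuous.continuousOn
  refine Integrable.mul_bdd (c := C) h P.continuous.aestronglyMeasurable ?_
  rw [ae_restrict_iff' measurableSet_Ioo]
  exact Eventually.of_forall fun t ht => hC t (Ioo_subset_Icc_self ht)

namespace HasFTC

variable {s₀ s₁ : ℝ}

theorem integrable {φ φ' : ℝ → ℝ} (h : HasFTC s₀ s₁ φ φ') (P : Polynomial ℝ) :
    IntegrableOn (fun t => φ t * P.derivative.eval t + φ' t * P.eval t) (Ioo s₀ s₁) :=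
  Integrable.add (IntegrableOn.mul_polynomial h.1 _) (IntegrableOn.mul_polynomial h.2.1 _)

theorem const_mul {φ φ' : ℝ → ℝ} (h : HasFTC s₀ s₁ φ φ') (c : ℝ) :
    HasFTC s₀ s₁ (fun t => c * φ t) fun t => c * φ' t := by
  refine ⟨h.1.const_mul c, h.2.1.const_mul c, fun P => ?_⟩
  have := congrArg (c * ·) (h.2.2 P)
  simp only [← integral_const_mul] at this
  rw [mul_sub] at this
  simp only [mul_assoc, ← this]
  congr 1 with t
  ring

theorem zero : HasFTC s₀ s₁ (fun _ => 0) fun _ => 0 := by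
  refine ⟨integrableOn_zero, integrableOn_zero, fun P => ?_⟩
  simp

theorem add {φ φ' γ γ' : ℝ → ℝ} (h : HasFTC s₀ s₁ φ φ') (h' : HasFTC s₀ s₁ γ γ') :
    HasFTC s₀ s₁ (fun t => φ t + γ t) fun t => φ' t + γ' t := by
  refine ⟨h.1.add h'.1, h.2.1.add h'.2.1, fun P => ?_⟩
  have e : (fun t => (φ t + γ t) * P.derivative.eval t + (φ' t + γ' t) * P.eval t) = fun t =>
      (φ t * P.derivative.eval t + φ' t * P.eval t) +
        (γ t * P.derivative.eval t + γ' t * P.eval t) := by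
    ext t; ring
  rw [e, integral_add (h.integrable P) (h'.integrable P), h.2.2 P, h'.2.2 P]
  ring

theorem sum {ι : Type*} (s : Finset ι) {φ φ' : ι → ℝ → ℝ} (h : ∀ i ∈ s, HasFTC s₀ s₁ (φ i) (φ' i)) :
    HasFTC s₀ s₁ (fun t => ∑ i ∈ s, φ i t) fun t => ∑ i ∈ s, φ' i t := by
  classical
  induction s using Finset.induction_on with
  | empty => simpa using zero
  | insert i s hi ih =>
    simp only [Finset.sum_insert hi]
    exact (h i (by simp)).add (ih fun j hj => h j (by simp [hj]))

end HasFTC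

/-- By linearity the powers of `t` may be replaced by all polynomials. -/
theorem TimeFTC.hasFTC {X : Type*} [MeasurableSpace X] {s₀ s₁ : ℝ} {μ : Measure X} [IsFiniteMeasure μ]
    {f f' : ℝ → X → ℝ} (h : TimeFTC s₀ s₁ μ f f')
    (hf : MemLp (fun z : ℝ × X => f z.1 z.2) 2 ((volume.restrict (Ioo s₀ s₁)).prod μ))
    (hf' : MemLp (fun z : ℝ × X => f' z.1 z.2) 2 ((volume.restrict (Ioo s₀ s₁)).prod μ)) :
    ∀ᵐ x ∂μ, HasFTC s₀ s₁ (fun t => f t x) fun t => f' t x := by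
  have : IsFiniteMeasure (volume.restrict (Ioo s₀ s₁)) := ⟨by simp⟩
  filter_upwards [h, (hf.integrable one_le_two).prod_left_ae, (hf'.integrable one_le_two).prod_left_ae]
    with x hx h1 h2
  refine ⟨h1, h2, fun P => ?_⟩
  induction P using Polynomial.induction_on' with
  | add P Q hP hQ =>
    have i : ∀ P : Polynomial ℝ, IntegrableOn (fun t => f t x * P.derivative.eval t +
        f' t x * P.eval t) (Ioo s₀ s₁) := fun P =>
      Integrable.add (IntegrableOn.mul_polynomial h1 _) (IntegrableOn.mul_polynomial h2 _)
    have e : (fun t => f t x * (P + Q).derivative.eval t + f' t x * (P + Q).eval t) = fun t =>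
        (f t x * P.derivative.eval t + f' t x * P.eval t) +
          (f t x * Q.derivative.eval t + f' t x * Q.eval t) := by
      ext t; simp; ring
    rw [e, integral_add (i P) (i Q), hP, hQ]
    simp; ring
  | monomial j c =>
    have e : (fun t => f t x * (Polynomial.monomial j c).derivative.eval t +
        f' t x * (Polynomial.monomial j c).eval t) = fun t =>
        c * (t ^ j * f' t x + (j * t ^ (j - 1)) * f t x) := by
      ext t; simp [Polynomial.derivative_monomial]; ring
    rw [e, integral_const_mul, hx j]
    simp; ring

/-- `g` is a polynomial with derivative `g'`. -/
def IsTimePoly (g g' : ℝ → ℝ) : Prop :=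
  ∃ P : Polynomial ℝ, ∀ t, g t = P.eval t ∧ g' t = P.derivative.eval t

namespace IsTimePoly

theorem const_mul {g g' : ℝ → ℝ} (h : IsTimePoly g g') (c : ℝ) :
    IsTimePoly (fun t => c * g t) fun t => c * g' t := by
  obtain ⟨P, hP⟩ := h
  exact ⟨Polynomial.C c * P, fun t => by simp [(hP t).1, (hP t).2]⟩

theorem sum {ι : Type*} (s : Finset ι) {g g' : ι → ℝ → ℝ} (h : ∀ i ∈ s, IsTimePoly (g i) (g' i)) :
    IsTimePoly (fun t => ∑ i ∈ s, g i t) fun t => ∑ i ∈ s, g' i t := by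
  choose! P hP using h
  refine ⟨∑ i ∈ s, P i, fun t => ⟨?_, ?_⟩⟩
  · rw [Polynomial.eval_finsetSum]
    exact Finset.sum_congr rfl fun i hi => (hP i hi t).1
  · rw [Polynomial.derivative_sum, Polynomial.eval_finsetSum]
    exact Finset.sum_congr rfl fun i hi => (hP i hi t).2

end IsTimePoly

theorem HasFTC.pairing_inner {d : ℕ} {s₀ s₁ : ℝ} {f f' g g' : ℝ → E d}
    (hf : ∀ i, HasFTC s₀ s₁ (fun t => f t i) fun t => f' t i)
    (hg : ∀ i, IsTimePoly (fun t => g t i) fun t => g' t i) :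
    ∫ t in Ioo s₀ s₁, (inner ℝ (f t) (g' t) + inner ℝ (f' t) (g t)) =
      inner ℝ (f s₁) (g s₁) - inner ℝ (f s₀) (g s₀) := by
  choose P hP using hg
  beta_reduce at hP
  have e : (fun t => inner ℝ (f t) (g' t) + inner ℝ (f' t) (g t)) = fun t =>
      ∑ i, (f t i * (P i).derivative.eval t + f' t i * (P i).eval t) := by
    ext t
    rw [PiLp.inner_apply, PiLp.inner_apply, ← Finset.sum_add_distrib]
    refine Finset.sum_congr rfl fun i _ => ?_
    rw [← (hP i t).1, ← (hP i t).2]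
    simp only [Real.inner_apply]
  rw [e, integral_finsetSum _ fun i _ => (hf i).integrable (P i), PiLp.inner_apply, PiLp.inner_apply,
    ← Finset.sum_sub_distrib]
  refine Finset.sum_congr rfl fun i _ => ?_
  have h1 := (hf i).2.2 (P i)
  beta_reduce at h1
  rw [h1, ← (hP i s₁).1, ← (hP i s₀).1]
  simp only [Real.inner_apply]

theorem HasFTC.pairing_real {s₀ s₁ : ℝ} {f f' g g' : ℝ → ℝ} (hf : HasFTC s₀ s₁ f f')
    (hg : IsTimePoly g g') :
    ∫ t in Ioo s₀ s₁, (inner ℝ (f t) (g' t) + inner ℝ (f' t) (g t)) =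
      inner ℝ (f s₁) (g s₁) - inner ℝ (f s₀) (g s₀) := by
  obtain ⟨P, hP⟩ := hg
  have := hf.2.2 P
  simp only [← (hP _).1, ← (hP _).2] at this
  simp only [Real.inner_apply]
  exact this

/-- Integration by parts in time on a space-time domain with a time-independent weight. -/
theorem integral_pairing {X V : Type*} [MeasurableSpace X] {μ : Measure X} [IsFiniteMeasure μ]
    [NormedAddCommGroup V] [InnerProductSpace ℝ V] {s₀ s₁ : ℝ} {f f' g g' : ℝ → X → V} {ρ : X → ℝ}
    (hρ : MemLp ρ ⊤ μ)
    (hf : MemLp (fun z : ℝ × X => f z.1 z.2) 2 ((volume.restrict (Ioo s₀ s₁)).prod μ))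
    (hf' : MemLp (fun z : ℝ × X => f' z.1 z.2) 2 ((volume.restrict (Ioo s₀ s₁)).prod μ))
    (hg : MemLp (fun z : ℝ × X => g z.1 z.2) 2 ((volume.restrict (Ioo s₀ s₁)).prod μ))
    (hg' : MemLp (fun z : ℝ × X => g' z.1 z.2) 2 ((volume.restrict (Ioo s₀ s₁)).prod μ))
    (hf₀ : MemLp (f s₀) 2 μ) (hf₁ : MemLp (f s₁) 2 μ) (hg₀ : MemLp (g s₀) 2 μ)
    (hg₁ : MemLp (g s₁) 2 μ)
    (h : ∀ᵐ x ∂μ, ∫ t in Ioo s₀ s₁, (inner ℝ (f t x) (g' t x) + inner ℝ (f' t x) (g t x)) =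
      inner ℝ (f s₁ x) (g s₁ x) - inner ℝ (f s₀ x) (g s₀ x)) :
    (∫ t in Ioo s₀ s₁, ∫ x, ρ x * inner ℝ (f t x) (g' t x) ∂μ) +
        ∫ t in Ioo s₀ s₁, ∫ x, ρ x * inner ℝ (f' t x) (g t x) ∂μ =
      (∫ x, ρ x * inner ℝ (f s₁ x) (g s₁ x) ∂μ) - ∫ x, ρ x * inner ℝ (f s₀ x) (g s₀ x) ∂μ := by
  have hρ' := memLp_comp_snd_of_top (ν := volume.restrict (Ioo s₀ s₁)) hρ
  have i1 := integrable_weight_inner hρ' hf hg'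
  have i2 := integrable_weight_inner hρ' hf' hg
  rw [← integral_prod _ i1, ← integral_prod _ i2, ← integral_add i1 i2,
    ← integral_sub (integrable_weight_inner hρ hf₁ hg₁) (integrable_weight_inner hρ hf₀ hg₀)]
  have i3 : Integrable (fun z : ℝ × X => ρ z.2 * inner ℝ (f z.1 z.2) (g' z.1 z.2) +
    ρ z.2 * inner ℝ (f' z.1 z.2) (g z.1 z.2)) ((volume.restrict (Ioo s₀ s₁)).prod μ) := i1.add i2
  rw [integral_prod_symm _ i3]
  refine integral_congr_ae ?_
  filter_upwards [h] with x hx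
  simp only [← mul_add]
  rw [integral_const_mul, hx]
  ring

/-! ### Elementwise description of averages and integrals -/

namespace Mesh

variable {d : ℕ} (M : Mesh d)

instance (n : ℕ) : IsFiniteMeasure ((surf d).restrict (M.skel n)) :=
  ⟨by simpa using M.surf_skel_lt_top n⟩

instance : IsFiniteMeasure ((volume : Measure (E d)).restrict M.Ω) :=
  ⟨by simpa using M.bounded_Ω.measure_lt_top⟩

theorem restrict_skel_closure {n : ℕ} (hn : n < M.N) {K : Polytope d} (hK : K ∈ M.elems n) :
    ((surf d).restrict (M.skel n)).restrict (closure K.set) = (surf d).restrict (frontier K.set) := by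
  rw [Measure.restrict_restrict isClosed_closure.measurableSet, inter_comm, M.skel_inter_closure hn hK]

theorem restrict_Ω_set {n : ℕ} (hn : n < M.N) {K : Polytope d} (hK : K ∈ M.elems n) :
    ((volume : Measure (E d)).restrict M.Ω).restrict K.set = volume.restrict K.set := by
  rw [Measure.restrict_restrict K.measurableSet_set,
    inter_eq_self_of_subset_left (M.set_subset_of_mem hn hK)]

theorem ae_touching {n : ℕ} (hn : n < M.N) {p : Polytope d → E d → Prop}
    (h : ∀ K ∈ M.elems n, ∀ᵐ x ∂((surf d).restrict (frontier K.set)), p K x) :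
    ∀ᵐ x ∂((surf d).restrict (M.skel n)), ∀ K ∈ M.touching n x, p K x := by
  have h' : ∀ᵐ x ∂((surf d).restrict (M.skel n)), ∀ K ∈ M.elems n, x ∈ closure K.set → p K x := by
    rw [Finset.eventually_all]
    intro K hK
    rw [← ae_restrict_iff' isClosed_closure.measurableSet, M.restrict_skel_closure hn hK]
    exact h K hK
  filter_upwards [h'] with x hx K hK
  exact hx K (M.mem_touching.1 hK).1 (M.mem_touching.1 hK).2

theorem ae_bulk {n : ℕ} (hn : n < M.N) {p : Polytope d → E d → Prop}
    (h : ∀ K ∈ M.elems n, ∀ᵐ x ∂((volume : Measure (E d)).restrict K.set), p K x) :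
    ∀ᵐ x ∂(volume.restrict M.Ω), ∃ K ∈ M.elems n, x ∈ K.set ∧ p K x := by
  have h' : ∀ᵐ x ∂(volume : Measure (E d)), ∀ K ∈ M.elems n, x ∈ K.set → p K x := by
    rw [Finset.eventually_all]
    intro K hK
    rw [← ae_restrict_iff' K.measurableSet_set]
    exact h K hK
  rw [ae_restrict_iff' M.open_Ω.measurableSet]
  filter_upwards [h', M.ae_mem_elem hn] with x hx hx2 hΩ
  obtain ⟨K, hK, hxK⟩ := hx2 hΩ
  exact ⟨K, hK, hxK, hx K hK hxK⟩

theorem jump_apply (n : ℕ) (f : Polytope d → E d → ℝ) (x : E d) (i : Fin d) :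
    M.jump n f x i = ∑ K ∈ M.touching n x, K.normal x i * f K x := by
  have := map_sum (EuclideanSpace.proj i : E d →L[ℝ] ℝ) (fun K => f K x • K.normal x) (M.touching n x)
  refine this.trans (Finset.sum_congr rfl fun K _ => ?_)
  simp [mul_comm]

theorem avg_apply (n : ℕ) (f : Polytope d → E d → E d) (x : E d) (i : Fin d) :
    M.avg n f x i = ((M.touching n x).card : ℝ)⁻¹ * ∑ K ∈ M.touching n x, f K x i := by
  have := map_sum (EuclideanSpace.proj i : E d →L[ℝ] ℝ) (fun K => f K x) (M.touching n x)
  exact congrArg (((M.touching n x).card : ℝ)⁻¹ * ·) this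

end Mesh

theorem IsRegularJet.memLp_grad_boundary {d : ℕ} {M : Mesh d} {n : ℕ} {K : Polytope d} {J : Jet d}
    (h : IsRegularJet M n K J) : MemLp (fun z : ℝ × E d => J.grad z.1 z.2) 2
    ((volume.restrict (M.slab n)).prod ((surf d).restrict (frontier K.set))) :=
  MemLp.of_eval_piLp fun i => (h.lateral_grad i).2.1

theorem IsRegularJet.memLp_gradDt_boundary {d : ℕ} {M : Mesh d} {n : ℕ} {K : Polytope d} {J : Jet d}
    (h : IsRegularJet M n K J) : MemLp (fun z : ℝ × E d => J.gradDt z.1 z.2) 2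
    ((volume.restrict (M.slab n)).prod ((surf d).restrict (frontier K.set))) :=
  MemLp.of_eval_piLp fun i => (h.lateral_gradDt i).2.1

/-! ### Square integrability of the terms of the method -/

namespace Method

variable {d : ℕ} (S : Method d) {n : ℕ}

/-- All jets of `u` in the slab `n` are regular. -/
def RegularOn (n : ℕ) (u : Broken d) : Prop := ∀ K ∈ S.M.elems n, IsRegularJet S.M n K (u n K)

theorem regularOn_broken (n : ℕ) (v : PwPoly d) : S.RegularOn n v.broken :=
  fun K _ => Poly.isRegularJet S.M n K (v n K)

variable {S} {u : Broken d}

theorem memLp_lateral {F : Type*} [NormedAddCommGroup F] (hn : n < S.M.N) {f : Polytope d → ℝ × E d → F}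
    (hf : ∀ K ∈ S.M.elems n, MemLp (f K) 2
      ((volume.restrict (S.M.slab n)).prod ((surf d).restrict (frontier K.set)))) :
    ∀ K ∈ S.M.elems n, MemLp (f K) 2
      (((volume.restrict (S.M.slab n)).prod ((surf d).restrict (S.M.skel n))).restrict
        (Prod.snd ⁻¹' closure K.set)) := by
  intro K hK
  rw [prod_restrict_snd, S.M.restrict_skel_closure hn hK]
  exact hf K hK

theorem memLp_interior {F : Type*} [NormedAddCommGroup F] (hn : n < S.M.N) {f : Polytope d → ℝ × E d → F}
    (hf : ∀ K ∈ S.M.elems n, MemLp (f K) 2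
      ((volume.restrict (S.M.slab n)).prod (volume.restrict K.set))) :
    ∀ K ∈ S.M.elems n, MemLp (f K) 2
      (((volume.restrict (S.M.slab n)).prod (volume.restrict S.M.Ω)).restrict
        (Prod.snd ⁻¹' K.set)) := by
  intro K hK
  rw [prod_restrict_snd, S.M.restrict_Ω_set hn hK]
  exact hf K hK

theorem memLp_jmp (hn : n < S.M.N) (hu : S.RegularOn n u)
    : MemLp (fun z : ℝ × E d => S.jmp u n z.1 z.2) 2
    ((volume.restrict (S.M.slab n)).prod ((surf d).restrict (S.M.skel n))) :=
  S.M.memLp_jump (π := Prod.snd) measurable_snd n (memLp_lateral hn fun K hK => (hu K hK).lateral_val.2.1)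

theorem memLp_jmpDt (hn : n < S.M.N) (hu : S.RegularOn n u)
    : MemLp (fun z : ℝ × E d => S.jmpDt u n z.1 z.2) 2
    ((volume.restrict (S.M.slab n)).prod ((surf d).restrict (S.M.skel n))) :=
  S.M.memLp_jump (π := Prod.snd) measurable_snd n (memLp_lateral hn fun K hK => (hu K hK).lateral_dt.2.1)

theorem memLp_avgDt (hn : n < S.M.N) (hu : S.RegularOn n u)
    : MemLp (fun z : ℝ × E d => S.avgDt u n z.1 z.2) 2
    ((volume.restrict (S.M.slab n)).prod ((surf d).restrict (S.M.skel n))) :=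
  S.M.memLp_avg (π := Prod.snd) measurable_snd n (memLp_lateral hn fun K hK => (hu K hK).lateral_dt.2.1)

theorem memLp_jmpFlux (hn : n < S.M.N) (hu : S.RegularOn n u)
    : MemLp (fun z : ℝ × E d => S.jmpFlux u n z.1 z.2) 2
    ((volume.restrict (S.M.slab n)).prod ((surf d).restrict (S.M.skel n))) :=
  S.M.memLp_jumpV (π := Prod.snd) measurable_snd n
    (f := fun K z => coef S.a K • (u n K).grad z.1 z.2)
    (memLp_lateral hn fun K hK => (hu K hK).memLp_grad_boundary.const_smul (coef S.a K))

theorem memLp_avgFlux (hn : n < S.M.N) (hu : S.RegularOn n u)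
    : MemLp (fun z : ℝ × E d => S.avgFlux u n z.1 z.2) 2
    ((volume.restrict (S.M.slab n)).prod ((surf d).restrict (S.M.skel n))) :=
  S.M.memLp_avg (π := Prod.snd) measurable_snd n
    (f := fun K z => coef S.a K • (u n K).grad z.1 z.2)
    (memLp_lateral hn fun K hK => (hu K hK).memLp_grad_boundary.const_smul (coef S.a K))

theorem memLp_avgFluxDt (hn : n < S.M.N) (hu : S.RegularOn n u)
    : MemLp (fun z : ℝ × E d => S.avgFluxDt u n z.1 z.2) 2
    ((volume.restrict (S.M.slab n)).prod ((surf d).restrict (S.M.skel n))) :=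
  S.M.memLp_avg (π := Prod.snd) measurable_snd n
    (f := fun K z => coef S.a K • (u n K).gradDt z.1 z.2)
    (memLp_lateral hn fun K hK => (hu K hK).memLp_gradDt_boundary.const_smul (coef S.a K))

theorem memLp_bDt (hn : n < S.M.N) (hu : S.RegularOn n u)
    : MemLp (fun z : ℝ × E d => S.bDt u n z.1 z.2) 2
    ((volume.restrict (S.M.slab n)).prod (volume.restrict S.M.Ω)) :=
  S.M.memLp_bulk (π := Prod.snd) measurable_snd n (memLp_interior hn fun K hK => (hu K hK).lateral_dt.1)

theorem memLp_bDtt (hn : n < S.M.N) (hu : S.RegularOn n u)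
    : MemLp (fun z : ℝ × E d => S.bDtt u n z.1 z.2) 2
    ((volume.restrict (S.M.slab n)).prod (volume.restrict S.M.Ω)) :=
  S.M.memLp_bulk (π := Prod.snd) measurable_snd n (memLp_interior hn fun K hK => (hu K hK).memLp_dtt)

theorem memLp_bGrad (hn : n < S.M.N) (hu : S.RegularOn n u)
    : MemLp (fun z : ℝ × E d => S.bGrad u n z.1 z.2) 2
    ((volume.restrict (S.M.slab n)).prod (volume.restrict S.M.Ω)) :=
  S.M.memLp_bulk (π := Prod.snd) measurable_snd n
    (memLp_interior hn fun K hK => MemLp.of_eval_piLp fun i => ((hu K hK).lateral_grad i).1)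

theorem memLp_bGradDt (hn : n < S.M.N) (hu : S.RegularOn n u)
    : MemLp (fun z : ℝ × E d => S.bGradDt u n z.1 z.2) 2
    ((volume.restrict (S.M.slab n)).prod (volume.restrict S.M.Ω)) :=
  S.M.memLp_bulk (π := Prod.snd) measurable_snd n
    (memLp_interior hn fun K hK => (hu K hK).memLp_gradDt)

theorem memLp_jmp_start (hn : n < S.M.N) (hu : S.RegularOn n u)
    : MemLp (S.jmp u n (S.M.t n)) 2 ((surf d).restrict (S.M.skel n)) :=
  S.M.memLp_jump (π := fun x => x) measurable_id n fun K hK => by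
    rw [preimage_id', S.M.restrict_skel_closure hn hK]; exact (hu K hK).start_val.2.1

theorem memLp_avgFlux_start (hn : n < S.M.N) (hu : S.RegularOn n u)
    : MemLp (S.avgFlux u n (S.M.t n)) 2 ((surf d).restrict (S.M.skel n)) :=
  S.M.memLp_avg (π := fun x => x) measurable_id n
    (f := fun K x => coef S.a K • (u n K).grad (S.M.t n) x) fun K hK => by
    rw [preimage_id', S.M.restrict_skel_closure hn hK]
    exact (MemLp.of_eval_piLp fun i => ((hu K hK).start_grad i).2.1).const_smul (coef S.a K)

theorem memLp_bDt_at (hn : n < S.M.N) (hu : S.RegularOn n u)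
    {s : ℝ} (hs : s ∈ ({S.M.t n, S.M.t (n + 1)} : Set ℝ)) :
    MemLp (S.bDt u n s) 2 (volume.restrict S.M.Ω) :=
  S.M.memLp_bulk (π := fun x => x) measurable_id n fun K hK => by
    rw [preimage_id', S.M.restrict_Ω_set hn hK]; exact ((hu K hK).time_dt s hs).1

theorem memLp_bGrad_at (hn : n < S.M.N) (hu : S.RegularOn n u)
    {s : ℝ} (hs : s ∈ ({S.M.t n, S.M.t (n + 1)} : Set ℝ)) :
    MemLp (S.bGrad u n s) 2 (volume.restrict S.M.Ω) :=
  S.M.memLp_bulk (π := fun x => x) measurable_id n fun K hK => by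
    rw [preimage_id', S.M.restrict_Ω_set hn hK]; exact ((hu K hK).time_grad s hs).1

theorem memLp_jmp_end (hu : S.RegularOn n u) :
    MemLp (S.jmp u n (S.M.t (n + 1))) 2 ((surf d).restrict (S.M.nodeSkel n)) :=
  S.M.memLp_jump (π := fun x => x) measurable_id n fun K hK => by
    rw [preimage_id', Measure.restrict_restrict isClosed_closure.measurableSet]
    exact (hu K hK).end_val.2.1

theorem memLp_avgFlux_end (hu : S.RegularOn n u) :
    MemLp (S.avgFlux u n (S.M.t (n + 1))) 2 ((surf d).restrict (S.M.nodeSkel n)) :=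
  S.M.memLp_avg (π := fun x => x) measurable_id n
    (f := fun K x => coef S.a K • (u n K).grad (S.M.t (n + 1)) x) fun K hK => by
    rw [preimage_id', Measure.restrict_restrict isClosed_closure.measurableSet]
    exact (MemLp.of_eval_piLp fun i => ((hu K hK).end_grad i).2.1).const_smul (coef S.a K)

end Method


/-! ### Time dependence of the terms of the method -/

theorem Poly.isTimePoly {d : ℕ} (q : Poly d) (x : E d) :
    IsTimePoly (fun t => q.at t x) fun t => (Poly.dt q).at t x :=
  ⟨q.timePoly x, fun t => ⟨(q.eval_timePoly x t).symm, (q.eval_derivative_timePoly x t).symm⟩⟩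

theorem Poly.isTimePoly_gradAt {d : ℕ} (q : Poly d) (x : E d) (i : Fin d) :
    IsTimePoly (fun t => q.gradAt t x i) fun t => (Poly.dt q).gradAt t x i := by
  simp only [Poly.gradAt_apply, Poly.pderiv_dt]
  exact Poly.isTimePoly _ x

namespace Method

variable {d : ℕ} {S : Method d} {n : ℕ} {u : Broken d}

/-- The coefficient is constant on the elements of all meshes. -/
def ConstOnElems (S : Method d) : Prop :=
  ∀ n < S.M.N, ∀ K ∈ S.M.elems n, ∀ x ∈ K.set, ∀ y ∈ K.set, S.a x = S.a y

theorem ConstOnElems.eq_coef (ha : S.ConstOnElems) (hn : n < S.M.N) {K : Polytope d}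
    (hK : K ∈ S.M.elems n) {x : E d} (hx : x ∈ K.set) : S.a x = coef S.a K :=
  ha n hn K hK x hx _ K.nonempty.choose_spec

theorem ConstOnElems.memLp (ha : S.ConstOnElems) (hN : 0 < S.M.N) :
    MemLp S.a ⊤ (volume.restrict S.M.Ω) := by
  have h := S.M.memLp_bulk (μ := volume.restrict S.M.Ω) (π := fun x => x) measurable_id 0
    (f := fun K _ => coef S.a K) (p := ⊤) fun K _ => memLp_top_const _
  refine h.ae_eq ?_
  filter_upwards [S.M.ae_bulk hN (p := fun _ _ => True) fun _ _ => Eventually.of_forall fun _ => trivial]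
    with x ⟨K, hK, hxK, _⟩
  rw [S.M.bulk_eq hN hK _ hxK, ha.eq_coef hN hK hxK]

theorem hasFTC_bDt (hn : n < S.M.N) (hu : S.RegularOn n u) :
    ∀ᵐ x ∂(volume.restrict S.M.Ω), HasFTC (S.M.t n) (S.M.t (n + 1)) (fun t => S.bDt u n t x)
      fun t => S.bDtt u n t x := by
  filter_upwards [S.M.ae_bulk hn fun K hK => ((hu K hK).timeFTC_dt hn).hasFTC
    (hu K hK).lateral_dt.1 (hu K hK).memLp_dtt] with x ⟨K, hK, hxK, h⟩
  simpa only [bDt, bDtt, S.M.bulk_eq hn hK _ hxK] using h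

theorem hasFTC_bGrad (hn : n < S.M.N) (hu : S.RegularOn n u) :
    ∀ᵐ x ∂(volume.restrict S.M.Ω), ∀ i, HasFTC (S.M.t n) (S.M.t (n + 1))
      (fun t => S.bGrad u n t x i) fun t => S.bGradDt u n t x i := by
  rw [ae_all_iff]
  intro i
  filter_upwards [S.M.ae_bulk hn fun K hK => ((hu K hK).timeFTC_grad hn i).hasFTC
    ((hu K hK).lateral_grad i).1 ((hu K hK).lateral_gradDt i).1] with x ⟨K, hK, hxK, h⟩
  simpa only [bGrad, bGradDt, S.M.bulk_eq hn hK _ hxK] using h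

theorem hasFTC_jmp (hn : n < S.M.N) (hu : S.RegularOn n u) :
    ∀ᵐ x ∂((surf d).restrict (S.M.skel n)), ∀ i, HasFTC (S.M.t n) (S.M.t (n + 1))
      (fun t => S.jmp u n t x i) fun t => S.jmpDt u n t x i := by
  filter_upwards [S.M.ae_touching hn fun K hK => ((hu K hK).timeFTC_boundary_val hn hK).hasFTC
    (hu K hK).lateral_val.2.1 (hu K hK).lateral_dt.2.1] with x hx i
  simp only [jmp, jmpDt, S.M.jump_apply]
  exact HasFTC.sum _ fun K hK => (hx K hK).const_mul _

theorem hasFTC_avgFlux (hn : n < S.M.N) (hu : S.RegularOn n u) :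
    ∀ᵐ x ∂((surf d).restrict (S.M.skel n)), ∀ i, HasFTC (S.M.t n) (S.M.t (n + 1))
      (fun t => S.avgFlux u n t x i) fun t => S.avgFluxDt u n t x i := by
  rw [ae_all_iff]
  intro i
  filter_upwards [S.M.ae_touching hn fun K hK => ((hu K hK).timeFTC_boundary_grad hn hK i).hasFTC
    ((hu K hK).lateral_grad i).2.1 ((hu K hK).lateral_gradDt i).2.1] with x hx
  simp only [avgFlux, avgFluxDt, S.M.avg_apply, PiLp.smul_apply, smul_eq_mul]
  exact HasFTC.const_mul (HasFTC.sum _ fun K hK => (hx K hK).const_mul _) _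

theorem isTimePoly_jmp (v : PwPoly d) (x : E d) (i : Fin d) :
    IsTimePoly (fun t => S.jmp v.broken n t x i) fun t => S.jmpDt v.broken n t x i := by
  simp only [jmp, jmpDt, S.M.jump_apply]
  exact IsTimePoly.sum _ fun K _ => IsTimePoly.const_mul ((v n K).isTimePoly x) _

theorem isTimePoly_avgFlux (v : PwPoly d) (x : E d) (i : Fin d) :
    IsTimePoly (fun t => S.avgFlux v.broken n t x i) fun t => S.avgFluxDt v.broken n t x i := by
  simp only [avgFlux, avgFluxDt, S.M.avg_apply, PiLp.smul_apply, smul_eq_mul]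
  exact IsTimePoly.const_mul (IsTimePoly.sum _ fun K _ =>
    IsTimePoly.const_mul ((v n K).isTimePoly_gradAt x i) _) _

theorem isTimePoly_bDt (hn : n < S.M.N) (v : PwPoly d) : ∀ᵐ x ∂(volume.restrict S.M.Ω),
    IsTimePoly (fun t => S.bDt v.broken n t x) fun t => S.bDtt v.broken n t x := by
  filter_upwards [S.M.ae_bulk hn (p := fun _ _ => True) fun _ _ => Eventually.of_forall fun _ => trivial]
    with x ⟨K, hK, hxK, _⟩
  simp only [bDt, bDtt, S.M.bulk_eq hn hK _ hxK]
  exact (Poly.dt (v n K)).isTimePoly x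

theorem isTimePoly_bGrad (hn : n < S.M.N) (v : PwPoly d) : ∀ᵐ x ∂(volume.restrict S.M.Ω), ∀ i,
    IsTimePoly (fun t => S.bGrad v.broken n t x i) fun t => S.bGradDt v.broken n t x i := by
  filter_upwards [S.M.ae_bulk hn (p := fun _ _ => True) fun _ _ => Eventually.of_forall fun _ => trivial]
    with x ⟨K, hK, hxK, _⟩ i
  simp only [bGrad, bGradDt, S.M.bulk_eq hn hK _ hxK]
  exact (v n K).isTimePoly_gradAt x i

theorem memLp_jmp_stop (hu : S.RegularOn n u) :
    MemLp (S.jmp u n (S.M.t (n + 1))) 2 ((surf d).restrict (S.M.skel n)) :=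
  (memLp_jmp_end hu).mono_measure (Measure.restrict_mono (S.M.skel_subset_nodeSkel n) le_rfl)

theorem memLp_avgFlux_stop (hu : S.RegularOn n u) :
    MemLp (S.avgFlux u n (S.M.t (n + 1))) 2 ((surf d).restrict (S.M.skel n)) :=
  (memLp_avgFlux_end hu).mono_measure (Measure.restrict_mono (S.M.skel_subset_nodeSkel n) le_rfl)

/-! ### Integration by parts in time for the terms of the method -/

theorem pairing_dt (hn : n < S.M.N) (hu : S.RegularOn n u) (v : PwPoly d) :
    (∫ t in S.M.slab n, ∫ x in S.M.Ω, S.bDt u n t x * S.bDtt v.broken n t x) +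
        ∫ t in S.M.slab n, ∫ x in S.M.Ω, S.bDtt u n t x * S.bDt v.broken n t x =
      (∫ x in S.M.Ω, S.bDt u n (S.M.t (n + 1)) x * S.bDt v.broken n (S.M.t (n + 1)) x) -
        ∫ x in S.M.Ω, S.bDt u n (S.M.t n) x * S.bDt v.broken n (S.M.t n) x := by
  have hv := S.regularOn_broken n v
  have key := integral_pairing (ρ := fun _ => 1) (memLp_top_const _) (memLp_bDt hn hu)
    (memLp_bDtt hn hu) (memLp_bDt hn hv) (memLp_bDtt hn hv) (memLp_bDt_at hn hu (by simp))
    (memLp_bDt_at hn hu (by simp)) (memLp_bDt_at hn hv (by simp)) (memLp_bDt_at hn hv (by simp)) (by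
      filter_upwards [hasFTC_bDt hn hu, isTimePoly_bDt hn v] with x h1 h2
      exact h1.pairing_real h2)
  simpa only [one_mul, Real.inner_apply, Mesh.slab] using key

theorem pairing_grad (ha : S.ConstOnElems) (hn : n < S.M.N) (hu : S.RegularOn n u) (v : PwPoly d) :
    (∫ t in S.M.slab n, ∫ x in S.M.Ω, S.a x * inner ℝ (S.bGrad u n t x) (S.bGradDt v.broken n t x)) +
        ∫ t in S.M.slab n, ∫ x in S.M.Ω,
          S.a x * inner ℝ (S.bGradDt u n t x) (S.bGrad v.broken n t x) =
      (∫ x in S.M.Ω, S.a x *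
        inner ℝ (S.bGrad u n (S.M.t (n + 1)) x) (S.bGrad v.broken n (S.M.t (n + 1)) x)) -
        ∫ x in S.M.Ω, S.a x * inner ℝ (S.bGrad u n (S.M.t n) x) (S.bGrad v.broken n (S.M.t n) x) := by
  have hv := S.regularOn_broken n v
  exact integral_pairing (ha.memLp S.M.N_pos) (memLp_bGrad hn hu)
    (memLp_bGradDt hn hu) (memLp_bGrad hn hv) (memLp_bGradDt hn hv) (memLp_bGrad_at hn hu (by simp))
    (memLp_bGrad_at hn hu (by simp)) (memLp_bGrad_at hn hv (by simp))
    (memLp_bGrad_at hn hv (by simp)) (by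
      filter_upwards [hasFTC_bGrad hn hu, isTimePoly_bGrad hn v] with x h1 h2
      exact HasFTC.pairing_inner h1 h2)

theorem pairing_flux_jmp (hn : n < S.M.N) (hu : S.RegularOn n u) (v : PwPoly d) :
    (∫ t in S.M.slab n, ∫ x in S.M.skel n,
          inner ℝ (S.avgFlux u n t x) (S.jmpDt v.broken n t x) ∂(surf d)) +
        ∫ t in S.M.slab n, ∫ x in S.M.skel n,
          inner ℝ (S.avgFluxDt u n t x) (S.jmp v.broken n t x) ∂(surf d) =
      (∫ x in S.M.skel n, inner ℝ (S.avgFlux u n (S.M.t (n + 1)) x)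
          (S.jmp v.broken n (S.M.t (n + 1)) x) ∂(surf d)) -
        ∫ x in S.M.skel n, inner ℝ (S.avgFlux u n (S.M.t n) x)
          (S.jmp v.broken n (S.M.t n) x) ∂(surf d) := by
  have hv := S.regularOn_broken n v
  have key := integral_pairing (ρ := fun _ => 1) (memLp_top_const _) (memLp_avgFlux hn hu)
    (memLp_avgFluxDt hn hu) (memLp_jmp hn hv) (memLp_jmpDt hn hv) (memLp_avgFlux_start hn hu)
    (memLp_avgFlux_stop hu) (memLp_jmp_start hn hv) (memLp_jmp_stop hv) (by
      filter_upwards [hasFTC_avgFlux hn hu] with x h1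
      exact HasFTC.pairing_inner h1 (isTimePoly_jmp v x))
  simpa only [one_mul, Mesh.slab] using key

theorem pairing_jmp_flux (hn : n < S.M.N) (hu : S.RegularOn n u) (v : PwPoly d) :
    (∫ t in S.M.slab n, ∫ x in S.M.skel n,
          inner ℝ (S.jmp u n t x) (S.avgFluxDt v.broken n t x) ∂(surf d)) +
        ∫ t in S.M.slab n, ∫ x in S.M.skel n,
          inner ℝ (S.jmpDt u n t x) (S.avgFlux v.broken n t x) ∂(surf d) =
      (∫ x in S.M.skel n, inner ℝ (S.jmp u n (S.M.t (n + 1)) x)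
          (S.avgFlux v.broken n (S.M.t (n + 1)) x) ∂(surf d)) -
        ∫ x in S.M.skel n, inner ℝ (S.jmp u n (S.M.t n) x)
          (S.avgFlux v.broken n (S.M.t n) x) ∂(surf d) := by
  have hv := S.regularOn_broken n v
  have key := integral_pairing (ρ := fun _ => 1) (memLp_top_const _) (memLp_jmp hn hu)
    (memLp_jmpDt hn hu) (memLp_avgFlux hn hv) (memLp_avgFluxDt hn hv) (memLp_jmp_start hn hu)
    (memLp_jmp_stop hu) (memLp_avgFlux_start hn hv) (memLp_avgFlux_stop hv) (by
      filter_upwards [hasFTC_jmp hn hu] with x h1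
      exact HasFTC.pairing_inner h1 (isTimePoly_avgFlux v x))
  simpa only [one_mul, Mesh.slab] using key

theorem measurable_σ₀ (S : Method d) (n : ℕ) : Measurable (S.σ₀ n) :=
  measurable_const.div (S.M.measurable_h n)

theorem memLp_σ₀ (S : Method d) (n : ℕ) (μ : Measure (E d)) : MemLp (S.σ₀ n) ⊤ μ :=
  memLp_top_of_finite_range (S.measurable_σ₀ n)
    (finite_range_comp (S.M.finite_range_h n) fun h => S.Cσ * (S.p : ℝ) ^ 2 / h)

theorem pairing_jmp_jmp (hn : n < S.M.N) (hu : S.RegularOn n u) (v : PwPoly d) :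
    (∫ t in S.M.slab n, ∫ x in S.M.skel n,
          S.σ₀ n x * inner ℝ (S.jmp u n t x) (S.jmpDt v.broken n t x) ∂(surf d)) +
        ∫ t in S.M.slab n, ∫ x in S.M.skel n,
          S.σ₀ n x * inner ℝ (S.jmpDt u n t x) (S.jmp v.broken n t x) ∂(surf d) =
      (∫ x in S.M.skel n, S.σ₀ n x * inner ℝ (S.jmp u n (S.M.t (n + 1)) x)
          (S.jmp v.broken n (S.M.t (n + 1)) x) ∂(surf d)) -
        ∫ x in S.M.skel n, S.σ₀ n x * inner ℝ (S.jmp u n (S.M.t n) x)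
          (S.jmp v.broken n (S.M.t n) x) ∂(surf d) := by
  have hv := S.regularOn_broken n v
  exact integral_pairing (S.memLp_σ₀ n _) (memLp_jmp hn hu)
    (memLp_jmpDt hn hu) (memLp_jmp hn hv) (memLp_jmpDt hn hv) (memLp_jmp_start hn hu)
    (memLp_jmp_stop hu) (memLp_jmp_start hn hv) (memLp_jmp_stop hv) (by
      filter_upwards [hasFTC_jmp hn hu] with x h1
      exact HasFTC.pairing_inner h1 (isTimePoly_jmp v x))

end Method

/-! ### Integration by parts in a slab -/

namespace Mesh

variable {d : ℕ} (M : Mesh d)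

theorem intSkel_subset_skel (n : ℕ) : M.intSkel n ⊆ M.skel n := sdiff_subset

theorem measurableSet_intSkel (n : ℕ) : MeasurableSet (M.intSkel n) :=
  (M.measurableSet_skel n).diff isClosed_frontier.measurableSet

theorem integral_prod_Ω_eq_sum {n : ℕ} (hn : n < M.N) {F : ℝ × E d → ℝ}
    (hF : Integrable F ((volume.restrict (M.slab n)).prod (volume.restrict M.Ω))) :
    ∫ z, F z ∂((volume.restrict (M.slab n)).prod (volume.restrict M.Ω)) =
      ∑ K ∈ M.elems n, ∫ z, F z ∂((volume.restrict (M.slab n)).prod (volume.restrict K.set)) := by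
  have hm : ∀ K : Polytope d, MeasurableSet ((Prod.snd : ℝ × E d → E d) ⁻¹' K.set) := fun K =>
    measurable_snd K.measurableSet_set
  have e : F =ᵐ[(volume.restrict (M.slab n)).prod (volume.restrict M.Ω)]
      fun z => ∑ K ∈ M.elems n, (Prod.snd ⁻¹' K.set).indicator F z := by
    filter_upwards [Measure.quasiMeasurePreserving_snd.ae (M.ae_bulk hn (p := fun _ _ => True)
      fun _ _ => Eventually.of_forall fun _ => trivial)] with z ⟨K, hK, hzK, _⟩
    rw [Finset.sum_eq_single_of_mem K hK, indicator_of_mem (by exact hzK)]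
    intro L hL hne
    refine indicator_of_notMem (fun hzL => hne ?_) _
    exact M.eq_of_mem hn hL hK ⟨z.2, hzL, hzK⟩
  rw [integral_congr_ae e, integral_finsetSum _ fun K _ => hF.indicator (hm K)]
  refine Finset.sum_congr rfl fun K hK => ?_
  rw [integral_indicator (hm K), prod_restrict_snd, M.restrict_Ω_set hn hK]

theorem sum_integral_prod_frontier {n : ℕ} (hn : n < M.N) {g : Polytope d → ℝ × E d → ℝ}
    (hg : ∀ K ∈ M.elems n, Integrable (g K)
      ((volume.restrict (M.slab n)).prod ((surf d).restrict (frontier K.set)))) :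
    ∑ K ∈ M.elems n, ∫ z, g K z
        ∂((volume.restrict (M.slab n)).prod ((surf d).restrict (frontier K.set))) =
      ∫ z, ∑ K ∈ M.touching n z.2, g K z
        ∂((volume.restrict (M.slab n)).prod ((surf d).restrict (M.skel n))) := by
  have hm : ∀ K : Polytope d, MeasurableSet ((Prod.snd : ℝ × E d → E d) ⁻¹' closure K.set) := fun K =>
    measurable_snd isClosed_closure.measurableSet
  have hr : ∀ K ∈ M.elems n, ((volume.restrict (M.slab n)).prod ((surf d).restrict (M.skel n))).restrict
      (Prod.snd ⁻¹' closure K.set) =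
      (volume.restrict (M.slab n)).prod ((surf d).restrict (frontier K.set)) := fun K hK => by
    rw [prod_restrict_snd, M.restrict_skel_closure hn hK]
  have e : ∀ z : ℝ × E d, ∑ K ∈ M.touching n z.2, g K z =
      ∑ K ∈ M.elems n, (Prod.snd ⁻¹' closure K.set).indicator (g K) z := fun z => by
    rw [M.sum_touching]
    rfl
  simp only [e]
  rw [integral_finsetSum]
  · refine Finset.sum_congr rfl fun K hK => ?_
    rw [integral_indicator (hm K), hr K hK]
  · intro K hK
    rw [integrable_indicator_iff (hm K), IntegrableOn, hr K hK]
    exact hg K hK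

end Mesh

namespace Method

variable {d : ℕ} {S : Method d} {n : ℕ} {u : Broken d}

/-- The wave equation on the elements of the slab `n`. -/
theorem wave_eq {v : PwPoly d} (ha : S.ConstOnElems) (hv : IsTrefftz S.M S.a S.p v) (hn : n < S.M.N)
    {K : Polytope d} (hK : K ∈ S.M.elems n) {t : ℝ} (ht : t ∈ S.M.slab n) {x : E d} (hx : x ∈ K.set) :
    (Poly.dt (Poly.dt (v n K))).at t x = coef S.a K * (Poly.laplacian (v n K)).at t x := by
  rw [← ha.eq_coef hn hK hx]
  exact sub_eq_zero.1 ((hv n hn K hK).2 t ht x hx)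

/-- **Green's formula** on the slab `n`, between the time derivative of a regular function and a
Trefftz function. -/
theorem green_slab {v : PwPoly d} (ha : S.ConstOnElems) (hv : IsTrefftz S.M S.a S.p v)
    (hn : n < S.M.N) (hu : S.RegularOn n u) :
    (∫ t in S.M.slab n, ∫ x in S.M.Ω, S.bDt u n t x * S.bDtt v.broken n t x) +
        ∫ t in S.M.slab n, ∫ x in S.M.Ω,
          S.a x * inner ℝ (S.bGradDt u n t x) (S.bGrad v.broken n t x) =
      (∫ t in S.M.slab n, ∫ x in S.M.skel n,
          inner ℝ (S.jmpDt u n t x) (S.avgFlux v.broken n t x) ∂(surf d)) +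
        ∫ t in S.M.slab n, ∫ x in S.M.intSkel n,
          S.avgDt u n t x * S.jmpFlux v.broken n t x ∂(surf d) := by
  have hvr := S.regularOn_broken n v
  have i1 : Integrable (fun z : ℝ × E d => S.bDt u n z.1 z.2 * S.bDtt v.broken n z.1 z.2)
      ((volume.restrict (S.M.slab n)).prod (volume.restrict S.M.Ω)) :=
    (memLp_bDt hn hu).integrable_mul (memLp_bDtt hn hvr)
  have i2 := integrable_weight_inner (memLp_comp_snd_of_top (ν := volume.restrict (S.M.slab n))
    (ha.memLp S.M.N_pos)) (memLp_bGradDt hn hu) (memLp_bGrad hn hvr)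
  have i3 := MemLp.integrable_inner_of (memLp_jmpDt hn hu) (memLp_avgFlux hn hvr)
  have i4 : Integrable (fun z : ℝ × E d => S.avgDt u n z.1 z.2 * S.jmpFlux v.broken n z.1 z.2)
      ((volume.restrict (S.M.slab n)).prod ((surf d).restrict (S.M.skel n))) :=
    (memLp_avgDt hn hu).integrable_mul (memLp_jmpFlux hn hvr)
  have hmi : MeasurableSet ((Prod.snd : ℝ × E d → E d) ⁻¹' S.M.intSkel n) :=
    measurable_snd (S.M.measurableSet_intSkel n)
  have e4 : ∫ t in S.M.slab n, ∫ x in S.M.intSkel n,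
      S.avgDt u n t x * S.jmpFlux v.broken n t x ∂(surf d) =
      ∫ z, (Prod.snd ⁻¹' S.M.intSkel n).indicator
        (fun z => S.avgDt u n z.1 z.2 * S.jmpFlux v.broken n z.1 z.2) z
        ∂((volume.restrict (S.M.slab n)).prod ((surf d).restrict (S.M.skel n))) := by
    rw [integral_prod _ (i4.indicator hmi)]
    congr 1 with t
    have := setIntegral_indicator (s := S.M.skel n) (μ := surf d) (S.M.measurableSet_intSkel n)
      (f := fun x => S.avgDt u n t x * S.jmpFlux v.broken n t x)
    rw [inter_eq_self_of_subset_right (S.M.intSkel_subset_skel n)] at this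
    rw [← this]
    rfl
  have e1 := integral_prod _ i1
  have e2 := integral_prod _ i2
  have e3 := integral_prod _ i3
  rw [e4, ← e1, ← e2, ← e3]
  have i12 : Integrable (fun z : ℝ × E d => S.bDt u n z.1 z.2 * S.bDtt v.broken n z.1 z.2 +
      S.a z.2 * inner ℝ (S.bGradDt u n z.1 z.2) (S.bGrad v.broken n z.1 z.2))
      ((volume.restrict (S.M.slab n)).prod (volume.restrict S.M.Ω)) := i1.add i2
  rw [← integral_add i1 i2, ← integral_add i3 (i4.indicator hmi)]
  rw [S.M.integral_prod_Ω_eq_sum hn i12]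
  have hK : ∀ K ∈ S.M.elems n, ∫ z, (S.bDt u n z.1 z.2 * S.bDtt v.broken n z.1 z.2 +
      S.a z.2 * inner ℝ (S.bGradDt u n z.1 z.2) (S.bGrad v.broken n z.1 z.2))
      ∂((volume.restrict (S.M.slab n)).prod (volume.restrict K.set)) =
      ∫ z, (u n K).dt z.1 z.2 * inner ℝ (coef S.a K • (v n K).gradAt z.1 z.2) (K.normal z.2)
        ∂((volume.restrict (S.M.slab n)).prod ((surf d).restrict (frontier K.set))) := by
    intro K hK
    have := congrArg (coef S.a K * ·) ((hu K hK).green (v n K))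
    simp only [← integral_const_mul] at this
    convert this.symm using 1
    · refine integral_congr_ae ?_
      have hmem : ∀ᵐ z ∂((volume.restrict (S.M.slab n)).prod (volume.restrict K.set)),
          z ∈ S.M.slab n ×ˢ K.set := by
        rw [Measure.prod_restrict]
        exact ae_restrict_mem (measurableSet_Ioo.prod K.measurableSet_set)
      filter_upwards [hmem] with z hz
      simp only [bDt, bDtt, bGrad, bGradDt, S.M.bulk_eq hn hK _ hz.2, ha.eq_coef hn hK hz.2]
      change _ * (Poly.dt (Poly.dt (v n K))).at z.1 z.2 + _ * inner ℝ _ ((v n K).gradAt z.1 z.2) = _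
      rw [wave_eq ha hv hn hK hz.1 hz.2]
      ring
    · congr 1 with z
      rw [real_inner_smul_left]
      ring
  rw [Finset.sum_congr rfl hK, S.M.sum_integral_prod_frontier hn]
  · refine integral_congr_ae ?_
    have hae := S.M.ae_sum_touching_flux hn
    rw [← ae_restrict_iff' (S.M.measurableSet_skel n)] at hae
    filter_upwards [Measure.quasiMeasurePreserving_snd.ae hae] with z hz
    exact hz (fun K => (u n K).dt z.1) fun K x => coef S.a K • (v n K).gradAt z.1 x
  · intro K hK
    have hgn : MemLp (fun z : ℝ × E d => inner ℝ (coef S.a K • (v n K).gradAt z.1 z.2) (K.normal z.2)) 2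
        ((volume.restrict (S.M.slab n)).prod ((surf d).restrict (frontier K.set))) := by
      have hg := ((S.regularOn_broken n v K hK).memLp_grad_boundary).const_smul (coef S.a K)
      refine MemLp.of_le_mul (c := K.faces.card) hg (hg.1.inner
        (K.measurable_normal.comp measurable_snd).aestronglyMeasurable)
        (Eventually.of_forall fun z => ?_)
      refine (norm_inner_le_norm _ _).trans ?_
      rw [mul_comm]
      exact mul_le_mul_of_nonneg_right (K.norm_normal_le _) (norm_nonneg _)
    exact (hu K hK).lateral_dt.2.1.integrable_mul hgn

/-- The terms of the form on the slab `n` at the time `s`. -/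
noncomputable def endForm (S : Method d) (n : ℕ) (s : ℝ) (u v : Broken d) : ℝ :=
  (∫ x in S.M.Ω, S.bDt u n s x * S.bDt v n s x)
  + (∫ x in S.M.Ω, S.a x * inner ℝ (S.bGrad u n s x) (S.bGrad v n s x))
  - (∫ x in S.M.skel n, inner ℝ (S.avgFlux u n s x) (S.jmp v n s x) ∂(surf d))
  - (∫ x in S.M.skel n, inner ℝ (S.jmp u n s x) (S.avgFlux v n s x) ∂(surf d))
  + (∫ x in S.M.skel n, S.σ₀ n x * inner ℝ (S.jmp u n s x) (S.jmp v n s x) ∂(surf d))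

/-- The penalty terms of the form on the skeleton of the slab `n`. -/
noncomputable def penaltyForm (S : Method d) (n : ℕ) (u v : Broken d) : ℝ :=
  (∫ t in S.M.slab n, ∫ x in S.M.skel n,
      S.σ₁ n x * inner ℝ (S.jmp u n t x) (S.jmp v n t x) ∂(surf d))
  + (∫ t in S.M.slab n, ∫ x in S.M.intSkel n,
      S.σ₂ n x * (S.jmpFlux u n t x * S.jmpFlux v n t x) ∂(surf d))

/-- Integration by parts in time and space moves all derivatives of the slab form to `u`; since
`v` solves the wave equation, only terms on the skeleton and at the end of the slab remain. -/
theorem slabForm_eq {v : PwPoly d} (ha : S.ConstOnElems) (hv : IsTrefftz S.M S.a S.p v)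
    (hn : n < S.M.N) (hu : S.RegularOn n u) :
    S.slabForm n u v.broken = S.endForm n (S.M.t (n + 1)) u v.broken
      - (∫ t in S.M.slab n, ∫ x in S.M.intSkel n,
          S.avgDt u n t x * S.jmpFlux v.broken n t x ∂(surf d))
      + (∫ t in S.M.slab n, ∫ x in S.M.skel n,
          inner ℝ (S.avgFluxDt u n t x) (S.jmp v.broken n t x) ∂(surf d))
      - (∫ t in S.M.slab n, ∫ x in S.M.skel n,
          S.σ₀ n x * inner ℝ (S.jmpDt u n t x) (S.jmp v.broken n t x) ∂(surf d))
      + S.penaltyForm n u v.broken := by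
  have h1 := pairing_dt hn hu v
  have h2 := pairing_grad ha hn hu v
  have h3 := pairing_flux_jmp hn hu v
  have h4 := pairing_jmp_flux hn hu v
  have h5 := pairing_jmp_jmp hn hu v
  have h6 := green_slab ha hv hn hu
  unfold slabForm endForm penaltyForm
  linarith

/-- The slab form of a piecewise polynomial with itself is an energy at the two ends of the slab plus
the penalty terms. -/
theorem slabForm_self (ha : S.ConstOnElems) (hn : n < S.M.N) (v : PwPoly d) :
    S.slabForm n v.broken v.broken = 1 / 2 * S.endForm n (S.M.t n) v.broken v.broken +
      1 / 2 * S.endForm n (S.M.t (n + 1)) v.broken v.broken + S.penaltyForm n v.broken v.broken := by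
  have hu := S.regularOn_broken n v
  have h1 := pairing_dt hn hu v
  have h2 := pairing_grad ha hn hu v
  have h3 := pairing_flux_jmp hn hu v
  have h4 := pairing_jmp_flux hn hu v
  have h5 := pairing_jmp_jmp hn hu v
  have c1 : ∫ t in S.M.slab n, ∫ x in S.M.Ω, S.bDt v.broken n t x * S.bDtt v.broken n t x =
      ∫ t in S.M.slab n, ∫ x in S.M.Ω, S.bDtt v.broken n t x * S.bDt v.broken n t x := by
    congr 1 with t
    congr 1 with x
    exact mul_comm _ _
  have c2 : ∀ A B : ℝ → E d → E d,
      ∫ t in S.M.slab n, ∫ x in S.M.Ω, S.a x * inner ℝ (A t x) (B t x) =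
      ∫ t in S.M.slab n, ∫ x in S.M.Ω, S.a x * inner ℝ (B t x) (A t x) := fun A B => by
    congr 1 with t
    congr 1 with x
    rw [real_inner_comm]
  have c3 : ∀ A B : ℝ → E d → E d,
      ∫ t in S.M.slab n, ∫ x in S.M.skel n, inner ℝ (A t x) (B t x) ∂(surf d) =
      ∫ t in S.M.slab n, ∫ x in S.M.skel n, inner ℝ (B t x) (A t x) ∂(surf d) := fun A B => by
    congr 1 with t
    congr 1 with x
    rw [real_inner_comm]
  have c4 : ∀ A B : ℝ → E d → E d,
      ∫ t in S.M.slab n, ∫ x in S.M.skel n, S.σ₀ n x * inner ℝ (A t x) (B t x) ∂(surf d) =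
      ∫ t in S.M.slab n, ∫ x in S.M.skel n, S.σ₀ n x * inner ℝ (B t x) (A t x) ∂(surf d) :=
    fun A B => by
    congr 1 with t
    congr 1 with x
    rw [real_inner_comm]
  have c5 : ∀ s, ∫ x in S.M.skel n, inner ℝ (S.avgFlux v.broken n s x) (S.jmp v.broken n s x) ∂(surf d) =
      ∫ x in S.M.skel n, inner ℝ (S.jmp v.broken n s x) (S.avgFlux v.broken n s x) ∂(surf d) := fun s => by
    congr 1 with x
    rw [real_inner_comm]
  have d2 := c2 (S.bGrad v.broken n) (S.bGradDt v.broken n)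
  have d3 := c3 (S.avgFlux v.broken n) (S.jmpDt v.broken n)
  have d4 := c3 (S.jmp v.broken n) (S.avgFluxDt v.broken n)
  have d5 := c4 (S.jmp v.broken n) (S.jmpDt v.broken n)
  have d6 := c5 (S.M.t n)
  have d7 := c5 (S.M.t (n + 1))
  unfold slabForm endForm penaltyForm
  linarith

end Method


/-! ### Weighted inner products and Young's inequality -/

section WInner

variable {X V : Type*} [MeasurableSpace X] [NormedAddCommGroup V] [InnerProductSpace ℝ V]

/-- The inner product of `L²(μ; V)` with a weight `ρ`. -/
noncomputable def wInner (μ : Measure X) (ρ : X → ℝ) (f g : X → V) : ℝ :=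
  ∫ x, ρ x * inner ℝ (f x) (g x) ∂μ

variable {μ : Measure X} {ρ ρ₁ ρ₂ : X → ℝ} {f g h : X → V}

theorem wInner_comm (μ : Measure X) (ρ : X → ℝ) (f g : X → V) :
    wInner μ ρ f g = wInner μ ρ g f := by
  unfold wInner
  simp only [real_inner_comm]

theorem wInner_sub_right (hρ : MemLp ρ ⊤ μ) (hf : MemLp f 2 μ) (hg : MemLp g 2 μ) (hh : MemLp h 2 μ) :
    wInner μ ρ f (fun x => g x - h x) = wInner μ ρ f g - wInner μ ρ f h := by
  unfold wInner
  rw [← integral_sub (integrable_weight_inner hρ hf hg) (integrable_weight_inner hρ hf hh)]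
  simp only [inner_sub_right, mul_sub]

theorem wInner_self_nonneg (h : ∀ᵐ x ∂μ, 0 ≤ ρ x) : 0 ≤ wInner μ ρ f f := by
  refine integral_nonneg_of_ae ?_
  filter_upwards [h] with x hx
  exact mul_nonneg hx real_inner_self_nonneg

/-- Young's inequality for a weighted inner product, with the weight split between the factors. -/
theorem abs_wInner_le {l : ℝ} (hl : 0 < l) (h₁ : MemLp ρ₁ ⊤ μ) (h₂ : MemLp ρ₂ ⊤ μ)
    (hf : MemLp f 2 μ) (hg : MemLp g 2 μ)
    (h : ∀ᵐ x ∂μ, 0 ≤ ρ₁ x ∧ 0 ≤ ρ₂ x ∧ (f x = 0 ∨ g x = 0 ∨ ρ x ^ 2 ≤ ρ₁ x * ρ₂ x)) :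
    |wInner μ ρ f g| ≤ 1 / 2 * (l * wInner μ ρ₁ f f + l⁻¹ * wInner μ ρ₂ g g) := by
  have i1 := (integrable_weight_inner h₁ hf hf).const_mul l
  have i2 := (integrable_weight_inner h₂ hg hg).const_mul l⁻¹
  unfold wInner
  rw [← integral_const_mul, ← integral_const_mul, ← integral_add i1 i2, ← integral_const_mul]
  refine (norm_integral_le_integral_norm fun x => ρ x * inner ℝ (f x) (g x)).trans ?_
  refine integral_mono_of_nonneg (Eventually.of_forall fun _ => norm_nonneg _)
    (Integrable.const_mul (i1.add i2 : Integrable (fun x => l * (ρ₁ x * inner ℝ (f x) (f x)) +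
      l⁻¹ * (ρ₂ x * inner ℝ (g x) (g x))) μ) _) ?_
  filter_upwards [h] with x hx
  obtain ⟨p1, p2, hx⟩ := hx
  have hli : 0 < l⁻¹ := inv_pos.2 hl
  have key : |ρ x * inner ℝ (f x) (g x)| ≤ |ρ x| * (‖f x‖ * ‖g x‖) := by
    rw [abs_mul]
    exact mul_le_mul_of_nonneg_left (abs_real_inner_le_norm _ _) (abs_nonneg _)
  rw [Real.norm_eq_abs, real_inner_self_eq_norm_sq, real_inner_self_eq_norm_sq]
  refine key.trans ?_
  have hnn : 0 ≤ l * (ρ₁ x * ‖f x‖ ^ 2) ∧ 0 ≤ l⁻¹ * (ρ₂ x * ‖g x‖ ^ 2) :=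
    ⟨by positivity, by positivity⟩
  rcases hx with hx | hx | hx
  · rw [hx, norm_zero, zero_mul, mul_zero] at *
    linarith [hnn.1, hnn.2]
  · rw [hx, norm_zero, mul_zero, mul_zero] at *
    linarith [hnn.1, hnn.2]
  · -- `2 |ρ| |f| |g| ≤ 2 √(l ρ₁ |f|² · l⁻¹ ρ₂ |g|²)`
    have h3 : (2 * (|ρ x| * (‖f x‖ * ‖g x‖))) ^ 2 ≤
        (l * (ρ₁ x * ‖f x‖ ^ 2) + l⁻¹ * (ρ₂ x * ‖g x‖ ^ 2)) ^ 2 := by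
      have e1 : (l * (ρ₁ x * ‖f x‖ ^ 2)) * (l⁻¹ * (ρ₂ x * ‖g x‖ ^ 2)) =
          (ρ₁ x * ρ₂ x) * (‖f x‖ * ‖g x‖) ^ 2 := by
        field_simp
      have e2 : (|ρ x| * (‖f x‖ * ‖g x‖)) ^ 2 ≤
          (l * (ρ₁ x * ‖f x‖ ^ 2)) * (l⁻¹ * (ρ₂ x * ‖g x‖ ^ 2)) := by
        rw [e1, mul_pow, sq_abs]
        exact mul_le_mul_of_nonneg_right hx (sq_nonneg _)
      nlinarith [sq_nonneg (l * (ρ₁ x * ‖f x‖ ^ 2) - l⁻¹ * (ρ₂ x * ‖g x‖ ^ 2))]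
    have := abs_le_of_sq_le_sq' h3 (by linarith [hnn.1, hnn.2])
    linarith [this.2]

end WInner

namespace Mesh

variable {d : ℕ} (M : Mesh d)

/-- Inside an element the normal, a sum over the faces through the point, vanishes. -/
theorem jump_eq_zero {n : ℕ} {x : E d} (hx : x ∉ M.skel n) (f : Polytope d → E d → ℝ) :
    M.jump n f x = 0 := by
  refine Finset.sum_eq_zero fun K hK => ?_
  rw [M.mem_touching] at hK
  have hxK : x ∈ K.set := by
    by_contra h
    exact hx (M.frontier_subset_skel hK.1 ((K.mem_frontier x).2 ⟨hK.2, h⟩))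
  have : K.normal x = 0 := by
    classical
    unfold Polytope.normal
    rw [Finset.filter_eq_empty_iff.2, Finset.sum_empty]
    exact fun f hf => (hxK f hf).ne
  rw [this, smul_zero]

theorem setIntegral_jump_right {m : ℕ} {Y : Set (E d)} (hY : MeasurableSet Y)
    (hmY : M.skel m ⊆ Y) (ρ : E d → ℝ) (F : E d → E d) (f : Polytope d → E d → ℝ) :
    ∫ x in M.skel m, ρ x * inner ℝ (F x) (M.jump m f x) ∂(surf d) =
      wInner ((surf d).restrict Y) ρ F (M.jump m f) := by
  unfold wInner
  refine (setIntegral_eq_of_subset_of_forall_sdiff_eq_zero hY hmY fun x hx => ?_).symm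
  rw [M.jump_eq_zero hx.2, inner_zero_right, mul_zero]

theorem setIntegral_jump_left {m : ℕ} {Y : Set (E d)} (hY : MeasurableSet Y)
    (hmY : M.skel m ⊆ Y) (ρ : E d → ℝ) (F : E d → E d) (f : Polytope d → E d → ℝ) :
    ∫ x in M.skel m, ρ x * inner ℝ (M.jump m f x) (F x) ∂(surf d) =
      wInner ((surf d).restrict Y) ρ (M.jump m f) F := by
  unfold wInner
  refine (setIntegral_eq_of_subset_of_forall_sdiff_eq_zero hY hmY fun x hx => ?_).symm
  rw [M.jump_eq_zero hx.2, inner_zero_left, mul_zero]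

end Mesh


/-! ### The form at a time node -/

/-- The values of a broken function at a fixed time that enter the terms of the method at a time
node. -/
structure Section (d : ℕ) where
  /-- the time derivative in `Ω` -/
  dt : E d → ℝ
  /-- the broken gradient in `Ω` -/
  grad : E d → E d
  /-- the average `{a ∇u}` on the skeleton -/
  flux : E d → E d
  /-- the jump `[u]` on the skeleton -/
  jump : E d → E d

namespace Section

variable {d : ℕ} {μ ν : Measure (E d)} {a ρ : E d → ℝ} {u v v' : Section d}

instance : Sub (Section d) where
  sub u v := ⟨fun x => u.dt x - v.dt x, fun x => u.grad x - v.grad x, fun x => u.flux x - v.flux x,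
    fun x => u.jump x - v.jump x⟩

/-- Square integrability of all components. -/
structure SqIntegrable (μ ν : Measure (E d)) (u : Section d) : Prop where
  dt : MemLp u.dt 2 μ
  grad : MemLp u.grad 2 μ
  flux : MemLp u.flux 2 ν
  jump : MemLp u.jump 2 ν

theorem SqIntegrable.sub (hu : u.SqIntegrable μ ν) (hv : v.SqIntegrable μ ν) :
    (u - v).SqIntegrable μ ν :=
  ⟨hu.dt.sub hv.dt, hu.grad.sub hv.grad, hu.flux.sub hv.flux, hu.jump.sub hv.jump⟩

/-- The interior penalty form of two sections, together with the kinetic term: `μ` is the volume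
measure, `ν` the surface measure and `ρ` the penalty weight. -/
noncomputable def energyForm (μ ν : Measure (E d)) (a ρ : E d → ℝ) (u v : Section d) : ℝ :=
  wInner μ (fun _ => 1) u.dt v.dt + wInner μ a u.grad v.grad - wInner ν (fun _ => 1) u.flux v.jump
    - wInner ν (fun _ => 1) u.jump v.flux + wInner ν ρ u.jump v.jump

theorem energyForm_sub_right (ha : MemLp a ⊤ μ) (hρ : MemLp ρ ⊤ ν) [IsFiniteMeasure μ]
    [IsFiniteMeasure ν] (hu : u.SqIntegrable μ ν) (hv : v.SqIntegrable μ ν)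
    (hv' : v'.SqIntegrable μ ν) :
    energyForm μ ν a ρ u (v - v') = energyForm μ ν a ρ u v - energyForm μ ν a ρ u v' := by
  have e1 := wInner_sub_right (memLp_top_const (1 : ℝ)) hu.dt hv.dt hv'.dt
  have e2 := wInner_sub_right ha hu.grad hv.grad hv'.grad
  have e3 := wInner_sub_right (memLp_top_const (1 : ℝ)) hu.flux hv.jump hv'.jump
  have e4 := wInner_sub_right (memLp_top_const (1 : ℝ)) hu.jump hv.flux hv'.flux
  have e5 := wInner_sub_right hρ hu.jump hv.jump hv'.jump
  simp only [energyForm]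
  linear_combination e1 + e2 - e3 - e4 + e5

theorem energyForm_comm : energyForm μ ν a ρ u v = energyForm μ ν a ρ v u := by
  simp only [energyForm, wInner_comm _ _ u.dt, wInner_comm _ _ u.grad, wInner_comm _ _ u.flux,
    wInner_comm _ _ u.jump]
  ring

theorem energyForm_sub_self (ha : MemLp a ⊤ μ) (hρ : MemLp ρ ⊤ ν) [IsFiniteMeasure μ]
    [IsFiniteMeasure ν] (hv : v.SqIntegrable μ ν) (hv' : v'.SqIntegrable μ ν) :
    energyForm μ ν a ρ (v - v') (v - v') =
      energyForm μ ν a ρ v v - 2 * energyForm μ ν a ρ v v' + energyForm μ ν a ρ v' v' := by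
  rw [energyForm_sub_right ha hρ (hv.sub hv') hv hv', energyForm_comm,
    energyForm_sub_right ha hρ hv hv hv', energyForm_comm (u := v - v'),
    energyForm_sub_right ha hρ hv' hv hv', energyForm_comm (u := v')]
  ring

/-- If the flux is controlled by the gradient as in the discrete trace inequality, then the form
controls all components. The constants come from Young's inequality with parameter `3/2`. -/
theorem le_energyForm_self (hρ : MemLp ρ ⊤ ν) (hρi : MemLp (fun x => (ρ x)⁻¹) ⊤ ν)
    (hρ0 : ∀ᵐ x ∂ν, 0 < ρ x) (hv : v.SqIntegrable μ ν)
    (hF : wInner ν (fun x => (ρ x)⁻¹) v.flux v.flux ≤ 1 / 2 * wInner μ a v.grad v.grad) :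
    wInner μ (fun _ => 1) v.dt v.dt + 1 / 4 * wInner μ a v.grad v.grad +
      1 / 3 * wInner ν ρ v.jump v.jump ≤ energyForm μ ν a ρ v v := by
  have h := abs_wInner_le (ρ := fun _ => (1 : ℝ)) (l := 3 / 2) (by norm_num) hρi hρ hv.flux hv.jump (by
    filter_upwards [hρ0] with x hx
    refine ⟨(inv_pos.2 hx).le, hx.le, Or.inr (Or.inr ?_)⟩
    rw [inv_mul_cancel₀ hx.ne', one_pow])
  rw [energyForm, wInner_comm ν _ v.jump v.flux]
  have := (abs_le.1 h).2
  norm_num at this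
  linarith

/-- Continuity of the form: Young's inequality with parameter `l` in each of its terms. -/
theorem abs_energyForm_le {l : ℝ} (hl : 0 < l) [IsFiniteMeasure μ] (ha : MemLp a ⊤ μ)
    (ha0 : ∀ᵐ x ∂μ, 0 ≤ a x) (hρ : MemLp ρ ⊤ ν) (hρi : MemLp (fun x => (ρ x)⁻¹) ⊤ ν)
    (hρ0 : ∀ᵐ x ∂ν, 0 < ρ x) (hu : u.SqIntegrable μ ν) (hv : v.SqIntegrable μ ν)
    (hF : wInner ν (fun x => (ρ x)⁻¹) v.flux v.flux ≤ 1 / 2 * wInner μ a v.grad v.grad) :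
    |energyForm μ ν a ρ u v| ≤
      1 / 2 * l * (wInner μ (fun _ => 1) u.dt u.dt + wInner μ a u.grad u.grad +
        wInner ν (fun x => (ρ x)⁻¹) u.flux u.flux + 2 * wInner ν ρ u.jump u.jump) +
      6 * l⁻¹ * (1 / 2 * energyForm μ ν a ρ v v) := by
  have hE := le_energyForm_self hρ hρi hρ0 hv hF
  have hli : 0 < l⁻¹ := inv_pos.2 hl
  have d0 : 0 ≤ wInner μ (fun _ => 1) v.dt v.dt :=
    wInner_self_nonneg (Eventually.of_forall fun _ => zero_le_one)
  have h1 := abs_wInner_le (ρ := fun _ => (1 : ℝ)) hl (memLp_top_const (1 : ℝ))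
    (memLp_top_const (1 : ℝ)) hu.dt hv.dt (Eventually.of_forall fun x => by simp)
  have h2 := abs_wInner_le (ρ := a) hl ha ha hu.grad hv.grad (by
    filter_upwards [ha0] with x hx
    exact ⟨hx, hx, Or.inr (Or.inr (sq _).le)⟩)
  have h3 := abs_wInner_le (ρ := fun _ => (1 : ℝ)) hl hρi hρ hu.flux hv.jump (by
    filter_upwards [hρ0] with x hx
    refine ⟨(inv_pos.2 hx).le, hx.le, Or.inr (Or.inr ?_)⟩
    rw [inv_mul_cancel₀ hx.ne', one_pow])
  have h4 := abs_wInner_le (ρ := fun _ => (1 : ℝ)) hl hρ hρi hu.jump hv.flux (by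
    filter_upwards [hρ0] with x hx
    refine ⟨hx.le, (inv_pos.2 hx).le, Or.inr (Or.inr ?_)⟩
    rw [mul_inv_cancel₀ hx.ne', one_pow])
  have h5 := abs_wInner_le (ρ := ρ) hl hρ hρ hu.jump hv.jump (by
    filter_upwards [hρ0] with x hx
    exact ⟨hx.le, hx.le, Or.inr (Or.inr (sq _).le)⟩)
  have hE' := mul_le_mul_of_nonneg_left hE hli.le
  have hF' := mul_le_mul_of_nonneg_left hF hli.le
  have d0' := mul_nonneg hli.le d0
  unfold energyForm at hE' ⊢
  rw [abs_le] at *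
  constructor <;> linarith [h1.1, h1.2, h2.1, h2.2, h3.1, h3.2, h4.1, h4.2, h5.1, h5.2]

end Section

/-! ### Sections of piecewise polynomials and coercivity -/

theorem memLp_of_continuous_of_isBounded {d : ℕ} {μ : Measure (E d)} {A : Set (E d)}
    (hA : MeasurableSet A) (hAb : Bornology.IsBounded A) (hμ : μ A < ⊤) {F : Type*}
    [NormedAddCommGroup F] {p : ENNReal} {g : E d → F} (hg : Continuous g) :
    MemLp g p (μ.restrict A) := by
  obtain ⟨C, hC⟩ := (hAb.isCompact_closure.image hg).isBounded.exists_norm_le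
  have : IsFiniteMeasure (μ.restrict A) := ⟨by simpa using hμ⟩
  refine MemLp.of_bound hg.aestronglyMeasurable C ?_
  rw [ae_restrict_iff' hA]
  exact Eventually.of_forall fun x hx => hC _ (mem_image_of_mem g (subset_closure hx))

namespace Mesh

variable {d : ℕ} (M : Mesh d) {m n : ℕ}

theorem isBounded_skel (n : ℕ) : Bornology.IsBounded (M.skel n) :=
  (Bornology.isBounded_biUnion (M.elems n).finite_toSet).2 fun K _ => K.isBounded_frontier

theorem measurable_pairH (m n : ℕ) : Measurable (M.pairH m n) :=
  ((M.measurable_h m).indicator (M.measurableSet_skel m)).max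
    ((M.measurable_h n).indicator (M.measurableSet_skel n))

theorem finite_range_pairH (m n : ℕ) : (range (M.pairH m n)).Finite := by
  refine ((finite_range_indicator (s := M.skel m) (M.finite_range_h m)).image2 max
    (finite_range_indicator (s := M.skel n) (M.finite_range_h n))).subset ?_
  rintro _ ⟨x, rfl⟩
  exact ⟨_, mem_range_self x, _, mem_range_self x, rfl⟩

theorem pairH_comm (m n : ℕ) (x : E d) : M.pairH m n x = M.pairH n m x := max_comm _ _

theorem h_le_pairH {x : E d} (hx : x ∈ M.skel m) : M.h m x ≤ M.pairH m n x := by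
  unfold pairH
  rw [indicator_of_mem hx]
  exact le_max_left _ _

theorem pairH_pos (hd : 1 ≤ d) {x : E d} (hx : x ∈ M.skel m ∪ M.skel n) : 0 < M.pairH m n x := by
  rcases hx with hx | hx
  · exact (M.h_pos hd hx).trans_le (M.h_le_pairH hx)
  · rw [M.pairH_comm]
    exact (M.h_pos hd hx).trans_le (M.h_le_pairH hx)

theorem surf_union_skel_lt_top (m n : ℕ) : surf d (M.skel m ∪ M.skel n) < ⊤ :=
  measure_union_lt_top (M.surf_skel_lt_top m) (M.surf_skel_lt_top n)

instance (m n : ℕ) : IsFiniteMeasure ((surf d).restrict (M.skel m ∪ M.skel n)) :=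
  ⟨by simpa using M.surf_union_skel_lt_top m n⟩

end Mesh

namespace Method

variable {d : ℕ} (S : Method d) {m n : ℕ} {u : Broken d}

/-- The values of `u` at the time `s`, taken from the slab `n`. -/
noncomputable def sect (u : Broken d) (n : ℕ) (s : ℝ) : Section d :=
  ⟨S.bDt u n s, S.bGrad u n s, S.avgFlux u n s, S.jmp u n s⟩

/-- The penalty weight on the union of the skeletons of the slabs `m` and `n`. -/
noncomputable def pairσ (m n : ℕ) (x : E d) : ℝ := S.Cσ * (S.p : ℝ) ^ 2 / S.M.pairH m n x

theorem memLp_pairσ (m n : ℕ) (μ : Measure (E d)) : MemLp (S.pairσ m n) ⊤ μ :=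
  memLp_top_of_finite_range (measurable_const.div (S.M.measurable_pairH m n))
    (finite_range_comp (S.M.finite_range_pairH m n) fun h => S.Cσ * (S.p : ℝ) ^ 2 / h)

theorem memLp_pairσ_inv (m n : ℕ) (μ : Measure (E d)) : MemLp (fun x => (S.pairσ m n x)⁻¹) ⊤ μ :=
  memLp_top_of_finite_range (measurable_const.div (S.M.measurable_pairH m n)).inv
    (finite_range_comp (S.M.finite_range_pairH m n) fun h => (S.Cσ * (S.p : ℝ) ^ 2 / h)⁻¹)

theorem pairσ_pos (hd : 1 ≤ d) (hp : 1 ≤ S.p) (hσ : 0 < S.Cσ) {x : E d}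
    (hx : x ∈ S.M.skel m ∪ S.M.skel n) : 0 < S.pairσ m n x := by
  have := S.M.pairH_pos hd hx
  have : (0 : ℝ) < S.p := by exact_mod_cast hp
  unfold pairσ
  positivity

variable {S}

theorem sqIntegrable_sect_stop (hn : n < S.M.N) (hu : S.RegularOn n u) :
    (S.sect u n (S.M.t (n + 1))).SqIntegrable (volume.restrict S.M.Ω)
      ((surf d).restrict (S.M.nodeSkel n)) :=
  ⟨memLp_bDt_at hn hu (by simp), memLp_bGrad_at hn hu (by simp), memLp_avgFlux_end hu,
    memLp_jmp_end hu⟩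

theorem continuous_gradAt_slice (q : Poly d) (s : ℝ) : Continuous (q.gradAt s) :=
  (PiLp.continuous_toLp 2 _).comp (continuous_pi fun i =>
    (Poly.contDiff_slice (MvPolynomial.pderiv i.succ q) s).continuous)

theorem memLp_sect_dt (v : PwPoly d) (n : ℕ) (s : ℝ) :
    MemLp (S.bDt v.broken n s) 2 (volume.restrict S.M.Ω) := by
  refine S.M.memLp_bulk (π := fun x => x) (f := fun K => (Poly.dt (v n K)).at s) measurable_id n
    fun K _ => MemLp.mono_measure Measure.restrict_le_self ?_
  exact memLp_of_continuous_of_isBounded S.M.open_Ω.measurableSet S.M.bounded_Ω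
      S.M.bounded_Ω.measure_lt_top (Poly.contDiff_slice _ s).continuous

theorem memLp_sect_grad (v : PwPoly d) (n : ℕ) (s : ℝ) :
    MemLp (S.bGrad v.broken n s) 2 (volume.restrict S.M.Ω) := by
  refine S.M.memLp_bulk (π := fun x => x) (f := fun K => (v n K).gradAt s) measurable_id n
    fun K _ => MemLp.mono_measure Measure.restrict_le_self ?_
  exact memLp_of_continuous_of_isBounded S.M.open_Ω.measurableSet S.M.bounded_Ω
      S.M.bounded_Ω.measure_lt_top (continuous_gradAt_slice _ s)

theorem memLp_sect_flux (v : PwPoly d) (n : ℕ) (s : ℝ) {Y : Set (E d)}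
    (hY : MeasurableSet Y) (hYb : Bornology.IsBounded Y) (hYf : surf d Y < ⊤) :
    MemLp (S.avgFlux v.broken n s) 2 ((surf d).restrict Y) := by
  refine S.M.memLp_avg (π := fun x => x) measurable_id n
    (f := fun K x => coef S.a K • (v n K).gradAt s x)
    fun K _ => MemLp.mono_measure Measure.restrict_le_self ?_
  exact memLp_of_continuous_of_isBounded hY hYb hYf
    ((continuous_gradAt_slice (v n K) s).const_smul (coef S.a K))

theorem memLp_sect_jump (v : PwPoly d) (n : ℕ) (s : ℝ) {Y : Set (E d)}
    (hY : MeasurableSet Y) (hYb : Bornology.IsBounded Y) (hYf : surf d Y < ⊤) :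
    MemLp (S.jmp v.broken n s) 2 ((surf d).restrict Y) := by
  refine S.M.memLp_jump (π := fun x => x) (f := fun K => (v n K).at s) measurable_id n
    fun K _ => MemLp.mono_measure Measure.restrict_le_self ?_
  exact memLp_of_continuous_of_isBounded hY hYb hYf (Poly.contDiff_slice _ s).continuous

/-- The surface is not restricted to the skeleton of the slab `n`: at a node the sections of two
slabs are compared on the union of both skeletons. -/
theorem sqIntegrable_sect_broken (v : PwPoly d) (n : ℕ) (s : ℝ) {Y : Set (E d)}
    (hY : MeasurableSet Y) (hYb : Bornology.IsBounded Y) (hYf : surf d Y < ⊤) :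
    (S.sect v.broken n s).SqIntegrable (volume.restrict S.M.Ω) ((surf d).restrict Y) :=
  ⟨memLp_sect_dt v n s, memLp_sect_grad v n s, memLp_sect_flux v n s hY hYb hYf,
    memLp_sect_jump v n s hY hYb hYf⟩

theorem ConstOnElems.coef_eq (ha : S.ConstOnElems) (hm : m < S.M.N) (hn : n < S.M.N)
    {K L : Polytope d} (hK : K ∈ S.M.elems m) (hL : L ∈ S.M.elems n)
    (h : (K.set ∩ L.set).Nonempty) : coef S.a L = coef S.a K := by
  obtain ⟨x, hxK, hxL⟩ := h
  rw [← ha.eq_coef hn hL hxL, ha.eq_coef hm hK hxK]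

/-- The energy of a difference of sections from two meshes, as a sum over the overlaps of their
elements. -/
theorem wInner_grad_sub_eq_sum (ha : S.ConstOnElems) (hm : m < S.M.N) (hn : n < S.M.N)
    (v v' : PwPoly d) (s : ℝ) :
    wInner (volume.restrict S.M.Ω) S.a (S.sect v.broken m s - S.sect v'.broken n s).grad
        (S.sect v.broken m s - S.sect v'.broken n s).grad =
      ∑ K ∈ S.M.elems m, ∑ L ∈ S.M.elems n, coef S.a K *
        ∫ x in K.set ∩ L.set, ‖(v m K).gradAt s x - (v' n L).gradAt s x‖ ^ 2 := by
  have hsq := (sqIntegrable_sect_broken (S := S) v m s (S.M.measurableSet_skel m)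
    (S.M.isBounded_skel m) (S.M.surf_skel_lt_top m)).grad.sub
    (sqIntegrable_sect_broken (S := S) v' n s (S.M.measurableSet_skel m)
    (S.M.isBounded_skel m) (S.M.surf_skel_lt_top m)).grad
  have hint := integrable_weight_inner (ha.memLp S.M.N_pos) hsq hsq
  unfold wInner
  refine (S.M.setIntegral_Ω_eq_sum hm hint).trans (Finset.sum_congr rfl fun K hK => ?_)
  have hKΩ := S.M.set_subset_of_mem hm hK
  rw [S.M.setIntegral_eq_sum hn hKΩ K.measurableSet_set (IntegrableOn.mono_set hint hKΩ)]
  refine Finset.sum_congr rfl fun L hL => ?_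
  rw [← integral_const_mul]
  refine setIntegral_congr_fun (K.measurableSet_set.inter L.measurableSet_set) fun x hx => ?_
  simp only [Pi.sub_apply, real_inner_self_eq_norm_sq, sect, bGrad, S.M.bulk_eq hm hK _ hx.1,
    S.M.bulk_eq hn hL _ hx.2, ha.eq_coef hm hK hx.1]
  rfl

variable (S)

/-- The discrete trace inequality that makes the interior penalty form coercive, for the sections of
two piecewise polynomials in equal or consecutive slabs: the difference of the averaged fluxes on
the union of both skeletons is controlled by the difference of the gradients in `Ω`. -/
def FluxBound : Prop :=
  ∀ m n, S.M.Adjacent m n → ∀ v v' : PwPoly d, (∀ K ∈ S.M.elems m, (v m K).totalDegree ≤ S.p) →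
    (∀ K ∈ S.M.elems n, (v' n K).totalDegree ≤ S.p) → ∀ s,
    wInner ((surf d).restrict (S.M.skel m ∪ S.M.skel n)) (fun x => (S.pairσ m n x)⁻¹)
        (S.sect v.broken m s - S.sect v'.broken n s).flux
        (S.sect v.broken m s - S.sect v'.broken n s).flux ≤
      1 / 2 * wInner (volume.restrict S.M.Ω) S.a (S.sect v.broken m s - S.sect v'.broken n s).grad
        (S.sect v.broken m s - S.sect v'.broken n s).grad

variable {S}

/-- The lower bound on the penalty constant gives the discrete trace inequality; the factor `1 / 2`
comes from the factor `2` in that bound. -/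
theorem fluxBound (hd : 1 ≤ d) (hp : 1 ≤ S.p) {ca cT κ Cinv : ℝ} (hca : 0 < ca)
    (hbd : ∀ x ∈ S.M.Ω, ca ≤ S.a x ∧ S.a x ≤ S.Ca) (ha : S.ConstOnElems)
    (hT : S.M.ShapeRegular cT) (hκ : S.M.LocallyQuasiUniform κ)
    (hinv : S.M.IsInverseConstant S.p Cinv) (hκ0 : 0 < κ) (hcT0 : 0 < cT) (hC0 : 0 < Cinv)
    (hCa : ca ≤ S.Ca) (hσ : 2 * d * κ * cT * S.Ca ^ 2 * Cinv / ca ≤ S.Cσ) : S.FluxBound := by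
  intro m n hmn v v' hv hv' s
  rw [wInner_grad_sub_eq_sum ha hmn.left hmn.right]
  set q : PwPoly d → ℕ → Polytope d → Fin d → MvPolynomial (Fin d) ℝ := fun v n K i =>
    Poly.slice (MvPolynomial.pderiv i.succ (v n K)) s with hq
  have hpf : ∀ (v : PwPoly d) (n : ℕ) (K : Polytope d), polyField (q v n) K = (v n K).gradAt s := by
    intro v n K
    ext x i
    exact Poly.eval_slice _ _ _
  have hcK : ∀ K ∈ S.M.elems m, ca ≤ coef S.a K ∧ coef S.a K ≤ S.Ca := fun K hK =>
    hbd _ (S.M.set_subset_of_mem hmn.left hK K.nonempty.choose_spec)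
  have key := S.M.integral_pairH_mul_sq_le hd hT hκ hinv hmn hκ0.le hcT0.le hC0.le
    (c := coef S.a) (Ca := S.Ca) (fun K hK => hca.le.trans (hcK K hK).1) (fun K hK => (hcK K hK).2)
    (fun K hK L hL h => ha.coef_eq hmn.left hmn.right hK hL h) (q := q v m) (q' := q v' n)
    (fun K hK i => (Poly.totalDegree_slice_le _ _).trans
      ((Poly.totalDegree_pderiv_le _ _).trans (hv K hK)))
    (fun K hK i => (Poly.totalDegree_slice_le _ _).trans
      ((Poly.totalDegree_pderiv_le _ _).trans (hv' K hK)))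
  simp only [hpf] at key
  set A := ∑ K ∈ S.M.elems m, ∑ L ∈ S.M.elems n, coef S.a K *
        ∫ x in K.set ∩ L.set, ‖(v m K).gradAt s x - (v' n L).gradAt s x‖ ^ 2 with hA
  have hA0 : 0 ≤ A := Finset.sum_nonneg fun K hK => Finset.sum_nonneg fun L _ =>
    mul_nonneg (hca.le.trans (hcK K hK).1) (integral_nonneg fun _ => sq_nonneg _)
  have hp0 : (0 : ℝ) < S.p := by exact_mod_cast hp
  have hd0 : (0 : ℝ) < d := by exact_mod_cast hd
  have hCa0 : 0 < S.Ca := hca.trans_le hCa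
  have hσ0 : 0 < S.Cσ := lt_of_lt_of_le (by positivity) hσ
  have e : wInner ((surf d).restrict (S.M.skel m ∪ S.M.skel n)) (fun x => (S.pairσ m n x)⁻¹)
        (S.sect v.broken m s - S.sect v'.broken n s).flux
        (S.sect v.broken m s - S.sect v'.broken n s).flux =
      (S.Cσ * (S.p : ℝ) ^ 2)⁻¹ * ∫ x in S.M.skel m ∪ S.M.skel n, S.M.pairH m n x *
        ‖S.M.avg m (fun K x => coef S.a K • (v m K).gradAt s x) x -
        S.M.avg n (fun K x => coef S.a K • (v' n K).gradAt s x) x‖ ^ 2 ∂(surf d) := by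
    unfold wInner
    rw [← integral_const_mul]
    refine integral_congr_ae (Eventually.of_forall fun x => ?_)
    simp only [real_inner_self_eq_norm_sq, pairσ, div_eq_mul_inv, mul_inv, inv_inv]
    change _ * ‖S.avgFlux v.broken m s x - S.avgFlux v'.broken n s x‖ ^ 2 = _
    simp only [avgFlux, PwPoly.broken, Poly.jet]
    ring
  rw [e, inv_mul_le_iff₀ (by positivity)]
  refine key.trans ?_
  -- the hypothesis on the penalty parameter, with one of the factors `Ca / ca ≥ 1` dropped
  have h1 : 2 * d * κ * cT * S.Ca * Cinv ≤ S.Cσ := by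
    refine le_trans ?_ hσ
    rw [le_div_iff₀ hca]
    have : 0 ≤ 2 * d * κ * cT * S.Ca * Cinv := by positivity
    nlinarith
  have h2 : κ * cT * Cinv * (S.p : ℝ) ^ 2 * d * S.Ca ≤ S.Cσ * (S.p : ℝ) ^ 2 * (1 / 2) := by
    have := mul_le_mul_of_nonneg_right h1 (sq_nonneg (S.p : ℝ))
    linarith
  calc _ ≤ S.Cσ * (S.p : ℝ) ^ 2 * (1 / 2) * A := mul_le_mul_of_nonneg_right h2 hA0
    _ = _ := by ring

end Method

/-! ### Energy estimates at a time node -/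

namespace Method

variable {d : ℕ} (S : Method d) {m n : ℕ} {u w : Broken d}

theorem pairσ_comm (m n : ℕ) : S.pairσ m n = S.pairσ n m := by
  ext x
  rw [pairσ, pairσ, S.M.pairH_comm]

/-- The excess of the penalty weight `σ₀` of the slab `m` over the weight on the union of the
skeletons of the slabs `m` and `n`. -/
noncomputable def excess (m n : ℕ) (x : E d) : ℝ :=
  (S.M.skel m).indicator (fun x => S.σ₀ m x - S.pairσ m n x) x

theorem memLp_excess (m n : ℕ) (μ : Measure (E d)) : MemLp (S.excess m n) ⊤ μ :=
  ((S.memLp_σ₀ m μ).sub (S.memLp_pairσ m n μ)).indicator (S.M.measurableSet_skel m)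

theorem excess_nonneg (hd : 1 ≤ d) (hσ : 0 < S.Cσ) (x : E d) : 0 ≤ S.excess m n x := by
  refine indicator_nonneg (fun x hx => sub_nonneg.2 ?_) x
  exact div_le_div_of_nonneg_left (by positivity) (S.M.h_pos hd hx) (S.M.h_le_pairH hx)

variable {S}

/-- On the skeleton of the slab `m` the penalty weight `σ₀` is the common weight of both slabs plus
the excess; off that skeleton the jumps vanish. -/
theorem wInner_pairσ_add_excess {Y : Set (E d)} (hY : MeasurableSet Y)
    (hmY : S.M.skel m ⊆ Y) {s : ℝ} (hu : MemLp (S.jmp u m s) 2 ((surf d).restrict Y))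
    (hw : MemLp (S.jmp w m s) 2 ((surf d).restrict Y)) :
    wInner ((surf d).restrict Y) (S.pairσ m n) (S.jmp u m s) (S.jmp w m s) +
        wInner ((surf d).restrict Y) (S.excess m n) (S.jmp u m s) (S.jmp w m s) =
      ∫ x in S.M.skel m, S.σ₀ m x * inner ℝ (S.jmp u m s x) (S.jmp w m s x) ∂(surf d) := by
  refine Eq.trans ?_ (S.M.setIntegral_jump_right hY hmY _ _ _).symm
  unfold wInner
  rw [← integral_add (integrable_weight_inner (S.memLp_pairσ m n _) hu hw)
    (integrable_weight_inner (S.memLp_excess m n _) hu hw)]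
  refine integral_congr_ae (Eventually.of_forall fun x => ?_)
  by_cases hx : x ∈ S.M.skel m
  · simp only [excess, indicator_of_mem hx, jmp]
    ring
  · simp only [jmp, S.M.jump_eq_zero hx, inner_zero_right, mul_zero, add_zero]

/-- The terms at the end of a slab are the energy form of the section, with the penalty weight of
the pair of slabs, plus the penalty with the excess weight. -/
theorem endForm_eq {Y : Set (E d)} (hY : MeasurableSet Y) (hmY : S.M.skel m ⊆ Y)
    {s : ℝ} (hu : MemLp (S.jmp u m s) 2 ((surf d).restrict Y))
    (hw : MemLp (S.jmp w m s) 2 ((surf d).restrict Y)) (n : ℕ) :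
    S.endForm m s u w = Section.energyForm (volume.restrict S.M.Ω) ((surf d).restrict Y) S.a
        (S.pairσ m n) (S.sect u m s) (S.sect w m s) +
      wInner ((surf d).restrict Y) (S.excess m n) (S.jmp u m s) (S.jmp w m s) := by
  have e := wInner_pairσ_add_excess (n := n) hY hmY hu hw
  have e1 := S.M.setIntegral_jump_right hY hmY (fun _ => 1) (S.avgFlux u m s)
    (fun K => (w m K).val s)
  have e2 := S.M.setIntegral_jump_left hY hmY (fun _ => 1) (S.avgFlux w m s)
    (fun K => (u m K).val s)
  simp only [one_mul] at e1 e2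
  rw [endForm, ← e]
  simp only [jmp] at e1 e2 ⊢
  rw [e1, e2]
  simp only [Section.energyForm, sect, wInner, Real.inner_apply, one_mul, jmp]
  ring

/-- The energy of two piecewise polynomials meeting at a time node. -/
theorem endForm_add_endForm_sub (ha : S.ConstOnElems) (m n : ℕ) (v v' : PwPoly d)
    (s : ℝ) :
    1 / 2 * S.endForm m s v.broken v.broken + 1 / 2 * S.endForm n s v'.broken v'.broken -
        Section.energyForm (volume.restrict S.M.Ω) ((surf d).restrict (S.M.skel m ∪ S.M.skel n)) S.a
          (S.pairσ m n) (S.sect v.broken m s) (S.sect v'.broken n s) =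
      1 / 2 * Section.energyForm (volume.restrict S.M.Ω)
          ((surf d).restrict (S.M.skel m ∪ S.M.skel n)) S.a (S.pairσ m n)
          (S.sect v.broken m s - S.sect v'.broken n s) (S.sect v.broken m s - S.sect v'.broken n s) +
        1 / 2 * wInner ((surf d).restrict (S.M.skel m ∪ S.M.skel n)) (S.excess m n)
          (S.jmp v.broken m s) (S.jmp v.broken m s) +
        1 / 2 * wInner ((surf d).restrict (S.M.skel m ∪ S.M.skel n)) (S.excess n m)
          (S.jmp v'.broken n s) (S.jmp v'.broken n s) := by
  have hY := (S.M.measurableSet_skel m).union (S.M.measurableSet_skel n)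
  have hYb := (S.M.isBounded_skel m).union (S.M.isBounded_skel n)
  have hv := sqIntegrable_sect_broken (S := S) v m s hY hYb (S.M.surf_union_skel_lt_top m n)
  have hv' := sqIntegrable_sect_broken (S := S) v' n s hY hYb (S.M.surf_union_skel_lt_top m n)
  rw [endForm_eq hY subset_union_left hv.jump hv.jump n,
    endForm_eq hY subset_union_right hv'.jump hv'.jump m, S.pairσ_comm n m,
    Section.energyForm_sub_self (ha.memLp S.M.N_pos) (S.memLp_pairσ m n _) hv hv']
  ring

/-- The estimate at a time node: the section of `u` is tested with the difference of the sections of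
`v` and `v'`, and the result is bounded by the energy of `v` and `v'` at the node. -/
theorem abs_endForm_sub_le (hd : 1 ≤ d) (hp : 1 ≤ S.p) (hσ : 0 < S.Cσ) (ha : S.ConstOnElems)
    (ha0 : ∀ x ∈ S.M.Ω, 0 ≤ S.a x) (hF : S.FluxBound) (hmn : S.M.Adjacent m n) {v v' : PwPoly d}
    (hv : ∀ K ∈ S.M.elems m, (v m K).totalDegree ≤ S.p)
    (hv' : ∀ K ∈ S.M.elems n, (v' n K).totalDegree ≤ S.p) {s : ℝ}
    (hu : (S.sect u m s).SqIntegrable (volume.restrict S.M.Ω)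
      ((surf d).restrict (S.M.skel m ∪ S.M.skel n))) {l : ℝ} (hl : 0 < l) :
    |S.endForm m s u v.broken - Section.energyForm (volume.restrict S.M.Ω)
        ((surf d).restrict (S.M.skel m ∪ S.M.skel n)) S.a (S.pairσ m n) (S.sect u m s)
        (S.sect v'.broken n s)| ≤
      l * ((∫ x in S.M.Ω, (S.bDt u m s x) ^ 2) + (∫ x in S.M.Ω, S.a x * ‖S.bGrad u m s x‖ ^ 2) +
        (∫ x in S.M.skel m, S.σ₀ m x * ‖S.jmp u m s x‖ ^ 2 ∂(surf d)) +
        ∫ x in S.M.skel m ∪ S.M.skel n, (S.pairσ m n x)⁻¹ * ‖S.avgFlux u m s x‖ ^ 2 ∂(surf d)) +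
      6 * l⁻¹ * (1 / 2 * S.endForm m s v.broken v.broken + 1 / 2 * S.endForm n s v'.broken v'.broken -
        Section.energyForm (volume.restrict S.M.Ω) ((surf d).restrict (S.M.skel m ∪ S.M.skel n)) S.a
          (S.pairσ m n) (S.sect v.broken m s) (S.sect v'.broken n s)) := by
  have hY := (S.M.measurableSet_skel m).union (S.M.measurableSet_skel n)
  have hYb := (S.M.isBounded_skel m).union (S.M.isBounded_skel n)
  have hvs := sqIntegrable_sect_broken (S := S) v m s hY hYb (S.M.surf_union_skel_lt_top m n)
  have hvs' := sqIntegrable_sect_broken (S := S) v' n s hY hYb (S.M.surf_union_skel_lt_top m n)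
  have haL := ha.memLp S.M.N_pos
  have hρ0 : ∀ᵐ x ∂((surf d).restrict (S.M.skel m ∪ S.M.skel n)), 0 < S.pairσ m n x :=
    (ae_restrict_iff' hY).2 (Eventually.of_forall fun x hx => S.pairσ_pos hd hp hσ hx)
  have ha0' : ∀ᵐ x ∂(volume.restrict S.M.Ω), 0 ≤ S.a x :=
    (ae_restrict_iff' S.M.open_Ω.measurableSet).2 (Eventually.of_forall ha0)
  have hli : 0 < l⁻¹ := inv_pos.2 hl
  have hex : ∀ i j, ∀ᵐ x ∂((surf d).restrict (S.M.skel m ∪ S.M.skel n)), 0 ≤ S.excess i j x :=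
    fun i j => Eventually.of_forall (S.excess_nonneg hd hσ)
  have h1 := Section.abs_energyForm_le hl haL ha0' (S.memLp_pairσ m n _) (S.memLp_pairσ_inv m n _) hρ0 hu
    (hvs.sub hvs') (hF m n hmn v v' hv hv' s)
  rw [Section.energyForm_sub_right haL (S.memLp_pairσ m n _) hu hvs hvs'] at h1
  have h2 := abs_wInner_le (ρ := S.excess m n) hl (S.memLp_excess m n _) (S.memLp_excess m n _)
    hu.jump hvs.jump (by
      filter_upwards [hex m n] with x hx
      exact ⟨hx, hx, Or.inr (Or.inr (sq _).le)⟩)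
  have q1 := wInner_self_nonneg (f := S.jmp v.broken m s) (hex m n)
  have q2 := wInner_self_nonneg (f := S.jmp v'.broken n s) (hex n m)
  have q3 := wInner_self_nonneg (f := S.jmp u m s) (hex m n)
  have p1 : 0 ≤ wInner (volume.restrict S.M.Ω) (fun _ => 1) (S.bDt u m s) (S.bDt u m s) :=
    wInner_self_nonneg (Eventually.of_forall fun _ => zero_le_one)
  have p2 := wInner_self_nonneg (f := S.bGrad u m s) ha0'
  have p3 := wInner_self_nonneg (f := S.avgFlux u m s) (hρ0.mono fun x hx => (inv_pos.2 hx).le)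
  have e := wInner_pairσ_add_excess (n := n) hY subset_union_left hu.jump hu.jump
  rw [endForm_add_endForm_sub ha m n v v' s, endForm_eq hY subset_union_left hu.jump hvs.jump n]
  have r1 : ∫ x in S.M.Ω, (S.bDt u m s x) ^ 2 =
      wInner (volume.restrict S.M.Ω) (fun _ => 1) (S.bDt u m s) (S.bDt u m s) := by
    simp only [wInner, one_mul, real_inner_self_eq_norm_sq, Real.norm_eq_abs, sq_abs]
  simp only [real_inner_self_eq_norm_sq] at e
  have r2 : ∫ x in S.M.Ω, S.a x * ‖S.bGrad u m s x‖ ^ 2 =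
      wInner (volume.restrict S.M.Ω) S.a (S.bGrad u m s) (S.bGrad u m s) := by
    simp only [wInner, real_inner_self_eq_norm_sq]
  have r3 : ∫ x in S.M.skel m ∪ S.M.skel n, (S.pairσ m n x)⁻¹ * ‖S.avgFlux u m s x‖ ^ 2 ∂(surf d) =
      wInner ((surf d).restrict (S.M.skel m ∪ S.M.skel n)) (fun x => (S.pairσ m n x)⁻¹)
        (S.avgFlux u m s) (S.avgFlux u m s) := by
    simp only [wInner, real_inner_self_eq_norm_sq]
  rw [← e, r1, r2, r3]
  simp only [sect] at h1 h2 ⊢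
  have t1 := mul_nonneg hl.le p1
  have t2 := mul_nonneg hl.le p2
  have t3 := mul_nonneg hl.le p3
  have t4 := mul_nonneg hl.le q3
  have t5 := mul_nonneg hli.le q1
  have t6 := mul_nonneg hli.le q2
  rw [abs_le] at *
  constructor <;> linarith [h1.1, h1.2, h2.1, h2.2]

/-- The energy dissipated at a node is half the energy form of the jump `v - v'` plus two
nonnegative penalty terms with excess weights. -/
theorem node_energy_nonneg (hd : 1 ≤ d) (hp : 1 ≤ S.p) (hσ : 0 < S.Cσ) (ha : S.ConstOnElems)
    (ha0 : ∀ x ∈ S.M.Ω, 0 ≤ S.a x) (hF : S.FluxBound) (hmn : S.M.Adjacent m n) {v v' : PwPoly d}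
    (hv : ∀ K ∈ S.M.elems m, (v m K).totalDegree ≤ S.p)
    (hv' : ∀ K ∈ S.M.elems n, (v' n K).totalDegree ≤ S.p) (s : ℝ) :
    0 ≤ 1 / 2 * S.endForm m s v.broken v.broken + 1 / 2 * S.endForm n s v'.broken v'.broken -
        Section.energyForm (volume.restrict S.M.Ω) ((surf d).restrict (S.M.skel m ∪ S.M.skel n)) S.a
          (S.pairσ m n) (S.sect v.broken m s) (S.sect v'.broken n s) := by
  have hY := (S.M.measurableSet_skel m).union (S.M.measurableSet_skel n)
  have hYb := (S.M.isBounded_skel m).union (S.M.isBounded_skel n)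
  have hvs := sqIntegrable_sect_broken (S := S) v m s hY hYb (S.M.surf_union_skel_lt_top m n)
  have hvs' := sqIntegrable_sect_broken (S := S) v' n s hY hYb (S.M.surf_union_skel_lt_top m n)
  have hρ0 : ∀ᵐ x ∂((surf d).restrict (S.M.skel m ∪ S.M.skel n)), 0 < S.pairσ m n x :=
    (ae_restrict_iff' hY).2 (Eventually.of_forall fun x hx => S.pairσ_pos hd hp hσ hx)
  have ha0' : ∀ᵐ x ∂(volume.restrict S.M.Ω), 0 ≤ S.a x :=
    (ae_restrict_iff' S.M.open_Ω.measurableSet).2 (Eventually.of_forall ha0)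
  rw [endForm_add_endForm_sub ha m n v v' s]
  have h := Section.le_energyForm_self (S.memLp_pairσ m n _) (S.memLp_pairσ_inv m n _) hρ0
    (hvs.sub hvs') (hF m n hmn v v' hv hv' s)
  have p1 : 0 ≤ wInner (volume.restrict S.M.Ω) (fun _ => 1)
      (S.sect v.broken m s - S.sect v'.broken n s).dt (S.sect v.broken m s - S.sect v'.broken n s).dt :=
    wInner_self_nonneg (Eventually.of_forall fun _ => zero_le_one)
  have p2 := wInner_self_nonneg (f := (S.sect v.broken m s - S.sect v'.broken n s).grad) ha0'
  have p3 := wInner_self_nonneg (f := (S.sect v.broken m s - S.sect v'.broken n s).jump)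
    (hρ0.mono fun x hx => hx.le)
  have q1 := wInner_self_nonneg (μ := (surf d).restrict (S.M.skel m ∪ S.M.skel n))
    (f := S.jmp v.broken m s) (Eventually.of_forall (S.excess_nonneg (m := m) (n := n) hd hσ))
  have q2 := wInner_self_nonneg (μ := (surf d).restrict (S.M.skel m ∪ S.M.skel n))
    (f := S.jmp v'.broken n s) (Eventually.of_forall (S.excess_nonneg (m := n) (n := m) hd hσ))
  linarith

/-! ### The nodes of the time mesh -/

theorem Poly.jet_zero {d : ℕ} : Poly.jet (0 : Poly d) =
    ⟨fun _ _ => 0, fun _ _ => 0, fun _ _ => 0, fun _ _ => 0, fun _ _ => 0⟩ := by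
  have h : ∀ t x, Poly.at (0 : Poly d) t x = 0 := fun t x => map_zero _
  have hg : ∀ t x, Poly.gradAt (0 : Poly d) t x = 0 := fun t x => by
    ext i
    simp [Poly.gradAt_apply, h]
  have hdt : Poly.dt (0 : Poly d) = 0 := map_zero _
  unfold Poly.jet
  rw [hdt, hdt]
  simp only [funext fun t => funext (h t), funext fun t => funext (hg t)]

theorem sect_zero (n : ℕ) (s : ℝ) :
    S.sect (PwPoly.broken fun _ _ => 0) n s = ⟨fun _ => 0, fun _ => 0, fun _ => 0, fun _ => 0⟩ := by
  unfold sect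
  congr 1 <;> ext1 x <;>
    simp [bDt, bGrad, avgFlux, jmp, Mesh.bulk, Mesh.avg, Mesh.jump, PwPoly.broken, Poly.jet_zero]

theorem energyForm_sect_zero (m n : ℕ) (s : ℝ) (μ ν : Measure (E d)) :
    Section.energyForm μ ν S.a (S.pairσ m n) (S.sect u m s)
      (S.sect (PwPoly.broken fun _ _ => 0) n s) = 0 := by
  simp [sect_zero, Section.energyForm, wInner]

theorem endForm_zero (n : ℕ) (s : ℝ) :
    S.endForm n s (PwPoly.broken fun _ _ => 0) (PwPoly.broken fun _ _ => 0) = 0 := by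
  have hj : S.jmp (PwPoly.broken fun _ _ => 0) n s = fun _ => 0 := congrArg Section.jump (sect_zero n s)
  have h0 : MemLp (S.jmp (PwPoly.broken fun _ _ => 0) n s) 2 ((surf d).restrict (S.M.skel n)) := by
    rw [hj]; exact MemLp.zero
  rw [endForm_eq (S.M.measurableSet_skel n) Subset.rfl h0 h0 n, energyForm_sect_zero, hj]
  simp [wInner]

/-- The case `m = n`, `v' = 0` of `node_energy_nonneg`. -/
theorem endForm_self_nonneg (hd : 1 ≤ d) (hp : 1 ≤ S.p) (hσ : 0 < S.Cσ) (ha : S.ConstOnElems)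
    (ha0 : ∀ x ∈ S.M.Ω, 0 ≤ S.a x) (hF : S.FluxBound) (hn : n < S.M.N) {v : PwPoly d}
    (hv : ∀ K ∈ S.M.elems n, (v n K).totalDegree ≤ S.p) (s : ℝ) :
    0 ≤ S.endForm n s v.broken v.broken := by
  have h := node_energy_nonneg hd hp hσ ha ha0 hF ⟨hn, hn, Or.inl rfl⟩ hv (v' := fun _ _ => 0)
    (fun _ _ => by simp) s
  rw [energyForm_sect_zero, endForm_zero] at h
  linarith

/-- The coupling of two slabs is the energy form of the sections on either side of the node. -/
theorem couplingForm_eq (hn : n + 1 < S.M.N) (u w : Broken d) :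
    S.couplingForm n u w = Section.energyForm (volume.restrict S.M.Ω)
      ((surf d).restrict (S.M.skel n ∪ S.M.skel (n + 1))) S.a (S.pairσ n (n + 1))
      (S.sect u n (S.M.t (n + 1))) (S.sect w (n + 1) (S.M.t (n + 1))) := by
  have hY := (S.M.measurableSet_skel n).union (S.M.measurableSet_skel (n + 1))
  have e1 := S.M.setIntegral_jump_right hY subset_union_right (fun _ => 1)
    (S.avgFlux u n (S.M.t (n + 1))) (fun K => (w (n + 1) K).val (S.M.t (n + 1)))
  have e2 := S.M.setIntegral_jump_left hY subset_union_left (fun _ => 1)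
    (S.avgFlux w (n + 1) (S.M.t (n + 1))) (fun K => (u n K).val (S.M.t (n + 1)))
  have e3 : S.nodeσ₀ n = S.pairσ n (n + 1) := by
    ext x
    rw [nodeσ₀, pairσ, Mesh.nodeH, Mesh.pairH, if_pos hn]
  simp only [one_mul] at e1 e2
  rw [couplingForm, Mesh.nodeSkel, if_pos hn, e3]
  simp only [jmp] at e1 e2 ⊢
  rw [e1, e2]
  simp only [Section.energyForm, sect, wInner, Real.inner_apply, one_mul, jmp]

variable (S)

/-- The terms of the form at the time `t (n+1)`, after integration by parts in time. -/
noncomputable def stopForm (n : ℕ) (u w : Broken d) : ℝ :=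
  S.endForm n (S.M.t (n + 1)) u w - if n + 1 < S.M.N then S.couplingForm n u w else 0

/-- The contribution of the time `t (n+1)` to `|||w|||²`. -/
noncomputable def stopEnergy (n : ℕ) (w : Broken d) : ℝ :=
  1 / 2 * S.endForm n (S.M.t (n + 1)) w w + if n + 1 < S.M.N then
    1 / 2 * S.endForm (n + 1) (S.M.t (n + 1)) w w - S.couplingForm n w w else 0

variable {S}

/-- The terms at the end of a slab: the section of `u` is tested with the jump of `v` at the node,
and with `v` itself at the final time. -/
theorem stop_estimate (hd : 1 ≤ d) (hp : 1 ≤ S.p) (hσ : 0 < S.Cσ) (ha : S.ConstOnElems)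
    (ha0 : ∀ x ∈ S.M.Ω, 0 ≤ S.a x) (hF : S.FluxBound) (hn : n < S.M.N) {v : PwPoly d}
    (hv : ∀ n < S.M.N, ∀ K ∈ S.M.elems n, (v n K).totalDegree ≤ S.p) (hu : S.RegularOn n u) :
    0 ≤ S.stopEnergy n v.broken ∧ ∀ l : ℝ, 0 < l →
      |S.stopForm n u v.broken| ≤ l * S.starNode n u + 6 * l⁻¹ * S.stopEnergy n v.broken := by
  have hsq := sqIntegrable_sect_stop hn hu
  unfold stopForm stopEnergy starNode
  by_cases hN : n + 1 < S.M.N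
  · have hmn : S.M.Adjacent n (n + 1) := ⟨hn, hN, Or.inr rfl⟩
    have e3 : S.nodeσ₀ n = S.pairσ n (n + 1) := by
      ext x
      rw [nodeσ₀, pairσ, Mesh.nodeH, Mesh.pairH, if_pos hN]
    have hsk : S.M.nodeSkel n = S.M.skel n ∪ S.M.skel (n + 1) := by rw [Mesh.nodeSkel, if_pos hN]
    rw [hsk] at hsq ⊢
    rw [if_pos hN, if_pos hN, couplingForm_eq hN, couplingForm_eq hN, ← add_sub_assoc, e3]
    exact ⟨node_energy_nonneg hd hp hσ ha ha0 hF hmn (hv _ hn) (hv _ hN) _,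
      fun l hl => abs_endForm_sub_le hd hp hσ ha ha0 hF hmn (hv _ hn) (hv _ hN) hsq hl⟩
  · -- at the final time the section is tested with `v - 0`
    have hmn : S.M.Adjacent n n := ⟨hn, hn, Or.inl rfl⟩
    have hsk : S.M.nodeSkel n = S.M.skel n ∪ S.M.skel n := by
      rw [Mesh.nodeSkel, if_neg hN, union_empty, union_self]
    have e3 : ∀ x ∈ S.M.nodeSkel n, (S.nodeσ₀ n x)⁻¹ * ‖S.avgFlux u n (S.M.t (n + 1)) x‖ ^ 2 =
        (S.pairσ n n x)⁻¹ * ‖S.avgFlux u n (S.M.t (n + 1)) x‖ ^ 2 := by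
      intro x hx
      rw [hsk, union_self] at hx
      rw [nodeσ₀, pairσ, Mesh.nodeH, Mesh.pairH, if_neg hN, max_self, indicator_of_mem hx,
        max_eq_left (S.M.h_pos hd hx).le]
    rw [setIntegral_congr_fun (S.M.measurableSet_nodeSkel n) e3]
    rw [hsk] at hsq ⊢
    rw [if_neg hN, if_neg hN, add_zero, sub_zero]
    have h0 : ∀ K ∈ S.M.elems n, ((fun _ _ => 0 : PwPoly d) n K).totalDegree ≤ S.p :=
      fun _ _ => by simp
    have h1 := node_energy_nonneg hd hp hσ ha ha0 hF hmn (hv _ hn) (v' := fun _ _ => 0) h0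
      (S.M.t (n + 1))
    rw [energyForm_sect_zero, endForm_zero, mul_zero, add_zero, sub_zero] at h1
    refine ⟨h1, fun l hl => ?_⟩
    have h2 := abs_endForm_sub_le hd hp hσ ha ha0 hF hmn (hv _ hn) (v' := fun _ _ => 0) h0 hsq hl
    rw [energyForm_sect_zero, energyForm_sect_zero, endForm_zero, mul_zero, add_zero, sub_zero,
      sub_zero] at h2
    exact h2

end Method


/-! ### The skeleton terms in the slabs -/

theorem integral_integral_eq_wInner {X V : Type*} [MeasurableSpace X] [NormedAddCommGroup V]
    [InnerProductSpace ℝ V] {I : Set ℝ} {ν : Measure X} [SFinite ν] {ρ : X → ℝ} {f g : ℝ → X → V}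
    (hρ : MemLp ρ ⊤ ν)
    (hf : MemLp (fun z : ℝ × X => f z.1 z.2) 2 ((volume.restrict I).prod ν))
    (hg : MemLp (fun z : ℝ × X => g z.1 z.2) 2 ((volume.restrict I).prod ν)) :
    ∫ t in I, ∫ x, ρ x * inner ℝ (f t x) (g t x) ∂ν =
      wInner ((volume.restrict I).prod ν) (fun z => ρ z.2) (fun z => f z.1 z.2)
        (fun z => g z.1 z.2) :=
  (integral_prod _ (integrable_weight_inner (memLp_comp_snd_of_top hρ) hf hg)).symm

/-- Young's inequality for space-time integrals with weights that do not depend on time. -/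
theorem abs_integral_integral_le {X V : Type*} [MeasurableSpace X] [NormedAddCommGroup V]
    [InnerProductSpace ℝ V] {I : Set ℝ} {ν : Measure X} [SFinite ν] {ρ ρ₁ ρ₂ : X → ℝ}
    {f g : ℝ → X → V} {l : ℝ} (hl : 0 < l) (hρ : MemLp ρ ⊤ ν) (h₁ : MemLp ρ₁ ⊤ ν)
    (h₂ : MemLp ρ₂ ⊤ ν)
    (hf : MemLp (fun z : ℝ × X => f z.1 z.2) 2 ((volume.restrict I).prod ν))
    (hg : MemLp (fun z : ℝ × X => g z.1 z.2) 2 ((volume.restrict I).prod ν))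
    (h : ∀ᵐ x ∂ν, 0 ≤ ρ₁ x ∧ 0 ≤ ρ₂ x ∧ ρ x ^ 2 ≤ ρ₁ x * ρ₂ x) :
    |∫ t in I, ∫ x, ρ x * inner ℝ (f t x) (g t x) ∂ν| ≤
      1 / 2 * (l * (∫ t in I, ∫ x, ρ₁ x * inner ℝ (f t x) (f t x) ∂ν) +
        l⁻¹ * ∫ t in I, ∫ x, ρ₂ x * inner ℝ (g t x) (g t x) ∂ν) := by
  rw [integral_integral_eq_wInner hρ hf hg, integral_integral_eq_wInner h₁ hf hf,
    integral_integral_eq_wInner h₂ hg hg]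
  refine abs_wInner_le hl (memLp_comp_snd_of_top h₁) (memLp_comp_snd_of_top h₂) hf hg ?_
  filter_upwards [Measure.quasiMeasurePreserving_snd.ae h] with z hz
  exact ⟨hz.1, hz.2.1, Or.inr (Or.inr hz.2.2)⟩

namespace Method

variable {d : ℕ} {S : Method d} {n : ℕ} {u : Broken d}

theorem memLp_σ₁ (S : Method d) (n : ℕ) (μ : Measure (E d)) : MemLp (S.σ₁ n) ⊤ μ :=
  memLp_top_of_finite_range (measurable_const.div ((S.M.measurable_h n).mul measurable_const))
    (finite_range_comp (S.M.finite_range_h n) fun h => S.Ca * (S.p : ℝ) ^ 3 / (h * S.M.tau n))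

theorem memLp_σ₂ (S : Method d) (n : ℕ) (μ : Measure (E d)) : MemLp (S.σ₂ n) ⊤ μ :=
  memLp_top_of_finite_range ((S.M.measurable_h n).div measurable_const)
    (finite_range_comp (S.M.finite_range_h n) fun h => h / (S.Ca * S.M.tau n))

theorem memLp_σ₁_inv (S : Method d) (n : ℕ) (μ : Measure (E d)) : MemLp (fun x => (S.σ₁ n x)⁻¹) ⊤ μ :=
  memLp_top_of_finite_range (measurable_const.div ((S.M.measurable_h n).mul measurable_const)).inv
    (finite_range_comp (S.M.finite_range_h n) fun h => (S.Ca * (S.p : ℝ) ^ 3 / (h * S.M.tau n))⁻¹)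

theorem memLp_σ₂_inv (S : Method d) (n : ℕ) (μ : Measure (E d)) : MemLp (fun x => (S.σ₂ n x)⁻¹) ⊤ μ :=
  memLp_top_of_finite_range ((S.M.measurable_h n).div measurable_const).inv
    (finite_range_comp (S.M.finite_range_h n) fun h => (h / (S.Ca * S.M.tau n))⁻¹)

theorem memLp_σ₀_sq_mul (S : Method d) (n : ℕ) (μ : Measure (E d)) :
    MemLp (fun x => S.σ₀ n x ^ 2 * (S.σ₁ n x)⁻¹) ⊤ μ :=
  memLp_top_of_finite_range (((S.measurable_σ₀ n).pow_const 2).mul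
      (measurable_const.div ((S.M.measurable_h n).mul measurable_const)).inv)
    (finite_range_comp (S.M.finite_range_h n) fun h =>
      (S.Cσ * (S.p : ℝ) ^ 2 / h) ^ 2 * (S.Ca * (S.p : ℝ) ^ 3 / (h * S.M.tau n))⁻¹)

theorem σ₁_pos (hd : 1 ≤ d) (hp : 1 ≤ S.p) (hCa : 0 < S.Ca) (hn : n < S.M.N) {x : E d}
    (hx : x ∈ S.M.skel n) : 0 < S.σ₁ n x := by
  have h1 := S.M.h_pos hd hx
  have h2 : 0 < S.M.tau n := sub_pos.2 (S.M.t_lt n hn)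
  have h3 : (0 : ℝ) < S.p := by exact_mod_cast hp
  unfold σ₁
  positivity

theorem σ₂_pos (hd : 1 ≤ d) (hCa : 0 < S.Ca) (hn : n < S.M.N) {x : E d} (hx : x ∈ S.M.skel n) :
    0 < S.σ₂ n x := by
  have h1 := S.M.h_pos hd hx
  have h2 : 0 < S.M.tau n := sub_pos.2 (S.M.t_lt n hn)
  unfold σ₂
  positivity

theorem memLp_intSkel {F : Type*} [NormedAddCommGroup F] {f : ℝ × E d → F}
    (hf : MemLp f 2 ((volume.restrict (S.M.slab n)).prod ((surf d).restrict (S.M.skel n)))) :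
    MemLp f 2 ((volume.restrict (S.M.slab n)).prod ((surf d).restrict (S.M.intSkel n))) := by
  have h := hf.restrict (Prod.snd ⁻¹' S.M.intSkel n)
  rwa [prod_restrict_snd, Measure.restrict_restrict (S.M.measurableSet_intSkel n),
    inter_eq_self_of_subset_left (S.M.intSkel_subset_skel n)] at h

variable (S)

/-- The skeleton terms of the form in the slab `n`, after integration by parts. -/
noncomputable def sideForm (n : ℕ) (u v : Broken d) : ℝ :=
  - (∫ t in S.M.slab n, ∫ x in S.M.intSkel n, S.avgDt u n t x * S.jmpFlux v n t x ∂(surf d))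
  + (∫ t in S.M.slab n, ∫ x in S.M.skel n, inner ℝ (S.avgFluxDt u n t x) (S.jmp v n t x) ∂(surf d))
  - (∫ t in S.M.slab n, ∫ x in S.M.skel n,
      S.σ₀ n x * inner ℝ (S.jmpDt u n t x) (S.jmp v n t x) ∂(surf d))
  + S.penaltyForm n u v

variable {S}

instance (n : ℕ) : IsFiniteMeasure ((surf d).restrict (S.M.intSkel n)) :=
  isFiniteMeasure_restrict.2
    ((measure_mono (S.M.intSkel_subset_skel n)).trans_lt (S.M.surf_skel_lt_top n)).ne

/-- The terms on the skeleton in a slab, where only the penalty terms of the energy of `v` are used.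
-/
theorem side_estimate (hd : 1 ≤ d) (hp : 1 ≤ S.p) (hCa : 0 < S.Ca) (hn : n < S.M.N) (v : PwPoly d)
    (hu : S.RegularOn n u) {l : ℝ} (hl : 0 < l) :
    |S.sideForm n u v.broken| ≤
      l * S.starSlab n u + 6 * l⁻¹ * S.penaltyForm n v.broken v.broken := by
  have hv := S.regularOn_broken n v
  have pos : ∀ᵐ x ∂((surf d).restrict (S.M.skel n)), 0 < S.σ₁ n x ∧ 0 < S.σ₂ n x :=
    (ae_restrict_iff' (S.M.measurableSet_skel n)).2 (Eventually.of_forall fun x hx =>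
      ⟨σ₁_pos hd hp hCa hn hx, σ₂_pos hd hCa hn hx⟩)
  have posi : ∀ᵐ x ∂((surf d).restrict (S.M.intSkel n)), 0 < S.σ₂ n x :=
    (ae_restrict_iff' (S.M.measurableSet_intSkel n)).2 (Eventually.of_forall fun x hx =>
      σ₂_pos hd hCa hn (S.M.intSkel_subset_skel n hx))
  have h1 := abs_integral_integral_le hl (memLp_top_const (1 : ℝ)) (S.memLp_σ₂_inv n _)
    (S.memLp_σ₂ n _) (memLp_intSkel (memLp_avgDt hn hu)) (memLp_intSkel (memLp_jmpFlux hn hv)) (by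
      filter_upwards [posi] with x hx
      rw [inv_mul_cancel₀ hx.ne', one_pow]
      exact ⟨(inv_pos.2 hx).le, hx.le, le_rfl⟩)
  have h2 := abs_integral_integral_le hl (memLp_top_const (1 : ℝ)) (S.memLp_σ₁_inv n _)
    (S.memLp_σ₁ n _) (memLp_avgFluxDt hn hu) (memLp_jmp hn hv) (by
      filter_upwards [pos] with x hx
      rw [inv_mul_cancel₀ hx.1.ne', one_pow]
      exact ⟨(inv_pos.2 hx.1).le, hx.1.le, le_rfl⟩)
  have h3 := abs_integral_integral_le hl (S.memLp_σ₀ n _) (S.memLp_σ₀_sq_mul n _)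
    (S.memLp_σ₁ n _) (memLp_jmpDt hn hu) (memLp_jmp hn hv) (by
      filter_upwards [pos] with x hx
      rw [inv_mul_cancel_right₀ hx.1.ne']
      exact ⟨mul_nonneg (sq_nonneg _) (inv_pos.2 hx.1).le, hx.1.le, le_rfl⟩)
  have h4 := abs_integral_integral_le hl (S.memLp_σ₁ n _) (S.memLp_σ₁ n _)
    (S.memLp_σ₁ n _) (memLp_jmp hn hu) (memLp_jmp hn hv) (by
      filter_upwards [pos] with x hx
      exact ⟨hx.1.le, hx.1.le, (sq _).le⟩)
  have h5 := abs_integral_integral_le hl (S.memLp_σ₂ n _) (S.memLp_σ₂ n _)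
    (S.memLp_σ₂ n _) (memLp_intSkel (memLp_jmpFlux hn hu)) (memLp_intSkel (memLp_jmpFlux hn hv)) (by
      filter_upwards [posi] with x hx
      exact ⟨hx.le, hx.le, (sq _).le⟩)
  have nn : ∀ {X V : Type} [MeasurableSpace X] [NormedAddCommGroup V] [InnerProductSpace ℝ V]
      {ν : Measure X} {ρ : X → ℝ} (f : ℝ → X → V), (∀ᵐ x ∂ν, 0 ≤ ρ x) →
      0 ≤ ∫ t in S.M.slab n, ∫ x, ρ x * inner ℝ (f t x) (f t x) ∂ν := fun f h =>
    integral_nonneg fun t => wInner_self_nonneg (f := f t) h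
  have li : 0 < l⁻¹ := inv_pos.2 hl
  have a1 := mul_nonneg hl.le (nn (fun t x => S.avgDt u n t x) (posi.mono fun x hx => (inv_pos.2 hx).le))
  have a2 := mul_nonneg hl.le (nn (fun t x => S.avgFluxDt u n t x)
    (pos.mono fun x hx => (inv_pos.2 hx.1).le))
  have a3 := mul_nonneg hl.le (nn (ρ := fun x => S.σ₀ n x ^ 2 * (S.σ₁ n x)⁻¹)
    (fun t x => S.jmpDt u n t x)
    (pos.mono fun x hx => mul_nonneg (sq_nonneg _) (inv_pos.2 hx.1).le))
  have a4 := mul_nonneg hl.le (nn (fun t x => S.jmp u n t x) (pos.mono fun x hx => hx.1.le))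
  have a5 := mul_nonneg hl.le (nn (fun t x => S.jmpFlux u n t x) (posi.mono fun x hx => hx.le))
  have b4 := mul_nonneg li.le (nn (fun t x => S.jmp v.broken n t x) (pos.mono fun x hx => hx.1.le))
  have b5 := mul_nonneg li.le (nn (fun t x => S.jmpFlux v.broken n t x) (posi.mono fun x hx => hx.le))
  unfold sideForm starSlab penaltyForm
  simp only [one_mul, real_inner_self_eq_norm_sq, Real.norm_eq_abs, sq_abs] at *
  simp only [Real.inner_apply] at h1 h5
  simp only [← sq]
  rw [abs_le] at *
  constructor <;> linarith [h1.1, h1.2, h2.1, h2.2, h3.1, h3.2, h4.1, h4.2, h5.1, h5.2]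

theorem penaltyForm_self_nonneg (hd : 1 ≤ d) (hp : 1 ≤ S.p) (hCa : 0 < S.Ca) (hn : n < S.M.N)
    (u : Broken d) : 0 ≤ S.penaltyForm n u u := by
  refine add_nonneg (integral_nonneg fun t => ?_) (integral_nonneg fun t => ?_)
  · exact setIntegral_nonneg (S.M.measurableSet_skel n) fun x hx =>
      mul_nonneg (σ₁_pos hd hp hCa hn hx).le real_inner_self_nonneg
  · exact setIntegral_nonneg (S.M.measurableSet_intSkel n) fun x hx =>
      mul_nonneg (σ₂_pos hd hCa hn (S.M.intSkel_subset_skel n hx)).le (mul_self_nonneg _)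

end Method


/-! ### Summation over the slabs -/

theorem sum_range_ite_succ_lt {N : ℕ} (f : ℕ → ℝ) :
    ∑ n ∈ Finset.range N, (if n + 1 < N then f n else 0) = ∑ n ∈ Finset.range (N - 1), f n := by
  cases N with
  | zero => simp
  | succ N =>
    rw [Finset.sum_range_succ, if_neg (lt_irrefl _), add_zero, Nat.add_sub_cancel]
    exact Finset.sum_congr rfl fun n hn => if_pos (Nat.succ_lt_succ (Finset.mem_range.1 hn))

/-- Optimisation of the parameter in Young's inequality. -/
theorem le_mul_sqrt_mul_sqrt {x W V : ℝ} (hW : 0 ≤ W) (hV : 0 ≤ V)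
    (h : ∀ l : ℝ, 0 < l → x ≤ l * (2 * W) + 6 * l⁻¹ * V) : x ≤ 8 * √W * √V := by
  -- the optimal `l = √V / √W` is approximated, since `V` or `W` may vanish
  have key : ∀ ε : ℝ, 0 < ε → x ≤ 8 * (√W + ε) * (√V + ε) := by
    intro ε hε
    have hw := Real.sqrt_nonneg W
    have hv := Real.sqrt_nonneg V
    have h1 := h ((√V + ε) / (√W + ε)) (by positivity)
    have e1 : (√V + ε) / (√W + ε) * (2 * W) ≤ 2 * (√W + ε) * (√V + ε) := by
      rw [div_mul_eq_mul_div, div_le_iff₀ (by positivity)]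
      have : W ≤ (√W + ε) * (√W + ε) := by
        nlinarith [Real.mul_self_sqrt hW, mul_nonneg hw hε.le]
      have := mul_le_mul_of_nonneg_left this (by positivity : 0 ≤ 2 * (√V + ε))
      linarith
    have e2 : 6 * ((√V + ε) / (√W + ε))⁻¹ * V ≤ 6 * (√W + ε) * (√V + ε) := by
      rw [inv_div, mul_div_assoc', div_mul_eq_mul_div, div_le_iff₀ (by positivity)]
      have : V ≤ (√V + ε) * (√V + ε) := by
        nlinarith [Real.mul_self_sqrt hV, mul_nonneg hv hε.le]
      have := mul_le_mul_of_nonneg_left this (by positivity : 0 ≤ 6 * (√W + ε))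
      linarith
    linarith
  have hc : Tendsto (fun ε : ℝ => 8 * (√W + ε) * (√V + ε)) (𝓝[>] 0) (𝓝 (8 * (√W + 0) * (√V + 0))) :=
    ((by fun_prop : Continuous fun ε : ℝ => 8 * (√W + ε) * (√V + ε)).tendsto 0).mono_left
      nhdsWithin_le_nhds
  rw [add_zero, add_zero] at hc
  exact ge_of_tendsto hc (eventually_mem_nhdsWithin.mono fun ε hε => key ε hε)

namespace Method

variable {d : ℕ} {S : Method d} {n : ℕ} {u : Broken d}

/-- After integration by parts the form consists of terms on the skeletons and, at each positive
node, the terms of the slab ending there minus the coupling to the next slab. -/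
theorem form_eq_sum {v : PwPoly d} (ha : S.ConstOnElems) (hv : IsTrefftz S.M S.a S.p v)
    (hu : IsRegular S.M u) :
    S.form u v.broken =
      ∑ n ∈ Finset.range S.M.N, (S.stopForm n u v.broken + S.sideForm n u v.broken) := by
  have h : ∀ n ∈ Finset.range S.M.N, S.slabForm n u v.broken =
      S.endForm n (S.M.t (n + 1)) u v.broken + S.sideForm n u v.broken := fun n hn => by
    rw [slabForm_eq ha hv (Finset.mem_range.1 hn) (hu n (Finset.mem_range.1 hn)), sideForm]
    ring
  rw [form, Finset.sum_congr rfl h, ← sum_range_ite_succ_lt, ← Finset.sum_sub_distrib]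
  refine Finset.sum_congr rfl fun n _ => ?_
  rw [stopForm]
  ring

/-- The energy identity: the half energies at the beginning of each slab are grouped with the node
at which the slab begins. -/
theorem form_self_eq_sum (ha : S.ConstOnElems) (v : PwPoly d) :
    S.form v.broken v.broken = 1 / 2 * S.endForm 0 (S.M.t 0) v.broken v.broken +
      (∑ n ∈ Finset.range S.M.N, S.stopEnergy n v.broken) +
      ∑ n ∈ Finset.range S.M.N, S.penaltyForm n v.broken v.broken := by
  have h : ∀ n ∈ Finset.range S.M.N, S.slabForm n v.broken v.broken = _ := fun n hn =>
    slabForm_self ha (Finset.mem_range.1 hn) v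
  have e : ∑ n ∈ Finset.range S.M.N, 1 / 2 * S.endForm n (S.M.t n) v.broken v.broken =
      (∑ n ∈ Finset.range (S.M.N - 1), 1 / 2 * S.endForm (n + 1) (S.M.t (n + 1)) v.broken v.broken) +
        1 / 2 * S.endForm 0 (S.M.t 0) v.broken v.broken := by
    conv_lhs => rw [← Nat.sub_add_cancel (Nat.one_le_iff_ne_zero.2 S.M.N_pos.ne')]
    exact Finset.sum_range_succ' _ _
  rw [form, Finset.sum_congr rfl h, Finset.sum_add_distrib, Finset.sum_add_distrib, e]
  simp only [stopEnergy]
  rw [Finset.sum_add_distrib, sum_range_ite_succ_lt, Finset.sum_sub_distrib]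
  ring

theorem starNode_nonneg (hd : 1 ≤ d) (hσ : 0 < S.Cσ) (ha0 : ∀ x ∈ S.M.Ω, 0 ≤ S.a x) (n : ℕ)
    (w : Broken d) : 0 ≤ S.starNode n w := by
  refine add_nonneg (add_nonneg (add_nonneg (integral_nonneg fun x => sq_nonneg _) ?_) ?_) ?_
  · exact setIntegral_nonneg S.M.open_Ω.measurableSet fun x hx => mul_nonneg (ha0 x hx) (sq_nonneg _)
  · refine setIntegral_nonneg (S.M.measurableSet_skel n) fun x hx => mul_nonneg ?_ (sq_nonneg _)
    have := S.M.h_pos hd hx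
    unfold σ₀
    positivity
  · refine setIntegral_nonneg (S.M.measurableSet_nodeSkel n) fun x hx => mul_nonneg ?_ (sq_nonneg _)
    have := S.M.nodeH_pos hd hx
    unfold nodeσ₀
    positivity

theorem starSlab_nonneg (hd : 1 ≤ d) (hp : 1 ≤ S.p) (hCa : 0 < S.Ca) (hn : n < S.M.N)
    (w : Broken d) : 0 ≤ S.starSlab n w := by
  have p1 : ∀ x ∈ S.M.skel n, 0 < S.σ₁ n x := fun x hx => σ₁_pos hd hp hCa hn hx
  have p2 : ∀ x ∈ S.M.intSkel n, 0 < S.σ₂ n x := fun x hx =>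
    σ₂_pos hd hCa hn (S.M.intSkel_subset_skel n hx)
  have m1 := S.M.measurableSet_skel n
  have m2 := S.M.measurableSet_intSkel n
  refine add_nonneg (add_nonneg (add_nonneg (add_nonneg ?_ ?_) ?_) ?_) ?_ <;>
    refine integral_nonneg fun t => ?_
  · exact setIntegral_nonneg m1 fun x hx => mul_nonneg (p1 x hx).le (sq_nonneg _)
  · exact setIntegral_nonneg m2 fun x hx => mul_nonneg (p2 x hx).le (sq_nonneg _)
  · exact setIntegral_nonneg m2 fun x hx => mul_nonneg (inv_pos.2 (p2 x hx)).le (sq_nonneg _)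
  · exact setIntegral_nonneg m1 fun x hx => mul_nonneg (inv_pos.2 (p1 x hx)).le (sq_nonneg _)
  · exact setIntegral_nonneg m1 fun x hx =>
      mul_nonneg (mul_nonneg (sq_nonneg _) (inv_pos.2 (p1 x hx)).le) (sq_nonneg _)

/-- Continuity of the form, given the discrete trace inequality. -/
theorem abs_form_le (hd : 1 ≤ d) (hp : 1 ≤ S.p) (hσ : 0 < S.Cσ) (hCa : 0 < S.Ca)
    (ha : S.ConstOnElems) (ha0 : ∀ x ∈ S.M.Ω, 0 ≤ S.a x) (hF : S.FluxBound) {v : PwPoly d}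
    (hv : IsTrefftz S.M S.a S.p v) {w : Broken d} (hw : IsRegular S.M w) :
    |S.form w v.broken| ≤ 8 * S.starNorm w * S.dgNorm v := by
  have hdeg : ∀ n < S.M.N, ∀ K ∈ S.M.elems n, (v n K).totalDegree ≤ S.p := fun n hn K hK =>
    (hv n hn K hK).1
  have hmem : ∀ {n}, n ∈ Finset.range S.M.N → n < S.M.N := Finset.mem_range.1
  have hE0 := endForm_self_nonneg hd hp hσ ha ha0 hF S.M.N_pos (hdeg 0 S.M.N_pos) (S.M.t 0)
  have hst := fun n (hn : n ∈ Finset.range S.M.N) =>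
    stop_estimate hd hp hσ ha ha0 hF (hmem hn) hdeg (hw n (hmem hn))
  have hpen := fun n (hn : n ∈ Finset.range S.M.N) =>
    penaltyForm_self_nonneg hd hp hCa (hmem hn) v.broken
  have hnode : 0 ≤ ∑ n ∈ Finset.range S.M.N, S.starNode n w :=
    Finset.sum_nonneg fun n _ => starNode_nonneg hd hσ ha0 n w
  have hslab : 0 ≤ ∑ n ∈ Finset.range S.M.N, S.starSlab n w :=
    Finset.sum_nonneg fun n hn => starSlab_nonneg hd hp hCa (hmem hn) w
  have hV := form_self_eq_sum ha v
  have henergy : 0 ≤ ∑ n ∈ Finset.range S.M.N, S.stopEnergy n v.broken :=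
    Finset.sum_nonneg fun n hn => (hst n hn).1
  have hpenS : 0 ≤ ∑ n ∈ Finset.range S.M.N, S.penaltyForm n v.broken v.broken :=
    Finset.sum_nonneg hpen
  refine le_mul_sqrt_mul_sqrt (by linarith) (by linarith) fun l hl => ?_
  have hli : 0 < l⁻¹ := inv_pos.2 hl
  have h1 : |S.form w v.broken| ≤ ∑ n ∈ Finset.range S.M.N,
      (l * S.starNode n w + 6 * l⁻¹ * S.stopEnergy n v.broken +
        (l * S.starSlab n w + 6 * l⁻¹ * S.penaltyForm n v.broken v.broken)) := by
    rw [form_eq_sum ha hv hw]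
    refine (Finset.abs_sum_le_sum_abs _ _).trans (Finset.sum_le_sum fun n hn => ?_)
    exact (abs_add_le _ _).trans (add_le_add ((hst n hn).2 l hl)
      (side_estimate hd hp hCa (hmem hn) v (hw n (hmem hn)) hl))
  simp only [Finset.sum_add_distrib, ← Finset.mul_sum] at h1
  rw [hV]
  have g1 := mul_nonneg hl.le hslab
  have g2 := mul_nonneg hli.le hE0
  linarith

/-- The elements and the skeletons lie in the closure of `Ω`, so all integrals vanish. -/
theorem form_eq_zero_of_isEmpty (hΩ : S.M.Ω = ∅) (u v : Broken d) : S.form u v = 0 := by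
  have hsk : ∀ n < S.M.N, S.M.skel n = ∅ := fun n hn => by
    rw [← subset_empty_iff]
    simpa [hΩ] using S.M.skel_subset_closure hn
  have hi : ∀ n < S.M.N, S.M.intSkel n = ∅ := fun n hn => by simp [Mesh.intSkel, hsk n hn]
  have h1 : ∀ n ∈ Finset.range S.M.N, S.slabForm n u v = 0 := fun n hn => by
    have hn' := Finset.mem_range.1 hn
    simp [slabForm, hΩ, hsk n hn', hi n hn']
  have h2 : ∀ n ∈ Finset.range (S.M.N - 1), S.couplingForm n u v = 0 := fun n hn => by
    have hn' : n + 1 < S.M.N := Nat.add_lt_of_lt_sub (Finset.mem_range.1 hn)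
    simp [couplingForm, Mesh.nodeSkel, hΩ, hsk n (Nat.lt_of_succ_lt hn'), hsk (n + 1) hn']
  rw [form, Finset.sum_eq_zero h1, Finset.sum_eq_zero h2, sub_zero]

end Method

end TrefftzDG

theorem mainTheorem5 :
    ∃ Cstar : ℝ, 0 < Cstar ∧
      ∀ (d : ℕ), 1 ≤ d →
      ∀ (S : TrefftzDG.Method d) (ca cT κ Cinv : ℝ),
        1 ≤ S.p →
        0 < ca →
        (∀ x ∈ S.M.Ω, ca ≤ S.a x ∧ S.a x ≤ S.Ca) →
        (∀ n < S.M.N, ∀ K ∈ S.M.elems n, ∀ x ∈ K.set, ∀ y ∈ K.set, S.a x = S.a y) →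
        S.M.ShapeRegular cT →
        S.M.LocallyQuasiUniform κ →
        S.M.IsInverseConstant S.p Cinv →
        2 * d * κ * cT * S.Ca ^ 2 * Cinv / ca ≤ S.Cσ →
        ∀ (w : TrefftzDG.Broken d) (v : TrefftzDG.PwPoly d),
          TrefftzDG.InSolutionPlusTrefftz S.M S.a S.p w →
          TrefftzDG.IsRegular S.M w →
          TrefftzDG.IsTrefftz S.M S.a S.p v →
          |S.form w v.broken| ≤ Cstar * S.starNorm w * S.dgNorm v := by
  refine ⟨8, by norm_num, fun d hd S ca cT κ Cinv hp hca hbd ha hT hκ hinv hσ w v _ hw hv => ?_⟩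
  rcases S.M.Ω.eq_empty_or_nonempty with hΩ | ⟨x, hx⟩
  · -- without elements the hypotheses do not force the constants to be positive
    rw [TrefftzDG.Method.form_eq_zero_of_isEmpty hΩ, abs_zero]
    exact mul_nonneg (mul_nonneg (by norm_num) (Real.sqrt_nonneg _)) (Real.sqrt_nonneg _)
  have hN := S.M.N_pos
  obtain ⟨K, hK, -⟩ : ∃ K ∈ S.M.elems 0, x ∈ closure K.set := by
    have : x ∈ ⋃ K ∈ S.M.elems 0, closure K.set := S.M.cover 0 hN ▸ subset_closure hx
    simpa using this
  have hκ0 : 0 < κ := zero_lt_one.trans_le (S.M.one_le_of_locallyQuasiUniform hd hκ hN hK)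
  have hp0 : (0 : ℝ) < S.p := by exact_mod_cast hp
  have hd0 : (0 : ℝ) < d := by exact_mod_cast hd
  have hC0 : 0 < Cinv := by
    have h := zero_lt_one.trans_le (S.M.one_le_inverseConstant hd hinv hN hK)
    exact pos_of_mul_pos_left h (sq_nonneg _)
  have hne : (K.set ∩ K.set).Nonempty := by rw [inter_self]; exact K.nonempty
  have hadj : S.M.Adjacent 0 0 := ⟨hN, hN, Or.inl rfl⟩
  have hcT : 0 < cT :=
    pos_of_mul_pos_left ((K.diam_pos hd).trans_le (hT 0 0 hadj K hK K hK hne).1)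
      (TrefftzDG.Polytope.inradius_inter_pos hd hne).le
  have hCa : ca ≤ S.Ca := (hbd x hx).1.trans (hbd x hx).2
  have hCa0 : 0 < S.Ca := hca.trans_le hCa
  exact TrefftzDG.Method.abs_form_le hd hp (lt_of_lt_of_le (by positivity) hσ) hCa0 ha
    (fun y hy => hca.le.trans (hbd y hy).1)
    (TrefftzDG.Method.fluxBound hd hp hca hbd ha hT hκ hinv hκ0 hcT hC0 hCa hσ) hv hw
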